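/- Let $\mathbb K$ be the field of locally convergent generalized Puiseux series: series $\sum_{r\in R}\alpha_r t^r$ with $R\subset\mathbb R$ well-ordered, $\alpha_r\in\mathbb C$, convergent for all small $t>0$. Let $\mathrm{val}$ be its valuation (the smallest exponent), let $\mathbb K_{\mathbb R}\subset\mathbb K$ be the series with real coefficients, and put $\mathrm{Trop}(z,w)=(-\mathrm{val}(z),-\mathrm{val}(w))$ on $(\mathbb K^\times)^2$. A point of $(\mathbb K^\times)^2$ is real if both coordinates lie in $\mathbb K_{\mathbb R}$; conjugation is coefficientwise. A tropical curve $C\subset\mathbb R^2$ is the corner locus of a tropical polynomial $P(x,y)=\max_{(i,j)\in A}(a_{ij}+ix+jy)$, $A\subset\mathbb Z_{\ge0}^2$ finite, with its (closed) edges and their weights. It is non-singular if its dual subdivision is a triangulation whose two-dimensional cells have area $1/2$ and all edges have weight $1$ (automatic if the Newton polygon is two-dimensional). A distribution of signs $\delta$ on the integer points of the dual subdivision defines, for every edge $e$ with dual edge $[\alpha,\beta]$, the set $$\mathcal E_e=\{\varepsilon\in\mathbb Z_2^2 : (-1)^{\varepsilon_1\alpha_1+\varepsilon_2\alpha_2}\delta(\alpha)\neq(-1)^{\varepsilon_1\beta_1+\varepsilon_2\beta_2}\delta(\beta)\};$$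 a real phase structure on $C$ is a family $\mathcal E=(\mathcal E_e)_e$ of this form. A bounded edge $e$ is twisted if for every $\varepsilon\in\mathcal E_e$ the two edges $e_1,e_2$ adjacent to $e$ with $\varepsilon\in\mathcal E_{e_1}$, $\varepsilon\in\mathcal E_{e_2}$ lie on distinct sides of the line containing $e$. A realisation of $(C,\mathcal E)$ is a curve in $(\mathbb K^\times)^2$ defined by a polynomial over $\mathbb K_{\mathbb R}$ whose tropicalisation (image under $\mathrm{Trop}$, with weights) is $C$ and whose coefficient signs (signs of leading coefficients) induce $\mathcal E$. **Theorem.** Let $C,C'$ be non-singular tropical curves in $\mathbb R^2$ with real phase structures $\mathcal E,\mathcal E'$, and let $e$ be a closed bounded edge of $C$ contained in the relative interior of an edge $e'$ of $C'$. 1. If $\mathcal E_e\ne\mathcal E'_{e'}$, or if $\mathcal E_e=\mathcal E'_{e'}$ and $e$ is twisted, then for all realisations $\mathcal C$ of $(C,\mathcal E)$ and $\mathcal C'$ of $(C',\mathcal E')$ the points of $\mathcal C\cap\mathcal C'$ with tropicalisation in $e$ are exactly two distinct real points, each of intersection multiplicity $1$. 2. If $\mathcal E_e=\mathcal E'_{e'}$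 and $e$ is not twisted, then for all realisations $\mathcal C,\mathcal C'$ the points of $\mathcal C\cap\mathcal C'$ with tropicalisation in $e$ are (i) two distinct real points of multiplicity $1$, or (ii) two distinct complex conjugate points of multiplicity $1$, or (iii) one real point of multiplicity $2$. Type (i) occurs for infinitely many pairs of realisations, and so does type (ii). Moreover, let $F,G$ be defining polynomials over $\mathbb K_{\mathbb R}$ of realisations of $(C,\mathcal E)$ and $(C',\mathcal E')$. Fix all coefficients of $F$ and $G$ except one coefficient $c$, namely the coefficient of $F$ at one of the two endpoints of the edge dual to $e$, or the coefficient of $G$ at one of the two endpoints of the edge dual to $e'$. Among the pairs of realisations of $(C,\mathcal E)$ and $(C',\mathcal E')$ obtained by letting $c$ vary in $\mathbb K$, infinitely many are of type (i), infinitely many are of type (ii), and exactly two are of type (iii). -/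

import Mathlib

noncomputable section

open scoped ENNReal

/-! Locally convergent generalized Puiseux series. -/

/-- The series `∑ αᵣ tʳ` (a Hahn series: real exponents in a well-ordered set, complex
coefficients) converges for all sufficiently small real `t > 0`. -/
def LocConv (x : HahnSeries ℝ ℂ) : Prop :=
  ∃ ρ : ℝ, 0 < ρ ∧ ∀ t : ℝ, 0 < t → t < ρ → Summable fun r : ℝ => x.coeff r * ((t ^ r : ℝ) : ℂ)

namespace LocConv

/-- Auxiliary: the sum of the absolute values of the terms at `t`. -/
def mass (t : ℝ) (x : HahnSeries ℝ ℂ) : ℝ≥0∞ := ∑' r : ℝ, ‖x.coeff r * ((t ^ r : ℝ) : ℂ)‖ₑ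

theorem summable_iff (t : ℝ) (x : HahnSeries ℝ ℂ) :
    (Summable fun r : ℝ => x.coeff r * ((t ^ r : ℝ) : ℂ)) ↔ mass t x ≠ ∞ := by
  rw [mass, tsum_enorm_ne_top_iff_summable_norm, summable_norm_iff]

theorem mass_mul {t : ℝ} (ht : 0 < t) (x y : HahnSeries ℝ ℂ) :
    mass t (x * y) ≤ mass t x * mass t y := by
  classical
  have key : ∀ a : ℝ, ‖(x * y).coeff a * ((t ^ a : ℝ) : ℂ)‖ₑ ≤
      ∑' i : ℝ, ‖x.coeff i * ((t ^ i : ℝ) : ℂ)‖ₑ *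
        ‖y.coeff (a - i) * ((t ^ (a - i) : ℝ) : ℂ)‖ₑ := by
    intro a
    rw [HahnSeries.coeff_mul, Finset.sum_mul]
    refine (enorm_sum_le _ _).trans ?_
    have hinj : Set.InjOn Prod.fst
        (↑(Finset.antidiagonal x.isPWO_support y.isPWO_support a) : Set (ℝ × ℝ)) := by
      rintro ⟨i, j⟩ h ⟨i', j'⟩ h' hh
      simp only [Finset.mem_coe, Finset.mem_antidiagonal] at h h'
      simp only at hh
      subst hh
      have : j = j' := by linarith [h.2.2, h'.2.2]
      rw [this]
    refine le_trans (le_of_eq ?_) (ENNReal.sum_le_tsum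
      ((Finset.antidiagonal x.isPWO_support y.isPWO_support a).image Prod.fst))
    rw [Finset.sum_image hinj]
    refine Finset.sum_congr rfl ?_
    rintro ⟨i, j⟩ h
    simp only [Finset.mem_antidiagonal] at h
    have hj : a - i = j := by linarith [h.2.2]
    have hta : t ^ a = t ^ i * t ^ j := by rw [← Real.rpow_add ht, h.2.2]
    rw [← enorm_mul]
    simp only [hj, hta]
    push_cast
    congr 1
    ring
  refine (ENNReal.tsum_le_tsum key).trans ?_
  rw [ENNReal.tsum_comm]
  simp_rw [ENNReal.tsum_mul_left]
  have : ∀ i : ℝ, ∑' a : ℝ, ‖y.coeff (a - i) * ((t ^ (a - i) : ℝ) : ℂ)‖ₑ = mass t y := fun i =>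
    (Equiv.subRight i).tsum_eq fun j : ℝ => ‖y.coeff j * ((t ^ j : ℝ) : ℂ)‖ₑ
  simp_rw [this]
  rw [ENNReal.tsum_mul_right]
  rfl

theorem single (r : ℝ) (c : ℂ) : LocConv (HahnSeries.single r c) := by
  refine ⟨1, one_pos, fun t _ _ => summable_of_ne_finset_zero (s := {r}) fun s hs => ?_⟩
  rw [HahnSeries.coeff_single_of_ne (by simpa using hs), zero_mul]

theorem add {x y : HahnSeries ℝ ℂ} (hx : LocConv x) (hy : LocConv y) : LocConv (x + y) := by
  obtain ⟨ρ, h0, h⟩ := hx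
  obtain ⟨σ, k0, k⟩ := hy
  refine ⟨min ρ σ, lt_min h0 k0, fun t ht htl => ?_⟩
  have := (h t ht (htl.trans_le (min_le_left _ _))).add (k t ht (htl.trans_le (min_le_right _ _)))
  simpa [add_mul] using this

theorem neg {x : HahnSeries ℝ ℂ} (hx : LocConv x) : LocConv (-x) := by
  obtain ⟨ρ, h0, h⟩ := hx
  exact ⟨ρ, h0, fun t ht htl => by simpa using (h t ht htl).neg⟩

theorem mul {x y : HahnSeries ℝ ℂ} (hx : LocConv x) (hy : LocConv y) : LocConv (x * y) := by
  obtain ⟨ρ, h0, h⟩ := hx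
  obtain ⟨σ, k0, k⟩ := hy
  refine ⟨min ρ σ, lt_min h0 k0, fun t ht htl => ?_⟩
  have h1 := (summable_iff t x).1 (h t ht (htl.trans_le (min_le_left _ _)))
  have h2 := (summable_iff t y).1 (k t ht (htl.trans_le (min_le_right _ _)))
  exact (summable_iff _ _).2 (ne_top_of_le_ne_top (ENNReal.mul_ne_top h1 h2) (mass_mul ht x y))

theorem mass_one (t : ℝ) : mass t 1 = 1 := by
  rw [mass, tsum_eq_single 0]
  · simp
  · intro r hr
    simp [HahnSeries.coeff_one, hr]

theorem mass_pow {t : ℝ} (ht : 0 < t) (x : HahnSeries ℝ ℂ) (n : ℕ) :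
    mass t (x ^ n) ≤ mass t x ^ n := by
  induction n with
  | zero => simp [mass_one]
  | succ n ih =>
    rw [pow_succ, pow_succ]
    exact (mass_mul ht _ _).trans (mul_le_mul_left ih _)

theorem mass_hsum (t : ℝ) (s : HahnSeries.SummableFamily ℝ ℂ ℕ) :
    mass t s.hsum ≤ ∑' n, mass t (s n) := by
  have : ∑' n, mass t (s n) =
      ∑' r : ℝ, ∑' n, ‖(s n).coeff r * ((t ^ r : ℝ) : ℂ)‖ₑ := ENNReal.tsum_comm
  rw [this]
  refine ENNReal.tsum_le_tsum fun r => ?_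
  rw [HahnSeries.SummableFamily.coeff_hsum_eq_sum, Finset.sum_mul]
  exact (enorm_sum_le _ _).trans (ENNReal.sum_le_tsum _)

/-- A series with positive order has arbitrarily small mass. -/
theorem exists_mass_lt_one {y : HahnSeries ℝ ℂ} (hy : LocConv y) (hpos : 0 < y.orderTop) :
    ∃ ρ : ℝ, 0 < ρ ∧ ∀ t : ℝ, 0 < t → t < ρ → mass t y < 1 := by
  rcases eq_or_ne y 0 with rfl | hne
  · exact ⟨1, one_pos, fun t _ _ => by simp [mass]⟩
  obtain ⟨σ, k0, k⟩ := hy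
  set ρ := σ / 2 with hρ
  have hρ0 : 0 < ρ := by positivity
  have hM : mass ρ y ≠ ∞ := (summable_iff _ _).1 (k ρ hρ0 (by linarith))
  set a := y.order with ha
  have ha0 : 0 < a := by
    rw [HahnSeries.orderTop_of_ne_zero hne] at hpos
    have : ((0 : ℝ) : WithTop ℝ) < (a : WithTop ℝ) := by
      rw [ha, HahnSeries.order_eq_orderTop_of_ne_zero hne, HahnSeries.orderTop_of_ne_zero hne]
      exact hpos
    exact_mod_cast this
  have hbound : ∀ t : ℝ, 0 < t → t < ρ →
      mass t y ≤ ENNReal.ofReal ((t / ρ) ^ a) * mass ρ y := by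
    intro t ht htρ
    rw [mass, mass, ← ENNReal.tsum_mul_left]
    refine ENNReal.tsum_le_tsum fun r => ?_
    by_cases hr : y.coeff r = 0
    · simp [hr]
    have har : a ≤ r := HahnSeries.order_le_of_coeff_ne_zero hr
    have hq0 : 0 < t / ρ := by positivity
    have hq1 : t / ρ ≤ 1 := by rw [div_le_one hρ0]; exact htρ.le
    have h1 : t ^ r = (t / ρ) ^ r * ρ ^ r := by
      rw [← Real.mul_rpow hq0.le hρ0.le, div_mul_cancel₀ _ hρ0.ne']
    have h2 : (t / ρ) ^ r ≤ (t / ρ) ^ a := Real.rpow_le_rpow_of_exponent_ge hq0 hq1 har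
    rw [← ofReal_norm, ← ofReal_norm, ← ENNReal.ofReal_mul (by positivity)]
    refine ENNReal.ofReal_le_ofReal ?_
    rw [norm_mul, norm_mul, Complex.norm_real, Complex.norm_real,
      Real.norm_of_nonneg (by positivity), Real.norm_of_nonneg (by positivity), h1]
    calc ‖y.coeff r‖ * ((t / ρ) ^ r * ρ ^ r)
        = (t / ρ) ^ r * (‖y.coeff r‖ * ρ ^ r) := by ring
      _ ≤ _ := by gcongr
  have hlim : Filter.Tendsto (fun t : ℝ => ENNReal.ofReal ((t / ρ) ^ a) * mass ρ y)
      (nhds 0) (nhds 0) := by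
    have h1 : Filter.Tendsto (fun t : ℝ => (t / ρ) ^ a) (nhds 0) (nhds 0) := by
      have : ContinuousAt (fun t : ℝ => (t / ρ) ^ a) 0 :=
        (continuousAt_id.div_const ρ).rpow_const (Or.inr ha0.le)
      simpa [ContinuousAt, Real.zero_rpow ha0.ne'] using this
    have h2 := ENNReal.Tendsto.mul_const (b := mass ρ y) (ENNReal.tendsto_ofReal h1) (Or.inr hM)
    simpa using h2
  obtain ⟨δ, hδ, hδ'⟩ := Metric.eventually_nhds_iff.1
    (hlim.eventually (gt_mem_nhds (zero_lt_one : (0 : ℝ≥0∞) < 1)))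
  refine ⟨min δ ρ, lt_min hδ hρ0, fun t ht htl => ?_⟩
  refine (hbound t ht (htl.trans_le (min_le_right _ _))).trans_lt (hδ' ?_)
  rw [Real.dist_eq, sub_zero, abs_of_pos ht]
  exact htl.trans_le (min_le_left _ _)

theorem inv {x : HahnSeries ℝ ℂ} (hx : LocConv x) : LocConv x⁻¹ := by
  rcases eq_or_ne x 0 with rfl | hne
  · simpa using hx
  rw [HahnSeries.inv_def]
  refine mul (single _ _) ?_
  set y : HahnSeries ℝ ℂ := 1 - HahnSeries.single (-x.order) x.leadingCoeff⁻¹ * x with hydef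
  have hpos : 0 < y.orderTop := HahnSeries.unit_aux x
    (inv_mul_cancel₀ (HahnSeries.leadingCoeff_ne_zero.mpr hne)) _ (neg_add_cancel x.order)
  have hy : LocConv y := by
    rw [hydef, sub_eq_add_neg]
    exact add (single 0 1) (neg (mul (single _ _) hx))
  obtain ⟨ρ, h0, h⟩ := exists_mass_lt_one hy hpos
  refine ⟨ρ, h0, fun t ht htl => (summable_iff _ _).2 ?_⟩
  refine ne_top_of_le_ne_top ?_ (mass_hsum t _)
  have hle : ∑' n, mass t (HahnSeries.SummableFamily.powers y n) ≤ ∑' n, mass t y ^ n := by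
    refine ENNReal.tsum_le_tsum fun n => ?_
    rw [HahnSeries.SummableFamily.powers_of_orderTop_pos hpos]
    exact mass_pow ht y n
  refine ne_top_of_le_ne_top ?_ hle
  rw [ENNReal.tsum_geometric]
  exact ENNReal.inv_ne_top.2 (tsub_pos_of_lt (h t ht htl)).ne'

end LocConv

/-- The locally convergent generalized Puiseux series, as a subfield of all Hahn series. -/
def puiseuxSubfield : Subfield (HahnSeries ℝ ℂ) where
  carrier := {x | LocConv x}
  mul_mem' := LocConv.mul
  one_mem' := LocConv.single 0 1
  add_mem' := LocConv.add
  zero_mem' := by simpa using LocConv.single 0 0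
  neg_mem' := LocConv.neg
  inv_mem' _ := LocConv.inv

/-- The field of locally convergent generalized Puiseux series. -/
def Puiseux : Type := puiseuxSubfield

instance : Field Puiseux := inferInstanceAs (Field puiseuxSubfield)

/-- The underlying series. -/
def Puiseux.series (x : Puiseux) : HahnSeries ℝ ℂ := Subtype.val (p := (· ∈ puiseuxSubfield)) x

/-- Every coefficient of the series is a real number. -/
def IsRealSeries (x : Puiseux) : Prop := ∀ r : ℝ, (x.series.coeff r).im = 0

/-- A point with both coordinates real. -/
def IsRealPoint (p : Fin 2 → Puiseux) : Prop := ∀ i, IsRealSeries (p i)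

/-- `q` is the complex conjugate of `p` (coefficientwise conjugation of each coordinate). -/
def IsConjPoint (p q : Fin 2 → Puiseux) : Prop :=
  ∀ i r, (q i).series.coeff r = starRingEnd ℂ ((p i).series.coeff r)

/-- The valuation of a nonzero series: its smallest exponent. -/
def val (x : Puiseux) : ℝ := x.series.order

/-- Tropicalisation of a point of the torus (max convention). -/
def tropPoint (p : Fin 2 → Puiseux) : Fin 2 → ℝ := fun i => -val (p i)

/-! Tropical polynomials and tropical curves in `ℝ²` (max convention). -/

/-- A tropical polynomial in two variables: a finite set of exponents in `ℕ²` and, on it, real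
coefficients. Its value at `v` is the maximum over `α ∈ supp` of `coeff α + ⟨α, v⟩`. Only the
values of `coeff` on `supp` matter (outside `supp` the coefficient is `-∞`). -/
structure TropPoly where
  supp : Finset (Fin 2 →₀ ℕ)
  coeff : (Fin 2 →₀ ℕ) → ℝ

/-- An exponent as a point of the plane. -/
def expVec (α : Fin 2 →₀ ℕ) : Fin 2 → ℝ := fun i => (α i : ℝ)

/-- Euclidean area of the triangle with vertices `α, β, γ`. -/
def triangleArea (α β γ : Fin 2 →₀ ℕ) : ℝ :=
  |((β 0 : ℝ) - α 0) * ((γ 1 : ℝ) - α 1) - ((β 1 : ℝ) - α 1) * ((γ 0 : ℝ) - α 0)| / 2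

namespace TropPoly

/-- The value at `v` of the monomial with exponent `α`. -/
def term (P : TropPoly) (α : Fin 2 →₀ ℕ) (v : Fin 2 → ℝ) : ℝ :=
  P.coeff α + ∑ i, (α i : ℝ) * v i

open Classical in
/-- The exponents whose monomials attain the maximum at `v`. Their convex hull is the cell of the
dual subdivision corresponding to the cell that contains `v` in its relative interior. -/
def maxAt (P : TropPoly) (v : Fin 2 → ℝ) : Finset (Fin 2 →₀ ℕ) :=
  P.supp.filter fun α => ∀ β ∈ P.supp, P.term β v ≤ P.term α v

/-- The corner locus: the points where the maximum is attained at least twice. -/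
def curve (P : TropPoly) : Set (Fin 2 → ℝ) := {v | 2 ≤ (P.maxAt v).card}

/-- The closed edges of the tropical curve, i.e. the closed one-dimensional cells of the corner
locus: those whose dual cell is one-dimensional. -/
def IsEdge (P : TropPoly) (e : Set (Fin 2 → ℝ)) : Prop :=
  ∃ v, 2 ≤ (P.maxAt v).card ∧ Collinear ℝ (expVec '' (P.maxAt v : Set (Fin 2 →₀ ℕ))) ∧
    e = {w | P.maxAt v ⊆ P.maxAt w}

open Classical in
/-- The exponents of the monomials that attain the maximum on all of `e`; for an edge `e` of a
non-singular curve these are the two endpoints of the dual edge `e^∨`. -/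
def dual (P : TropPoly) (e : Set (Fin 2 → ℝ)) : Finset (Fin 2 →₀ ℕ) :=
  P.supp.filter fun α => ∀ v ∈ e, α ∈ P.maxAt v

/-- The weight of an edge. -/
def weight (P : TropPoly) (e : Set (Fin 2 → ℝ)) : ℕ :=
  (P.dual e ×ˢ P.dual e).sup fun x =>
    Int.gcd ((x.1 0 : ℤ) - (x.2 0 : ℤ)) ((x.1 1 : ℤ) - (x.2 1 : ℤ))

/-- The tropical curve is non-singular: the dual subdivision is a triangulation whose
two-dimensional cells have area `1/2`. The condition that all edges have weight one follows from
this when the Newton polygon is two-dimensional; when the Newton polygon is a segment it says that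
all its integer points are vertices of the subdivision. -/
def Nonsingular (P : TropPoly) : Prop :=
  (∀ v, ¬ Collinear ℝ (expVec '' (P.maxAt v : Set (Fin 2 →₀ ℕ))) →
    ∃ α β γ, (P.maxAt v : Set (Fin 2 →₀ ℕ)) = {α, β, γ} ∧ triangleArea α β γ = 1 / 2) ∧
  ∀ e, P.IsEdge e → P.weight e = 1

/-- The sign at the symmetric copy `ε(α)` of `α` of the extension of a distribution of signs:
`δ(ε(α)) = (-1)^{ε₁ α₁ + ε₂ α₂} δ(α)`. -/
def symSign (δ : (Fin 2 →₀ ℕ) → ℤˣ) (ε : Fin 2 → ZMod 2) (α : Fin 2 →₀ ℕ) : ℤˣ :=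
  (-1) ^ (∑ i, (ε i).val * α i) * δ α

/-- The set `𝓔_e ⊆ ℤ₂²` determined by a distribution of signs: the symmetries `ε` such that
`ε(e^∨)` has two vertices of opposite signs. -/
def phase (P : TropPoly) (δ : (Fin 2 →₀ ℕ) → ℤˣ) (e : Set (Fin 2 → ℝ)) : Set (Fin 2 → ZMod 2) :=
  {ε | ∃ α ∈ P.dual e, ∃ β ∈ P.dual e, symSign δ ε α ≠ symSign δ ε β}

/-- `E` (used on the edges only) is a real phase structure on the tropical curve of `P`. -/
def IsRealPhase (P : TropPoly) (E : Set (Fin 2 → ℝ) → Set (Fin 2 → ZMod 2)) : Prop :=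
  ∃ δ : (Fin 2 →₀ ℕ) → ℤˣ, ∀ e, P.IsEdge e → E e = P.phase δ e

/-- The edge `e` is twisted: for every `ε ∈ 𝓔_e`, the two edges adjacent to `e` that carry `ε` lie
on distinct sides of the line containing `e`. -/
def IsTwisted (P : TropPoly) (E : Set (Fin 2 → ℝ) → Set (Fin 2 → ZMod 2))
    (e : Set (Fin 2 → ℝ)) : Prop :=
  ∀ ε ∈ E e, ∀ e₁ e₂, P.IsEdge e₁ → P.IsEdge e₂ → e₁ ≠ e → e₂ ≠ e → e₁ ≠ e₂ →
    (e₁ ∩ e).Nonempty → (e₂ ∩ e).Nonempty → ε ∈ E e₁ → ε ∈ E e₂ →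
    ∃ x ∈ e₁, ∃ y ∈ e₂, (affineSpan ℝ e).SOppSide x y

end TropPoly

/-! Algebraic curves in the torus and their realisations. -/

/-- The curve defined by `F` in the torus `(K^×)²`. -/
def torusCurve (F : MvPolynomial (Fin 2) Puiseux) : Set (Fin 2 → Puiseux) :=
  {p | (∀ i, p i ≠ 0) ∧ MvPolynomial.eval p F = 0}

/-- The tropical polynomial of `F`, with coefficients `-val`. -/
def tropPoly (F : MvPolynomial (Fin 2) Puiseux) : TropPoly where
  supp := F.support
  coeff α := -val (F.coeff α)

/-- The distribution of signs of a polynomial with real coefficients: the sign of the leading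
coefficient of each coefficient. -/
def signDist (F : MvPolynomial (Fin 2) Puiseux) (α : Fin 2 →₀ ℕ) : ℤˣ :=
  if 0 < ((F.coeff α).series.leadingCoeff).re then 1 else -1

/-- The weighted tropical curve of `P` is the tropicalisation of the curve of `F`: the image of the
curve under `tropPoint`, as a polyhedral complex, with the weights given by `F`. -/
def HasTropicalisation (F : MvPolynomial (Fin 2) Puiseux) (P : TropPoly) : Prop :=
  tropPoint '' torusCurve F = P.curve ∧
  ∀ e, ((tropPoly F).IsEdge e ↔ P.IsEdge e) ∧
    (P.IsEdge e → (tropPoly F).weight e = P.weight e)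

/-- The real curve defined by `F` is a realisation of the real tropical curve given by `P`, `E`. -/
def IsRealisation (P : TropPoly) (E : Set (Fin 2 → ℝ) → Set (Fin 2 → ZMod 2))
    (F : MvPolynomial (Fin 2) Puiseux) : Prop :=
  (∀ α, IsRealSeries (F.coeff α)) ∧ HasTropicalisation F P ∧
  ∀ e, P.IsEdge e → (tropPoly F).phase (signDist F) e = E e

/-- The ideal of polynomials vanishing at `p`. -/
def pointIdeal (p : Fin 2 → Puiseux) : Ideal (MvPolynomial (Fin 2) Puiseux) :=
  RingHom.ker (MvPolynomial.eval p)

instance pointIdeal_isPrime (p : Fin 2 → Puiseux) : (pointIdeal p).IsPrime :=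
  RingHom.ker_isPrime _

/-- The local ring of the plane at `p`. -/
abbrev LocalRingAt (p : Fin 2 → Puiseux) : Type := Localization.AtPrime (pointIdeal p)

/-- Intersection multiplicity at `p`: the dimension of the local ring of the plane at `p` modulo
the two equations. -/
def interMult (F G : MvPolynomial (Fin 2) Puiseux) (p : Fin 2 → Puiseux) : ℕ :=
  Module.finrank Puiseux
    (LocalRingAt p ⧸ (Ideal.span {algebraMap _ (LocalRingAt p) F, algebraMap _ (LocalRingAt p) G}))

/-- The intersection points of the two curves that tropicalise into `e`. -/
def interPoints (F G : MvPolynomial (Fin 2) Puiseux) (e : Set (Fin 2 → ℝ)) :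
    Set (Fin 2 → Puiseux) :=
  {p | p ∈ torusCurve F ∧ p ∈ torusCurve G ∧ tropPoint p ∈ e}

/-- Over `e` the curves meet in exactly two distinct real points, both of multiplicity one. -/
def TwoReal (F G : MvPolynomial (Fin 2) Puiseux) (e : Set (Fin 2 → ℝ)) : Prop :=
  ∃ p q, p ≠ q ∧ IsRealPoint p ∧ IsRealPoint q ∧ interPoints F G e = {p, q} ∧
    interMult F G p = 1 ∧ interMult F G q = 1

/-- Over `e` the curves meet in exactly two distinct complex conjugate points, both of
multiplicity one. -/
def TwoConj (F G : MvPolynomial (Fin 2) Puiseux) (e : Set (Fin 2 → ℝ)) : Prop :=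
  ∃ p q, p ≠ q ∧ IsConjPoint p q ∧ interPoints F G e = {p, q} ∧
    interMult F G p = 1 ∧ interMult F G q = 1

/-- Over `e` the curves meet in exactly one point, which is real and of multiplicity two. -/
def DoubleReal (F G : MvPolynomial (Fin 2) Puiseux) (e : Set (Fin 2 → ℝ)) : Prop :=
  ∃ p, IsRealPoint p ∧ interPoints F G e = {p} ∧ interMult F G p = 2

/-- `F` with the coefficient of exponent `α` replaced by `c`. -/
def setCoeff (F : MvPolynomial (Fin 2) Puiseux) (α : Fin 2 →₀ ℕ) (c : Puiseux) :
    MvPolynomial (Fin 2) Puiseux :=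
  F + MvPolynomial.monomial α (c - F.coeff α)

end

noncomputable section
open scoped ENNReal

/-! ### Locally convergent series: valuation, real series, conjugation -/

namespace Puiseux

/-! Normal form. Let α₀, α₁ be the endpoints of the edge dual to `e` and α₂, α₃ the third vertices
of the two triangles next to it. In the lattice basis α₁ - α₀, α₂ - α₀ the vector α₃ - α₀ is (k,
-1). The corresponding monomials, suitably rescaled, are functions x, u, w on the torus with u w = θ
xᵏ, where val θ is the lattice length of `e`. A point tropicalises into `e` exactly if x has order
zero and u, w have non-negative order (`EdgeChart.tropPoint_mem_iff`). Up to invertible factors F =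
f₀ + f₁ x + u + w + (small) and G = g₀ + g₁ x + (small): along `e` only the two endpoints of the
edge dual to `e'` are maximal for G. Eliminating x from the linear part of F leaves a `QuadSystem`
with parameter a = f₀ - f₁ g₀ / g₁ (`EdgeChart.Adapted.isQuadChart`). Without the small terms, w
would be a root of w² + a w + θ h, where h is xᵏ up to sign.

Solving. With the small terms, the system is solved in a quadratic algebra whose generator ω
satisfies ω² + p ω + θ κ = 0 and plays the role of w. Comparing coordinates with respect to 1, ω
turns the system into a fixed point problem with perturbations in the maximal ideal. It is solved by
`realRing_fixedPointProperty`, where an iteration converges in valuation and, for every small t > 0,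
absolutely. The solution has p ≡ a and κ ≡ h modulo the maximal ideal. By Nakayama's lemma
(`QuadSystem.IsSol.mem_ideal`) the original equations imply x = X(w), u = U(w) and w² + p w + θ κ =
0. Hence the points over `e` correspond to the roots of this quadratic, a simple root has
multiplicity one and a double root multiplicity two (`IsQuadChart.interMult_eq_one`,
`IsQuadChart.interMult_eq_two`). To obtain this, the identities of `IsQuadChart` are used over the
field, over local rings and over the dual numbers. Since positive real series have real square
roots, the sign of the discriminant p² - 4 θ κ decides the type of the intersection.

Signs. The sign of θ is moved into h, so that θ is positive. The phases of `e` and `e'` differ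
exactly if the relative signs of the endpoints differ (`TropPoly.phase_eq_iff`). In this case f₀ and
f₁ g₀ / g₁ have opposite signs, a is a unit, and p² dominates the discriminant. If the phases agree,
the sign of κ is `EdgeChart.edgeSign`, and it is -1 exactly for twisted edges
(`EdgeChart.isTwisted_iff`). A negative κ makes the discriminant positive.

Varying a coefficient. For an untwisted edge with equal phases κ is a positive unit. Varying one of
the four coefficients amounts to varying a in a fixed system. Every small a has a unique p, and
every small p occurs for some small a. Values of p of low order give two real points and values of
high order give two conjugate points. The discriminant vanishes exactly if p = 2 r σ with r² = θ and
σ the square root of κ near a fixed one; each of the two choices of r belongs to exactly one a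
(`IsQuadChart.Family.encard_doubleReal`).

Realisations. A realisation prescribes the weighted tropical curve and not the tropical polynomial.
Non-singularity therefore has to be recovered from the curve (`TropPoly.Nonsingular.transfer`), and
polynomials that are to be realisations need a tropicalisation that fills the whole curve
(`image_torusCurve_eq`). The latter follows again from the fixed point principle. -/

theorem series_injective : Function.Injective Puiseux.series := Subtype.val_injective

theorem locConv (x : Puiseux) : LocConv x.series := x.2

@[simp] theorem series_zero : (0 : Puiseux).series = 0 := rfl
@[simp] theorem series_one : (1 : Puiseux).series = 1 := rfl
@[simp] theorem series_add (x y : Puiseux) : (x + y).series = x.series + y.series := rfl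
@[simp] theorem series_sub (x y : Puiseux) : (x - y).series = x.series - y.series := rfl
@[simp] theorem series_neg (x : Puiseux) : (-x).series = -x.series := rfl
@[simp] theorem series_mul (x y : Puiseux) : (x * y).series = x.series * y.series := rfl

@[simp] theorem series_eq_zero {x : Puiseux} : x.series = 0 ↔ x = 0 :=
  ⟨fun h => series_injective h, fun h => by rw [h]; rfl⟩

/-- The monomial `c t^r`. -/
def mono (r : ℝ) (c : ℂ) : Puiseux := (⟨HahnSeries.single r c, LocConv.single r c⟩ : puiseuxSubfield)

@[simp] theorem series_mono (r : ℝ) (c : ℂ) : (mono r c).series = HahnSeries.single r c := rfl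

theorem mono_ne_zero {r : ℝ} {c : ℂ} (hc : c ≠ 0) : mono r c ≠ 0 := by
  rw [Ne, ← series_eq_zero]; simpa using hc

theorem mono_mul (r s : ℝ) (c d : ℂ) : mono r c * mono s d = mono (r + s) (c * d) := by
  apply series_injective; simp

/-- The valuation with values in `ℝ ∪ {∞}`. -/
def ord (x : Puiseux) : WithTop ℝ := x.series.orderTop

@[simp] theorem ord_zero : ord 0 = ⊤ := by simp [ord]
@[simp] theorem ord_one : ord 1 = 0 := by simp [ord]
theorem ord_eq_top {x : Puiseux} : ord x = ⊤ ↔ x = 0 := by simp [ord]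
theorem ord_mul (x y : Puiseux) : ord (x * y) = ord x + ord y := HahnSeries.orderTop_mul _ _
theorem ord_neg (x : Puiseux) : ord (-x) = ord x := HahnSeries.orderTop_neg
theorem ord_add (x y : Puiseux) : min (ord x) (ord y) ≤ ord (x + y) :=
  HahnSeries.min_orderTop_le_orderTop_add
theorem ord_eq_val {x : Puiseux} (hx : x ≠ 0) : ord x = (val x : ℝ) :=
  (HahnSeries.order_eq_orderTop_of_ne_zero (by simpa using hx)).symm

theorem ord_mono {r : ℝ} {c : ℂ} (hc : c ≠ 0) : ord (mono r c) = (r : ℝ) := by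
  simpa [ord] using HahnSeries.orderTop_single hc

theorem val_mono {r : ℝ} {c : ℂ} (hc : c ≠ 0) : val (mono r c) = r := by
  simpa [val] using HahnSeries.order_single hc

theorem val_mul {x y : Puiseux} (hx : x ≠ 0) (hy : y ≠ 0) : val (x * y) = val x + val y := by
  have := ord_mul x y
  rw [ord_eq_val hx, ord_eq_val hy, ord_eq_val (mul_ne_zero hx hy)] at this
  exact_mod_cast this

@[simp] theorem val_one : val 1 = 0 := by simp [val]

theorem val_inv {x : Puiseux} (hx : x ≠ 0) : val x⁻¹ = -val x := by
  have := val_mul hx (inv_ne_zero hx)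
  rw [mul_inv_cancel₀ hx, val_one] at this
  linarith

theorem val_div {x y : Puiseux} (hx : x ≠ 0) (hy : y ≠ 0) : val (x / y) = val x - val y := by
  rw [div_eq_mul_inv, val_mul hx (inv_ne_zero hy), val_inv hy]; ring

theorem val_pow {x : Puiseux} (hx : x ≠ 0) (n : ℕ) : val (x ^ n) = n * val x := by
  induction n with
  | zero => simp
  | succ n ih => rw [pow_succ, val_mul (pow_ne_zero _ hx) hx, ih]; push_cast; ring

theorem val_zpow {x : Puiseux} (hx : x ≠ 0) (n : ℤ) : val (x ^ n) = n * val x := by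
  cases n with
  | ofNat n => simpa using val_pow hx n
  | negSucc n => rw [zpow_negSucc, val_inv (pow_ne_zero _ hx), val_pow hx]; push_cast; ring

theorem ord_nonneg_iff {x : Puiseux} (hx : x ≠ 0) : 0 ≤ ord x ↔ 0 ≤ val x := by
  rw [ord_eq_val hx]; exact_mod_cast Iff.rfl

theorem ord_pos_iff {x : Puiseux} (hx : x ≠ 0) : 0 < ord x ↔ 0 < val x := by
  rw [ord_eq_val hx]; exact_mod_cast Iff.rfl

theorem ord_eq_zero_iff {x : Puiseux} (hx : x ≠ 0) : ord x = 0 ↔ val x = 0 := by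
  rw [ord_eq_val hx]; exact_mod_cast Iff.rfl

theorem ne_zero_of_ord_eq_zero {x : Puiseux} (hx : ord x = 0) : x ≠ 0 := by
  rintro rfl; simp at hx

theorem ord_inv_of_ord_eq_zero {x : Puiseux} (hx : ord x = 0) : ord x⁻¹ = 0 := by
  have h := ne_zero_of_ord_eq_zero hx
  rw [ord_eq_zero_iff (inv_ne_zero h), val_inv h, (ord_eq_zero_iff h).1 hx, neg_zero]

theorem ord_add_eq_left {x y : Puiseux} (h : ord x < ord y) : ord (x + y) = ord x :=
  HahnSeries.orderTop_add_eq_left h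

theorem ord_sum_lt {ι : Type*} (s : Finset ι) (f : ι → Puiseux) (r : WithTop ℝ) (hr : r < ⊤)
    (h : ∀ i ∈ s, r < ord (f i)) : r < ord (∑ i ∈ s, f i) := by
  classical
  induction s using Finset.induction_on with
  | empty => simpa using hr
  | insert a s ha ih =>
    rw [Finset.sum_insert ha]
    exact (lt_min (h a (Finset.mem_insert_self _ _))
      (ih fun i hi => h i (Finset.mem_insert_of_mem hi))).trans_le (ord_add _ _)

/-- Coefficientwise conjugation. -/
def conj : Puiseux →+* Puiseux where
  toFun x := (⟨x.series.map (starRingEnd ℂ), by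
    obtain ⟨ρ, h0, h⟩ := x.locConv
    refine ⟨ρ, h0, fun t ht htl => ?_⟩
    -- Conjugation preserves the absolute values of the terms, and convergence here means absolute
    -- convergence.
    have h1 := (summable_norm_iff.2 (h t ht htl))
    rw [← summable_norm_iff]
    refine h1.congr fun r => ?_
    simp⟩ : puiseuxSubfield)
  map_one' := series_injective (HahnSeries.map_one (starRingEnd ℂ).toMonoidWithZeroHom)
  map_zero' := series_injective (HahnSeries.map_zero (starRingEnd ℂ : ZeroHom ℂ ℂ))
  map_mul' x y := series_injective (HahnSeries.map_mul (starRingEnd ℂ : ℂ →ₙ+* ℂ))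
  map_add' x y := series_injective (HahnSeries.map_add (starRingEnd ℂ : ℂ →+ ℂ))

theorem coeff_conj (x : Puiseux) (r : ℝ) :
    (conj x).series.coeff r = starRingEnd ℂ (x.series.coeff r) := rfl

theorem isRealSeries_iff {x : Puiseux} : IsRealSeries x ↔ conj x = x := by
  constructor
  · intro h
    apply series_injective
    ext r
    rw [coeff_conj]
    exact Complex.conj_eq_iff_im.2 (h r)
  · intro h r
    rw [← Complex.conj_eq_iff_im, ← coeff_conj, h]

end Puiseux

/-! ### The real subfield and its valuation ring -/

open Puiseux

/-- The field of real series. -/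
def realSubfield : Subfield Puiseux := RingHom.eqLocusField conj (RingHom.id _)

theorem mem_realSubfield {x : Puiseux} : x ∈ realSubfield ↔ IsRealSeries x :=
  isRealSeries_iff.symm

namespace IsRealSeries

theorem zero : IsRealSeries 0 := fun _ => by simp
theorem one : IsRealSeries 1 := mem_realSubfield.1 (one_mem _)
theorem add {x y : Puiseux} (hx : IsRealSeries x) (hy : IsRealSeries y) : IsRealSeries (x + y) :=
  mem_realSubfield.1 (add_mem (mem_realSubfield.2 hx) (mem_realSubfield.2 hy))
theorem sub {x y : Puiseux} (hx : IsRealSeries x) (hy : IsRealSeries y) : IsRealSeries (x - y) :=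
  mem_realSubfield.1 (sub_mem (mem_realSubfield.2 hx) (mem_realSubfield.2 hy))
theorem mul {x y : Puiseux} (hx : IsRealSeries x) (hy : IsRealSeries y) : IsRealSeries (x * y) :=
  mem_realSubfield.1 (mul_mem (mem_realSubfield.2 hx) (mem_realSubfield.2 hy))
theorem div {x y : Puiseux} (hx : IsRealSeries x) (hy : IsRealSeries y) : IsRealSeries (x / y) :=
  mem_realSubfield.1 (div_mem (mem_realSubfield.2 hx) (mem_realSubfield.2 hy))
theorem neg {x : Puiseux} (hx : IsRealSeries x) : IsRealSeries (-x) :=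
  mem_realSubfield.1 (neg_mem (mem_realSubfield.2 hx))
theorem inv {x : Puiseux} (hx : IsRealSeries x) : IsRealSeries x⁻¹ :=
  mem_realSubfield.1 (inv_mem (mem_realSubfield.2 hx))
theorem zpow {x : Puiseux} (hx : IsRealSeries x) (n : ℤ) : IsRealSeries (x ^ n) :=
  mem_realSubfield.1 (zpow_mem (mem_realSubfield.2 hx) n)
theorem pow {x : Puiseux} (hx : IsRealSeries x) (n : ℕ) : IsRealSeries (x ^ n) :=
  mem_realSubfield.1 (pow_mem (mem_realSubfield.2 hx) n)
theorem mono (r c : ℝ) : IsRealSeries (Puiseux.mono r c) := by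
  intro s
  rw [series_mono, HahnSeries.coeff_single]
  split <;> simp

end IsRealSeries

/-- The valuation ring of all series. -/
def valRing : Subring Puiseux where
  carrier := {x | 0 ≤ ord x}
  one_mem' := by simp
  zero_mem' := by simp
  add_mem' ha hb := (le_min ha hb).trans (ord_add _ _)
  neg_mem' ha := by simpa [ord_neg] using ha
  mul_mem' ha hb := by
    simp only [Set.mem_ofPred_eq] at *
    rw [ord_mul]; exact add_nonneg ha hb

theorem mem_valRing {x : Puiseux} : x ∈ valRing ↔ 0 ≤ ord x := Iff.rfl

/-- The valuation ring of the real series. -/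
def realRing : Subring Puiseux := valRing ⊓ realSubfield.toSubring

theorem mem_realRing {x : Puiseux} : x ∈ realRing ↔ 0 ≤ ord x ∧ IsRealSeries x :=
  ⟨fun h => ⟨h.1, mem_realSubfield.1 h.2⟩, fun h => ⟨h.1, mem_realSubfield.2 h.2⟩⟩

/-- The maximal ideal of the real valuation ring. -/
def realIdeal : Ideal realRing where
  carrier := {x | 0 < ord (x : Puiseux)}
  zero_mem' := by simp
  add_mem' ha hb := (lt_min ha hb).trans_le (ord_add _ _)
  smul_mem' c x hx := by
    simp only [Set.mem_ofPred_eq, smul_eq_mul, Subring.coe_mul, ord_mul] at *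
    exact hx.trans_le (le_add_of_nonneg_left c.2.1)

theorem mem_realIdeal {x : realRing} : x ∈ realIdeal ↔ 0 < ord (x : Puiseux) := Iff.rfl

theorem isUnit_realRing_iff {x : realRing} : IsUnit x ↔ ord (x : Puiseux) = 0 := by
  constructor
  · rintro ⟨u, rfl⟩
    have h1 : ord (u : realRing).1 + ord ((u⁻¹ : realRingˣ) : realRing).1 = 0 := by
      rw [← ord_mul, ← Subring.coe_mul, Units.mul_inv]; simp
    have h2 := (u : realRing).2.1
    have h3 := ((u⁻¹ : realRingˣ) : realRing).2.1
    rw [SetLike.mem_coe, mem_valRing] at h2 h3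
    exact ((add_eq_zero_iff_of_nonneg h2 h3).1 h1).1
  · intro h
    have h0 := ne_zero_of_ord_eq_zero h
    refine IsUnit.of_mul_eq_one ⟨(x : Puiseux)⁻¹, mem_realRing.2 ⟨(ord_inv_of_ord_eq_zero h).ge,
      (mem_realRing.1 x.2).2.inv⟩⟩ ?_
    apply Subtype.ext
    simp [mul_inv_cancel₀ h0]

/-- The real valuation ring is local with maximal ideal `realIdeal`. "Unit" and "outside
`realIdeal`" are used interchangeably from here on. -/
theorem isUnit_realRing_iff_notMem {x : realRing} : IsUnit x ↔ x ∉ realIdeal := by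
  rw [isUnit_realRing_iff, mem_realIdeal, not_lt]
  exact ⟨fun h => h.le, fun h => le_antisymm h x.2.1⟩

theorem isUnit_of_sub_mem {x y : realRing} (hx : IsUnit x) (h : y - x ∈ realIdeal) : IsUnit y := by
  rw [isUnit_realRing_iff_notMem] at *
  intro hy
  exact hx (by simpa using realIdeal.sub_mem hy h)
end

noncomputable section
open scoped ENNReal
open Puiseux

/-! ### A fixed point principle (Hensel's lemma) for the real valuation ring -/

/-- Every system `zᵢ = cᵢ + Ψᵢ(z)` whose polynomials `Ψᵢ` have coefficients in `m` has exactly one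
solution. -/
def FixedPointProperty {O : Type*} [CommRing O] (m : Ideal O) : Prop :=
  ∀ (n : ℕ) (c : Fin n → O) (Ψ : Fin n → MvPolynomial (Fin n) O),
    (∀ i, Ψ i ∈ m.map MvPolynomial.C) → ∃! z : Fin n → O, ∀ i, z i = c i + MvPolynomial.eval z (Ψ i)

/-! ### Masses of convergent series as t tends to zero -/

open Filter Topology

namespace LocConv

theorem mass_add (t : ℝ) (x y : HahnSeries ℝ ℂ) : mass t (x + y) ≤ mass t x + mass t y := by
  rw [mass, mass, mass, ← ENNReal.tsum_add]
  refine ENNReal.tsum_le_tsum fun r => ?_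
  rw [HahnSeries.coeff_add, add_mul]
  exact enorm_add_le _ _

theorem mass_zero (t : ℝ) : mass t 0 = 0 := by simp [mass]

theorem mass_natCast_mul {t : ℝ} (N : ℕ) (x : HahnSeries ℝ ℂ) :
    mass t ((N : HahnSeries ℝ ℂ) * x) = N * mass t x := by
  rw [mass, mass, ← ENNReal.tsum_mul_left]
  refine tsum_congr fun r => ?_
  rw [← nsmul_eq_mul, HahnSeries.coeff_nsmul, Pi.smul_apply, nsmul_eq_mul, mul_assoc, enorm_mul]
  congr 1
  rw [← ofReal_norm]
  simp

/-- A mass below 1 near zero is known for every convergent series of positive order. Applied to the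
multiple N y, this bounds the mass of y by 1 / N. -/
theorem tendsto_mass_zero {y : HahnSeries ℝ ℂ} (hy : LocConv y) (hpos : 0 < y.orderTop) :
    Tendsto (fun t => mass t y) (𝓝[>] 0) (𝓝 0) := by
  rw [ENNReal.tendsto_nhds_zero]
  intro ε hε
  obtain ⟨N, hN⟩ := ENNReal.exists_inv_nat_lt hε.ne'
  have h1 : LocConv ((N : HahnSeries ℝ ℂ) * y) := by
    rw [← nsmul_eq_mul]
    exact puiseuxSubfield.nsmul_mem (x := y) hy N
  have h2 : 0 < ((N : HahnSeries ℝ ℂ) * y).orderTop := by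
    rw [← nsmul_eq_mul]
    exact hpos.trans_le (by simpa using HahnSeries.orderTop_le_orderTop_smul N y)
  obtain ⟨ρ, h0, h⟩ := exists_mass_lt_one h1 h2
  filter_upwards [Ioo_mem_nhdsGT h0] with t ht
  have h3 := h t ht.1 ht.2
  rw [mass_natCast_mul] at h3
  refine le_trans ?_ hN.le
  rw [ENNReal.le_inv_iff_mul_le, mul_comm]
  exact h3.le

/-- All exponents are non-negative, so each |αᵣ| tʳ increases with t and the mass at one fixed
radius bounds the masses at all smaller t. -/
theorem eventually_mass_le {x : HahnSeries ℝ ℂ} (hx : LocConv x) (h0 : 0 ≤ x.orderTop) :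
    ∃ B : ℝ≥0∞, B ≠ ∞ ∧ ∀ᶠ t in 𝓝[>] (0 : ℝ), mass t x ≤ B := by
  obtain ⟨ρ, hρ, h⟩ := hx
  refine ⟨mass (ρ / 2) x, (summable_iff _ _).1 (h _ (by linarith) (by linarith)), ?_⟩
  filter_upwards [Ioo_mem_nhdsGT (half_pos hρ)] with t ht
  refine ENNReal.tsum_le_tsum fun r => ?_
  by_cases hr : x.coeff r = 0
  · simp [hr]
  have hr0 : 0 ≤ r := by
    have := h0.trans (HahnSeries.orderTop_le_of_coeff_ne_zero hr)
    exact_mod_cast this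
  rw [enorm_mul, enorm_mul]
  gcongr
  rw [← ofReal_norm, ← ofReal_norm]
  refine ENNReal.ofReal_le_ofReal ?_
  have h1 := ht.1
  rw [Complex.norm_real, Complex.norm_real, Real.norm_of_nonneg (by positivity),
    Real.norm_of_nonneg (by positivity)]
  exact Real.rpow_le_rpow h1.le ht.2.le hr0

end LocConv

open LocConv

/-- The sum of absolute values of the terms of a real series at `t`. -/
def rmass (t : ℝ) (x : realRing) : ℝ≥0∞ := mass t (x : Puiseux).series

theorem rmass_add (t : ℝ) (x y : realRing) : rmass t (x + y) ≤ rmass t x + rmass t y :=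
  mass_add _ _ _
theorem rmass_mul {t : ℝ} (ht : 0 < t) (x y : realRing) :
    rmass t (x * y) ≤ rmass t x * rmass t y := mass_mul ht _ _

theorem eventually_rmass_le (x : realRing) :
    ∃ B : ℝ≥0∞, B ≠ ∞ ∧ ∀ᶠ t in 𝓝[>] (0 : ℝ), rmass t x ≤ B :=
  eventually_mass_le (x : Puiseux).locConv x.2.1

/-! ### Polynomial maps: Lipschitz bounds for masses and for valuations -/

section Polynomial

variable {n : ℕ}

/-- `Q` is bounded by `L` and Lipschitz with constant `L` on the points of mass at most `B`. -/
def MassBound (B L : ℝ≥0∞) (t : ℝ) (Q : MvPolynomial (Fin n) realRing) : Prop :=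
  ∀ (z z' : Fin n → realRing) (D : ℝ≥0∞), (∀ i, rmass t (z i) ≤ B) → (∀ i, rmass t (z' i) ≤ B) →
    (∀ i, rmass t (z i - z' i) ≤ D) → rmass t (MvPolynomial.eval z Q) ≤ L ∧
      rmass t (MvPolynomial.eval z Q - MvPolynomial.eval z' Q) ≤ L * D

theorem MassBound.add {B L L' : ℝ≥0∞} {t : ℝ} {Q Q' : MvPolynomial (Fin n) realRing}
    (h : MassBound B L t Q) (h' : MassBound B L' t Q') : MassBound B (L + L') t (Q + Q') := by
  intro z z' D h1 h2 h3
  obtain ⟨a, b⟩ := h z z' D h1 h2 h3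
  obtain ⟨a', b'⟩ := h' z z' D h1 h2 h3
  rw [map_add, map_add]
  refine ⟨(rmass_add _ _ _).trans (add_le_add a a'), ?_⟩
  rw [add_sub_add_comm, add_mul]
  exact (rmass_add _ _ _).trans (add_le_add b b')

/-- By the product rule Q Q' - q q' = Q (Q' - q') + (Q - q) q', the Lipschitz constant is the sum of
two terms L L'. This is the reason for the factor 2. -/
theorem MassBound.mul {B L L' : ℝ≥0∞} {t : ℝ} (ht : 0 < t) {Q Q' : MvPolynomial (Fin n) realRing}
    (h : MassBound B L t Q) (h' : MassBound B L' t Q') :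
    MassBound B (2 * L * L') t (Q * Q') := by
  intro z z' D h1 h2 h3
  obtain ⟨a, b⟩ := h z z' D h1 h2 h3
  obtain ⟨a', b'⟩ := h' z z' D h1 h2 h3
  obtain ⟨a'', -⟩ := h' z' z' D h2 h2 (fun i => by simp [rmass, mass_zero])
  rw [map_mul, map_mul]
  constructor
  · refine (rmass_mul ht _ _).trans ((mul_le_mul' a a').trans ?_)
    rw [two_mul, add_mul]
    exact le_self_add
  · have : MvPolynomial.eval z Q * MvPolynomial.eval z Q' -
        MvPolynomial.eval z' Q * MvPolynomial.eval z' Q' =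
        MvPolynomial.eval z Q * (MvPolynomial.eval z Q' - MvPolynomial.eval z' Q') +
        (MvPolynomial.eval z Q - MvPolynomial.eval z' Q) * MvPolynomial.eval z' Q' := by ring
    rw [this]
    refine (rmass_add _ _ _).trans ((add_le_add ((rmass_mul ht _ _).trans (mul_le_mul' a b'))
      ((rmass_mul ht _ _).trans (mul_le_mul' b a''))).trans (le_of_eq ?_))
    ring

theorem exists_massBound {B : ℝ≥0∞} (hB : B ≠ ∞) (Q : MvPolynomial (Fin n) realRing) :
    ∃ L : ℝ≥0∞, L ≠ ∞ ∧ ∀ᶠ t in 𝓝[>] (0 : ℝ), MassBound B L t Q := by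
  induction Q using MvPolynomial.induction_on with
  | C a =>
    obtain ⟨L, hL, h⟩ := eventually_rmass_le a
    refine ⟨L, hL, h.mono fun t ht z z' D _ _ _ => ?_⟩
    simp only [MvPolynomial.eval_C, sub_self]
    exact ⟨ht, by simp [rmass, mass_zero]⟩
  | add p q hp hq =>
    obtain ⟨L, hL, h⟩ := hp
    obtain ⟨L', hL', h'⟩ := hq
    exact ⟨L + L', ENNReal.add_ne_top.2 ⟨hL, hL'⟩, (h.and h').mono fun t ht => ht.1.add ht.2⟩
  | mul_X p i hp =>
    obtain ⟨L, hL, h⟩ := hp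
    -- A variable is bounded by B and has Lipschitz constant 1; B + 1 serves for both.
    refine ⟨2 * L * (B + 1), by finiteness, ?_⟩
    filter_upwards [h, self_mem_nhdsWithin] with t ht ht0
    refine ht.mul ht0 fun z z' D h1 h2 h3 => ?_
    simp only [MvPolynomial.eval_X]
    refine ⟨(h1 i).trans le_self_add, (h3 i).trans ?_⟩
    rw [add_mul, one_mul]
    exact le_add_self

/-- The coefficients have positive order, so their masses tend to zero with t. This makes the fixed
point iteration a contraction for every small t. -/
theorem exists_massBound_tendsto {B : ℝ≥0∞} (hB : B ≠ ∞) {Q : MvPolynomial (Fin n) realRing}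
    (hQ : Q ∈ realIdeal.map (MvPolynomial.C (σ := Fin n))) :
    ∃ L : ℝ → ℝ≥0∞, Tendsto L (𝓝[>] 0) (𝓝 0) ∧
      ∀ᶠ t in 𝓝[>] (0 : ℝ), MassBound B (L t) t Q := by
  induction hQ using Submodule.span_induction with
  | mem x hx =>
    obtain ⟨a, ha, rfl⟩ := hx
    refine ⟨fun t => rmass t a, tendsto_mass_zero (a : Puiseux).locConv ha,
      Eventually.of_forall fun t z z' D _ _ _ => ?_⟩
    simp [rmass, mass_zero]
  | zero =>
    refine ⟨fun _ => 0, tendsto_const_nhds, Eventually.of_forall fun t z z' D _ _ _ => ?_⟩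
    simp [rmass, mass_zero]
  | add x y _ _ hx hy =>
    obtain ⟨L, hL, h⟩ := hx
    obtain ⟨L', hL', h'⟩ := hy
    exact ⟨fun t => L t + L' t, by simpa using hL.add hL', (h.and h').mono fun t ht => ht.1.add ht.2⟩
  | smul a x _ hx =>
    obtain ⟨L, hL, h⟩ := hx
    obtain ⟨L', hL', h'⟩ := exists_massBound hB a
    refine ⟨fun t => 2 * L' * L t, ?_, ?_⟩
    · simpa using ENNReal.Tendsto.const_mul (a := 2 * L') hL (Or.inr (by finiteness))
    · filter_upwards [h, h', self_mem_nhdsWithin] with t ht ht' ht0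
      exact ht'.mul ht0 ht

/-- The ideal of series with valuation at least `r`. -/
def levelIdeal (r : ℝ) : Ideal realRing where
  carrier := {x | (r : WithTop ℝ) ≤ ord (x : Puiseux)}
  zero_mem' := by simp
  add_mem' ha hb := (le_min ha hb).trans (ord_add _ _)
  smul_mem' c x hx := by
    simp only [Set.mem_ofPred_eq, smul_eq_mul, Subring.coe_mul, ord_mul] at *
    exact hx.trans (le_add_of_nonneg_left c.2.1)

theorem mem_levelIdeal {r : ℝ} {x : realRing} :
    x ∈ levelIdeal r ↔ (r : WithTop ℝ) ≤ ord (x : Puiseux) := Iff.rfl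

/-- The value group is ℝ, so the maximal ideal is not principal. The finitely many coefficients of a
system still have orders above a common δ > 0, which becomes the rate of convergence in valuation.
-/
theorem exists_pos_le_of_finset {ι : Type*} (s : Finset ι) (f : ι → WithTop ℝ)
    (h : ∀ i ∈ s, 0 < f i) : ∃ δ : ℝ, 0 < δ ∧ ∀ i ∈ s, (δ : WithTop ℝ) ≤ f i := by
  classical
  induction s using Finset.induction_on with
  | empty => exact ⟨1, one_pos, by simp⟩
  | insert a s ha ih =>
    obtain ⟨δ, h0, h1⟩ := ih fun i hi => h i (Finset.mem_insert_of_mem hi)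
    have h2 := h a (Finset.mem_insert_self _ _)
    obtain ⟨δ', h0', h1'⟩ : ∃ δ' : ℝ, 0 < δ' ∧ (δ' : WithTop ℝ) ≤ f a := by
      cases hfa : f a with
      | top => exact ⟨1, one_pos, le_top⟩
      | coe r => rw [hfa] at h2; exact ⟨r, by exact_mod_cast h2, le_rfl⟩
    refine ⟨min δ δ', lt_min h0 h0', fun i hi => ?_⟩
    rcases Finset.mem_insert.1 hi with rfl | hi
    · exact le_trans (by exact_mod_cast min_le_right _ _) h1'
    · exact le_trans (by exact_mod_cast min_le_left _ _) (h1 i hi)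

/-- Monomials preserve congruences modulo an ideal, and each coefficient adds at least δ to the
valuation. -/
theorem eval_sub_eval_mem_levelIdeal {Q : MvPolynomial (Fin n) realRing} {r δ : ℝ}
    (hQ : ∀ γ ∈ Q.support, (δ : WithTop ℝ) ≤ ord ((Q.coeff γ : realRing) : Puiseux)) {z z' : Fin n → realRing}
    (h : ∀ i, z i - z' i ∈ levelIdeal r) :
    MvPolynomial.eval z Q - MvPolynomial.eval z' Q ∈ levelIdeal (r + δ) := by
  rw [MvPolynomial.eval_eq', MvPolynomial.eval_eq', ← Finset.sum_sub_distrib]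
  refine Ideal.sum_mem _ fun γ hγ => ?_
  rw [← mul_sub, mem_levelIdeal, Subring.coe_mul, ord_mul, add_comm r δ, WithTop.coe_add]
  refine add_le_add (hQ γ hγ) (mem_levelIdeal.1 ?_)
  rw [← Ideal.Quotient.eq, map_prod, map_prod]
  refine Finset.prod_congr rfl fun i _ => ?_
  rw [map_pow, map_pow, Ideal.Quotient.eq.2 (h i)]

end Polynomial

/-- Either a later term of the sequence is at least its first term, and a pair is found, or the
whole sequence stays below its first term and lies in one of the given sets. -/
theorem isPWO_of_forall_inter_Iic {U : Set ℝ} (h : ∀ g, (U ∩ Set.Iic g).IsPWO) : U.IsPWO := by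
  intro f
  by_cases h1 : ∃ n, 0 < n ∧ (f 0 : ℝ) ≤ f n
  · obtain ⟨n, hn, h2⟩ := h1
    exact ⟨0, n, hn, h2⟩
  · push Not at h1
    obtain ⟨m, n, hmn, hle⟩ := h (f 0) fun n => ⟨f n, (f n).2, by
      rcases Nat.eq_zero_or_pos n with rfl | hn
      · exact Set.self_mem_Iic
      · exact (h1 n hn).le⟩
    exact ⟨m, n, hmn, hle⟩

/-- A sequence of series starting at zero whose increments have linearly growing valuations and
summable masses converges. -/
theorem exists_limit (Z : ℕ → realRing) (hZ0 : Z 0 = 0) {δ : ℝ} (hδ : 0 < δ)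
    (hZ : ∀ k : ℕ, Z (k + 1) - Z k ∈ levelIdeal (k * δ)) {ρ : ℝ} (hρ : 0 < ρ)
    (hm : ∀ t : ℝ, 0 < t → t < ρ → ∑' k, rmass t (Z (k + 1) - Z k) ≠ ∞) :
    ∃ z : realRing, ∀ k : ℕ, z - Z k ∈ levelIdeal (k * δ) := by
  have hco : ∀ (g : ℝ) (k : ℕ), g < k * δ → ((Z (k + 1) - Z k : realRing) : Puiseux).series.coeff g
      = 0 := fun g k hg =>
    HahnSeries.coeff_eq_zero_of_lt_orderTop (lt_of_lt_of_le (by exact_mod_cast hg) (hZ k))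
  have hfin : ∀ g : ℝ, ∃ K : ℕ, ∀ k, K ≤ k → g < k * δ := by
    intro g
    obtain ⟨K, hK⟩ := exists_nat_gt (g / δ)
    refine ⟨K, fun k hk => ?_⟩
    rw [div_lt_iff₀ hδ] at hK
    exact hK.trans_le (by gcongr)
  -- The increments form a summable family: below any exponent only finitely many of them have
  -- non-zero coefficients.
  let s : HahnSeries.SummableFamily ℝ ℂ ℕ :=
    { toFun := fun k => ((Z (k + 1) - Z k : realRing) : Puiseux).series
      isPWO_iUnion_support' := by
        refine isPWO_of_forall_inter_Iic fun g => ?_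
        obtain ⟨K, hK⟩ := hfin g
        have hP : (⋃ k ∈ Finset.range K,
            (((Z (k + 1) - Z k : realRing) : Puiseux).series).support).IsPWO :=
          (Finset.partiallyWellOrderedOn_bUnion _).2 fun k _ => HahnSeries.isPWO_support _
        refine hP.mono ?_
        rintro x ⟨hx, hxg⟩
        obtain ⟨k, hk⟩ := Set.mem_iUnion.1 hx
        refine Set.mem_biUnion (x := k) ?_ hk
        rw [Finset.mem_coe, Finset.mem_range]
        by_contra hkK
        exact hk (hco x k (lt_of_le_of_lt hxg (hK k (not_lt.1 hkK))))
      finite_co_support' := by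
        intro g
        obtain ⟨K, hK⟩ := hfin g
        refine (Finset.range K).finite_toSet.subset fun k hk => ?_
        rw [Finset.mem_coe, Finset.mem_range]
        by_contra hkK
        exact hk (hco g k (hK k (not_lt.1 hkK))) }
  have hs : ∀ k, s k = ((Z (k + 1) - Z k : realRing) : Puiseux).series := fun k => rfl
  have hloc : LocConv s.hsum := by
    refine ⟨ρ, hρ, fun t h0 h1 => (summable_iff _ _).2 ?_⟩
    exact ne_top_of_le_ne_top (hm t h0 h1) (mass_hsum t s)
  let z : Puiseux := (⟨s.hsum, hloc⟩ : puiseuxSubfield)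
  have hz : z.series = s.hsum := rfl
  -- The sum telescopes; the increments from the k-th one on do not reach exponents below k δ.
  have hcoeff : ∀ (k : ℕ) (g : ℝ), g < k * δ → z.series.coeff g = (Z k : Puiseux).series.coeff g := by
    intro k g hg
    rw [hz, HahnSeries.SummableFamily.coeff_hsum_eq_sum_of_subset (t := Finset.range k)]
    · have h1 : ∀ j, (s j).coeff g = (Z (j + 1) : Puiseux).series.coeff g -
          (Z j : Puiseux).series.coeff g := fun j => by rw [hs]; simp
      simp_rw [h1]
      rw [Finset.sum_range_sub (fun j => (Z j : Puiseux).series.coeff g), hZ0]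
      simp
    · intro j hj
      rw [Finset.mem_coe, Finset.mem_range]
      by_contra hjk
      refine hj (hco g j (hg.trans_le ?_))
      have := not_lt.1 hjk
      gcongr
  have hreal : IsRealSeries z := by
    intro g
    obtain ⟨K, hK⟩ := hfin g
    rw [hcoeff K g (hK K le_rfl)]
    exact (mem_realRing.1 (Z K).2).2 g
  have hord : ∀ k : ℕ, ((k * δ : ℝ) : WithTop ℝ) ≤ ord (z - Z k) := by
    intro k
    rw [ord, HahnSeries.le_orderTop_iff_forall]
    intro g hg
    rw [series_sub, HahnSeries.coeff_sub, hcoeff k g (by exact_mod_cast hg), sub_self]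
  refine ⟨⟨z, mem_realRing.2 ⟨?_, hreal⟩⟩, fun k => hord k⟩
  simpa [hZ0] using hord 0

theorem eq_zero_of_forall_mem_levelIdeal {x : realRing} {δ : ℝ} (hδ : 0 < δ)
    (h : ∀ k : ℕ, x ∈ levelIdeal (k * δ)) : x = 0 := by
  by_contra hx
  have hx' : (x : Puiseux) ≠ 0 := fun h0 => hx (Subtype.ext h0)
  obtain ⟨k, hk⟩ := exists_nat_gt (val (x : Puiseux) / δ)
  have h1 := mem_levelIdeal.1 (h k)
  rw [ord_eq_val hx'] at h1
  rw [div_lt_iff₀ hδ] at hk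
  have h2 : k * δ ≤ val (x : Puiseux) := by exact_mod_cast h1
  linarith

/-- The iteration started at 0 is a contraction in two senses. Each step raises the valuation of
differences by δ, which gives a formal limit and uniqueness. For small t each step also halves the
masses of the increments, which makes the limit locally convergent. -/
theorem realRing_fixedPointProperty : FixedPointProperty realIdeal := by
  intro n c Ψ hΨ
  obtain ⟨δ, hδ, hδ'⟩ := exists_pos_le_of_finset
    ((Finset.univ : Finset (Fin n)).sigma fun i => (Ψ i).support)
    (fun p => ord (((Ψ p.1).coeff p.2 : realRing) : Puiseux)) (by
      rintro ⟨i, γ⟩ -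
      exact (MvPolynomial.mem_map_C_iff.1 (hΨ i)) γ)
  have hlip : ∀ (z z' : Fin n → realRing) (r : ℝ), (∀ i, z i - z' i ∈ levelIdeal r) → ∀ i,
      (c i + MvPolynomial.eval z (Ψ i)) - (c i + MvPolynomial.eval z' (Ψ i)) ∈
        levelIdeal (r + δ) := by
    intro z z' r h i
    rw [add_sub_add_left_eq_sub]
    exact eval_sub_eval_mem_levelIdeal
      (fun γ hγ => hδ' ⟨i, γ⟩ (Finset.mem_sigma.2 ⟨Finset.mem_univ _, hγ⟩)) h
  have hnn : ∀ x : realRing, x ∈ levelIdeal 0 := fun x => x.2.1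
  -- the iteration
  let Z : ℕ → Fin n → realRing := fun k =>
    Nat.rec (fun _ => 0) (fun _ z i => c i + MvPolynomial.eval z (Ψ i)) k
  have hZs : ∀ k i, Z (k + 1) i = c i + MvPolynomial.eval (Z k) (Ψ i) := fun k i => rfl
  have hZd : ∀ (k : ℕ) i, Z (k + 1) i - Z k i ∈ levelIdeal (k * δ) := by
    intro k
    induction k with
    | zero => intro i; simpa using hnn _
    | succ k ih =>
      intro i
      rw [hZs (k + 1), hZs k]
      convert hlip _ _ _ ih i using 2
      push_cast; ring
  -- masses
  have hc : ∃ B : ℝ≥0∞, B ≠ ∞ ∧ ∀ᶠ t in 𝓝[>] (0 : ℝ), ∀ i, rmass t (c i) ≤ B := by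
    choose B hB hB' using fun i => eventually_rmass_le (c i)
    refine ⟨∑ i, B i, by simpa using hB, ?_⟩
    rw [Filter.eventually_all]
    intro i
    exact (hB' i).mono fun t ht =>
      ht.trans (Finset.single_le_sum (f := B) (fun _ _ => zero_le) (Finset.mem_univ i))
  obtain ⟨B, hB, hcB⟩ := hc
  have hB1 : B + 1 ≠ ∞ := by finiteness
  have hsmall : ∀ᶠ t in 𝓝[>] (0 : ℝ), ∀ i, MassBound (B + 1) 2⁻¹ t (Ψ i) := by
    rw [Filter.eventually_all]
    intro i
    obtain ⟨L, hL, h⟩ := exists_massBound_tendsto hB1 (hΨ i)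
    filter_upwards [h, hL.eventually (gt_mem_nhds (show (0 : ℝ≥0∞) < 2⁻¹ by simp))] with t ht hlt
    intro z z' D h1 h2 h3
    obtain ⟨h4, h5⟩ := ht z z' D h1 h2 h3
    exact ⟨h4.trans hlt.le, h5.trans (by gcongr)⟩
  obtain ⟨ρ, hρ, hρ'⟩ := (mem_nhdsGT_iff_exists_Ioo_subset).1 (hcB.and hsmall)
  have hmass : ∀ t : ℝ, 0 < t → t < ρ → ∀ i, ∑' k, rmass t (Z (k + 1) i - Z k i) ≠ ∞ := by
    intro t h0 h1 i
    obtain ⟨hA, hS⟩ := hρ' ⟨h0, h1⟩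
    -- The constants contribute at most B and the perturbation at most 1/2, so the iterates never
    -- leave the region where the Lipschitz constant 1/2 is valid.
    have hle : ∀ k i, rmass t (Z k i) ≤ B + 1 := by
      intro k
      induction k with
      | zero =>
        intro i
        have : Z 0 i = 0 := rfl
        rw [this]
        simp [rmass, mass_zero]
      | succ k ih =>
        intro i
        rw [hZs]
        refine (rmass_add _ _ _).trans (add_le_add (hA i) ?_)
        exact ((hS i (Z k) (Z k) 0 ih ih (fun j => by rw [sub_self]; exact (mass_zero t).le)).1).trans (by simp)
    have hd : ∀ k i, rmass t (Z (k + 1) i - Z k i) ≤ (2⁻¹ : ℝ≥0∞) ^ k * (B + 1) := by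
      intro k
      induction k with
      | zero =>
        intro i
        have : Z 0 i = 0 := rfl
        rw [this, sub_zero]
        simpa using hle 1 i
      | succ k ih =>
        intro i
        rw [hZs (k + 1), hZs k, add_sub_add_left_eq_sub]
        refine ((hS i _ _ _ (hle (k + 1)) (hle k) ih).2).trans (le_of_eq ?_)
        rw [pow_succ]; ring
    refine ne_top_of_le_ne_top ?_ (ENNReal.tsum_le_tsum fun k => hd k i)
    rw [ENNReal.tsum_mul_right, ENNReal.tsum_geometric]
    refine ENNReal.mul_ne_top (ENNReal.inv_ne_top.2 ?_) hB1
    rw [ENNReal.one_sub_inv_two]; simp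
  choose z hz using fun i => exists_limit (fun k => Z k i) rfl hδ (fun k => hZd k i) hρ
    (fun t h0 h1 => hmass t h0 h1 i)
  refine ⟨z, fun i => ?_, fun z' hz' => ?_⟩
  · rw [← sub_eq_zero]
    refine eq_zero_of_forall_mem_levelIdeal hδ fun k => ?_
    have h1 := hlip z (Z k) (k * δ) (fun j => hz j k) i
    rw [← hZs] at h1
    have h2 := hz i (k + 1)
    have h3 : (↑(k + 1) * δ : ℝ) = k * δ + δ := by push_cast; ring
    rw [h3] at h2
    have h4 := (levelIdeal (k * δ + δ)).sub_mem h2 h1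
    have h5 : z i - (c i + MvPolynomial.eval z (Ψ i)) ∈ levelIdeal (k * δ + δ) := by
      convert h4 using 1; ring
    rw [mem_levelIdeal] at h5 ⊢
    exact le_trans (by exact_mod_cast (by linarith)) h5
  · funext i
    rw [← sub_eq_zero]
    refine eq_zero_of_forall_mem_levelIdeal hδ fun k => ?_
    -- The difference of two solutions gains δ in valuation with every application of the equations,
    -- so it lies in all level ideals.
    have : ∀ (k : ℕ) i, z' i - z i ∈ levelIdeal (k * δ) := by
      intro k
      induction k with
      | zero => intro i; simpa using hnn _
      | succ k ih =>
        intro i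
        have hzi : z i = c i + MvPolynomial.eval z (Ψ i) := by
          rw [← sub_eq_zero]
          refine eq_zero_of_forall_mem_levelIdeal hδ fun k => ?_
          have h1 := hlip z (Z k) (k * δ) (fun j => hz j k) i
          rw [← hZs] at h1
          have h2 := hz i (k + 1)
          have h3 : (↑(k + 1) * δ : ℝ) = k * δ + δ := by push_cast; ring
          rw [h3] at h2
          have h4 := (levelIdeal (k * δ + δ)).sub_mem h2 h1
          have h5 : z i - (c i + MvPolynomial.eval z (Ψ i)) ∈ levelIdeal (k * δ + δ) := by
            convert h4 using 1; ring
          rw [mem_levelIdeal] at h5 ⊢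
          exact le_trans (by exact_mod_cast (by linarith)) h5
        rw [hz' i, hzi]
        convert hlip _ _ _ ih i using 2
        push_cast; ring
    exact this k i
end

noncomputable section

/-! ### A perturbed system whose solutions form an algebra of rank two -/

open MvPolynomial in
theorem MvPolynomial.eval₂_sub_eval₂_mem {O R σ : Type*} [CommRing O] [CommRing R] (ι : O →+* R)
    (I : Ideal R) {v v' : σ → R} (h : ∀ i, v i - v' i ∈ I) (p : MvPolynomial σ O) :
    eval₂ ι v p - eval₂ ι v' p ∈ I := by
  rw [← Ideal.Quotient.eq]
  have h1 : (fun i => Ideal.Quotient.mk I (v i)) = fun i => Ideal.Quotient.mk I (v' i) := by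
    ext i; exact Ideal.Quotient.eq.2 (h i)
  rw [hom_eval₂, hom_eval₂]
  exact congrArg (fun g => eval₂ _ g p) h1

open MvPolynomial in
theorem MvPolynomial.eval₂_mem_of_mem_map {O R σ : Type*} [CommRing O] [CommRing R] (ι : O →+* R)
    {m : Ideal O} {I : Ideal R} (h : ∀ a ∈ m, ι a ∈ I) (v : σ → R) {p : MvPolynomial σ O}
    (hp : p ∈ m.map (C : O →+* MvPolynomial σ O)) : eval₂ ι v p ∈ I := by
  have : m.map (C : O →+* MvPolynomial σ O) ≤ I.comap (eval₂Hom ι v) :=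
    Ideal.map_le_iff_le_comap.2 fun a ha => by
      rw [Ideal.mem_comap, Ideal.mem_comap, coe_eval₂Hom, eval₂_C]
      exact h a ha
  exact this hp

namespace QuadraticAlgebra

/-- Functoriality of the quadratic algebra in the base ring. -/
def mapHom {R R' : Type*} [CommRing R] [CommRing R'] (f : R →+* R') {a b : R} {a' b' : R'}
    (ha : f a = a') (hb : f b = b') : QuadraticAlgebra R a b →+* QuadraticAlgebra R' a' b' where
  toFun s := ⟨f s.re, f s.im⟩
  map_one' := by ext <;> simp
  map_zero' := by ext <;> simp
  map_mul' s t := by ext <;> simp [ha, hb]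
  map_add' s t := by ext <;> simp

@[simp] theorem re_mapHom {R R' : Type*} [CommRing R] [CommRing R'] (f : R →+* R') {a b : R}
    {a' b' : R'} (ha : f a = a') (hb : f b = b') (s : QuadraticAlgebra R a b) :
    (mapHom f ha hb s).re = f s.re := rfl
@[simp] theorem im_mapHom {R R' : Type*} [CommRing R] [CommRing R'] (f : R →+* R') {a b : R}
    {a' b' : R'} (ha : f a = a') (hb : f b = b') (s : QuadraticAlgebra R a b) :
    (mapHom f ha hb s).im = f s.im := rfl

/-- The extension of an ideal of the base ring to the quadratic algebra. -/
def extIdeal {R : Type*} [CommRing R] (I : Ideal R) (a b : R) : Ideal (QuadraticAlgebra R a b) where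
  carrier := {s | s.re ∈ I ∧ s.im ∈ I}
  zero_mem' := by simp
  add_mem' hx hy := ⟨I.add_mem hx.1 hy.1, I.add_mem hx.2 hy.2⟩
  smul_mem' c x hx := by
    refine ⟨?_, ?_⟩
    · rw [smul_eq_mul, re_mul]
      exact I.add_mem (I.mul_mem_left _ hx.1) (I.mul_mem_left _ hx.2)
    · rw [smul_eq_mul, im_mul]
      exact I.add_mem (I.add_mem (I.mul_mem_left _ hx.2) (I.mul_mem_left _ hx.1))
        (I.mul_mem_left _ hx.2)

end QuadraticAlgebra

open QuadraticAlgebra MvPolynomial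

/-- The data of the system `x = x₀ + ε a - ψB`, `x y = 1`, `a + u + w + ψA = 0`, `u w = θ h(x, y)`
in the unknowns `x, y, u, w`. -/
structure QuadSystem (O : Type*) [CommRing O] where
  ψA : MvPolynomial (Fin 4) O
  ψB : MvPolynomial (Fin 4) O
  θ : O
  x₀ : O
  ε : O
  h : MvPolynomial (Fin 2) O

/-- The parameters of the fixed point problem attached to a system: start values and the linear
condition `p = d + μ₁ (p - a) + μ₂ σ`. -/
structure QuadParams (O : Type*) where
  d : O
  y : O
  k : O
  s : O
  t : O
  μ₁ : O
  μ₂ : O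

namespace QuadSystem

variable {O : Type*} [CommRing O] (D : QuadSystem O) (Q : QuadParams O)

/-! ### One step of the iteration, over an arbitrary base ring -/

section Step

variable {R : Type*} [CommRing R] (φ : O →+* R) (z : Fin 11 → R)

/-- The quadratic algebra in which the system is solved. -/
abbrev Alg : Type _ := QuadraticAlgebra R (-(φ D.θ * z 7)) (-(z 6))

/-- The structure map. -/
def inc : O →+* D.Alg φ z := (algebraMap R (D.Alg φ z)).comp φ

theorem inc_apply (a : O) : D.inc φ z a = ⟨φ a, 0⟩ := rfl

/-- Slots 0 to 5 of z hold the coordinates of x, y, u with respect to 1, ω. Slot 6 holds p, slot 7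
holds κ, slot 8 holds a. Slots 9 and 10 hold an approximate square root σ of κ and the inverse of σ
+ s. The unknown w is ω itself, and `Alg` imposes ω² = -θ κ - p ω. -/
def pX : D.Alg φ z := ⟨z 0, z 1⟩
def pY : D.Alg φ z := ⟨z 2, z 3⟩
def pU : D.Alg φ z := ⟨z 4, z 5⟩
def pW : D.Alg φ z := ⟨0, 1⟩
def vPA : D.Alg φ z := eval₂ (D.inc φ z) ![D.pX φ z, D.pY φ z, D.pU φ z, D.pW φ z] D.ψA
def vPB : D.Alg φ z := eval₂ (D.inc φ z) ![D.pX φ z, D.pY φ z, D.pU φ z, D.pW φ z] D.ψB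
def vH : D.Alg φ z := eval₂ (D.inc φ z) ![D.pX φ z, D.pY φ z] D.h
-- The value forced on p - a. The two coordinates of a + u + ω + ψA = 0 express u through a and ψA,
-- and inserting this into the ω-coordinate of u ω = θ h gives p - a.
def psi : R := (D.vPA φ z).re - z 6 * (D.vPA φ z).im + φ D.θ * (D.vH φ z).im
-- The remaining degree of freedom. With (μ₁, μ₂) = (1, 0) the condition fixes a = d, with (0, 0) it
-- fixes p = d, and with d = 0 and (0, 2 r) it reads p = 2 r σ, the condition for a double root.
def tp : R := φ Q.d + φ Q.μ₁ * D.psi φ z + φ Q.μ₂ * z 9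
def ta : R := D.tp Q φ z - D.psi φ z
def tX : D.Alg φ z := D.inc φ z D.x₀ + D.inc φ z D.ε * algebraMap R _ (D.ta Q φ z) - D.vPB φ z
-- A division-free form of y = 1 / x: if c is the start value of x and c y₀ = 1, then y = y₀ - y₀ y
-- (x - c) is equivalent to x y = 1.
def tY : D.Alg φ z := D.inc φ z Q.y -
  D.inc φ z Q.y * D.pY φ z * (D.tX Q φ z - D.inc φ z (D.x₀ + D.ε * Q.d))
def tU : D.Alg φ z := -(algebraMap R _ (D.ta Q φ z) + D.pW φ z + D.vPA φ z)
-- The constant coordinate of u ω = θ h reads θ κ (1 + (ψA)_ω) = θ h₁; this is the same equation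
-- with θ cancelled and κ isolated.
def tk : R := (eval₂ (D.inc φ z) ![D.tX Q φ z, D.tY Q φ z] D.h).re - z 7 * (D.vPA φ z).im
-- If t = 1 / (σ + s₀), then σ = s₀ + t (κ - k) says σ² - s₀² = κ - k. The slot of t uses the same
-- division-free inversion as `tY`, around 1 / (2 s₀).
def ts : R := φ Q.s + z 10 * (D.tk Q φ z - φ Q.k)
def tt : R := φ Q.t - φ Q.t * z 10 * (D.ts Q φ z - φ Q.s)

/-- One step of the fixed point iteration. -/
def step : Fin 11 → R := ![(D.tX Q φ z).re, (D.tX Q φ z).im, (D.tY Q φ z).re, (D.tY Q φ z).im,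
  (D.tU Q φ z).re, (D.tU Q φ z).im, D.tp Q φ z, D.tk Q φ z, D.ta Q φ z, D.ts Q φ z, D.tt Q φ z]

variable {R' : Type*} [CommRing R'] (f : R →+* R')

/-- Functoriality of the quadratic algebra. -/
def algMap : D.Alg φ z →+* D.Alg (f.comp φ) (f ∘ z) := mapHom f (by simp) (by simp)

theorem algMap_inc (a : O) : D.algMap φ z f (D.inc φ z a) = D.inc (f.comp φ) (f ∘ z) a := by
  ext
  · simp [algMap, inc_apply]
  · simp [algMap, inc_apply]

theorem algMap_comp_inc : (D.algMap φ z f).comp (D.inc φ z) = D.inc (f.comp φ) (f ∘ z) :=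
  RingHom.ext (D.algMap_inc φ z f)

theorem algMap_algebraMap (r : R) :
    D.algMap φ z f (algebraMap R _ r) = algebraMap R' _ (f r) := by
  ext
  · rfl
  · exact f.map_zero

theorem algMap_pX : D.algMap φ z f (D.pX φ z) = D.pX (f.comp φ) (f ∘ z) := rfl
theorem algMap_pY : D.algMap φ z f (D.pY φ z) = D.pY (f.comp φ) (f ∘ z) := rfl
theorem algMap_pU : D.algMap φ z f (D.pU φ z) = D.pU (f.comp φ) (f ∘ z) := rfl
theorem algMap_pW : D.algMap φ z f (D.pW φ z) = D.pW (f.comp φ) (f ∘ z) := by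
  ext
  · exact f.map_zero
  · exact f.map_one

theorem algMap_eval₂_four (p : MvPolynomial (Fin 4) O) (a b c d : D.Alg φ z) :
    D.algMap φ z f (eval₂ (D.inc φ z) ![a, b, c, d] p) = eval₂ (D.inc (f.comp φ) (f ∘ z))
      ![D.algMap φ z f a, D.algMap φ z f b, D.algMap φ z f c, D.algMap φ z f d] p := by
  rw [hom_eval₂, algMap_comp_inc]
  congr 1
  funext i
  fin_cases i <;> rfl

theorem algMap_eval₂_two (p : MvPolynomial (Fin 2) O) (a b : D.Alg φ z) :
    D.algMap φ z f (eval₂ (D.inc φ z) ![a, b] p) = eval₂ (D.inc (f.comp φ) (f ∘ z))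
      ![D.algMap φ z f a, D.algMap φ z f b] p := by
  rw [hom_eval₂, algMap_comp_inc]
  congr 1
  funext i
  fin_cases i <;> rfl

theorem algMap_vPA : D.algMap φ z f (D.vPA φ z) = D.vPA (f.comp φ) (f ∘ z) := by
  rw [vPA, algMap_eval₂_four, algMap_pX, algMap_pY, algMap_pU, algMap_pW]; rfl
theorem algMap_vPB : D.algMap φ z f (D.vPB φ z) = D.vPB (f.comp φ) (f ∘ z) := by
  rw [vPB, algMap_eval₂_four, algMap_pX, algMap_pY, algMap_pU, algMap_pW]; rfl
theorem algMap_vH : D.algMap φ z f (D.vH φ z) = D.vH (f.comp φ) (f ∘ z) := by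
  rw [vH, algMap_eval₂_two, algMap_pX, algMap_pY]; rfl

theorem map_psi : f (D.psi φ z) = D.psi (f.comp φ) (f ∘ z) := by
  simp only [psi, ← algMap_vPA, ← algMap_vH, map_add, map_sub, map_mul]; rfl

theorem map_tp : f (D.tp Q φ z) = D.tp Q (f.comp φ) (f ∘ z) := by
  simp only [tp, ← map_psi, map_add, map_mul]; rfl

theorem map_ta : f (D.ta Q φ z) = D.ta Q (f.comp φ) (f ∘ z) := by
  simp only [ta, ← map_psi, ← map_tp, map_sub]

theorem algMap_tX : D.algMap φ z f (D.tX Q φ z) = D.tX Q (f.comp φ) (f ∘ z) := by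
  rw [tX, tX, map_sub, map_add, map_mul, algMap_inc, algMap_inc, algMap_vPB, algMap_algebraMap,
    map_ta]

theorem algMap_tY : D.algMap φ z f (D.tY Q φ z) = D.tY Q (f.comp φ) (f ∘ z) := by
  rw [tY, tY, map_sub, map_mul, map_mul, map_sub, algMap_inc, algMap_inc, algMap_tX, algMap_pY]

theorem algMap_tU : D.algMap φ z f (D.tU Q φ z) = D.tU Q (f.comp φ) (f ∘ z) := by
  rw [tU, tU, map_neg, map_add, map_add, algMap_algebraMap, map_ta, algMap_pW, algMap_vPA]

theorem map_tk : f (D.tk Q φ z) = D.tk Q (f.comp φ) (f ∘ z) := by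
  rw [tk, tk, map_sub, map_mul, ← algMap_vPA, ← algMap_tX, ← algMap_tY, ← algMap_eval₂_two]; rfl

theorem map_ts : f (D.ts Q φ z) = D.ts Q (f.comp φ) (f ∘ z) := by
  rw [ts, ts, map_add, map_mul, map_sub, map_tk]; rfl

theorem map_tt : f (D.tt Q φ z) = D.tt Q (f.comp φ) (f ∘ z) := by
  rw [tt, tt, map_sub, map_mul, map_mul, map_sub, map_ts]; rfl

/-- Applied to evaluation on the polynomial ring at the tautological point, this shows that the step
is a polynomial map, as the fixed point property requires. -/
theorem map_step (i : Fin 11) : f (D.step Q φ z i) = D.step Q (f.comp φ) (f ∘ z) i := by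
  have hX := D.algMap_tX Q φ z f
  have hY := D.algMap_tY Q φ z f
  have hU := D.algMap_tU Q φ z f
  fin_cases i
  · exact congrArg QuadraticAlgebra.re hX
  · exact congrArg QuadraticAlgebra.im hX
  · exact congrArg QuadraticAlgebra.re hY
  · exact congrArg QuadraticAlgebra.im hY
  · exact congrArg QuadraticAlgebra.re hU
  · exact congrArg QuadraticAlgebra.im hU
  · exact D.map_tp Q φ z f
  · exact D.map_tk Q φ z f
  · exact D.map_ta Q φ z f
  · exact D.map_ts Q φ z f
  · exact D.map_tt Q φ z f

end Step

/-- The perturbation terms have coefficients in `m`. -/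
structure Small (m : Ideal O) : Prop where
  ψA : D.ψA ∈ m.map (C : O →+* MvPolynomial (Fin 4) O)
  ψB : D.ψB ∈ m.map (C : O →+* MvPolynomial (Fin 4) O)
  θ : D.θ ∈ m

/-- The start values of the iteration. -/
def start : Fin 11 → O :=
  ![D.x₀ + D.ε * Q.d, 0, Q.y, 0, -Q.d, -1, Q.d, Q.k, Q.d, Q.s, Q.t]

variable {D Q}

/-- Modulo m the terms ψA, ψB, θ and μ₂ disappear, and with them all dependence on z: the step
becomes the constant map with value `start`. The slots are updated in an order in which each one
uses only new values already known to be constant modulo m. -/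
theorem step_sub_start_mem {m : Ideal O} (hD : D.Small m) (hμ : Q.μ₂ ∈ m)
    (hk : Q.k = eval ![D.x₀ + D.ε * Q.d, Q.y] D.h) (i : Fin 11) :
    D.step Q C X i - C (D.start Q i) ∈ m.map (C : O →+* MvPolynomial (Fin 11) O) := by
  set M := m.map (C : O →+* MvPolynomial (Fin 11) O) with hM
  let z : Fin 11 → MvPolynomial (Fin 11) O := X
  have hC : ∀ a ∈ m, (C a : MvPolynomial (Fin 11) O) ∈ M := fun a ha => Ideal.mem_map_of_mem _ ha
  let MS : Ideal (D.Alg C z) := extIdeal M _ _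
  have hinc : ∀ a ∈ m, D.inc C z a ∈ MS := fun a ha => ⟨hC a ha, M.zero_mem⟩
  have hPA : D.vPA C z ∈ MS := eval₂_mem_of_mem_map _ hinc _ hD.ψA
  have hPB : D.vPB C z ∈ MS := eval₂_mem_of_mem_map _ hinc _ hD.ψB
  have hpsi : D.psi C z ∈ M := M.add_mem (M.sub_mem hPA.1 (M.mul_mem_left _ hPA.2))
    (M.mul_mem_right _ (hC _ hD.θ))
  have htp : D.tp Q C z - C Q.d ∈ M := by
    rw [tp, add_assoc, add_sub_cancel_left]
    exact M.add_mem (M.mul_mem_left _ hpsi) (M.mul_mem_right _ (hC _ hμ))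
  have hta : D.ta Q C z - C Q.d ∈ M := by
    rw [ta, sub_right_comm]; exact M.sub_mem htp hpsi
  have hta' : algebraMap _ (D.Alg C z) (D.ta Q C z) - D.inc C z Q.d ∈ MS := by
    rw [inc, RingHom.comp_apply, ← map_sub]
    exact ⟨hta, M.zero_mem⟩
  have htX : D.tX Q C z - D.inc C z (D.x₀ + D.ε * Q.d) ∈ MS := by
    have : D.tX Q C z - D.inc C z (D.x₀ + D.ε * Q.d) = D.inc C z D.ε *
        (algebraMap _ (D.Alg C z) (D.ta Q C z) - D.inc C z Q.d) - D.vPB C z := by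
      rw [tX, map_add, map_mul]; ring
    rw [this]
    exact MS.sub_mem (MS.mul_mem_left _ hta') hPB
  have htY : D.tY Q C z - D.inc C z Q.y ∈ MS := by
    rw [tY, sub_sub_cancel_left]
    exact MS.neg_mem (MS.mul_mem_left _ htX)
  have htU : D.tU Q C z - ⟨C (-Q.d), C (-1)⟩ ∈ MS := by
    have : D.tU Q C z - ⟨C (-Q.d), C (-1)⟩ =
        -((algebraMap _ (D.Alg C z) (D.ta Q C z) - D.inc C z Q.d) + D.vPA C z) := by
      rw [tU]
      ext
      · simp [pW, inc_apply]; ring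
      · simp [pW, inc_apply]
    rw [this]
    exact MS.neg_mem (MS.add_mem hta' hPA)
  have hh : eval₂ (D.inc C z) ![D.tX Q C z, D.tY Q C z] D.h - D.inc C z Q.k ∈ MS := by
    have h1 : D.inc C z Q.k =
        eval₂ (D.inc C z) ![D.inc C z (D.x₀ + D.ε * Q.d), D.inc C z Q.y] D.h := by
      rw [hk, eval, coe_eval₂Hom, hom_eval₂]
      congr 1
      funext i
      fin_cases i <;> rfl
    rw [h1]
    refine eval₂_sub_eval₂_mem _ _ (fun i => ?_) _
    fin_cases i
    · exact htX
    · exact htY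
  have htk : D.tk Q C z - C Q.k ∈ M := by
    rw [tk, sub_right_comm]
    exact M.sub_mem hh.1 (M.mul_mem_left _ hPA.2)
  have hts : D.ts Q C z - C Q.s ∈ M := by
    rw [ts, add_sub_cancel_left]; exact M.mul_mem_left _ htk
  have htt : D.tt Q C z - C Q.t ∈ M := by
    rw [tt, sub_sub_cancel_left]; exact M.neg_mem (M.mul_mem_left _ hts)
  have key : ∀ {s : D.Alg C z} {a : O}, s - D.inc C z a ∈ MS → s.im - C 0 ∈ M := by
    intro s a hs
    have := hs.2
    rwa [im_sub, inc_apply, ← C_0] at this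
  fin_cases i
  · exact htX.1
  · exact key htX
  · exact htY.1
  · exact key htY
  · exact htU.1
  · exact htU.2
  · exact htp
  · exact htk
  · exact hta
  · exact hts
  · exact htt

theorem existsUnique_step {m : Ideal O} (hm : FixedPointProperty m) (hD : D.Small m)
    (hμ : Q.μ₂ ∈ m) (hk : Q.k = eval ![D.x₀ + D.ε * Q.d, Q.y] D.h) :
    (∃ z : Fin 11 → O, z = D.step Q (RingHom.id O) z ∧ ∀ i, z i - D.start Q i ∈ m) ∧
    ∀ z z' : Fin 11 → O, z = D.step Q (RingHom.id O) z → z' = D.step Q (RingHom.id O) z' →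
      z = z' := by
  have hev : ∀ (z : Fin 11 → O) (i : Fin 11), D.start Q i +
      eval z (D.step Q C X i - C (D.start Q i)) = D.step Q (RingHom.id O) z i := by
    intro z i
    rw [map_sub, eval_C, add_sub_cancel, map_step]
    have h1 : (eval z).comp C = RingHom.id O := by ext; simp
    have h2 : (eval z : MvPolynomial (Fin 11) O → O) ∘ X = z := by funext; simp
    rw [h1, h2]
  obtain ⟨z, hz, hz'⟩ := hm 11 (D.start Q) (fun i => D.step Q C X i - C (D.start Q i))
    (step_sub_start_mem hD hμ hk)
  refine ⟨⟨z, funext fun i => (hz i).trans (hev z i), fun i => ?_⟩, fun w w' hw hw' => ?_⟩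
  · rw [hz i, add_sub_cancel_left]
    exact eval₂_mem_of_mem_map (RingHom.id O) (fun _ h => h) z (step_sub_start_mem hD hμ hk i)
  · have h1 := hz' w fun i => (congrFun hw i).trans (hev w i).symm
    have h2 := hz' w' fun i => (congrFun hw' i).trans (hev w' i).symm
    rw [h1, h2]

/-! ### Fixed points of the step and solutions of the system -/

variable (D)

/-- `(X, Y, U, ω)` solves the system in the quadratic algebra with `ω² = -θ κ - p ω`. -/
structure IsSol (a p κ : O) (X Y U : QuadraticAlgebra O (-(D.θ * κ)) (-p)) : Prop where
  x : X = algebraMap O _ (D.x₀ + D.ε * a) - eval₂ (algebraMap O _) ![X, Y, U, ⟨0, 1⟩] D.ψB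
  xy : X * Y = 1
  u : algebraMap O _ a + U + ⟨0, 1⟩ + eval₂ (algebraMap O _) ![X, Y, U, ⟨0, 1⟩] D.ψA = 0
  uw : U * ⟨0, 1⟩ = algebraMap O _ D.θ * eval₂ (algebraMap O _) ![X, Y] D.h

variable {D}

/-- The eliminations that led to the step are undone coordinate by coordinate; they are all
reversible without any assumption on θ. -/
theorem IsSol.of_step {z : Fin 11 → O} (hz : z = D.step Q (RingHom.id O) z)
    (hy : (D.x₀ + D.ε * Q.d) * Q.y = 1) :
    D.IsSol (z 8) (z 6) (z 7) (D.pX (RingHom.id O) z) (D.pY (RingHom.id O) z)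
      (D.pU (RingHom.id O) z) ∧
    z 6 = Q.d + Q.μ₁ * (z 6 - z 8) + Q.μ₂ * z 9 ∧
    z 9 = Q.s + z 10 * (z 7 - Q.k) ∧ z 10 = Q.t - Q.t * z 10 * (z 9 - Q.s) := by
  let i := RingHom.id O
  have hX : D.tX Q i z = D.pX i z := by
    ext
    · exact (congrFun hz 0).symm
    · exact (congrFun hz 1).symm
  have hY : D.tY Q i z = D.pY i z := by
    ext
    · exact (congrFun hz 2).symm
    · exact (congrFun hz 3).symm
  have hU : D.tU Q i z = D.pU i z := by
    ext
    · exact (congrFun hz 4).symm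
    · exact (congrFun hz 5).symm
  have hp : D.tp Q i z = z 6 := (congrFun hz 6).symm
  have hk : D.tk Q i z = z 7 := (congrFun hz 7).symm
  have ha : D.ta Q i z = z 8 := (congrFun hz 8).symm
  have hs : D.ts Q i z = z 9 := (congrFun hz 9).symm
  have ht : D.tt Q i z = z 10 := (congrFun hz 10).symm
  have hpsi : D.psi i z = z 6 - z 8 := by rw [ta, hp] at ha; linear_combination -ha
  have hinc : D.inc i z = algebraMap O _ := rfl
  refine ⟨⟨?_, ?_, ?_, ?_⟩, ?_, ?_, ?_⟩
  · conv_lhs => rw [← hX]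
    rw [tX, ha, map_add, map_mul]; rfl
  · have h1 : D.pY i z = _ := hY.symm.trans (by rw [tY, hX])
    have h2 : D.inc i z (D.x₀ + D.ε * Q.d) * D.inc i z Q.y = 1 := by rw [← map_mul, hy, map_one]
    linear_combination (D.inc i z (D.x₀ + D.ε * Q.d)) * h1 +
      (1 + D.pY i z * D.inc i z (D.x₀ + D.ε * Q.d) - D.pX i z * D.pY i z) * h2
  · have h1 : D.pU i z = _ := hU.symm
    rw [tU, ha] at h1
    change algebraMap O (D.Alg i z) (z 8) + D.pU i z + D.pW i z + D.vPA i z = 0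
    rw [h1]; ring
  · have h1 : D.pU i z = _ := hU.symm
    rw [tU, ha] at h1
    have h2 : z 4 = _ := congrArg QuadraticAlgebra.re h1
    have h3 : z 5 = _ := congrArg QuadraticAlgebra.im h1
    have hk' := hk
    rw [tk, hX, hY] at hk'
    change (D.vH i z).re - _ = _ at hk'
    rw [psi] at hpsi
    change _ = _ * D.vH i z
    simp [pW] at h2 h3
    ext
    · simp [pU]
      change _ = D.θ * (D.vH i z).re
      linear_combination (-D.θ * z 7) * h3 - D.θ * hk'
    · simp [pU]
      change _ = D.θ * (D.vH i z).im
      change _ + D.θ * (D.vH i z).im = _ at hpsi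
      linear_combination h2 - (z 6) * h3 - hpsi
  · have := hp.symm
    rw [tp, hpsi] at this
    exact this
  · have := hs.symm
    rw [ts, hk] at this
    exact this
  · have := ht.symm
    rw [tt, hs] at this
    exact this

/-- In this direction θ has to be cancelled, since the system constrains κ only through θ κ. -/
theorem IsSol.step_eq [IsDomain O] (hθ : D.θ ≠ 0) {a p κ s t : O}
    {X Y U : QuadraticAlgebra O (-(D.θ * κ)) (-p)} (h : D.IsSol a p κ X Y U)
    (hy : (D.x₀ + D.ε * Q.d) * Q.y = 1) (hp : p = Q.d + Q.μ₁ * (p - a) + Q.μ₂ * s)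
    (hs : s = Q.s + t * (κ - Q.k)) (ht : t = Q.t - Q.t * t * (s - Q.s)) :
    ![X.re, X.im, Y.re, Y.im, U.re, U.im, p, κ, a, s, t] = D.step Q (RingHom.id O)
      ![X.re, X.im, Y.re, Y.im, U.re, U.im, p, κ, a, s, t] := by
  let i := RingHom.id O
  set z : Fin 11 → O := ![X.re, X.im, Y.re, Y.im, U.re, U.im, p, κ, a, s, t] with hz
  have hx : D.pX i z = algebraMap O (D.Alg i z) (D.x₀ + D.ε * a) - D.vPB i z := h.x
  have hxy : D.pX i z * D.pY i z = 1 := h.xy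
  have hu : algebraMap O (D.Alg i z) a + D.pU i z + D.pW i z + D.vPA i z = 0 := h.u
  have huw : D.pU i z * D.pW i z = algebraMap O (D.Alg i z) D.θ * D.vH i z := h.uw
  have hu0 : a + U.re + 0 + (D.vPA i z).re = 0 := congrArg QuadraticAlgebra.re hu
  have hu1 : 0 + U.im + 1 + (D.vPA i z).im = 0 := congrArg QuadraticAlgebra.im hu
  have huw0 := congrArg QuadraticAlgebra.re huw
  have huw1 := congrArg QuadraticAlgebra.im huw
  rw [re_mul, re_mul] at huw0
  rw [im_mul, im_mul] at huw1
  change U.re * 0 + -(D.θ * κ) * U.im * 1 = D.θ * (D.vH i z).re +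
    -(D.θ * κ) * 0 * (D.vH i z).im at huw0
  change U.re * 1 + U.im * 0 + -p * U.im * 1 = D.θ * (D.vH i z).im + 0 * (D.vH i z).re +
    -p * 0 * (D.vH i z).im at huw1
  have hκ : κ = (D.vH i z).re - κ * (D.vPA i z).im := by
    have h1 : D.θ * κ = D.θ * ((D.vH i z).re - κ * (D.vPA i z).im) := by
      linear_combination huw0 + D.θ * κ * hu1
    exact mul_left_cancel₀ hθ h1
  have hpsi : D.psi i z = p - a := by
    change (D.vPA i z).re - p * (D.vPA i z).im + D.θ * (D.vH i z).im = p - a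
    linear_combination hu0 - p * hu1 - huw1
  have htp : D.tp Q i z = p := by
    rw [tp, hpsi]; exact hp.symm
  have hta : D.ta Q i z = a := by rw [ta, htp, hpsi]; ring
  have htX : D.tX Q i z = D.pX i z := by
    rw [tX, hta]
    refine Eq.trans ?_ hx.symm
    rw [map_add, map_mul]; rfl
  have htY : D.tY Q i z = D.pY i z := by
    rw [tY, htX]
    have h2 : D.inc i z (D.x₀ + D.ε * Q.d) * D.inc i z Q.y = 1 := by rw [← map_mul, hy, map_one]
    linear_combination (-D.inc i z Q.y) * hxy + D.pY i z * h2
  have htU : D.tU Q i z = D.pU i z := by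
    rw [tU, hta]
    linear_combination -hu
  have htk : D.tk Q i z = κ := by
    rw [tk, htX, htY]
    exact hκ.symm
  have hts : D.ts Q i z = s := by rw [ts, htk]; exact hs.symm
  have htt : D.tt Q i z = t := by rw [tt, hts]; exact ht.symm
  funext j
  fin_cases j
  · exact (congrArg QuadraticAlgebra.re htX).symm
  · exact (congrArg QuadraticAlgebra.im htX).symm
  · exact (congrArg QuadraticAlgebra.re htY).symm
  · exact (congrArg QuadraticAlgebra.im htY).symm
  · exact (congrArg QuadraticAlgebra.re htU).symm
  · exact (congrArg QuadraticAlgebra.im htU).symm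
  · exact htp.symm
  · exact htk.symm
  · exact hta.symm
  · exact hts.symm
  · exact htt.symm

/-- For a given `a`, the system has a solution. -/
theorem exists_isSol_of_left {m : Ideal O} (hm : FixedPointProperty m) (hD : D.Small m) {a y : O}
    (hy : (D.x₀ + D.ε * a) * y = 1) :
    ∃ p κ X Y U, D.IsSol a p κ X Y U ∧ p - a ∈ m ∧ κ - eval ![D.x₀ + D.ε * a, y] D.h ∈ m := by
  -- With μ₁ = 1, μ₂ = 0 the side condition p = a₀ + (p - a) pins a to the prescribed value; the
  -- slots of s and t are idle.
  let Q : QuadParams O := ⟨a, y, eval ![D.x₀ + D.ε * a, y] D.h, 0, 0, 1, 0⟩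
  obtain ⟨z, hz, hz'⟩ := (existsUnique_step (Q := Q) hm hD m.zero_mem rfl).1
  obtain ⟨h1, h2, -, -⟩ := IsSol.of_step hz hy
  have ha : z 8 = a := by
    simp only [Q] at h2
    linear_combination h2
  have h3 := hz' 6
  have h4 := hz' 7
  rw [ha] at h1
  exact ⟨z 6, z 7, _, _, _, h1, h3, h4⟩

/-- For a given `a`, the solution is unique. -/
theorem IsSol.unique_of_left [IsDomain O] {m : Ideal O} (hm : FixedPointProperty m)
    (hD : D.Small m) (hθ : D.θ ≠ 0) {a y : O} (hy : (D.x₀ + D.ε * a) * y = 1) {p κ p' κ' : O}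
    {X Y U : QuadraticAlgebra O (-(D.θ * κ)) (-p)} (h : D.IsSol a p κ X Y U)
    {X' Y' U' : QuadraticAlgebra O (-(D.θ * κ')) (-p')} (h' : D.IsSol a p' κ' X' Y' U') :
    p = p' ∧ κ = κ' := by
  let Q : QuadParams O := ⟨a, y, eval ![D.x₀ + D.ε * a, y] D.h, 0, 0, 1, 0⟩
  have h1 := h.step_eq (Q := Q) (s := 0) (t := 0) hθ hy (by simp [Q]) (by simp [Q]) (by simp [Q])
  have h2 := h'.step_eq (Q := Q) (s := 0) (t := 0) hθ hy (by simp [Q]) (by simp [Q]) (by simp [Q])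
  have h3 := (existsUnique_step (Q := Q) hm hD m.zero_mem rfl).2 _ _ h1 h2
  exact ⟨congrFun h3 6, congrFun h3 7⟩

/-- For a given `p`, there is an `a` for which the system has a solution with this `p`. -/
theorem exists_isSol_of_right {m : Ideal O} (hm : FixedPointProperty m) (hD : D.Small m) {p y : O}
    (hy : (D.x₀ + D.ε * p) * y = 1) :
    ∃ a κ X Y U, D.IsSol a p κ X Y U ∧ a - p ∈ m ∧ κ - eval ![D.x₀ + D.ε * p, y] D.h ∈ m := by
  -- With μ₁ = μ₂ = 0 the side condition pins p, and a becomes an unknown.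
  let Q : QuadParams O := ⟨p, y, eval ![D.x₀ + D.ε * p, y] D.h, 0, 0, 0, 0⟩
  obtain ⟨z, hz, hz'⟩ := (existsUnique_step (Q := Q) hm hD m.zero_mem rfl).1
  obtain ⟨h1, h2, -, -⟩ := IsSol.of_step hz hy
  have ha : z 6 = p := by
    simp only [Q] at h2
    linear_combination h2
  have h3 := hz' 7
  have h4 := hz' 8
  have key : ∀ q, z 6 = q → ∃ a κ X Y U, D.IsSol a q κ X Y U ∧ a - p ∈ m ∧
      κ - eval ![D.x₀ + D.ε * p, y] D.h ∈ m := by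
    rintro q rfl
    exact ⟨z 8, z 7, _, _, _, h1, h4, h3⟩
  exact key p ha

/-- There is exactly one `a` near zero for which the quadratic polynomial `w² + p w + θ κ` is a
square with a prescribed choice of the square roots of `θ` and (approximately) of `κ`. -/
theorem exists_isSol_double {m : Ideal O} (hm : FixedPointProperty m) (hD : D.Small m)
    {y r s t : O} (hy : D.x₀ * y = 1) (hr : r ∈ m) (hs : s ^ 2 = eval ![D.x₀, y] D.h)
    (ht : 2 * s * t = 1) :
    ∃ a σ X Y U, D.IsSol a (2 * r * σ) (σ ^ 2) X Y U ∧ σ - s ∈ m ∧ a ∈ m := by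
  -- With μ₁ = 0, μ₂ = 2 r the side condition is p = 2 r σ; all start values are those of a = 0.
  let Q : QuadParams O := ⟨0, y, eval ![D.x₀, y] D.h, s, t, 0, 2 * r⟩
  have hy' : (D.x₀ + D.ε * Q.d) * Q.y = 1 := by simpa [Q] using hy
  obtain ⟨z, hz, hz'⟩ := (existsUnique_step (Q := Q) hm hD (m.mul_mem_left _ hr)
    (by simp [Q])).1
  obtain ⟨h1, h2, h3, h4⟩ := IsSol.of_step hz hy'
  have hp : z 6 = 2 * r * z 9 := by
    simp only [Q] at h2
    linear_combination h2
  -- The last slot is the inverse of σ + s, which turns the equation for σ into σ² = κ.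
  have hk : z 7 = z 9 ^ 2 := by
    simp only [Q] at h3 h4
    have h5 : z 10 * (z 9 + s) = 1 := by
      linear_combination (2 * s) * h4 + (1 - z 10 * (z 9 - s)) * ht
    rw [← hs] at h3
    linear_combination (-(z 7 - s ^ 2)) * h5 - (z 9 + s) * h3
  have h5 := hz' 8
  have h6 := hz' 9
  have key : ∀ q k, z 6 = q → z 7 = k → ∃ a X Y U, D.IsSol a q k X Y U ∧ a ∈ m := by
    rintro q k rfl rfl
    exact ⟨z 8, _, _, _, h1, by simpa [start, Q] using h5⟩
  obtain ⟨a, X, Y, U, h7, h8⟩ := key _ _ hp hk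
  exact ⟨a, z 9, X, Y, U, h7, h6, h8⟩

/-- Both solutions are fixed points for the same parameters, and uniqueness of fixed points is
global. The choice between the two roots of κ is made by the requirement that σ + s be invertible,
with inverse τ. -/
theorem IsSol.unique_double [IsDomain O] {m : Ideal O} (hm : FixedPointProperty m)
    (hD : D.Small m) (hθ : D.θ ≠ 0) {y r s t : O} (hy : D.x₀ * y = 1) (hr : r ∈ m)
    (hs : s ^ 2 = eval ![D.x₀, y] D.h) (ht : 2 * s * t = 1) {a σ τ a' σ' τ' : O}
    (hτ : τ * (σ + s) = 1) (hτ' : τ' * (σ' + s) = 1) {p p' κ κ' : O}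
    (hp : p = 2 * r * σ) (hκ : κ = σ ^ 2) (hp' : p' = 2 * r * σ') (hκ' : κ' = σ' ^ 2)
    {X Y U : QuadraticAlgebra O (-(D.θ * κ)) (-p)} (h : D.IsSol a p κ X Y U)
    {X' Y' U' : QuadraticAlgebra O (-(D.θ * κ')) (-p')} (h' : D.IsSol a' p' κ' X' Y' U') :
    a = a' := by
  let Q : QuadParams O := ⟨0, y, eval ![D.x₀, y] D.h, s, t, 0, 2 * r⟩
  have hy' : (D.x₀ + D.ε * Q.d) * Q.y = 1 := by simpa [Q] using hy
  have h1 := h.step_eq (Q := Q) (s := σ) (t := τ) hθ hy' (by simp [Q, hp])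
    (by simp only [Q]; rw [← hs, hκ]; linear_combination (s - σ) * hτ)
    (by simp only [Q]; linear_combination (-τ) * ht + t * hτ)
  have h2 := h'.step_eq (Q := Q) (s := σ') (t := τ') hθ hy' (by simp [Q, hp'])
    (by simp only [Q]; rw [← hs, hκ']; linear_combination (s - σ') * hτ')
    (by simp only [Q]; linear_combination (-τ') * ht + t * hτ')
  exact congrFun ((existsUnique_step (Q := Q) hm hD (m.mul_mem_left _ hr) (by simp [Q])).2 _ _ h1 h2) 8

end QuadSystem
end

/-! ### Specialisation of solutions at roots, and Nakayama's lemma -/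

noncomputable section
open QuadraticAlgebra MvPolynomial

namespace QuadraticAlgebra

/-- The homomorphism from a quadratic algebra that sends the generator to a given root. -/
def evalHom {R R' : Type*} [CommRing R] [CommRing R'] (f : R →+* R') {a b : R} (r : R')
    (hr : r * r = f a + f b * r) : QuadraticAlgebra R a b →+* R' where
  toFun s := f s.re + f s.im * r
  map_one' := by simp
  map_zero' := by simp
  map_mul' s t := by
    simp only [re_mul, im_mul, map_add, map_mul]
    linear_combination (-f s.im * f t.im) * hr
  map_add' s t := by simp; ring

theorem evalHom_apply {R R' : Type*} [CommRing R] [CommRing R'] (f : R →+* R') {a b : R} (r : R')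
    (hr : r * r = f a + f b * r) (s : QuadraticAlgebra R a b) :
    evalHom f r hr s = f s.re + f s.im * r := rfl

@[simp] theorem evalHom_omega {R R' : Type*} [CommRing R] [CommRing R'] (f : R →+* R') {a b : R}
    (r : R') (hr : r * r = f a + f b * r) :
    evalHom f r hr (⟨0, 1⟩ : QuadraticAlgebra R a b) = r := by simp [evalHom_apply]

@[simp] theorem evalHom_algebraMap {R R' : Type*} [CommRing R] [CommRing R'] (f : R →+* R')
    {a b : R} (r : R') (hr : r * r = f a + f b * r) (x : R) :
    evalHom f r hr (algebraMap R (QuadraticAlgebra R a b) x) = f x := by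
  change f x + f 0 * r = f x
  simp

theorem evalHom_comp_algebraMap {R R' : Type*} [CommRing R] [CommRing R'] (f : R →+* R')
    {a b : R} (r : R') (hr : r * r = f a + f b * r) :
    (evalHom f r hr).comp (algebraMap R (QuadraticAlgebra R a b)) = f :=
  RingHom.ext (evalHom_algebraMap f r hr)

end QuadraticAlgebra

namespace QuadSystem

variable {O : Type*} [CommRing O] {D : QuadSystem O}

theorem hom_eval₂_four {S T : Type*} [CommRing S] [CommRing T] (f : S →+* T) (φ : O →+* S)
    (a b c d : S) (P : MvPolynomial (Fin 4) O) :
    f (eval₂ φ ![a, b, c, d] P) = eval₂ (f.comp φ) ![f a, f b, f c, f d] P := by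
  rw [hom_eval₂]
  congr 1
  funext i; fin_cases i <;> rfl

theorem hom_eval₂_two {S T : Type*} [CommRing S] [CommRing T] (f : S →+* T) (φ : O →+* S)
    (a b : S) (P : MvPolynomial (Fin 2) O) :
    f (eval₂ φ ![a, b] P) = eval₂ (f.comp φ) ![f a, f b] P := by
  rw [hom_eval₂]
  congr 1
  funext i; fin_cases i <;> rfl

/-- The equations of a solution hold at every root of its quadratic polynomial. -/
theorem IsSol.map {a p κ : O} {X Y U : QuadraticAlgebra O (-(D.θ * κ)) (-p)}
    (h : D.IsSol a p κ X Y U) {R : Type*} [CommRing R] (φ : O →+* R) (w : R)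
    (hw : w ^ 2 + φ p * w + φ (D.θ * κ) = 0) :
    let x := φ X.re + φ X.im * w
    let y := φ Y.re + φ Y.im * w
    let u := φ U.re + φ U.im * w
    x - φ (D.x₀ + D.ε * a) + eval₂ φ ![x, y, u, w] D.ψB = 0 ∧ x * y = 1 ∧
      φ a + u + w + eval₂ φ ![x, y, u, w] D.ψA = 0 ∧ u * w = φ D.θ * eval₂ φ ![x, y] D.h := by
  intro x y u
  have hr : w * w = φ (-(D.θ * κ)) + φ (-p) * w := by
    rw [map_neg, map_neg]; linear_combination hw
  let e := evalHom φ w hr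
  have hX : e X = x := rfl
  have hY : e Y = y := rfl
  have hU : e U = u := rfl
  have hW : e ⟨0, 1⟩ = w := evalHom_omega φ w hr
  have hφ : e.comp (algebraMap O _) = φ := evalHom_comp_algebraMap φ w hr
  have hφ' : ∀ c, e (algebraMap O _ c) = φ c := evalHom_algebraMap φ w hr
  have h4 : ∀ P : MvPolynomial (Fin 4) O, e (eval₂ (algebraMap O _) ![X, Y, U, ⟨0, 1⟩] P) =
      eval₂ φ ![x, y, u, w] P := by
    intro P
    rw [hom_eval₂_four, hφ, hX, hY, hU, hW]
  have h2 : e (eval₂ (algebraMap O _) ![X, Y] D.h) = eval₂ φ ![x, y] D.h := by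
    rw [hom_eval₂_two, hφ, hX, hY]
  refine ⟨?_, ?_, ?_, ?_⟩
  · have := congrArg e h.x
    rw [map_sub, hφ', h4, hX] at this
    linear_combination this
  · rw [← hX, ← hY, ← map_mul, h.xy, map_one]
  · have := congrArg e h.u
    rw [map_add, map_add, map_add, hφ', h4, hU, hW, map_zero] at this
    exact this
  · have := congrArg e h.uw
    rw [map_mul, map_mul, hφ', h2, hU, hW] at this
    exact this

/-- To first order u = -a - ω. The ω-coordinate of u is thus a unit in the rings where m maps into
the Jacobson radical, and the quadratic relation can be divided by it. -/
theorem IsSol.im_u_add_one_mem {m : Ideal O} (hD : D.Small m) {a p κ : O}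
    {X Y U : QuadraticAlgebra O (-(D.θ * κ)) (-p)} (h : D.IsSol a p κ X Y U) : U.im + 1 ∈ m := by
  have hPA : eval₂ (algebraMap O _) ![X, Y, U, ⟨0, 1⟩] D.ψA ∈
      extIdeal m (-(D.θ * κ)) (-p) :=
    eval₂_mem_of_mem_map _ (I := extIdeal m (-(D.θ * κ)) (-p)) (fun b hb => ⟨hb, m.zero_mem⟩) _ hD.ψA
  have h1 : 0 + U.im + 1 + (eval₂ (algebraMap O _) ![X, Y, U, ⟨0, 1⟩] D.ψA).im = 0 :=
    congrArg QuadraticAlgebra.im h.u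
  have h2 : U.im + 1 = -(eval₂ (algebraMap O _) ![X, Y, U, ⟨0, 1⟩] D.ψA).im := by
    linear_combination h1
  rw [h2]
  exact m.neg_mem hPA.2

/-- In a ring in which `m` generates an ideal of the Jacobson radical, the equations of the system
imply those of its solution in the quadratic algebra. -/
theorem IsSol.mem_ideal {m : Ideal O} (hD : D.Small m) {a p κ : O}
    {X Y U : QuadraticAlgebra O (-(D.θ * κ)) (-p)} (h : D.IsSol a p κ X Y U)
    {R : Type*} [CommRing R] (φ : O →+* R) (hφ : ∀ b ∈ m, φ b ∈ Ideal.jacobson (⊥ : Ideal R))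
    {x y u w : R} (hxy : x * y = 1) (huw : u * w = φ D.θ * eval₂ φ ![x, y] D.h) {I : Ideal R}
    (hB : x - φ (D.x₀ + D.ε * a) + eval₂ φ ![x, y, u, w] D.ψB ∈ I)
    (hA : φ a + u + w + eval₂ φ ![x, y, u, w] D.ψA ∈ I) :
    x - (φ X.re + φ X.im * w) ∈ I ∧ u - (φ U.re + φ U.im * w) ∈ I ∧
      w ^ 2 + φ p * w + φ (D.θ * κ) ∈ I := by
  let l : QuadraticAlgebra O (-(D.θ * κ)) (-p) → R := fun s => φ s.re + φ s.im * w
  let q : R := w ^ 2 + φ p * w + φ (D.θ * κ)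
  -- J is the ideal to be shown to lie in I. Modulo J the given elements are the images of X, U, ω,
  -- so polynomials in them agree with their counterparts modulo J, and polynomials with small
  -- coefficients agree modulo m J. The equations then give J ≤ I + m J.
  let J : Ideal R := Ideal.span {x - l X, u - l U, q}
  have hJx : x - l X ∈ J := Ideal.subset_span (by simp)
  have hJu : u - l U ∈ J := Ideal.subset_span (by simp)
  have hJq : q ∈ J := Ideal.subset_span (by simp)
  let π := Ideal.Quotient.mk J
  have hr : π w * π w = (π.comp φ) (-(D.θ * κ)) + (π.comp φ) (-p) * π w := by
    have : π q = 0 := Ideal.Quotient.eq_zero_iff_mem.2 hJq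
    simp only [q, map_add, map_mul, map_pow] at this
    simp only [RingHom.comp_apply, map_neg, map_mul]
    linear_combination this
  let e := evalHom (π.comp φ) (π w) hr
  have hel : ∀ s, e s = π (l s) := fun s => by
    simp only [e, l, evalHom_apply, RingHom.comp_apply, map_add, map_mul]
  have hX : e X = π x := by rw [hel]; exact (Ideal.Quotient.eq.2 hJx).symm
  have hU : e U = π u := by rw [hel]; exact (Ideal.Quotient.eq.2 hJu).symm
  have hY : e Y = π y := by
    have h1 : e X * e Y = 1 := by rw [← map_mul, h.xy, map_one]
    have h2 : π x * π y = 1 := by rw [← map_mul, hxy, map_one]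
    rw [hX] at h1
    linear_combination π y * h1 - e Y * h2
  have hW : e ⟨0, 1⟩ = π w := evalHom_omega _ _ hr
  have hφe : e.comp (algebraMap O _) = π.comp φ := evalHom_comp_algebraMap _ _ hr
  have h4 : ∀ P : MvPolynomial (Fin 4) O,
      eval₂ φ ![x, y, u, w] P - l (eval₂ (algebraMap O _) ![X, Y, U, ⟨0, 1⟩] P) ∈ J := by
    intro P
    rw [← Ideal.Quotient.eq]
    change π _ = π _
    rw [← hel, hom_eval₂_four, hom_eval₂_four, hφe,
      hX, hY, hU, hW]
  have h2 : eval₂ φ ![x, y] D.h - l (eval₂ (algebraMap O _) ![X, Y] D.h) ∈ J := by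
    rw [← Ideal.Quotient.eq]
    change π _ = π _
    rw [← hel, hom_eval₂_two, hom_eval₂_two, hφe, hX, hY]
  let M : Ideal R := m.map φ
  have hMm : ∀ b ∈ m, φ b ∈ M := fun b hb => Ideal.mem_map_of_mem _ hb
  have ladd : ∀ s t : QuadraticAlgebra O (-(D.θ * κ)) (-p), l (s + t) = l s + l t := fun s t => by
    simp only [l, re_add, im_add, map_add]; ring
  have lneg : ∀ s : QuadraticAlgebra O (-(D.θ * κ)) (-p), l (-s) = -l s := fun s => by
    simp only [l, re_neg, im_neg, map_neg]; ring
  have lC : ∀ (b : O) (s : QuadraticAlgebra O (-(D.θ * κ)) (-p)), l (algebraMap O (QuadraticAlgebra O (-(D.θ * κ)) (-p)) b * s) = φ b * l s := by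
    intro b s
    have : algebraMap O (QuadraticAlgebra O (-(D.θ * κ)) (-p)) b * s = b • s := (Algebra.smul_def b s).symm
    rw [this]
    simp only [l, re_smul, im_smul, smul_eq_mul, map_mul]; ring
  have lC' : ∀ b : O, l (algebraMap O (QuadraticAlgebra O (-(D.θ * κ)) (-p)) b) = φ b := by
    intro b
    change φ b + φ 0 * w = φ b
    simp
  let lh : QuadraticAlgebra O (-(D.θ * κ)) (-p) →+ R := AddMonoidHom.mk' l ladd
  have hsmall : ∀ P ∈ m.map (C : O →+* MvPolynomial (Fin 4) O),
      eval₂ φ ![x, y, u, w] P - l (eval₂ (algebraMap O _) ![X, Y, U, ⟨0, 1⟩] P) ∈ M * J := by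
    intro P hP
    have hP' : ∀ γ, P.coeff γ ∈ m := mem_map_C_iff.1 hP
    have h5 : P = ∑ γ ∈ P.support, C (P.coeff γ) * monomial γ 1 := by
      conv_lhs => rw [P.as_sum]
      simp [C_mul_monomial]
    rw [h5, eval₂_sum, eval₂_sum]
    change _ - lh _ ∈ _
    rw [map_sum, ← Finset.sum_sub_distrib]
    refine Ideal.sum_mem _ fun γ _ => ?_
    change _ - l _ ∈ _
    rw [eval₂_mul, eval₂_mul, eval₂_C, eval₂_C, lC, ← mul_sub]
    exact Ideal.mul_mem_mul (hMm _ (hP' γ)) (h4 _)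
  have hx' : x - l X ∈ I ⊔ M * J := by
    have h5 : l X = φ (D.x₀ + D.ε * a) -
        l (eval₂ (algebraMap O _) ![X, Y, U, ⟨0, 1⟩] D.ψB) := by
      conv_lhs => rw [h.x]
      rw [sub_eq_add_neg, ladd, lneg, lC', sub_eq_add_neg]
    have h6 : x - l X = (x - φ (D.x₀ + D.ε * a) + eval₂ φ ![x, y, u, w] D.ψB) -
        (eval₂ φ ![x, y, u, w] D.ψB - l (eval₂ (algebraMap O _) ![X, Y, U, ⟨0, 1⟩] D.ψB)) := by
      rw [h5]; ring
    rw [h6]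
    exact Ideal.sub_mem _ (Ideal.mem_sup_left hB) (Ideal.mem_sup_right (hsmall _ hD.ψB))
  have hu' : u - l U ∈ I ⊔ M * J := by
    have h5 : φ a + l U + w + l (eval₂ (algebraMap O _) ![X, Y, U, ⟨0, 1⟩] D.ψA) = 0 := by
      have h7 := congrArg l h.u
      rw [ladd, ladd, ladd, lC'] at h7
      have h8 : l ⟨0, 1⟩ = w := by simp [l]
      have h9 : l 0 = 0 := by simp [l]
      rw [h8, h9] at h7
      exact h7
    have h6 : u - l U = (φ a + u + w + eval₂ φ ![x, y, u, w] D.ψA) -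
        (eval₂ φ ![x, y, u, w] D.ψA - l (eval₂ (algebraMap O _) ![X, Y, U, ⟨0, 1⟩] D.ψA)) := by
      linear_combination -h5
    rw [h6]
    exact Ideal.sub_mem _ (Ideal.mem_sup_left hA) (Ideal.mem_sup_right (hsmall _ hD.ψA))
  have hq' : q ∈ I ⊔ M * J := by
    have h5 := congrArg l h.uw
    rw [lC] at h5
    -- The map l is additive but not multiplicative; for the product with ω the defect is a multiple
    -- of q. This isolates q.
    have h6 : l (U * ⟨0, 1⟩) = l U * w - φ U.im * q := by
      simp only [l, q, re_mul, im_mul, map_add, map_mul, map_neg, map_zero, map_one]; ring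
    have h7 : φ U.im * q = -(w * (u - l U)) +
        φ D.θ * (eval₂ φ ![x, y] D.h - l (eval₂ (algebraMap O _) ![X, Y] D.h)) := by
      linear_combination h6 - h5 + huw
    have h8 : φ U.im * q ∈ I ⊔ M * J := by
      rw [h7]
      exact Ideal.add_mem _ (neg_mem (Ideal.mul_mem_left _ _ hu'))
        (Ideal.mem_sup_right (Ideal.mul_mem_mul (hMm _ hD.θ) h2))
    have h9 : IsUnit (φ U.im) := by
      have h10 := hφ _ (h.im_u_add_one_mem hD)
      have h11 := (Ideal.mem_jacobson_bot.1 h10) (-1)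
      have h12 : φ (U.im + 1) * (-1) + 1 = -φ U.im := by rw [map_add, map_one]; ring
      rw [h12] at h11
      exact (IsUnit.neg_iff _).1 h11
    exact (Ideal.unit_mul_mem_iff_mem _ h9).1 h8
  -- Nakayama's lemma for the finitely generated ideal J.
  have hle : J ≤ I := by
    refine Submodule.le_of_le_smul_of_le_jacobson_bot (I := M) (Submodule.fg_span (by simp))
      (Ideal.map_le_iff_le_comap.2 hφ) ?_
    refine Ideal.span_le.2 ?_
    rintro s (rfl | rfl | rfl)
    · exact hx'
    · exact hu'
    · exact hq'
  exact ⟨hle hJx, hle hJu, hle hJq⟩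

end QuadSystem
end

noncomputable section
open Puiseux

/-! ### Signs and square roots of real series -/

/-- A real series with positive leading coefficient. -/
def IsPos (x : Puiseux) : Prop := IsRealSeries x ∧ 0 < (x.series.leadingCoeff).re

theorem IsRealSeries.leadingCoeff_eq {x : Puiseux} (hx : IsRealSeries x) :
    x.series.leadingCoeff = ((x.series.leadingCoeff).re : ℂ) := by
  apply Complex.ext
  · simp
  · rw [HahnSeries.leadingCoeff_eq, hx]; simp

theorem IsRealSeries.re_leadingCoeff_ne_zero {x : Puiseux} (hx : IsRealSeries x) (h0 : x ≠ 0) :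
    (x.series.leadingCoeff).re ≠ 0 := by
  intro h
  have h1 := hx.leadingCoeff_eq
  rw [h, Complex.ofReal_zero, HahnSeries.leadingCoeff_eq_zero, series_eq_zero] at h1
  exact h0 h1

theorem leadingCoeff_re_mul {x y : Puiseux} (hx : IsRealSeries x) (hy : IsRealSeries y) :
    ((x * y).series.leadingCoeff).re = (x.series.leadingCoeff).re * (y.series.leadingCoeff).re := by
  rw [series_mul, HahnSeries.leadingCoeff_mul, hx.leadingCoeff_eq, hy.leadingCoeff_eq]
  simp

namespace IsPos

theorem isReal {x : Puiseux} (hx : IsPos x) : IsRealSeries x := hx.1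

theorem ne_zero {x : Puiseux} (hx : IsPos x) : x ≠ 0 := by
  rintro rfl
  simpa using hx.2

theorem mul {x y : Puiseux} (hx : IsPos x) (hy : IsPos y) : IsPos (x * y) :=
  ⟨hx.1.mul hy.1, by rw [leadingCoeff_re_mul hx.1 hy.1]; exact mul_pos hx.2 hy.2⟩

theorem sq {x : Puiseux} (hx : IsRealSeries x) (h0 : x ≠ 0) : IsPos (x ^ 2) :=
  ⟨hx.pow 2, by
    rw [pow_two, leadingCoeff_re_mul hx hx]
    exact mul_self_pos.2 (hx.re_leadingCoeff_ne_zero h0)⟩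

theorem one : IsPos 1 := ⟨IsRealSeries.one, by simp⟩

theorem not_neg {x : Puiseux} (hx : IsPos x) : ¬ IsPos (-x) := fun h => by
  have := h.2
  rw [series_neg, HahnSeries.leadingCoeff_neg, Complex.neg_re] at this
  linarith [hx.2]

theorem or_neg {x : Puiseux} (hx : IsRealSeries x) (h0 : x ≠ 0) : IsPos x ∨ IsPos (-x) := by
  rcases lt_or_gt_of_ne (hx.re_leadingCoeff_ne_zero h0) with h | h
  · refine Or.inr ⟨hx.neg, ?_⟩
    rw [series_neg, HahnSeries.leadingCoeff_neg, Complex.neg_re]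
    linarith
  · exact Or.inl ⟨hx, h⟩

theorem not_iff {x : Puiseux} (hx : IsRealSeries x) (h0 : x ≠ 0) : ¬ IsPos x ↔ IsPos (-x) :=
  ⟨fun h => (or_neg hx h0).resolve_left h, fun h h' => h'.not_neg h⟩

theorem add_of_ord_lt {x y : Puiseux} (hx : IsPos x) (hy : IsRealSeries y) (h : ord x < ord y) :
    IsPos (x + y) :=
  ⟨hx.1.add hy, by rw [series_add, HahnSeries.leadingCoeff_add_eq_left h]; exact hx.2⟩

/-- If the orders are equal, the two leading coefficients are positive and cannot cancel. -/
theorem add {x y : Puiseux} (hx : IsPos x) (hy : IsPos y) : IsPos (x + y) := by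
  rcases lt_trichotomy (ord x) (ord y) with h | h | h
  · exact hx.add_of_ord_lt hy.1 h
  · refine ⟨hx.1.add hy.1, ?_⟩
    rw [ord_eq_val hx.ne_zero, ord_eq_val hy.ne_zero, WithTop.coe_inj] at h
    have hX := hx.2
    have hY := hy.2
    rw [HahnSeries.leadingCoeff_eq] at hX hY
    have h1 : ((x + y).series.coeff (val x)).re =
        (x.series.coeff (val x)).re + (y.series.coeff (val y)).re := by
      rw [series_add, HahnSeries.coeff_add, Complex.add_re, ← h]
    have h2 : 0 < ((x + y).series.coeff (val x)).re := by rw [h1]; exact add_pos hX hY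
    have h3 : (x + y).series.coeff (val x) ≠ 0 := fun h0 => by rw [h0] at h2; simp at h2
    have h4 : ord (x + y) = (val x : ℝ) := by
      refine le_antisymm (HahnSeries.orderTop_le_of_coeff_ne_zero h3) ?_
      refine le_trans (le_min ?_ ?_) (ord_add x y)
      · rw [ord_eq_val hx.ne_zero]
      · rw [ord_eq_val hy.ne_zero, h]
    have h5 : x + y ≠ 0 := fun h0 => by rw [h0] at h3; simp at h3
    rw [ord_eq_val h5, WithTop.coe_inj] at h4
    rw [HahnSeries.leadingCoeff_eq]
    change 0 < ((x + y).series.coeff (val (x + y))).re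
    rw [h4]
    exact h2
  · rw [add_comm]
    exact hy.add_of_ord_lt hx.1 h

theorem inv {x : Puiseux} (hx : IsPos x) : IsPos x⁻¹ := by
  have : x⁻¹ = x * (x⁻¹) ^ 2 := by
    rw [pow_two, ← mul_assoc, mul_inv_cancel₀ hx.ne_zero, one_mul]
  rw [this]
  exact hx.mul (sq hx.1.inv (inv_ne_zero hx.ne_zero))

theorem monomial {r c : ℝ} (hc : 0 < c) : IsPos (Puiseux.mono r c) :=
  ⟨IsRealSeries.mono r c, by simpa using hc⟩

theorem mul_iff {x y : Puiseux} (hx : IsRealSeries x) (hx0 : x ≠ 0) (hy : IsRealSeries y)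
    (hy0 : y ≠ 0) : IsPos (x * y) ↔ (IsPos x ↔ IsPos y) := by
  rcases or_neg hx hx0 with h | h <;> rcases or_neg hy hy0 with h' | h'
  · simp [h, h', h.mul h']
  · have h1 : ¬ IsPos y := (not_iff hy hy0).2 h'
    have h2 : ¬ IsPos (x * y) := by
      rw [not_iff (hx.mul hy) (mul_ne_zero hx0 hy0), ← mul_neg]; exact h.mul h'
    simp [h, h1, h2]
  · have h1 : ¬ IsPos x := (not_iff hx hx0).2 h
    have h2 : ¬ IsPos (x * y) := by
      rw [not_iff (hx.mul hy) (mul_ne_zero hx0 hy0), ← neg_mul]; exact h.mul h'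
    simp [h', h1, h2]
  · have h1 : ¬ IsPos x := (not_iff hx hx0).2 h
    have h2 : ¬ IsPos y := (not_iff hy hy0).2 h'
    have h3 : IsPos (x * y) := by rw [← neg_mul_neg]; exact h.mul h'
    simp [h1, h2, h3]

end IsPos

theorem ord_lt_ord_sub_leading {x : Puiseux} (hx : x ≠ 0) :
    ord x < ord (x - mono (val x) x.series.leadingCoeff) := by
  rw [ord_eq_val hx]
  refine lt_of_le_of_ne ?_ (Ne.symm ?_)
  · rw [ord, HahnSeries.le_orderTop_iff_forall]
    intro r hr
    have hr' : r < val x := by exact_mod_cast hr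
    rw [series_sub, HahnSeries.coeff_sub, series_mono, HahnSeries.coeff_single_of_ne hr'.ne,
      HahnSeries.coeff_eq_zero_of_lt_order hr', sub_zero]
  · refine HahnSeries.orderTop_ne_of_coeff_eq_zero ?_
    rw [series_sub, HahnSeries.coeff_sub, series_mono, HahnSeries.coeff_single_same,
      HahnSeries.leadingCoeff_eq]
    exact sub_self _

/-- The sign is that of the leading term, which x and y share. The converse direction passes to -x
and -y. -/
theorem isPos_congr {x y : Puiseux} (hx : IsRealSeries x) (hy : IsRealSeries y)
    (h : ord x < ord (y - x)) : IsPos x ↔ IsPos y := by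
  have hx0 : x ≠ 0 := by rintro rfl; simp at h
  have hle : ∀ {x y : Puiseux}, IsPos x → IsRealSeries y → ord x < ord (y - x) → IsPos y := by
    intro x y h1 h2 h3
    have := h1.add_of_ord_lt (h2.sub h1.1) h3
    rwa [add_sub_cancel] at this
  refine ⟨fun h1 => hle h1 hy h, fun h1 => ?_⟩
  by_contra h2
  rw [IsPos.not_iff hx hx0] at h2
  refine (hle h2 hy.neg ?_).not_neg (by rwa [neg_neg])
  rw [ord_neg, show -y - -x = -(y - x) by ring, ord_neg]
  exact h

/-- One half. -/
def half : realRing := ⟨mono 0 (2⁻¹ : ℝ), mem_realRing.2 ⟨by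
  rw [ord_mono (by norm_num)]; simp, IsRealSeries.mono _ _⟩⟩

theorem two_mul_half : 2 * half = 1 := by
  apply Subtype.ext
  apply series_injective
  rw [two_mul]
  change HahnSeries.single (0 : ℝ) ((2⁻¹ : ℝ) : ℂ) + HahnSeries.single (0 : ℝ) ((2⁻¹ : ℝ) : ℂ) = 1
  rw [← HahnSeries.single_add, ← HahnSeries.single_zero_one]
  congr 1
  push_cast
  norm_num

open MvPolynomial in
-- The unknowns are σ and ζ = 1 / (σ + 1). The equation σ² = 1 + μ becomes σ = 1 + μ ζ, and ζ (2 + μ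
-- ζ) = 1 becomes ζ = 1/2 - (μ / 2) ζ²; both perturbations are small.
theorem exists_sq_eq_one_add {μ : realRing} (hμ : μ ∈ realIdeal) :
    ∃ σ : realRing, σ ^ 2 = 1 + μ ∧ σ - 1 ∈ realIdeal := by
  obtain ⟨z, hz, -⟩ := realRing_fixedPointProperty 2 ![1, half]
    ![C μ * X 1, C μ * (-C half * X 1 ^ 2)] (by
      intro i
      fin_cases i
      · exact Ideal.mul_mem_right _ _ (Ideal.mem_map_of_mem _ hμ)
      · exact Ideal.mul_mem_right _ _ (Ideal.mem_map_of_mem _ hμ))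
  have h0 : z 0 = 1 + μ * z 1 := by simpa using hz 0
  have h1 : z 1 = half + μ * (-half * z 1 ^ 2) := by simpa using hz 1
  refine ⟨z 0, ?_, ?_⟩
  · have h2 : z 1 * (z 0 + 1) = 1 := by
      rw [h0]
      linear_combination 2 * h1 + (1 - μ * z 1 ^ 2) * two_mul_half
    linear_combination (z 0 + 1) * h0 + μ * h2
  · rw [h0, add_sub_cancel_left]
    exact realIdeal.mul_mem_right _ hμ

/-- The leading monomial has an explicit square root, since the exponents are real and its
coefficient is positive; the remaining factor is 1 + μ with μ of positive order. -/
theorem IsPos.exists_sqrt {x : Puiseux} (hx : IsPos x) : ∃ s, IsPos s ∧ s ^ 2 = x := by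
  have h0 := hx.ne_zero
  set c := (x.series.leadingCoeff).re with hc
  have hc0 : 0 < c := hx.2
  set M := mono (val x) (c : ℂ) with hM
  have hM0 : M ≠ 0 := mono_ne_zero (by exact_mod_cast hc0.ne')
  have h1 := ord_lt_ord_sub_leading h0
  rw [hx.1.leadingCoeff_eq, ← hc, ← hM] at h1
  have hMr : IsRealSeries M := IsRealSeries.mono _ _
  have h2 : 0 < ord ((x - M) / M) := by
    by_cases h3 : x - M = 0
    · rw [h3, zero_div, ord_zero]; exact WithTop.coe_lt_top 0
    · rw [ord_pos_iff (div_ne_zero h3 hM0), val_div h3 hM0, hM, val_mono (by exact_mod_cast hc0.ne')]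
      rw [ord_eq_val h0, ord_eq_val h3, WithTop.coe_lt_coe] at h1
      rw [← hM]
      linarith
  obtain ⟨σ, h3, h4⟩ := exists_sq_eq_one_add (μ := ⟨(x - M) / M, mem_realRing.2
    ⟨h2.le, (hx.1.sub hMr).div hMr⟩⟩) h2
  have h5 : (σ : Puiseux) ^ 2 = 1 + (x - M) / M := congrArg Subtype.val h3
  refine ⟨mono (val x / 2) (Real.sqrt c : ℝ) * σ, ?_, ?_⟩
  · refine (IsPos.monomial (Real.sqrt_pos.2 hc0)).mul ?_
    refine (isPos_congr IsRealSeries.one (mem_realRing.1 σ.2).2 ?_).1 IsPos.one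
    rw [ord_one]
    exact h4
  · have h6 : mono (val x / 2) (Real.sqrt c : ℝ) ^ 2 = M := by
      rw [pow_two, mono_mul, hM, add_halves, ← Complex.ofReal_mul, Real.mul_self_sqrt hc0.le]
    rw [mul_pow, h5, h6]
    field_simp
    ring
end

noncomputable section
open Filter Topology

/-! ### Combinatorics of tropical curves -/

/-- The pairing of an exponent with a vector. -/
def pairing (α : Fin 2 →₀ ℕ) (d : Fin 2 → ℝ) : ℝ := (α 0 : ℝ) * d 0 + (α 1 : ℝ) * d 1

/-- Twice the signed area of a lattice triangle. -/
def cross (α β γ : Fin 2 →₀ ℕ) : ℤ :=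
  ((β 0 : ℤ) - α 0) * ((γ 1 : ℤ) - α 1) - ((β 1 : ℤ) - α 1) * ((γ 0 : ℤ) - α 0)

/-- The lattice length of the segment between two exponents. -/
def latLen (α β : Fin 2 →₀ ℕ) : ℕ := Int.gcd ((α 0 : ℤ) - (β 0 : ℤ)) ((α 1 : ℤ) - (β 1 : ℤ))

theorem exponent_ext {α β : Fin 2 →₀ ℕ} (h0 : (α 0 : ℤ) = β 0) (h1 : (α 1 : ℤ) = β 1) : α = β := by
  ext i
  fin_cases i
  · exact_mod_cast h0
  · exact_mod_cast h1

theorem latLen_ne_zero {α β : Fin 2 →₀ ℕ} (h : α ≠ β) : latLen α β ≠ 0 := by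
  intro h0
  rw [latLen, Int.gcd_eq_zero_iff] at h0
  exact h (exponent_ext (by linarith [h0.1]) (by linarith [h0.2]))

theorem exists_smul_of_gcd_eq_one {a b c d : ℤ} (h : Int.gcd a b = 1) (h0 : a * d - b * c = 0) :
    ∃ k, c = k * a ∧ d = k * b := by
  obtain ⟨s, t, hst⟩ := Int.isCoprime_iff_gcd_eq_one.2 h
  refine ⟨s * c + t * d, ?_, ?_⟩
  · linear_combination (-c) * hst - t * h0
  · linear_combination (-d) * hst + s * h0

theorem triangleArea_eq_half_iff (α β γ : Fin 2 →₀ ℕ) :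
    triangleArea α β γ = 1 / 2 ↔ |cross α β γ| = 1 := by
  have : triangleArea α β γ = ((|cross α β γ| : ℤ) : ℝ) / 2 := by
    rw [triangleArea, cross]; push_cast; rfl
  rw [this]
  constructor
  · intro h
    have : ((|cross α β γ| : ℤ) : ℝ) = 1 := by linarith
    exact_mod_cast this
  · intro h; rw [h]; simp

theorem collinear_expVec_iff (S : Set (Fin 2 →₀ ℕ)) :
    Collinear ℝ (expVec '' S) ↔ ∀ α ∈ S, ∀ β ∈ S, ∀ γ ∈ S, cross α β γ = 0 := by
  constructor
  · intro h α hα β hβ γ hγ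
    obtain ⟨v, hv⟩ := (collinear_iff_of_mem (Set.mem_image_of_mem expVec hα)).1 h
    obtain ⟨r, hr⟩ := hv _ (Set.mem_image_of_mem expVec hβ)
    obtain ⟨s, hs⟩ := hv _ (Set.mem_image_of_mem expVec hγ)
    have r0 : (β 0 : ℝ) = r * v 0 + α 0 := congrFun hr 0
    have r1 : (β 1 : ℝ) = r * v 1 + α 1 := congrFun hr 1
    have s0 : (γ 0 : ℝ) = s * v 0 + α 0 := congrFun hs 0
    have s1 : (γ 1 : ℝ) = s * v 1 + α 1 := congrFun hs 1
    have : ((cross α β γ : ℤ) : ℝ) = 0 := by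
      rw [cross]; push_cast; rw [r0, r1, s0, s1]; ring
    exact_mod_cast this
  · intro h
    by_cases hS : ∃ α ∈ S, ∃ β ∈ S, α ≠ β
    · obtain ⟨α, hα, β, hβ, hαβ⟩ := hS
      refine (collinear_iff_of_mem (Set.mem_image_of_mem expVec hα)).2
        ⟨expVec β - expVec α, ?_⟩
      rintro _ ⟨γ, hγ, rfl⟩
      have hc : ((cross α β γ : ℤ) : ℝ) = 0 := by exact_mod_cast h α hα β hβ γ hγ
      rw [cross] at hc
      push_cast at hc
      by_cases h0 : (β 0 : ℝ) - α 0 = 0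
      · have h1 : (β 1 : ℝ) - α 1 ≠ 0 := fun h1 => hαβ (exponent_ext
          (by have : (α 0 : ℝ) = β 0 := by linarith
              exact_mod_cast this)
          (by have : (α 1 : ℝ) = β 1 := by linarith
              exact_mod_cast this))
        refine ⟨((γ 1 : ℝ) - α 1) / ((β 1 : ℝ) - α 1), ?_⟩
        have h2 : (γ 0 : ℝ) - α 0 = 0 := by
          rw [h0, zero_mul, zero_sub, neg_eq_zero] at hc
          exact (mul_eq_zero.1 hc).resolve_left h1
        funext i
        fin_cases i
        · change (γ 0 : ℝ) = _ * ((β 0 : ℝ) - α 0) + α 0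
          rw [h0]; linarith
        · change (γ 1 : ℝ) = _ * ((β 1 : ℝ) - α 1) + α 1
          rw [div_mul_cancel₀ _ h1]; ring
      · refine ⟨((γ 0 : ℝ) - α 0) / ((β 0 : ℝ) - α 0), ?_⟩
        funext i
        fin_cases i
        · change (γ 0 : ℝ) = _ * ((β 0 : ℝ) - α 0) + α 0
          rw [div_mul_cancel₀ _ h0]; ring
        · change (γ 1 : ℝ) = _ * ((β 1 : ℝ) - α 1) + α 1
          field_simp
          linarith
    · push Not at hS
      have hsub : (expVec '' S).Subsingleton := by
        rintro _ ⟨α, hα, rfl⟩ _ ⟨β, hβ, rfl⟩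
        rw [hS α hα β hβ]
      rcases hsub.eq_empty_or_singleton with h0 | ⟨x, h0⟩ <;> rw [h0]
      · exact collinear_empty ℝ _
      · exact collinear_singleton ℝ _

/-- A collinear set of exponents with at least two elements, any two of which have lattice
distance at most one, has exactly two elements. -/
theorem eq_pair_of_collinear {M : Finset (Fin 2 →₀ ℕ)} (h2 : 2 ≤ M.card)
    (hc : ∀ α ∈ M, ∀ β ∈ M, ∀ γ ∈ M, cross α β γ = 0)
    (hl : ∀ α ∈ M, ∀ β ∈ M, latLen α β ≤ 1) :
    ∃ α β, α ≠ β ∧ M = {α, β} ∧ latLen α β = 1 := by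
  obtain ⟨α, hα, β, hβ, hne⟩ := Finset.one_lt_card.1 h2
  have hlen : ∀ {α β}, α ∈ M → β ∈ M → α ≠ β → latLen α β = 1 := fun hα hβ hne =>
    le_antisymm (hl _ hα _ hβ) (Nat.one_le_iff_ne_zero.2 (latLen_ne_zero hne))
  refine ⟨α, β, hne, Finset.Subset.antisymm (fun γ hγ => ?_) ?_, hlen hα hβ hne⟩
  · by_contra hγ'
    simp only [Finset.mem_insert, Finset.mem_singleton, not_or] at hγ'
    have h1 := hlen hβ hα hne.symm
    have h3 := hlen hγ hα hγ'.1
    have h4 := hlen hγ hβ hγ'.2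
    have h5 := hc α hα β hβ γ hγ
    -- A third element is α + k (β - α); its lattice distances |k| and |k - 1| from α and β would
    -- both be 1.
    obtain ⟨k, hk0, hk1⟩ := exists_smul_of_gcd_eq_one (a := (β 0 : ℤ) - α 0) (b := (β 1 : ℤ) - α 1)
      h1 h5
    rw [latLen, hk0, hk1, Int.gcd_mul_left] at h3
    rw [latLen, show (γ 0 : ℤ) - β 0 = (k - 1) * ((β 0 : ℤ) - α 0) by linarith,
      show (γ 1 : ℤ) - β 1 = (k - 1) * ((β 1 : ℤ) - α 1) by linarith, Int.gcd_mul_left] at h4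
    rw [latLen] at h1
    rw [h1, mul_one] at h3 h4
    omega
  · intro γ hγ
    simp only [Finset.mem_insert, Finset.mem_singleton] at hγ
    rcases hγ with rfl | rfl <;> assumption

/-! ### Dual cells, their faces, and edges of weight one -/

namespace TropPoly

variable (P : TropPoly)

theorem term_eq (α : Fin 2 →₀ ℕ) (v : Fin 2 → ℝ) : P.term α v = P.coeff α + pairing α v := by
  rw [term, Fin.sum_univ_two, pairing]

theorem term_add_smul (α : Fin 2 →₀ ℕ) (v d : Fin 2 → ℝ) (t : ℝ) :
    P.term α (v + t • d) = P.term α v + t * pairing α d := by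
  rw [term_eq, term_eq, pairing, pairing, pairing]
  simp only [Pi.add_apply, Pi.smul_apply, smul_eq_mul]
  ring

variable {P}

theorem mem_maxAt {v : Fin 2 → ℝ} {α : Fin 2 →₀ ℕ} :
    α ∈ P.maxAt v ↔ α ∈ P.supp ∧ ∀ β ∈ P.supp, P.term β v ≤ P.term α v := by
  classical
  rw [maxAt, Finset.mem_filter]

theorem mem_maxAt_iff_of_mem {v : Fin 2 → ℝ} {α : Fin 2 →₀ ℕ} (hα : α ∈ P.maxAt v)
    {β : Fin 2 →₀ ℕ} (hβ : β ∈ P.supp) : β ∈ P.maxAt v ↔ P.term β v = P.term α v := by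
  rw [mem_maxAt] at *
  refine ⟨fun h => le_antisymm (hα.2 β hβ) (h.2 α hα.1), fun h => ⟨hβ, fun γ hγ => ?_⟩⟩
  rw [h]; exact hα.2 γ hγ

theorem term_eq_of_mem {v : Fin 2 → ℝ} {α β : Fin 2 →₀ ℕ} (hα : α ∈ P.maxAt v)
    (hβ : β ∈ P.maxAt v) : P.term β v = P.term α v :=
  (mem_maxAt_iff_of_mem hα (mem_maxAt.1 hβ).1).1 hβ

theorem term_lt_of_notMem {v : Fin 2 → ℝ} {α β : Fin 2 →₀ ℕ} (hα : α ∈ P.maxAt v)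
    (hβ : β ∈ P.supp) (h : β ∉ P.maxAt v) : P.term β v < P.term α v :=
  lt_of_le_of_ne ((mem_maxAt.1 hα).2 β hβ) fun h' => h ((mem_maxAt_iff_of_mem hα hβ).2 h')

theorem mem_curve {v : Fin 2 → ℝ} : v ∈ P.curve ↔ 2 ≤ (P.maxAt v).card := Iff.rfl

open Classical in
/-- The face of the dual cell at `v` in direction `d`. -/
def face (P : TropPoly) (v d : Fin 2 → ℝ) : Finset (Fin 2 →₀ ℕ) :=
  (P.maxAt v).filter fun α => ∀ β ∈ P.maxAt v, pairing β d ≤ pairing α d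

theorem mem_face {v d : Fin 2 → ℝ} {α : Fin 2 →₀ ℕ} :
    α ∈ P.face v d ↔ α ∈ P.maxAt v ∧ ∀ β ∈ P.maxAt v, pairing β d ≤ pairing α d := by
  classical
  rw [face, Finset.mem_filter]

/-- Monomials below the maximum at v stay below for small t, and among the maximal ones the slope in
direction d decides. -/
theorem eventually_maxAt_eq_face (v d : Fin 2 → ℝ) (h : (P.maxAt v).Nonempty) :
    ∀ᶠ t : ℝ in 𝓝[>] 0, P.maxAt (v + t • d) = P.face v d := by
  obtain ⟨μ, hμ, hmax⟩ := (P.maxAt v).exists_max_image (fun α => pairing α d) h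
  have h1 : ∀ᶠ t : ℝ in 𝓝[>] 0, ∀ γ ∈ P.supp, γ ∉ P.maxAt v →
      P.term γ (v + t • d) < P.term μ (v + t • d) := by
    rw [Filter.eventually_all_finset]
    intro γ hγ
    by_cases h2 : γ ∈ P.maxAt v
    · exact Eventually.of_forall fun t h3 => absurd h2 h3
    have h3 := term_lt_of_notMem hμ hγ h2
    have h4 : Tendsto (fun t : ℝ => P.term γ v + t * pairing γ d - t * pairing μ d) (𝓝[>] 0)
        (𝓝 (P.term γ v + 0 * pairing γ d - 0 * pairing μ d)) := by
      refine tendsto_nhdsWithin_of_tendsto_nhds ?_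
      have : Continuous fun t : ℝ => P.term γ v + t * pairing γ d - t * pairing μ d := by fun_prop
      exact this.tendsto 0
    rw [zero_mul, zero_mul, add_zero, sub_zero] at h4
    filter_upwards [h4.eventually (gt_mem_nhds h3)] with t ht _
    rw [term_add_smul, term_add_smul]
    linarith
  filter_upwards [h1, self_mem_nhdsWithin] with t ht ht0
  have ht0' : 0 < t := ht0
  have hμt : μ ∈ P.maxAt (v + t • d) := by
    rw [mem_maxAt]
    refine ⟨(mem_maxAt.1 hμ).1, fun γ hγ => ?_⟩
    by_cases h2 : γ ∈ P.maxAt v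
    · rw [term_add_smul, term_add_smul, term_eq_of_mem hμ h2]
      have := mul_le_mul_of_nonneg_left (hmax γ h2) ht0'.le
      linarith
    · exact (ht γ hγ h2).le
  ext α
  rw [mem_face]
  constructor
  · intro hα
    have hαs := (mem_maxAt.1 hα).1
    have h2 : α ∈ P.maxAt v := by
      by_contra h2
      exact absurd (term_eq_of_mem hμt hα) (ht α hαs h2).ne
    refine ⟨h2, fun β hβ => ?_⟩
    have h3 := term_eq_of_mem hμt hα
    rw [term_add_smul, term_add_smul, term_eq_of_mem hμ h2] at h3
    have h4 : pairing α d = pairing μ d := by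
      have : t * pairing α d = t * pairing μ d := by linarith
      exact mul_left_cancel₀ ht0'.ne' this
    rw [h4]; exact hmax β hβ
  · rintro ⟨h2, h3⟩
    rw [mem_maxAt_iff_of_mem hμt (mem_maxAt.1 h2).1, term_add_smul, term_add_smul,
      term_eq_of_mem hμ h2, le_antisymm (hmax α h2) (h3 μ hμ)]

theorem cross_eq_zero_of_pairing_eq {α β γ : Fin 2 →₀ ℕ} {d : Fin 2 → ℝ} (hd : d ≠ 0)
    (hβ : pairing β d = pairing α d) (hγ : pairing γ d = pairing α d) : cross α β γ = 0 := by
  have : ((cross α β γ : ℤ) : ℝ) = 0 := by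
    rw [cross]; push_cast
    simp only [pairing] at hβ hγ
    by_cases h0 : d 0 = 0
    · have h1 : d 1 ≠ 0 := fun h1 => hd (by funext i; fin_cases i <;> assumption)
      refine mul_right_cancel₀ h1 ?_
      rw [h0] at hβ hγ
      linear_combination ((β 0 : ℝ) - α 0) * hγ - ((γ 0 : ℝ) - α 0) * hβ
    · refine mul_right_cancel₀ h0 ?_
      linear_combination ((γ 1 : ℝ) - α 1) * hβ - ((β 1 : ℝ) - α 1) * hγ
  exact_mod_cast this

theorem cross_eq_zero_of_mem_face {v d : Fin 2 → ℝ} (hd : d ≠ 0) :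
    ∀ α ∈ P.face v d, ∀ β ∈ P.face v d, ∀ γ ∈ P.face v d, cross α β γ = 0 := by
  intro α hα β hβ γ hγ
  rw [mem_face] at *
  exact cross_eq_zero_of_pairing_eq hd (le_antisymm (hα.2 β hβ.1) (hβ.2 α hα.1))
    (le_antisymm (hα.2 γ hγ.1) (hγ.2 α hα.1))

theorem dual_eq_maxAt (v : Fin 2 → ℝ) : P.dual {w | P.maxAt v ⊆ P.maxAt w} = P.maxAt v := by
  classical
  ext α
  rw [dual, Finset.mem_filter]
  exact ⟨fun h => h.2 v (Finset.Subset.refl _), fun h => ⟨(mem_maxAt.1 h).1, fun w hw => hw h⟩⟩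

theorem latLen_le_weight {e : Set (Fin 2 → ℝ)} {α β : Fin 2 →₀ ℕ} (hα : α ∈ P.dual e)
    (hβ : β ∈ P.dual e) : latLen α β ≤ P.weight e :=
  Finset.le_sup (f := fun x : (Fin 2 →₀ ℕ) × (Fin 2 →₀ ℕ) =>
    Int.gcd ((x.1 0 : ℤ) - (x.2 0 : ℤ)) ((x.1 1 : ℤ) - (x.2 1 : ℤ)))
    (Finset.mk_mem_product hα hβ)

/-- All edges have weight one. -/
def UnitWeights (P : TropPoly) : Prop := ∀ e, P.IsEdge e → P.weight e = 1

theorem UnitWeights.maxAt_eq_pair (hP : P.UnitWeights) {v : Fin 2 → ℝ}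
    (h2 : 2 ≤ (P.maxAt v).card) (hc : Collinear ℝ (expVec '' (P.maxAt v : Set (Fin 2 →₀ ℕ)))) :
    ∃ α β, α ≠ β ∧ P.maxAt v = {α, β} ∧ latLen α β = 1 := by
  refine eq_pair_of_collinear h2 ((collinear_expVec_iff _).1 hc) fun α hα β hβ => ?_
  rw [← hP _ ⟨v, h2, hc, rfl⟩]
  exact latLen_le_weight (by rwa [dual_eq_maxAt]) (by rwa [dual_eq_maxAt])

/-- Such a face is the dual cell of a point near v, and it is collinear, so this point lies on an
edge and the weight condition applies. -/
theorem UnitWeights.face_eq_pair (hP : P.UnitWeights) {v d : Fin 2 → ℝ} (hd : d ≠ 0)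
    (h2 : 2 ≤ (P.face v d).card) : ∃ α β, α ≠ β ∧ P.face v d = {α, β} ∧ latLen α β = 1 := by
  have hne : (P.maxAt v).Nonempty := by
    obtain ⟨α, hα⟩ := Finset.card_pos.1 (lt_of_lt_of_le two_pos h2)
    exact ⟨α, (mem_face.1 hα).1⟩
  obtain ⟨t, ht⟩ := (eventually_maxAt_eq_face v d hne).exists
  rw [← ht] at h2 ⊢
  refine hP.maxAt_eq_pair h2 ((collinear_expVec_iff _).2 ?_)
  rw [ht]
  exact cross_eq_zero_of_mem_face hd

/-- For a non-singular curve, the dual cell of a point on the curve is a primitive segment or a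
unimodular triangle. -/
theorem Nonsingular.maxAt_cases (hP : P.Nonsingular) {v : Fin 2 → ℝ} (h2 : 2 ≤ (P.maxAt v).card) :
    (∃ α β, α ≠ β ∧ P.maxAt v = {α, β} ∧ latLen α β = 1) ∨
      ∃ α β γ, P.maxAt v = {α, β, γ} ∧ |cross α β γ| = 1 := by
  by_cases hc : Collinear ℝ (expVec '' (P.maxAt v : Set (Fin 2 →₀ ℕ)))
  · exact Or.inl (UnitWeights.maxAt_eq_pair hP.2 h2 hc)
  · obtain ⟨α, β, γ, h, h'⟩ := hP.1 v hc
    refine Or.inr ⟨α, β, γ, ?_, (triangleArea_eq_half_iff _ _ _).1 h'⟩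
    rw [← Finset.coe_inj, h]; simp

end TropPoly

/-! ### Ties of linear functionals on finite sets of lattice points -/

section Faces

variable {ι : Type*} (M : Finset ι) (i j : ι → ℤ)

open Classical in
/-- The elements of `M` that maximise the functional `(a, b)`. -/
def faceOf (a b : ℝ) : Finset ι :=
  M.filter fun α => ∀ β ∈ M, i β * a + j β * b ≤ i α * a + j α * b

variable {M i j}

theorem mem_faceOf {a b : ℝ} {α : ι} : α ∈ faceOf M i j a b ↔
    α ∈ M ∧ ∀ β ∈ M, i β * a + j β * b ≤ i α * a + j α * b := by
  classical
  rw [faceOf, Finset.mem_filter]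

/-- A vertex stays a maximiser while the functional moves along a segment without ties. -/
theorem mem_faceOf_of_segment {a b a' b' : ℝ} {m : ι} (hm : m ∈ faceOf M i j a b)
    (h1 : ∀ γ ∈ faceOf M i j a b, i γ * a' + j γ * b' ≤ i m * a' + j m * b')
    (h2 : ∀ s : ℝ, 0 < s → s < 1 →
      ¬ 2 ≤ (faceOf M i j ((1 - s) * a + s * a') ((1 - s) * b + s * b')).card) :
    m ∈ faceOf M i j a' b' := by
  classical
  rw [mem_faceOf] at hm ⊢
  refine ⟨hm.1, ?_⟩
  by_contra hcon
  push Not at hcon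
  -- A is the lead of m over γ at the start of the segment and B the lead of γ over m at its end.
  let A : ι → ℝ := fun γ => (i m * a + j m * b) - (i γ * a + j γ * b)
  let B : ι → ℝ := fun γ => (i γ * a' + j γ * b') - (i m * a' + j m * b')
  have hA0 : ∀ γ ∈ M, 0 ≤ A γ := fun γ hγ => sub_nonneg.2 (hm.2 γ hγ)
  have hAB : ∀ γ ∈ M, 0 < B γ → 0 < A γ := by
    intro γ hγ hB
    refine lt_of_le_of_ne (hA0 γ hγ) fun h0 => ?_
    have h3 : γ ∈ faceOf M i j a b := by
      rw [mem_faceOf]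
      refine ⟨hγ, fun β hβ => (hm.2 β hβ).trans ?_⟩
      have : (i m * a + j m * b) - (i γ * a + j γ * b) = 0 := h0.symm
      linarith
    have h4 := h1 γ h3
    have : 0 < (i γ * a' + j γ * b') - (i m * a' + j m * b') := hB
    linarith
  obtain ⟨γ₀, hγ₀, hγ₀'⟩ := hcon
  have hne : (M.filter fun γ => 0 < B γ).Nonempty :=
    ⟨γ₀, Finset.mem_filter.2 ⟨hγ₀, sub_pos.2 hγ₀'⟩⟩
  obtain ⟨γ, hγ, hmin⟩ := (M.filter fun γ => 0 < B γ).exists_min_image (fun γ => A γ / B γ) hne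
  rw [Finset.mem_filter] at hγ
  have hAγ := hAB γ hγ.1 hγ.2
  have hBγ := hγ.2
  -- The first moment at which some γ catches up with m, reached by the γ with least A / B. There m
  -- and γ tie for the maximum.
  set s : ℝ := A γ / (A γ + B γ) with hs
  have hs0 : 0 < s := by positivity
  have hs1 : s < 1 := by rw [hs, div_lt_one (by positivity)]; linarith
  have hsA : (1 - s) * A γ = s * B γ := by rw [hs]; field_simp; ring
  refine h2 s hs0 hs1 ?_
  have hval : ∀ δ, (i δ * ((1 - s) * a + s * a') + j δ * ((1 - s) * b + s * b')) =
      (i m * ((1 - s) * a + s * a') + j m * ((1 - s) * b + s * b')) - (1 - s) * A δ + s * B δ := by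
    intro δ; simp only [A, B]; ring
  have hle : ∀ δ ∈ M, s * B δ ≤ (1 - s) * A δ := by
    intro δ hδ
    by_cases hB : 0 < B δ
    · have h3 := hmin δ (Finset.mem_filter.2 ⟨hδ, hB⟩)
      rw [div_le_div_iff₀ hBγ hB] at h3
      have h4 : s * (B δ * B γ) ≤ (1 - s) * (A δ * B γ) := by
        calc s * (B δ * B γ) = ((1 - s) * A γ) * B δ := by rw [hsA]; ring
          _ = (1 - s) * (A γ * B δ) := by ring
          _ ≤ _ := mul_le_mul_of_nonneg_left h3 (by linarith)
      nlinarith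
    · have h3 := hA0 δ hδ
      have h4 : s * B δ ≤ 0 := mul_nonpos_of_nonneg_of_nonpos hs0.le (not_lt.1 hB)
      have h5 : 0 ≤ (1 - s) * A δ := mul_nonneg (by linarith) h3
      linarith
  refine Finset.one_lt_card.2 ⟨m, ?_, γ, ?_, ?_⟩
  · rw [mem_faceOf]
    refine ⟨hm.1, fun β hβ => ?_⟩
    rw [hval β]
    linarith [hle β hβ]
  · rw [mem_faceOf]
    refine ⟨hγ.1, fun β hβ => ?_⟩
    rw [hval β, hval γ]
    linarith [hle β hβ]
  · rintro rfl
    exact hBγ.ne' (sub_self _)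

/-- If the only ties are those of a segment, all elements have the same height. -/
theorem height_eq_of_ties_segment
    (h : ∀ a b : ℝ, ¬ (a = 0 ∧ b = 0) → (2 ≤ (faceOf M i j a b).card ↔ a = 0)) :
    ∀ α ∈ M, ∀ β ∈ M, j α = j β := by
  classical
  have h1 : 1 < (faceOf M i j 0 1).card := (h 0 1 (by simp)).2 rfl
  -- The rightmost of the highest elements survives the rotation from (0, 1) through (1, 0) to (0,
  -- -1), as no tie occurs on the way. It is then also a lowest element.
  obtain ⟨m, hm, hmax⟩ := (faceOf M i j 0 1).exists_max_image i
    (Finset.card_pos.1 (by omega))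
  have h2 : m ∈ faceOf M i j 1 0 := by
    refine mem_faceOf_of_segment hm (fun γ hγ => ?_) fun s h0 h1 => ?_
    · have : (i γ : ℝ) ≤ i m := by exact_mod_cast hmax γ hγ
      linarith
    · rw [h _ _ (by rintro ⟨h3, h4⟩; linarith)]
      intro h3; linarith
  have h3 : m ∈ faceOf M i j 0 (-1) := by
    have huniq : ∀ γ ∈ faceOf M i j 1 0, γ = m := by
      intro γ hγ
      by_contra hne
      have : 2 ≤ (faceOf M i j 1 0).card := Finset.one_lt_card.2 ⟨γ, hγ, m, h2, hne⟩
      rw [h 1 0 (by simp)] at this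
      exact one_ne_zero this
    refine mem_faceOf_of_segment h2 (fun γ hγ => by rw [huniq γ hγ]) fun s h0 h1 => ?_
    rw [h _ _ (by rintro ⟨h3, h4⟩; linarith)]
    intro h3; linarith
  rw [mem_faceOf] at hm h3
  have h4 : ∀ α ∈ M, j α = j m := by
    intro α hα
    have h5 := hm.2 α hα
    have h6 := h3.2 α hα
    have : (j α : ℝ) = j m := by linarith
    exact_mod_cast this
  intro α hα β hβ
  rw [h4 α hα, h4 β hβ]

/-- If the ties are those of the standard triangle and all sides are primitive, the set is a
translate of the standard triangle. -/
theorem eq_triangle_of_ties [DecidableEq ι] (hinj : ∀ α ∈ M, ∀ β ∈ M, i α = i β → j α = j β → α = β)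
    (h : ∀ a b : ℝ, ¬ (a = 0 ∧ b = 0) → (2 ≤ (faceOf M i j a b).card ↔
      (a = 0 ∧ b ≤ 0) ∨ (b = 0 ∧ a ≤ 0) ∨ (a = b ∧ 0 ≤ a)))
    (hl : ∀ a b : ℝ, ¬ (a = 0 ∧ b = 0) → 2 ≤ (faceOf M i j a b).card →
      ∃ α β, faceOf M i j a b = {α, β} ∧ Int.gcd (i α - i β) (j α - j β) = 1) :
    ∃ α ∈ M, ∃ β ∈ M, ∃ γ ∈ M, (∀ δ ∈ M, δ = α ∨ δ = β ∨ δ = γ) ∧ i β = i α + 1 ∧ j β = j α ∧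
      i γ = i α ∧ j γ = j α + 1 := by
  obtain ⟨μ, ν, hF, hg, hle⟩ : ∃ μ ν, faceOf M i j 0 (-1) = {μ, ν} ∧
      Int.gcd (i μ - i ν) (j μ - j ν) = 1 ∧ i μ ≤ i ν := by
    obtain ⟨μ, ν, h1, h2⟩ := hl 0 (-1) (by simp) ((h 0 (-1) (by simp)).2 (by norm_num))
    rcases le_total (i μ) (i ν) with h3 | h3
    · exact ⟨μ, ν, h1, h2, h3⟩
    · refine ⟨ν, μ, by rw [h1, Finset.pair_comm], ?_, h3⟩
      rw [← Int.gcd_neg, ← Int.neg_gcd, neg_sub, neg_sub]; exact h2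
  have hμ : μ ∈ faceOf M i j 0 (-1) := by rw [hF]; simp
  have hν : ν ∈ faceOf M i j 0 (-1) := by rw [hF]; simp
  have hμ' := mem_faceOf.1 hμ
  have hν' := mem_faceOf.1 hν
  have hj : j μ = j ν := by
    have h1 := hμ'.2 ν hν'.1
    have h2 := hν'.2 μ hμ'.1
    have : (j μ : ℝ) = j ν := by linarith
    exact_mod_cast this
  have hi : i ν = i μ + 1 := by
    rw [hj, sub_self, Int.gcd_zero_right] at hg
    omega
  have hjmin : ∀ δ ∈ M, j μ ≤ j δ := by
    intro δ hδ
    have h1 := hμ'.2 δ hδ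
    have : (j μ : ℝ) ≤ j δ := by linarith
    exact_mod_cast this
  have hiR : (i ν : ℝ) = i μ + 1 := by exact_mod_cast hi
  have hjR : (j μ : ℝ) = j ν := by exact_mod_cast hj
  -- rotate to `(1, 1)`
  have h11 : ν ∈ faceOf M i j 1 1 := by
    refine mem_faceOf_of_segment hν (fun γ hγ => ?_) fun s h0 h1 => ?_
    · rw [hF, Finset.mem_insert, Finset.mem_singleton] at hγ
      rcases hγ with rfl | rfl
      · linarith
      · exact le_rfl
    · rw [h _ _ (by rintro ⟨h3, h4⟩; linarith)]
      rintro (⟨h3, h4⟩ | ⟨h3, h4⟩ | ⟨h3, h4⟩) <;> linarith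
  have h11' := mem_faceOf.1 h11
  obtain ⟨ξ, hξ, hξν, hgξ⟩ : ∃ ξ ∈ faceOf M i j 1 1, ξ ≠ ν ∧
      Int.gcd (i ξ - i ν) (j ξ - j ν) = 1 := by
    obtain ⟨α, β, h1, h2⟩ := hl 1 1 (by simp) ((h 1 1 (by simp)).2 (by norm_num))
    have hαβ : α ≠ β := by rintro rfl; simp at h2
    have h3 := h11
    rw [h1, Finset.mem_insert, Finset.mem_singleton] at h3
    rw [h1]
    rcases h3 with rfl | rfl
    · refine ⟨β, by simp, hαβ.symm, ?_⟩
      rw [← Int.gcd_neg, ← Int.neg_gcd, neg_sub, neg_sub]; exact h2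
    · exact ⟨α, by simp, hαβ, h2⟩
  have hξ' := mem_faceOf.1 hξ
  have hsum : i ξ + j ξ = i ν + j ν := by
    have h1 := hξ'.2 ν hν'.1
    have h2 := h11'.2 ξ hξ'.1
    have : (i ξ : ℝ) + j ξ = i ν + j ν := by linarith
    exact_mod_cast this
  have hξj : j ξ = j μ + 1 := by
    have h1 : i ξ - i ν = -(j ξ - j ν) := by linarith
    rw [h1, Int.neg_gcd, Int.gcd_self] at hgξ
    have h2 := hjmin ξ hξ'.1
    omega
  have hξi : i ξ = i μ := by omega
  -- rotate to `(-1, 0)`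
  have h10 : μ ∈ faceOf M i j (-1) 0 := by
    refine mem_faceOf_of_segment hμ (fun γ hγ => ?_) fun s h0 h1 => ?_
    · rw [hF, Finset.mem_insert, Finset.mem_singleton] at hγ
      rcases hγ with rfl | rfl
      · exact le_rfl
      · linarith
    · rw [h _ _ (by rintro ⟨h3, h4⟩; linarith)]
      rintro (⟨h3, h4⟩ | ⟨h3, h4⟩ | ⟨h3, h4⟩) <;> linarith
  have h10' := mem_faceOf.1 h10
  refine ⟨μ, hμ'.1, ν, hν'.1, ξ, hξ'.1, fun δ hδ => ?_, hi, hj.symm, hξi, hξj⟩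
  have h1 := hjmin δ hδ
  have h2 : i μ ≤ i δ := by
    have h3 := h10'.2 δ hδ
    have : (i μ : ℝ) ≤ i δ := by linarith
    exact_mod_cast this
  have h3 : i δ + j δ ≤ i μ + 1 + j μ := by
    have h4 := h11'.2 δ hδ
    have : (i δ : ℝ) + j δ ≤ i μ + 1 + j μ := by linarith
    exact_mod_cast this
  -- The three inequalities cut out a translate of the standard triangle, whose only lattice points
  -- are its vertices.
  by_cases h4 : i δ = i μ
  · by_cases h5 : j δ = j μ
    · exact Or.inl (hinj _ hδ _ hμ'.1 h4 h5)
    · exact Or.inr (Or.inr (hinj _ hδ _ hξ'.1 (by omega) (by omega)))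
  · exact Or.inr (Or.inl (hinj _ hδ _ hν'.1 (by omega) (by omega)))

end Faces
end

noncomputable section
open Filter Topology

/-! ### Transfer of non-singularity -/

/-- A basis `(e, f)` of the lattice `ℤ²`. -/
structure LatticeFrame where
  e0 : ℤ
  e1 : ℤ
  f0 : ℤ
  f1 : ℤ
  D : ℤ
  det_eq : e0 * f1 - e1 * f0 = D
  sq_eq : D * D = 1

namespace LatticeFrame

variable (L : LatticeFrame)

/-- The first coordinate of `γ - o`. -/
def i (o γ : Fin 2 →₀ ℕ) : ℤ := L.D * (((γ 0 : ℤ) - o 0) * L.f1 - ((γ 1 : ℤ) - o 1) * L.f0)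

/-- The second coordinate of `γ - o`. -/
def j (o γ : Fin 2 →₀ ℕ) : ℤ := L.D * (L.e0 * ((γ 1 : ℤ) - o 1) - L.e1 * ((γ 0 : ℤ) - o 0))

theorem zero_eq (o γ : Fin 2 →₀ ℕ) : (γ 0 : ℤ) - o 0 = L.i o γ * L.e0 + L.j o γ * L.f0 := by
  simp only [i, j]
  linear_combination (-((γ 0 : ℤ) - o 0)) * L.sq_eq - (L.D * ((γ 0 : ℤ) - o 0)) * L.det_eq

theorem one_eq (o γ : Fin 2 →₀ ℕ) : (γ 1 : ℤ) - o 1 = L.i o γ * L.e1 + L.j o γ * L.f1 := by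
  simp only [i, j]
  linear_combination (-((γ 1 : ℤ) - o 1)) * L.sq_eq - (L.D * ((γ 1 : ℤ) - o 1)) * L.det_eq

theorem i_eq_of {o γ : Fin 2 →₀ ℕ} {a b : ℤ} (h0 : (γ 0 : ℤ) - o 0 = a * L.e0 + b * L.f0)
    (h1 : (γ 1 : ℤ) - o 1 = a * L.e1 + b * L.f1) : L.i o γ = a := by
  rw [i, h0, h1]
  linear_combination (L.D * a) * L.det_eq + a * L.sq_eq

theorem j_eq_of {o γ : Fin 2 →₀ ℕ} {a b : ℤ} (h0 : (γ 0 : ℤ) - o 0 = a * L.e0 + b * L.f0)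
    (h1 : (γ 1 : ℤ) - o 1 = a * L.e1 + b * L.f1) : L.j o γ = b := by
  rw [j, h0, h1]
  linear_combination (L.D * b) * L.det_eq + b * L.sq_eq

theorem ext_of {o γ γ' : Fin 2 →₀ ℕ} (hi : L.i o γ = L.i o γ') (hj : L.j o γ = L.j o γ') :
    γ = γ' := by
  have h0 := L.zero_eq o γ
  have h1 := L.one_eq o γ
  rw [hi, hj] at h0 h1
  exact exponent_ext (by linarith [L.zero_eq o γ']) (by linarith [L.one_eq o γ'])

theorem cross_eq (o α β γ : Fin 2 →₀ ℕ) : cross α β γ =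
    L.D * ((L.i o β - L.i o α) * (L.j o γ - L.j o α) -
      (L.j o β - L.j o α) * (L.i o γ - L.i o α)) := by
  have a0 := L.zero_eq o α
  have a1 := L.one_eq o α
  have b0 := L.zero_eq o β
  have b1 := L.one_eq o β
  have c0 := L.zero_eq o γ
  have c1 := L.one_eq o γ
  rw [cross, show (β 0 : ℤ) - α 0 = (L.i o β - L.i o α) * L.e0 + (L.j o β - L.j o α) * L.f0 by
      linarith, show (β 1 : ℤ) - α 1 = (L.i o β - L.i o α) * L.e1 + (L.j o β - L.j o α) * L.f1 by
      linarith, show (γ 0 : ℤ) - α 0 = (L.i o γ - L.i o α) * L.e0 + (L.j o γ - L.j o α) * L.f0 by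
      linarith, show (γ 1 : ℤ) - α 1 = (L.i o γ - L.i o α) * L.e1 + (L.j o γ - L.j o α) * L.f1 by
      linarith, ← L.det_eq]
  ring

/-- The pairing of the first basis vector. -/
def pe (d : Fin 2 → ℝ) : ℝ := L.e0 * d 0 + L.e1 * d 1

/-- The pairing of the second basis vector. -/
def pf (d : Fin 2 → ℝ) : ℝ := L.f0 * d 0 + L.f1 * d 1

theorem pairing_eq (o γ : Fin 2 →₀ ℕ) (d : Fin 2 → ℝ) :
    pairing γ d = pairing o d + (L.i o γ * L.pe d + L.j o γ * L.pf d) := by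
  have h0 : (γ 0 : ℝ) - o 0 = L.i o γ * L.e0 + L.j o γ * L.f0 := by exact_mod_cast L.zero_eq o γ
  have h1 : (γ 1 : ℝ) - o 1 = L.i o γ * L.e1 + L.j o γ * L.f1 := by exact_mod_cast L.one_eq o γ
  rw [pairing, pairing, pe, pf]
  linear_combination (d 0) * h0 + (d 1) * h1

/-- The vector with given pairings with the basis. -/
def vec (a b : ℝ) : Fin 2 → ℝ :=
  ![L.D * (a * L.f1 - b * L.e1), L.D * (b * L.e0 - a * L.f0)]

theorem det_real : (L.e0 : ℝ) * L.f1 - L.e1 * L.f0 = L.D := by exact_mod_cast L.det_eq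

theorem sq_real : (L.D : ℝ) * L.D = 1 := by exact_mod_cast L.sq_eq

theorem pe_vec (a b : ℝ) : L.pe (L.vec a b) = a := by
  have h1 := L.det_real
  have h2 := L.sq_real
  simp only [pe, vec, Matrix.cons_val_zero, Matrix.cons_val_one]
  linear_combination (L.D * a) * h1 + a * h2

theorem pf_vec (a b : ℝ) : L.pf (L.vec a b) = b := by
  have h1 := L.det_real
  have h2 := L.sq_real
  simp only [pf, vec, Matrix.cons_val_zero, Matrix.cons_val_one]
  linear_combination (L.D * b) * h1 + b * h2

theorem pe_zero : L.pe 0 = 0 := by simp [pe]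
theorem pf_zero : L.pf 0 = 0 := by simp [pf]

theorem vec_ne_zero {a b : ℝ} (h : ¬ (a = 0 ∧ b = 0)) : L.vec a b ≠ 0 := by
  intro h0
  refine h ⟨?_, ?_⟩
  · rw [← L.pe_vec a b, h0, pe_zero]
  · rw [← L.pf_vec a b, h0, pf_zero]

theorem face_eq_faceOf (P : TropPoly) (o : Fin 2 →₀ ℕ) (v d : Fin 2 → ℝ) :
    P.face v d = faceOf (P.maxAt v) (L.i o) (L.j o) (L.pe d) (L.pf d) := by
  ext α
  rw [TropPoly.mem_face, mem_faceOf]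
  refine and_congr_right fun _ => forall₂_congr fun β _ => ?_
  rw [L.pairing_eq o β, L.pairing_eq o α, add_le_add_iff_left]

/-- The frame of a unimodular triangle. -/
def ofTriangle (α β γ : Fin 2 →₀ ℕ) (h : |cross α β γ| = 1) : LatticeFrame where
  e0 := (β 0 : ℤ) - α 0
  e1 := (β 1 : ℤ) - α 1
  f0 := (γ 0 : ℤ) - α 0
  f1 := (γ 1 : ℤ) - α 1
  D := cross α β γ
  det_eq := rfl
  sq_eq := by rw [← abs_mul_abs_self, h, one_mul]

theorem exists_ofPair {α β : Fin 2 →₀ ℕ} (h : latLen β α = 1) :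
    ∃ L : LatticeFrame, L.e0 = (β 0 : ℤ) - α 0 ∧ L.e1 = (β 1 : ℤ) - α 1 := by
  obtain ⟨s, t, hst⟩ := Int.isCoprime_iff_gcd_eq_one.2 h
  exact ⟨⟨_, _, -t, s, 1, by linear_combination hst, rfl⟩, rfl, rfl⟩

/-- The standard frame. -/
def std : LatticeFrame := ⟨1, 0, 0, 1, 1, rfl, rfl⟩

end LatticeFrame

section Faces

variable {ι : Type*} {M : Finset ι} {i j : ι → ℤ}

/-- Without ties the maximiser could not change while the functional is rotated through (1, 0), (0,
1), (-1, 0), (0, -1). One point would maximise two pairs of opposite functionals, so all points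
would coincide. -/
theorem exists_tie (hinj : ∀ α ∈ M, ∀ β ∈ M, i α = i β → j α = j β → α = β) (h2 : 2 ≤ M.card) :
    ∃ a b : ℝ, ¬ (a = 0 ∧ b = 0) ∧ 2 ≤ (faceOf M i j a b).card := by
  classical
  by_contra! hcon
  have hno : ∀ a b : ℝ, ¬ (a = 0 ∧ b = 0) → ¬ 2 ≤ (faceOf M i j a b).card :=
    fun a b h => not_le.2 (hcon a b (fun h0 h1 => h ⟨h0, h1⟩))
  have huniq : ∀ {a b : ℝ} {m : ι}, ¬ (a = 0 ∧ b = 0) → m ∈ faceOf M i j a b →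
      ∀ γ ∈ faceOf M i j a b, γ = m := by
    intro a b m hab hm γ hγ
    by_contra hne
    exact hno a b hab (Finset.one_lt_card.2 ⟨γ, hγ, m, hm, hne⟩)
  have hstep : ∀ {a b a' b' : ℝ} {m : ι}, ¬ (a = 0 ∧ b = 0) →
      (∀ s : ℝ, 0 < s → s < 1 → ¬ ((1 - s) * a + s * a' = 0 ∧ (1 - s) * b + s * b' = 0)) →
      m ∈ faceOf M i j a b → m ∈ faceOf M i j a' b' := by
    intro a b a' b' m hab hs hm
    refine mem_faceOf_of_segment hm (fun γ hγ => by rw [huniq hab hm γ hγ]) fun s h0 h1 => ?_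
    exact hno _ _ (hs s h0 h1)
  obtain ⟨m, hm, hmax⟩ := M.exists_max_image i (Finset.card_pos.1 (by omega))
  have h10 : m ∈ faceOf M i j 1 0 := by
    rw [mem_faceOf]
    refine ⟨hm, fun β hβ => ?_⟩
    have : (i β : ℝ) ≤ i m := by exact_mod_cast hmax β hβ
    linarith
  have h01 : m ∈ faceOf M i j 0 1 :=
    hstep (by simp) (fun s h0 h1 h => by linarith [h.1]) h10
  have hm10 : m ∈ faceOf M i j (-1) 0 :=
    hstep (by simp) (fun s h0 h1 h => by linarith [h.1]) h01
  have hm01 : m ∈ faceOf M i j 0 (-1) :=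
    hstep (by simp) (fun s h0 h1 h => by linarith [h.1]) hm10
  rw [mem_faceOf] at h10 h01 hm10 hm01
  obtain ⟨α, hα, hne⟩ := Finset.exists_mem_ne (by omega : 1 < M.card) m
  refine hne (hinj α hα m hm ?_ ?_)
  · have h3 := h10.2 α hα
    have h4 := hm10.2 α hα
    have : (i α : ℝ) = i m := by linarith
    exact_mod_cast this
  · have h3 := h01.2 α hα
    have h4 := hm01.2 α hα
    have : (j α : ℝ) = j m := by linarith
    exact_mod_cast this

end Faces

/-! ### Recovering the dual cells from the curve -/

namespace TropPoly

variable {P Q : TropPoly}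

theorem two_le_card_of_not_collinear {v : Fin 2 → ℝ}
    (h : ¬ Collinear ℝ (expVec '' (P.maxAt v : Set (Fin 2 →₀ ℕ)))) : 2 ≤ (P.maxAt v).card := by
  by_contra h2
  refine h ((collinear_expVec_iff _).2 fun α hα β hβ γ hγ => ?_)
  have h1 := Finset.card_le_one.1 (by omega : (P.maxAt v).card ≤ 1)
  rw [h1 β hβ α hα, h1 γ hγ α hα, cross]
  ring

/-- A tie in some direction d at v means that v + t d has a one-dimensional dual cell for small t,
and the closed edge through that point contains v. The curve is thereby determined by its edges. -/
theorem mem_curve_iff_exists_edge {v : Fin 2 → ℝ} : v ∈ P.curve ↔ ∃ e, P.IsEdge e ∧ v ∈ e := by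
  constructor
  · intro h
    obtain ⟨a, b, hab, hcard⟩ := exists_tie (M := P.maxAt v) (i := LatticeFrame.std.i 0)
      (j := LatticeFrame.std.j 0) (fun α _ β _ h1 h2 => LatticeFrame.std.ext_of h1 h2) h
    have hd := LatticeFrame.std.vec_ne_zero hab
    have hne : (P.maxAt v).Nonempty := Finset.card_pos.1 (lt_of_lt_of_le two_pos h)
    obtain ⟨t, ht⟩ := (eventually_maxAt_eq_face v (LatticeFrame.std.vec a b) hne).exists
    refine ⟨_, ⟨v + t • LatticeFrame.std.vec a b, ?_, ?_, rfl⟩, ?_⟩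
    · rw [ht, LatticeFrame.std.face_eq_faceOf _ 0, LatticeFrame.pe_vec, LatticeFrame.pf_vec]
      exact hcard
    · rw [collinear_expVec_iff, ht]
      exact cross_eq_zero_of_mem_face hd
    · change P.maxAt _ ⊆ P.maxAt v
      rw [ht]
      exact fun α hα => (mem_face.1 hα).1
  · rintro ⟨_, ⟨w, h2, -, rfl⟩, hv⟩
    exact h2.trans (Finset.card_le_card hv)

theorem curve_eq_of_isEdge_iff (h : ∀ e, Q.IsEdge e ↔ P.IsEdge e) : Q.curve = P.curve := by
  ext v
  simp only [mem_curve_iff_exists_edge, h]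

/-- A tie in direction d says that v + t d is on the curve for small t > 0, which involves the curve
only as a set. -/
theorem two_le_card_face_iff (h : Q.curve = P.curve) {v d : Fin 2 → ℝ} (hQ : (Q.maxAt v).Nonempty)
    (hP : (P.maxAt v).Nonempty) : 2 ≤ (Q.face v d).card ↔ 2 ≤ (P.face v d).card := by
  obtain ⟨t, ht, ht'⟩ := ((eventually_maxAt_eq_face v d hQ).and
    (eventually_maxAt_eq_face v d hP)).exists
  rw [← ht, ← ht', ← mem_curve, ← mem_curve, h]

theorem two_le_card_faceOf_pair {ι : Type*} [DecidableEq ι] {M : Finset ι} {i j : ι → ℤ} {m n : ι}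
    (hM : M = {m, n}) (hne : m ≠ n) (hi : i n = i m + 1) (hj : j n = j m) (a b : ℝ) :
    2 ≤ (faceOf M i j a b).card ↔ a = 0 := by
  have hval : i n * a + j n * b = (i m * a + j m * b) + a := by
    rw [hi, hj]; push_cast; ring
  constructor
  · intro h
    obtain ⟨α, hα, β, hβ, hαβ⟩ := Finset.one_lt_card.1 h
    rw [mem_faceOf] at hα hβ
    have h1 := hα.2 β hβ.1
    have h2 := hβ.2 α hα.1
    have h3 := hα.1
    have h4 := hβ.1
    rw [hM, Finset.mem_insert, Finset.mem_singleton] at h3 h4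
    rcases h3 with rfl | rfl <;> rcases h4 with rfl | rfl <;> first | exact absurd rfl hαβ | linarith
  · intro h
    refine Finset.one_lt_card.2 ⟨m, ?_, n, ?_, hne⟩ <;> rw [mem_faceOf, hM] <;>
      refine ⟨by simp, fun β hβ => ?_⟩ <;> rw [Finset.mem_insert, Finset.mem_singleton] at hβ <;>
      rcases hβ with rfl | rfl <;> linarith

theorem two_le_card_faceOf_triangle {ι : Type*} [DecidableEq ι] {M : Finset ι} {i j : ι → ℤ}
    {l m n : ι} (hM : M = {l, m, n}) (hi : i m = i l + 1) (hj : j m = j l) (hi' : i n = i l)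
    (hj' : j n = j l + 1) (a b : ℝ) : 2 ≤ (faceOf M i j a b).card ↔
      (a = 0 ∧ b ≤ 0) ∨ (b = 0 ∧ a ≤ 0) ∨ (a = b ∧ 0 ≤ a) := by
  have hm : i m * a + j m * b = (i l * a + j l * b) + a := by
    rw [hi, hj]; push_cast; ring
  have hn : i n * a + j n * b = (i l * a + j l * b) + b := by
    rw [hi', hj']; push_cast; ring
  have hlm : l ≠ m := by rintro rfl; omega
  have hln : l ≠ n := by rintro rfl; omega
  have hmn : m ≠ n := by rintro rfl; omega
  have hmem : ∀ α, α ∈ faceOf M i j a b ↔ (α = l ∨ α = m ∨ α = n) ∧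
      i l * a + j l * b ≤ i α * a + j α * b ∧ i m * a + j m * b ≤ i α * a + j α * b ∧
      i n * a + j n * b ≤ i α * a + j α * b := by
    intro α
    rw [mem_faceOf, hM]
    simp
  constructor
  · intro h
    obtain ⟨α, hα, β, hβ, hαβ⟩ := Finset.one_lt_card.1 h
    rw [hmem] at hα hβ
    obtain ⟨h1, h2, h3, h4⟩ := hα
    obtain ⟨h5, h6, h7, h8⟩ := hβ
    rcases h1 with rfl | rfl | rfl <;> rcases h5 with rfl | rfl | rfl
    · exact absurd rfl hαβ
    · exact Or.inl ⟨by linarith, by linarith⟩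
    · exact Or.inr (Or.inl ⟨by linarith, by linarith⟩)
    · exact Or.inl ⟨by linarith, by linarith⟩
    · exact absurd rfl hαβ
    · exact Or.inr (Or.inr ⟨by linarith, by linarith⟩)
    · exact Or.inr (Or.inl ⟨by linarith, by linarith⟩)
    · exact Or.inr (Or.inr ⟨by linarith, by linarith⟩)
    · exact absurd rfl hαβ
  · rintro (⟨h1, h2⟩ | ⟨h1, h2⟩ | ⟨h1, h2⟩)
    · refine Finset.one_lt_card.2 ⟨l, ?_, m, ?_, hlm⟩ <;> rw [hmem] <;>
        refine ⟨by simp, ?_, ?_, ?_⟩ <;> linarith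
    · refine Finset.one_lt_card.2 ⟨l, ?_, n, ?_, hln⟩ <;> rw [hmem] <;>
        refine ⟨by simp, ?_, ?_, ?_⟩ <;> linarith
    · refine Finset.one_lt_card.2 ⟨m, ?_, n, ?_, hmn⟩ <;> rw [hmem] <;>
        refine ⟨by simp, ?_, ?_, ?_⟩ <;> linarith

/-- Non-singularity only depends on the tropical curve and on its weights. -/
theorem Nonsingular.transfer (hP : P.Nonsingular) (he : ∀ e, Q.IsEdge e ↔ P.IsEdge e)
    (hw : ∀ e, P.IsEdge e → Q.weight e = P.weight e) : Q.Nonsingular := by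
  classical
  have hQ : Q.UnitWeights := fun e h => by
    rw [hw e ((he e).1 h), hP.2 e ((he e).1 h)]
  refine ⟨fun v hv => ?_, hQ⟩
  have hcurve := curve_eq_of_isEdge_iff he
  have hQ2 := two_le_card_of_not_collinear hv
  have hP2 : 2 ≤ (P.maxAt v).card := by rw [← mem_curve, ← hcurve]; exact hQ2
  have hQne := Finset.card_pos.1 (lt_of_lt_of_le two_pos hQ2)
  have hPne := Finset.card_pos.1 (lt_of_lt_of_le two_pos hP2)
  -- The dual cells of P and Q at v have ties for the same functionals, in any lattice coordinates.
  have key : ∀ (L : LatticeFrame) (o : Fin 2 →₀ ℕ) (a b : ℝ),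
      2 ≤ (faceOf (Q.maxAt v) (L.i o) (L.j o) a b).card ↔
      2 ≤ (faceOf (P.maxAt v) (L.i o) (L.j o) a b).card := by
    intro L o a b
    have := two_le_card_face_iff hcurve (d := L.vec a b) hQne hPne
    rwa [L.face_eq_faceOf Q o, L.face_eq_faceOf P o, L.pe_vec, L.pf_vec] at this
  rcases hP.maxAt_cases hP2 with ⟨α, β, hne, hM, hlen⟩ | ⟨α, β, γ, hM, hcr⟩
  -- If the cell of P is a segment, the ties force the cell of Q to have constant height, contrary
  -- to its being two-dimensional.
  · exfalso
    obtain ⟨L, hL0, hL1⟩ := LatticeFrame.exists_ofPair (α := β) (β := α) hlen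
    refine hv ((collinear_expVec_iff _).2 fun a ha b hb c hc => ?_)
    have hj := height_eq_of_ties_segment (M := Q.maxAt v) (i := L.i β) (j := L.j β)
      fun a b _ => by
        rw [key]
        refine two_le_card_faceOf_pair (by rw [hM, Finset.pair_comm]) hne.symm ?_ ?_ a b
        · rw [L.i_eq_of (o := β) (γ := α) (a := 1) (b := 0) (by rw [hL0]; ring)
            (by rw [hL1]; ring), L.i_eq_of (o := β) (γ := β) (a := 0) (b := 0) (by ring) (by ring)]
          rfl
        · rw [L.j_eq_of (o := β) (γ := α) (a := 1) (b := 0) (by rw [hL0]; ring)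
            (by rw [hL1]; ring), L.j_eq_of (o := β) (γ := β) (a := 0) (b := 0) (by ring) (by ring)]
    rw [L.cross_eq β, hj c hc a ha, hj b hb a ha]
    ring
  · set L := LatticeFrame.ofTriangle α β γ hcr with hL
    have e0 : L.e0 = (β 0 : ℤ) - α 0 := rfl
    have e1 : L.e1 = (β 1 : ℤ) - α 1 := rfl
    have f0 : L.f0 = (γ 0 : ℤ) - α 0 := rfl
    have f1 : L.f1 = (γ 1 : ℤ) - α 1 := rfl
    have hiα := L.i_eq_of (o := α) (γ := α) (a := 0) (b := 0) (by ring) (by ring)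
    have hjα := L.j_eq_of (o := α) (γ := α) (a := 0) (b := 0) (by ring) (by ring)
    have hiβ := L.i_eq_of (o := α) (γ := β) (a := 1) (b := 0) (by rw [e0]; ring) (by rw [e1]; ring)
    have hjβ := L.j_eq_of (o := α) (γ := β) (a := 1) (b := 0) (by rw [e0]; ring) (by rw [e1]; ring)
    have hiγ := L.i_eq_of (o := α) (γ := γ) (a := 0) (b := 1) (by rw [f0]; ring) (by rw [f1]; ring)
    have hjγ := L.j_eq_of (o := α) (γ := γ) (a := 0) (b := 1) (by rw [f0]; ring) (by rw [f1]; ring)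
    obtain ⟨μ, hμ, ν, hν, ξ, hξ, hall, h1, h2, h3, h4⟩ :=
      eq_triangle_of_ties (M := Q.maxAt v) (i := L.i α) (j := L.j α)
        (fun _ _ _ _ h h' => L.ext_of h h')
        (fun a b _ => by
          rw [key]
          exact two_le_card_faceOf_triangle hM (by rw [hiα, hiβ]; rfl) (by rw [hjα, hjβ])
            (by rw [hiα, hiγ]) (by rw [hjα, hjγ]; rfl) a b)
        (fun a b hab hc => by
          have hface := L.face_eq_faceOf Q α v (L.vec a b)
          rw [L.pe_vec, L.pf_vec] at hface
          rw [← hface] at hc ⊢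
          obtain ⟨m, n, -, hmn, hlen⟩ := hQ.face_eq_pair (L.vec_ne_zero hab) hc
          refine ⟨m, n, hmn, ?_⟩
          -- Primitivity of a side is carried over to the frame coordinates by transforming the
          -- Bézout coefficients.
          obtain ⟨s, t, hst⟩ := Int.isCoprime_iff_gcd_eq_one.2 hlen
          rw [← Int.isCoprime_iff_gcd_eq_one]
          have m0 := L.zero_eq α m
          have m1 := L.one_eq α m
          have n0 := L.zero_eq α n
          have n1 := L.one_eq α n
          refine ⟨s * L.e0 + t * L.e1, s * L.f0 + t * L.f1, ?_⟩
          rw [← hst]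
          linear_combination (-s) * (m0 - n0) - t * (m1 - n1))
    refine ⟨μ, ν, ξ, ?_, ?_⟩
    · ext δ
      simp only [Finset.mem_coe, Set.mem_insert_iff, Set.mem_singleton_iff]
      exact ⟨hall δ, by rintro (rfl | rfl | rfl) <;> assumption⟩
    · rw [triangleArea_eq_half_iff, L.cross_eq α, h1, h2, h3, h4]
      have : |L.D| = 1 := hcr
      rw [abs_mul, this]
      simp

end TropPoly
end

noncomputable section
open Filter Topology

/-! ### Charts around bounded edges -/

theorem abs_cross_eq_one_of_mem {a b c α β γ : Fin 2 →₀ ℕ} (h : |cross a b c| = 1)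
    (hα : α = a ∨ α = b ∨ α = c) (hβ : β = a ∨ β = b ∨ β = c) (hγ : γ = a ∨ γ = b ∨ γ = c)
    (h0 : cross α β γ ≠ 0) : |cross α β γ| = 1 := by
  have key : cross α β γ = 0 ∨ cross α β γ = cross a b c ∨ cross α β γ = -cross a b c := by
    rcases hα with rfl | rfl | rfl <;> rcases hβ with rfl | rfl | rfl <;>
      rcases hγ with rfl | rfl | rfl <;> unfold cross <;>
      first | (left; ring1) | (right; left; ring1) | (right; right; ring1)
  rcases key with h1 | h1 | h1
  · exact absurd h1 h0
  · rw [h1, h]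
  · rw [h1, abs_neg, h]

theorem cross_self_left (α β : Fin 2 →₀ ℕ) : cross α β α = 0 := by simp only [cross]; ring
theorem cross_self_right (α β : Fin 2 →₀ ℕ) : cross α β β = 0 := by simp only [cross]; ring
theorem cross_self_fst (α β : Fin 2 →₀ ℕ) : cross α α β = 0 := by simp only [cross]; ring
theorem cross_swap (α β γ : Fin 2 →₀ ℕ) : cross β α γ = -cross α β γ := by simp only [cross]; ring

namespace TropPoly

variable {Q : TropPoly}

theorem Nonsingular.maxAt_eq_triangle (hQ : Q.Nonsingular) {v : Fin 2 → ℝ} {α β γ : Fin 2 →₀ ℕ}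
    (hα : α ∈ Q.maxAt v) (hβ : β ∈ Q.maxAt v) (hγ : γ ∈ Q.maxAt v) (h0 : cross α β γ ≠ 0) :
    Q.maxAt v = {α, β, γ} ∧ |cross α β γ| = 1 := by
  have hαβ : α ≠ β := by rintro rfl; exact h0 (cross_self_fst _ _)
  have hαγ : α ≠ γ := by rintro rfl; exact h0 (cross_self_left _ _)
  have hβγ : β ≠ γ := by rintro rfl; exact h0 (cross_self_right _ _)
  have hsub : ({α, β, γ} : Finset (Fin 2 →₀ ℕ)) ⊆ Q.maxAt v := by
    intro δ hδ
    simp only [Finset.mem_insert, Finset.mem_singleton] at hδ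
    rcases hδ with rfl | rfl | rfl <;> assumption
  have hcard : ({α, β, γ} : Finset (Fin 2 →₀ ℕ)).card = 3 := Finset.card_eq_three.2
    ⟨α, β, γ, hαβ, hαγ, hβγ, rfl⟩
  have h3 := Finset.card_le_card hsub
  rw [hcard] at h3
  rcases hQ.maxAt_cases (v := v) (by omega) with ⟨a, b, hab, hM, -⟩ | ⟨a, b, c, hM, hcr⟩
  · rw [hM, Finset.card_pair hab] at h3; omega
  · refine ⟨(Finset.eq_of_subset_of_card_le hsub ?_).symm, ?_⟩
    · rw [hcard, hM]; exact Finset.card_le_three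
    · rw [hM] at hα hβ hγ
      simp only [Finset.mem_insert, Finset.mem_singleton] at hα hβ hγ
      exact abs_cross_eq_one_of_mem hcr hα hβ hγ h0

/-- An edge is the set of points where its two dual exponents are maximal. -/
theorem Nonsingular.isEdge_iff (hQ : Q.Nonsingular) {e : Set (Fin 2 → ℝ)} :
    Q.IsEdge e ↔ ∃ v α β, α ≠ β ∧ Q.maxAt v = {α, β} ∧ latLen α β = 1 ∧ Q.dual e = {α, β} ∧
      e = {w | α ∈ Q.maxAt w ∧ β ∈ Q.maxAt w} := by
  have hset : ∀ v α β, Q.maxAt v = {α, β} →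
      {w | Q.maxAt v ⊆ Q.maxAt w} = {w | α ∈ Q.maxAt w ∧ β ∈ Q.maxAt w} := by
    intro v α β h
    ext w
    rw [Set.mem_ofPred_eq, Set.mem_ofPred_eq, h]
    simp [Finset.insert_subset_iff]
  constructor
  · rintro ⟨v, h2, hc, rfl⟩
    obtain ⟨α, β, hne, hM, hl⟩ := UnitWeights.maxAt_eq_pair hQ.2 h2 hc
    exact ⟨v, α, β, hne, hM, hl, by rw [dual_eq_maxAt, hM], hset v α β hM⟩
  · rintro ⟨v, α, β, hne, hM, -, -, rfl⟩
    refine ⟨v, by rw [hM, Finset.card_pair hne], ?_, (hset v α β hM).symm⟩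
    rw [hM, Finset.coe_pair, Set.image_pair]
    exact collinear_pair _ _ _

/-- From v one moves along the edge. Either a monomial on the positive side of the line through α
and β catches up, and the first to do so spans a unimodular triangle with α and β, or the edge
contains a ray and is unbounded. Both ends are obtained by exchanging α and β. -/
theorem Nonsingular.exists_vertex (hQ : Q.Nonsingular) {v : Fin 2 → ℝ} {α β : Fin 2 →₀ ℕ}
    (hne : α ≠ β) (hM : Q.maxAt v = {α, β})
    (hb : Bornology.IsBounded {w | α ∈ Q.maxAt w ∧ β ∈ Q.maxAt w}) :
    ∃ w γ, Q.maxAt w = {α, β, γ} ∧ cross α β γ = 1 := by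
  have hα : α ∈ Q.maxAt v := by rw [hM]; simp
  have hβ : β ∈ Q.maxAt v := by rw [hM]; simp
  -- The dual edge turned by a right angle. Along n the monomial γ gains on α at the rate `cross α β
  -- γ`.
  set n : Fin 2 → ℝ := ![-((β 1 : ℝ) - α 1), (β 0 : ℝ) - α 0] with hn
  have hpair : ∀ γ, pairing γ n = pairing α n + cross α β γ := by
    intro γ
    simp only [pairing, hn, cross, Matrix.cons_val_zero, Matrix.cons_val_one]
    push_cast
    ring
  have hterm : ∀ γ (t : ℝ), Q.term γ (v + t • n) = Q.term γ v + t * pairing α n + t * cross α β γ := by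
    intro γ t
    rw [term_add_smul, hpair]; ring
  have hαt : ∀ t : ℝ, Q.term α (v + t • n) = Q.term α v + t * pairing α n := by
    intro t; rw [term_add_smul]
  have hβt : ∀ t : ℝ, Q.term β (v + t • n) = Q.term α v + t * pairing α n := by
    intro t; rw [hterm, cross_self_right, term_eq_of_mem hα hβ]; simp
  by_cases hS : (Q.supp.filter fun γ => 0 < cross α β γ).Nonempty
  · obtain ⟨γ, hγ, hmin⟩ := Finset.exists_min_image _
      (fun γ => (Q.term α v - Q.term γ v) / cross α β γ) hS
    rw [Finset.mem_filter] at hγ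
    have hcγ : (0 : ℝ) < cross α β γ := by exact_mod_cast hγ.2
    -- The first time at which a monomial on the positive side reaches the common value of α and β.
    set t := (Q.term α v - Q.term γ v) / cross α β γ with ht
    have ht0 : 0 ≤ t := div_nonneg (sub_nonneg.2 ((mem_maxAt.1 hα).2 γ hγ.1)) hcγ.le
    have hγt : Q.term γ (v + t • n) = Q.term α v + t * pairing α n := by
      rw [hterm, ht, div_mul_cancel₀ _ hcγ.ne']; ring
    have hmax : ∀ δ ∈ Q.supp, Q.term δ (v + t • n) ≤ Q.term α v + t * pairing α n := by
      intro δ hδ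
      rw [hterm]
      have h1 := (mem_maxAt.1 hα).2 δ hδ
      by_cases hc : 0 < cross α β δ
      · have hcδ : (0 : ℝ) < cross α β δ := by exact_mod_cast hc
        have h2 := hmin δ (Finset.mem_filter.2 ⟨hδ, hc⟩)
        rw [le_div_iff₀ hcδ] at h2
        linarith
      · have hcδ : (cross α β δ : ℝ) ≤ 0 := by exact_mod_cast not_lt.1 hc
        have := mul_nonpos_of_nonneg_of_nonpos ht0 hcδ
        linarith
    have hmem : ∀ δ ∈ Q.supp, Q.term δ (v + t • n) = Q.term α v + t * pairing α n →
        δ ∈ Q.maxAt (v + t • n) := by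
      intro δ hδ h1
      rw [mem_maxAt]
      exact ⟨hδ, fun η hη => by rw [h1]; exact hmax η hη⟩
    have h0 : cross α β γ ≠ 0 := hγ.2.ne'
    obtain ⟨h1, h2⟩ := hQ.maxAt_eq_triangle (hmem α (mem_maxAt.1 hα).1 (hαt t))
      (hmem β (mem_maxAt.1 hβ).1 (hβt t)) (hmem γ hγ.1 hγt) h0
    exact ⟨_, γ, h1, by rwa [abs_of_pos hγ.2] at h2⟩
  · exfalso
    rw [Finset.not_nonempty_iff_eq_empty, Finset.filter_eq_empty_iff] at hS
    have hmem : ∀ t : ℝ, 0 ≤ t → v + t • n ∈ {w | α ∈ Q.maxAt w ∧ β ∈ Q.maxAt w} := by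
      intro t ht
      have hmax : ∀ δ ∈ Q.supp, Q.term δ (v + t • n) ≤ Q.term α v + t * pairing α n := by
        intro δ hδ
        rw [hterm]
        have h1 := (mem_maxAt.1 hα).2 δ hδ
        have hcδ : (cross α β δ : ℝ) ≤ 0 := by exact_mod_cast not_lt.1 (hS hδ)
        have := mul_nonpos_of_nonneg_of_nonpos ht hcδ
        linarith
      refine ⟨mem_maxAt.2 ⟨(mem_maxAt.1 hα).1, fun δ hδ => ?_⟩,
        mem_maxAt.2 ⟨(mem_maxAt.1 hβ).1, fun δ hδ => ?_⟩⟩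
      · rw [hαt]; exact hmax δ hδ
      · rw [hβt]; exact hmax δ hδ
    obtain ⟨C, hC⟩ := hb.exists_norm_le
    have hn0 : ∃ l, n l ≠ 0 := by
      by_contra! h
      have h0 : -((β 1 : ℝ) - α 1) = 0 := h 0
      have h1 : (β 0 : ℝ) - α 0 = 0 := h 1
      refine hne (exponent_ext ?_ ?_)
      · have : (α 0 : ℝ) = β 0 := by linarith
        exact_mod_cast this
      · have : (α 1 : ℝ) = β 1 := by linarith
        exact_mod_cast this
    obtain ⟨l, hl⟩ := hn0
    have hl' : 0 < |n l| := abs_pos.2 hl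
    have hC0 : 0 ≤ C := (norm_nonneg _).trans (hC _ (hmem 0 le_rfl))
    have ht : 0 ≤ (C + |v l| + 1) / |n l| := by positivity
    have h1 := (norm_le_pi_norm _ l).trans (hC _ (hmem _ ht))
    rw [Real.norm_eq_abs] at h1
    have h2 : |((C + |v l| + 1) / |n l|) * n l| = C + |v l| + 1 := by
      rw [abs_mul, abs_div, abs_abs, div_mul_cancel₀ _ hl'.ne', abs_of_nonneg (by positivity)]
    have h3 := abs_sub_abs_le_abs_sub (((C + |v l| + 1) / |n l|) * n l) (-v l)
    rw [sub_neg_eq_add, abs_neg, h2, add_comm _ (v l)] at h3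
    have h4 : (v + ((C + |v l| + 1) / |n l|) • n) l = v l + ((C + |v l| + 1) / |n l|) * n l := rfl
    rw [h4] at h1
    linarith

end TropPoly

/-- The lattice and the two vertices adapted to a bounded edge. -/
structure EdgeChart (Q : TropPoly) (e : Set (Fin 2 → ℝ)) where
  L : LatticeFrame
  k : ℤ
  α0 : Fin 2 →₀ ℕ
  α1 : Fin 2 →₀ ℕ
  α2 : Fin 2 →₀ ℕ
  α3 : Fin 2 →₀ ℕ
  v1 : Fin 2 → ℝ
  v2 : Fin 2 → ℝ
  i1 : L.i α0 α1 = 1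
  j1 : L.j α0 α1 = 0
  i2 : L.i α0 α2 = 0
  j2 : L.j α0 α2 = 1
  i3 : L.i α0 α3 = k
  j3 : L.j α0 α3 = -1
  max1 : Q.maxAt v1 = {α0, α1, α2}
  max2 : Q.maxAt v2 = {α0, α1, α3}
  mem_iff : ∀ w, w ∈ e ↔ α0 ∈ Q.maxAt w ∧ α1 ∈ Q.maxAt w
  dual_eq : Q.dual e = {α0, α1}

theorem LatticeFrame.i_self (L : LatticeFrame) (o : Fin 2 →₀ ℕ) : L.i o o = 0 :=
  L.i_eq_of (b := 0) (by ring) (by ring)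

theorem LatticeFrame.j_self (L : LatticeFrame) (o : Fin 2 →₀ ℕ) : L.j o o = 0 :=
  L.j_eq_of (a := 0) (by ring) (by ring)

/-- The frame has origin α and is spanned by the triangle at one end. The triangle at the other end
has the opposite orientation, so its third vertex has second coordinate -1, while its first
coordinate k is arbitrary. Either endpoint of the dual edge may be taken as origin. -/
theorem exists_edgeChart {Q : TropPoly} (hQ : Q.Nonsingular) {e : Set (Fin 2 → ℝ)}
    (he : Q.IsEdge e) (hb : Bornology.IsBounded e) {α : Fin 2 →₀ ℕ} (hα : α ∈ Q.dual e) :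
    ∃ C : EdgeChart Q e, C.α0 = α := by
  obtain ⟨v, α, β, hne, hM, hd, rfl, rfl⟩ : ∃ v β γ, β ≠ γ ∧ Q.maxAt v = {β, γ} ∧
      Q.dual e = {β, γ} ∧ e = {w | β ∈ Q.maxAt w ∧ γ ∈ Q.maxAt w} ∧ β = α := by
    obtain ⟨v, β, γ, hne, hM, -, hd, h⟩ := hQ.isEdge_iff.1 he
    rw [hd, Finset.mem_insert, Finset.mem_singleton] at hα
    rcases hα with rfl | rfl
    · exact ⟨v, _, γ, hne, hM, hd, h, rfl⟩
    · refine ⟨v, _, β, hne.symm, by rw [hM, Finset.pair_comm], by rw [hd, Finset.pair_comm], ?_, rfl⟩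
      rw [h]; ext w; exact and_comm
  obtain ⟨v1, α2, hM1, hc1⟩ := hQ.exists_vertex hne hM hb
  obtain ⟨v2, α3, hM2, hc2⟩ := hQ.exists_vertex (v := v) hne.symm (by rw [hM, Finset.pair_comm])
    (by simpa only [and_comm] using hb)
  have hc1' : |cross α β α2| = 1 := by rw [hc1]; rfl
  have hj2 := (LatticeFrame.ofTriangle α β α2 hc1').cross_eq α α β α3
  have hi1 := (LatticeFrame.ofTriangle α β α2 hc1').i_eq_of (o := α) (γ := β) (a := 1) (b := 0)
    (by rw [LatticeFrame.ofTriangle]; ring) (by rw [LatticeFrame.ofTriangle]; ring)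
  have hj1 := (LatticeFrame.ofTriangle α β α2 hc1').j_eq_of (o := α) (γ := β) (a := 1) (b := 0)
    (by rw [LatticeFrame.ofTriangle]; ring) (by rw [LatticeFrame.ofTriangle]; ring)
  refine ⟨⟨LatticeFrame.ofTriangle α β α2 hc1', _, α, β, α2, α3, v1, v2, hi1, hj1, ?_, ?_, rfl, ?_,
    hM1, ?_, fun w => Iff.rfl, hd⟩, rfl⟩
  · exact LatticeFrame.i_eq_of _ (b := 1) (by rw [LatticeFrame.ofTriangle]; ring)
      (by rw [LatticeFrame.ofTriangle]; ring)
  · exact LatticeFrame.j_eq_of _ (a := 0) (by rw [LatticeFrame.ofTriangle]; ring)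
      (by rw [LatticeFrame.ofTriangle]; ring)
  · rw [hi1, hj1, LatticeFrame.i_self, LatticeFrame.j_self,
      show (LatticeFrame.ofTriangle α β α2 hc1').D = 1 from hc1] at hj2
    rw [cross_swap] at hc2
    linarith
  · rw [hM2]; exact Finset.insert_comm _ _ _

namespace EdgeChart

variable {Q : TropPoly} {e : Set (Fin 2 → ℝ)} (C : EdgeChart Q e)

theorem ne01 : C.α0 ≠ C.α1 := fun h => by
  have := C.i1; rw [← h, LatticeFrame.i_self] at this; omega
theorem ne02 : C.α0 ≠ C.α2 := fun h => by
  have := C.j2; rw [← h, LatticeFrame.j_self] at this; omega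
theorem ne03 : C.α0 ≠ C.α3 := fun h => by
  have := C.j3; rw [← h, LatticeFrame.j_self] at this; omega
theorem ne12 : C.α1 ≠ C.α2 := fun h => by
  have := C.j2; rw [← h, C.j1] at this; omega
theorem ne13 : C.α1 ≠ C.α3 := fun h => by
  have := C.j3; rw [← h, C.j1] at this; omega
theorem ne23 : C.α2 ≠ C.α3 := fun h => by
  have := C.j3; rw [← h, C.j2] at this; omega

theorem mem01 : C.α0 ∈ Q.maxAt C.v1 := by rw [C.max1]; simp
theorem mem11 : C.α1 ∈ Q.maxAt C.v1 := by rw [C.max1]; simp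
theorem mem21 : C.α2 ∈ Q.maxAt C.v1 := by rw [C.max1]; simp
theorem mem02 : C.α0 ∈ Q.maxAt C.v2 := by rw [C.max2]; simp
theorem mem12 : C.α1 ∈ Q.maxAt C.v2 := by rw [C.max2]; simp
theorem mem32 : C.α3 ∈ Q.maxAt C.v2 := by rw [C.max2]; simp

theorem v1_mem : C.v1 ∈ e := (C.mem_iff _).2 ⟨C.mem01, C.mem11⟩
theorem v2_mem : C.v2 ∈ e := (C.mem_iff _).2 ⟨C.mem02, C.mem12⟩

theorem mem_supp0 : C.α0 ∈ Q.supp := (TropPoly.mem_maxAt.1 C.mem01).1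
theorem mem_supp1 : C.α1 ∈ Q.supp := (TropPoly.mem_maxAt.1 C.mem11).1
theorem mem_supp2 : C.α2 ∈ Q.supp := (TropPoly.mem_maxAt.1 C.mem21).1
theorem mem_supp3 : C.α3 ∈ Q.supp := (TropPoly.mem_maxAt.1 C.mem32).1

theorem term2_v2_lt : Q.term C.α2 C.v2 < Q.term C.α0 C.v2 :=
  TropPoly.term_lt_of_notMem C.mem02 C.mem_supp2 (by
    rw [C.max2]; simp [C.ne02.symm, C.ne12.symm, C.ne23])

end EdgeChart

/-! ### The edge in the relative interior of the other edge -/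

theorem LatticeFrame.term_sub_eq (L : LatticeFrame) (Q : TropPoly) (o γ : Fin 2 →₀ ℕ)
    (v : Fin 2 → ℝ) : Q.term γ v - Q.term o v =
      Q.coeff γ - Q.coeff o + (L.i o γ * L.pe v + L.j o γ * L.pf v) := by
  rw [TropPoly.term_eq, TropPoly.term_eq, L.pairing_eq o γ]; ring

theorem term_mul_eq_of_smul {Q : TropPoly} {β γ : Fin 2 →₀ ℕ} (v w : Fin 2 → ℝ) (t : ℝ) :
    Q.term γ (v + t • (w - v)) - Q.term β (v + t • (w - v)) =
      (1 - t) * (Q.term γ v - Q.term β v) + t * (Q.term γ w - Q.term β w) := by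
  rw [TropPoly.term_add_smul, TropPoly.term_add_smul, TropPoly.term_eq, TropPoly.term_eq,
    TropPoly.term_eq, TropPoly.term_eq]
  simp only [pairing, Pi.sub_apply]
  ring

/-- A segment of s that ends at a relative interior point can be prolonged a little beyond it. -/
theorem exists_neg_of_mem_intrinsicInterior {s : Set (Fin 2 → ℝ)} {v w : Fin 2 → ℝ}
    (hv : v ∈ intrinsicInterior ℝ s) (hw : w ∈ s) : ∃ t : ℝ, t < 0 ∧ v + t • (w - v) ∈ s := by
  obtain ⟨y, hy, rfl⟩ := mem_intrinsicInterior.1 hv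
  have hw' : w ∈ affineSpan ℝ s := subset_affineSpan ℝ s hw
  have hmem : ∀ t : ℝ, (y : Fin 2 → ℝ) + t • (w - y) ∈ affineSpan ℝ s := by
    intro t
    have := AffineMap.lineMap_mem t y.2 hw'
    rw [AffineMap.lineMap_apply, vsub_eq_sub, vadd_eq_add, add_comm] at this
    exact this
  let f : ℝ → affineSpan ℝ s := fun t => ⟨_, hmem t⟩
  have hf : Continuous f := by
    refine Continuous.subtype_mk ?_ _
    fun_prop
  have hf0 : f 0 = y := Subtype.ext (by simp [f])
  have h1 : ∀ᶠ t in 𝓝 (0 : ℝ), f t ∈ ((↑) ⁻¹' s : Set (affineSpan ℝ s)) := by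
    refine (hf.tendsto 0).eventually ?_
    rw [hf0]
    exact mem_interior_iff_mem_nhds.1 hy
  obtain ⟨t, ht, ht0⟩ := ((h1.filter_mono nhdsWithin_le_nhds).and
    (self_mem_nhdsWithin (s := Set.Iio (0 : ℝ)))).exists
  exact ⟨t, ht0, ht⟩

/-- The dual cell of a point in the relative interior of an edge. -/
theorem TropPoly.maxAt_eq_of_mem_intrinsicInterior {Q : TropPoly} {e : Set (Fin 2 → ℝ)}
    {x v : Fin 2 → ℝ} (he : e = {w | Q.maxAt x ⊆ Q.maxAt w}) (hx : (Q.maxAt x).Nonempty)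
    (hv : v ∈ intrinsicInterior ℝ e) : Q.maxAt v = Q.maxAt x := by
  have hve : v ∈ e := intrinsicInterior_subset hv
  have hxe : x ∈ e := by rw [he]; exact Finset.Subset.refl _
  -- A monomial maximal at v but not at x would exceed the maximum beyond v on the prolonged
  -- segment, as differences of monomials are affine.
  obtain ⟨t, ht, htm⟩ := exists_neg_of_mem_intrinsicInterior hv hxe
  rw [he] at hve htm
  refine Finset.Subset.antisymm (fun γ hγ => ?_) hve
  obtain ⟨β, hβ⟩ := hx
  by_contra hcon
  have h1 := TropPoly.term_lt_of_notMem hβ (TropPoly.mem_maxAt.1 hγ).1 hcon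
  have h2 := (TropPoly.mem_maxAt.1 (htm hβ)).2 γ (TropPoly.mem_maxAt.1 hγ).1
  have h3 := TropPoly.term_eq_of_mem (hve hβ) hγ
  have h4 := term_mul_eq_of_smul (Q := Q) (β := β) (γ := γ) v x t
  rw [h3, sub_self, mul_zero, zero_add] at h4
  have h5 : 0 < t * (Q.term γ x - Q.term β x) := mul_pos_of_neg_of_neg ht (by linarith)
  linarith

/-- The edge `e'` and the edge of the chart are parallel, with the labelling of the endpoints of
the dual edge of `e'` chosen accordingly. -/
structure EdgeChart.Aligned {Q : TropPoly} {e : Set (Fin 2 → ℝ)} (C : EdgeChart Q e)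
    (Q' : TropPoly) (e' : Set (Fin 2 → ℝ)) (β0 β1 : Fin 2 →₀ ℕ) : Prop where
  i1 : C.L.i β0 β1 = 1
  j1 : C.L.j β0 β1 = 0
  dual_eq : Q'.dual e' = {β0, β1}
  maxAt_eq : ∀ v ∈ e, Q'.maxAt v = {β0, β1}

theorem LatticeFrame.i_swap (L : LatticeFrame) (o γ : Fin 2 →₀ ℕ) : L.i γ o = -L.i o γ := by
  simp only [LatticeFrame.i]; ring

theorem LatticeFrame.j_swap (L : LatticeFrame) (o γ : Fin 2 →₀ ℕ) : L.j γ o = -L.j o γ := by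
  simp only [LatticeFrame.j]; ring

/-- The two vertices of `e` differ only in the second dual coordinate. The monomials dual to `e'`
tie at both vertices, so their difference has j = 0; it is primitive, hence i = ±1, and the
labelling is chosen to make i = 1. -/
theorem EdgeChart.aligned_or {Q Q' : TropPoly} {e e' : Set (Fin 2 → ℝ)} (C : EdgeChart Q e)
    (hQ' : Q'.Nonsingular) (he' : Q'.IsEdge e') (hee' : e ⊆ intrinsicInterior ℝ e') :
    ∃ β0 β1, C.Aligned Q' e' β0 β1 := by
  obtain ⟨x, h2, hc, rfl⟩ := he'
  obtain ⟨β, β', hne, hM, hl⟩ := TropPoly.UnitWeights.maxAt_eq_pair hQ'.2 h2 hc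
  have hmax : ∀ v ∈ e, Q'.maxAt v = Q'.maxAt x := fun v hv =>
    TropPoly.maxAt_eq_of_mem_intrinsicInterior rfl (by rw [hM]; simp) (hee' hv)
  have hdiff : ∀ v ∈ e, Q'.term β' v - Q'.term β v = 0 := fun v hv => by
    rw [TropPoly.term_eq_of_mem (v := v) (α := β) (β := β') (by rw [hmax v hv, hM]; simp)
      (by rw [hmax v hv, hM]; simp), sub_self]
  have h1 := hdiff _ C.v1_mem
  have h2' := hdiff _ C.v2_mem
  rw [C.L.term_sub_eq] at h1 h2'
  have h3 : Q.term C.α1 C.v1 - Q.term C.α0 C.v1 = 0 :=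
    sub_eq_zero.2 (TropPoly.term_eq_of_mem C.mem01 C.mem11)
  have h4 : Q.term C.α1 C.v2 - Q.term C.α0 C.v2 = 0 :=
    sub_eq_zero.2 (TropPoly.term_eq_of_mem C.mem02 C.mem12)
  rw [C.L.term_sub_eq, C.i1, C.j1] at h3 h4
  have h5 : Q.term C.α2 C.v1 - Q.term C.α0 C.v1 = 0 :=
    sub_eq_zero.2 (TropPoly.term_eq_of_mem C.mem01 C.mem21)
  have h6 := C.term2_v2_lt
  rw [← sub_neg] at h6
  rw [C.L.term_sub_eq, C.i2, C.j2] at h5 h6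
  push_cast at h3 h4 h5 h6
  have hpe : C.L.pe C.v1 = C.L.pe C.v2 := by linarith
  have hpf : C.L.pf C.v1 - C.L.pf C.v2 ≠ 0 := by
    intro h; linarith
  have hj : C.L.j β β' = 0 := by
    have : (C.L.j β β' : ℝ) * (C.L.pf C.v1 - C.L.pf C.v2) = 0 := by
      rw [hpe] at h1; linarith
    exact_mod_cast (mul_eq_zero.1 this).resolve_right hpf
  have hi : (C.L.i β β').natAbs = 1 := by
    have hz := C.L.zero_eq β β'
    have ho := C.L.one_eq β β'
    rw [hj, zero_mul, add_zero] at hz ho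
    rw [latLen, ← Int.gcd_neg, ← Int.neg_gcd, neg_sub, neg_sub, hz, ho, Int.gcd_mul_left] at hl
    exact Nat.eq_one_of_mul_eq_one_right hl
  rcases Int.natAbs_eq (C.L.i β β') with h7 | h7
  · exact ⟨β, β', by rw [h7, hi]; rfl, hj, by rw [TropPoly.dual_eq_maxAt, hM],
      fun v hv => by rw [hmax v hv, hM]⟩
  · exact ⟨β', β, by rw [C.L.i_swap, h7, hi]; rfl, by rw [C.L.j_swap, hj, neg_zero],
      by rw [TropPoly.dual_eq_maxAt, hM, Finset.pair_comm],
      fun v hv => by rw [hmax v hv, hM, Finset.pair_comm]⟩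
end

noncomputable section
open Filter Topology

/-! ### Real phases and twisted edges -/

namespace LatticeFrame

variable (L : LatticeFrame)

/-- The value of the character `(-1)^ε` at the first basis vector. -/
def chiE (ε : Fin 2 → ZMod 2) : ℤˣ := (-1) ^ (((ε 0).val : ℤ) * L.e0 + (ε 1).val * L.e1)

/-- The value of the character `(-1)^ε` at the second basis vector. -/
def chiF (ε : Fin 2 → ZMod 2) : ℤˣ := (-1) ^ (((ε 0).val : ℤ) * L.f0 + (ε 1).val * L.f1)

theorem symSign_eq (δ : (Fin 2 →₀ ℕ) → ℤˣ) (ε : Fin 2 → ZMod 2) (o γ : Fin 2 →₀ ℕ) :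
    TropPoly.symSign δ ε γ = TropPoly.symSign δ ε o * δ o * L.chiE ε ^ L.i o γ *
      L.chiF ε ^ L.j o γ * δ γ := by
  have h : ∀ η : Fin 2 →₀ ℕ, TropPoly.symSign δ ε η =
      (-1) ^ (((ε 0).val : ℤ) * η 0 + (ε 1).val * η 1) * δ η := by
    intro η
    rw [TropPoly.symSign, Fin.sum_univ_two, ← zpow_natCast]
    push_cast
    rfl
  rw [h γ, h o, mul_assoc _ (δ o) (δ o), Int.units_mul_self, mul_one, chiE, chiF, ← zpow_mul,
    ← zpow_mul, ← zpow_add, ← zpow_add]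
  congr 2
  have h0 := L.zero_eq o γ
  have h1 := L.one_eq o γ
  linear_combination ((ε 0).val : ℤ) * h0 + ((ε 1).val : ℤ) * h1

theorem odd_or_odd : Odd L.e0 ∨ Odd L.e1 := by
  by_contra! h
  rw [Int.not_odd_iff_even, Int.not_odd_iff_even] at h
  have h1 : Even L.D := by
    rw [← L.det_eq]
    exact (h.1.mul_right _).sub (h.2.mul_right _)
  have h2 : Even (L.D * L.D) := h1.mul_right _
  rw [L.sq_eq] at h2
  exact absurd h2 (by decide)

/-- A primitive vector has an odd coordinate, so the character takes both values on it. In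
particular phases of edges are not empty. -/
theorem exists_chiE_eq (s : ℤˣ) : ∃ ε, L.chiE ε = s := by
  rcases Int.units_eq_one_or s with rfl | rfl
  · exact ⟨0, by simp [chiE]⟩
  · rcases L.odd_or_odd with h | h
    · exact ⟨![1, 0], by simpa [chiE, ZMod.val_one] using h.neg_one_zpow⟩
    · exact ⟨![0, 1], by simpa [chiE, ZMod.val_one] using h.neg_one_zpow⟩

end LatticeFrame

theorem abs_cross_eq_one_of_mem_of_ne {a b c α β γ : Fin 2 →₀ ℕ} (h : |cross a b c| = 1)
    (hα : α = a ∨ α = b ∨ α = c) (hβ : β = a ∨ β = b ∨ β = c) (hγ : γ = a ∨ γ = b ∨ γ = c)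
    (h1 : α ≠ β) (h2 : α ≠ γ) (h3 : β ≠ γ) : cross α β γ ≠ 0 := by
  have key : cross α β γ = cross a b c ∨ cross α β γ = -cross a b c := by
    rcases hα with rfl | rfl | rfl <;> rcases hβ with rfl | rfl | rfl <;>
      first
        | exact absurd rfl h1
        | (rcases hγ with rfl | rfl | rfl <;>
            first
              | exact absurd rfl h2
              | exact absurd rfl h3
              | (unfold cross; left; ring1)
              | (unfold cross; right; ring1))
  intro h0
  rcases key with h4 | h4 <;> rw [h0] at h4
  · rw [← h4] at h; simp at h
  · rw [eq_neg_iff_add_eq_zero, zero_add] at h4; rw [h4] at h; simp at h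

namespace TropPoly

variable {Q : TropPoly}

theorem isEdge_of_maxAt_eq_pair {v : Fin 2 → ℝ} {α β : Fin 2 →₀ ℕ} (hne : α ≠ β)
    (hM : Q.maxAt v = {α, β}) : Q.IsEdge {w | α ∈ Q.maxAt w ∧ β ∈ Q.maxAt w} ∧
      Q.dual {w | α ∈ Q.maxAt w ∧ β ∈ Q.maxAt w} = {α, β} := by
  have hset : {w | Q.maxAt v ⊆ Q.maxAt w} = {w | α ∈ Q.maxAt w ∧ β ∈ Q.maxAt w} := by
    ext w
    rw [Set.mem_ofPred_eq, Set.mem_ofPred_eq, hM]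
    simp [Finset.insert_subset_iff]
  rw [← hset]
  refine ⟨⟨v, by rw [hM, Finset.card_pair hne], ?_, rfl⟩, by rw [dual_eq_maxAt, hM]⟩
  rw [hM, Finset.coe_pair, Set.image_pair]
  exact collinear_pair _ _ _

/-- A point near w in the direction of the outer normal of the side a b. The factor -`cross a b c`
makes the normal point outwards for either orientation. -/
theorem exists_maxAt_eq_pair {w : Fin 2 → ℝ} {a b c : Fin 2 →₀ ℕ}
    (hM : ∀ γ, γ ∈ Q.maxAt w ↔ γ = a ∨ γ = b ∨ γ = c) (hc : cross a b c ≠ 0) :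
    ∃ v, Q.maxAt v = {a, b} := by
  set n : Fin 2 → ℝ := ![-((b 1 : ℝ) - a 1), (b 0 : ℝ) - a 0] with hn
  have hpair : ∀ γ, pairing γ (-(cross a b c : ℝ) • n) =
      pairing a (-(cross a b c : ℝ) • n) - cross a b c * cross a b γ := by
    intro γ
    simp only [pairing, hn, cross, Pi.smul_apply, smul_eq_mul, Matrix.cons_val_zero,
      Matrix.cons_val_one]
    push_cast
    ring
  have hne : (Q.maxAt w).Nonempty := ⟨a, by rw [hM]; simp⟩
  obtain ⟨t, ht⟩ := (eventually_maxAt_eq_face w (-(cross a b c : ℝ) • n) hne).exists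
  refine ⟨_, ht.trans ?_⟩
  have hb := hpair b
  have hc' := hpair c
  rw [cross_self_right, Int.cast_zero, mul_zero, sub_zero] at hb
  have hpos : (0 : ℝ) < cross a b c * cross a b c :=
    mul_self_pos.2 (by exact_mod_cast hc)
  ext γ
  rw [mem_face, Finset.mem_insert, Finset.mem_singleton]
  constructor
  · rintro ⟨h1, h2⟩
    rcases (hM γ).1 h1 with rfl | rfl | rfl
    · exact Or.inl rfl
    · exact Or.inr rfl
    · have := h2 a ((hM a).2 (Or.inl rfl))
      linarith
  · rintro (rfl | rfl)
    · refine ⟨(hM _).2 (by simp), fun β hβ => ?_⟩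
      rcases (hM β).1 hβ with rfl | rfl | rfl <;> linarith
    · refine ⟨(hM _).2 (by simp), fun β hβ => ?_⟩
      rcases (hM β).1 hβ with rfl | rfl | rfl <;> linarith

theorem isTwisted_congr {P : TropPoly} (h : ∀ f, Q.IsEdge f ↔ P.IsEdge f)
    (E : Set (Fin 2 → ℝ) → Set (Fin 2 → ZMod 2)) (e : Set (Fin 2 → ℝ)) :
    Q.IsTwisted E e ↔ P.IsTwisted E e := by
  simp only [IsTwisted, h]

theorem mem_phase_of_dual_eq {δ : (Fin 2 →₀ ℕ) → ℤˣ} {e : Set (Fin 2 → ℝ)} {α β : Fin 2 →₀ ℕ}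
    (hd : Q.dual e = {α, β}) (ε : Fin 2 → ZMod 2) :
    ε ∈ Q.phase δ e ↔ symSign δ ε α ≠ symSign δ ε β := by
  rw [phase, Set.mem_ofPred_eq, hd]
  constructor
  · rintro ⟨a, ha, b, hb, hab⟩
    rw [Finset.mem_insert, Finset.mem_singleton] at ha hb
    rcases ha with rfl | rfl <;> rcases hb with rfl | rfl
    · exact absurd rfl hab
    · exact hab
    · exact hab.symm
    · exact absurd rfl hab
  · intro h
    exact ⟨α, by simp, β, by simp, h⟩

/-- The phase is the set of ε whose character takes a prescribed value at the primitive vector of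
the dual edge; only the product of the signs of the endpoints matters. -/
theorem mem_phase_iff {δ : (Fin 2 →₀ ℕ) → ℤˣ} {e : Set (Fin 2 → ℝ)} {α β : Fin 2 →₀ ℕ}
    (L : LatticeFrame) (hd : Q.dual e = {α, β}) (hi : L.i α β = 1) (hj : L.j α β = 0)
    (ε : Fin 2 → ZMod 2) : ε ∈ Q.phase δ e ↔ L.chiE ε = -(δ α * δ β) := by
  rw [mem_phase_of_dual_eq hd, L.symSign_eq δ ε α β, hi, hj, zpow_one, zpow_zero, mul_one]
  generalize symSign δ ε α = s
  generalize L.chiE ε = t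
  generalize δ α = a
  generalize δ β = b
  revert s t a b
  decide

/-- The phases of two parallel edges agree if and only if the relative signs agree. -/
theorem phase_eq_iff {Q' : TropPoly} {δ δ' : (Fin 2 →₀ ℕ) → ℤˣ} {e e' : Set (Fin 2 → ℝ)}
    {α β α' β' : Fin 2 →₀ ℕ} (L : LatticeFrame) (hd : Q.dual e = {α, β}) (hi : L.i α β = 1)
    (hj : L.j α β = 0) (hd' : Q'.dual e' = {α', β'}) (hi' : L.i α' β' = 1) (hj' : L.j α' β' = 0) :
    Q.phase δ e = Q'.phase δ' e' ↔ δ α * δ β = δ' α' * δ' β' := by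
  constructor
  · intro h
    obtain ⟨ε, hε⟩ := L.exists_chiE_eq (-(δ α * δ β))
    have h1 := (mem_phase_iff (δ := δ) L hd hi hj ε).2 hε
    rw [h, mem_phase_iff L hd' hi' hj', hε] at h1
    exact neg_injective h1
  · intro h
    ext ε
    rw [mem_phase_iff L hd hi hj, mem_phase_iff L hd' hi' hj', h]

end TropPoly

/-! ### The sign criterion for twisted edges -/

namespace EdgeChart

variable {Q : TropPoly} {e : Set (Fin 2 → ℝ)} (C : EdgeChart Q e)

/-- The sign that decides whether the edge is twisted. -/
def edgeSign (δ : (Fin 2 →₀ ℕ) → ℤˣ) : ℤˣ :=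
  δ C.α2 * δ C.α3 * (-(δ C.α0 * δ C.α1)) ^ C.k

/-- Membership in the phase fixes the character on the first basis vector. The character on the
second one enters with exponents 1 and -1, that is equally, and cancels. The comparison of α₂ with
α₃ is therefore independent of ε. -/
theorem symSign_ne_iff {δ : (Fin 2 →₀ ℕ) → ℤˣ} {ε : Fin 2 → ZMod 2} (hε : ε ∈ Q.phase δ e) :
    TropPoly.symSign δ ε C.α2 ≠ TropPoly.symSign δ ε C.α3 ↔ C.edgeSign δ = -1 := by
  rw [TropPoly.mem_phase_iff C.L C.dual_eq C.i1 C.j1] at hε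
  rw [C.L.symSign_eq δ ε C.α0 C.α2, C.L.symSign_eq δ ε C.α0 C.α3, C.i2, C.j2, C.i3, C.j3, hε,
    edgeSign, zpow_zero, zpow_one, mul_one, zpow_neg_one, Int.units_inv_eq_self]
  generalize (-(δ C.α0 * δ C.α1)) ^ C.k = c
  generalize TropPoly.symSign δ ε C.α0 = s
  generalize C.L.chiF ε = t
  generalize δ C.α0 = a
  generalize δ C.α2 = b
  generalize δ C.α3 = d
  revert c s t a b d
  decide

theorem term1_sub (v : Fin 2 → ℝ) :
    Q.term C.α1 v - Q.term C.α0 v = C.L.pe v - C.L.pe C.v1 := by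
  have h1 : Q.term C.α1 C.v1 - Q.term C.α0 C.v1 = 0 :=
    sub_eq_zero.2 (TropPoly.term_eq_of_mem C.mem01 C.mem11)
  rw [C.L.term_sub_eq, C.i1, C.j1] at h1 ⊢
  push_cast at h1 ⊢
  linarith

theorem pe_eq {v : Fin 2 → ℝ} (hv : v ∈ e) : C.L.pe v = C.L.pe C.v1 := by
  have h := (C.mem_iff v).1 hv
  have := C.term1_sub v
  rw [TropPoly.term_eq_of_mem h.1 h.2] at this
  linarith

theorem pf_ne : C.L.pf C.v2 - C.L.pf C.v1 ≠ 0 := by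
  have h5 : Q.term C.α2 C.v1 - Q.term C.α0 C.v1 = 0 :=
    sub_eq_zero.2 (TropPoly.term_eq_of_mem C.mem01 C.mem21)
  have h6 := C.term2_v2_lt
  rw [← sub_neg] at h6
  rw [C.L.term_sub_eq, C.i2, C.j2] at h5 h6
  intro h
  push_cast at h5 h6
  linarith

/-- The line containing `e` is a level line of the first dual coordinate, so sides of this line are
read off from `pe`. -/
theorem mem_affineSpan_iff (w : Fin 2 → ℝ) :
    w ∈ affineSpan ℝ e ↔ C.L.pe w = C.L.pe C.v1 := by
  constructor
  · intro h
    refine affineSpan_induction (p := fun w => C.L.pe w = C.L.pe C.v1) h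
      (fun x hx => C.pe_eq hx) fun c x y z hx hy hz => ?_
    have : C.L.pe (c • (x -ᵥ y) +ᵥ z) = c * (C.L.pe x - C.L.pe y) + C.L.pe z := by
      simp only [LatticeFrame.pe, vsub_eq_sub, vadd_eq_add, Pi.add_apply, Pi.smul_apply,
        Pi.sub_apply, smul_eq_mul]
      ring
    change C.L.pe _ = _
    rw [this, hx, hy, hz]; ring
  · intro h
    have h2 := C.pe_eq C.v2_mem
    have hpf := C.pf_ne
    set t := (C.L.pf w - C.L.pf C.v1) / (C.L.pf C.v2 - C.L.pf C.v1) with ht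
    have hmem : AffineMap.lineMap C.v1 C.v2 t ∈ affineSpan ℝ e :=
      AffineMap.lineMap_mem t (subset_affineSpan ℝ e C.v1_mem) (subset_affineSpan ℝ e C.v2_mem)
    have ht' : t * (C.L.pf C.v2 - C.L.pf C.v1) = C.L.pf w - C.L.pf C.v1 := div_mul_cancel₀ _ hpf
    convert hmem using 1
    have hd := C.L.det_real
    have hs := C.L.sq_real
    rw [LatticeFrame.pe, LatticeFrame.pe] at h h2
    rw [LatticeFrame.pf, LatticeFrame.pf, LatticeFrame.pf] at ht'
    have k1 : ((C.L.D : ℝ) * C.L.D) * (w 0 - C.v1 0 - t * (C.v2 0 - C.v1 0)) = 0 := by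
      nth_rewrite 1 [← hd]
      linear_combination (C.L.D * C.L.f1 : ℝ) * (h - t * h2) + (C.L.D * C.L.e1 : ℝ) * ht'
    have k2 : ((C.L.D : ℝ) * C.L.D) * (w 1 - C.v1 1 - t * (C.v2 1 - C.v1 1)) = 0 := by
      nth_rewrite 1 [← hd]
      linear_combination (-C.L.D * C.L.f0 : ℝ) * (h - t * h2) - (C.L.D * C.L.e0 : ℝ) * ht'
    rw [hs, one_mul] at k1 k2
    funext l
    rw [AffineMap.lineMap_apply]
    fin_cases l
    · change w 0 = t * (C.v2 0 - C.v1 0) + C.v1 0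
      linarith
    · change w 1 = t * (C.v2 1 - C.v1 1) + C.v1 1
      linarith

theorem sOppSide_of_lt {x y : Fin 2 → ℝ} (hx : C.L.pe x < C.L.pe C.v1)
    (hy : C.L.pe C.v1 < C.L.pe y) : (affineSpan ℝ e).SOppSide x y := by
  refine ⟨?_, fun h => hx.ne ((C.mem_affineSpan_iff x).1 h),
    fun h => hy.ne' ((C.mem_affineSpan_iff y).1 h)⟩
  set t := (C.L.pe C.v1 - C.L.pe x) / (C.L.pe y - C.L.pe x) with ht
  have h0 : 0 < C.L.pe y - C.L.pe x := by linarith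
  have ht' : t * (C.L.pe y - C.L.pe x) = C.L.pe C.v1 - C.L.pe x := div_mul_cancel₀ _ h0.ne'
  have hw : Wbtw ℝ x (AffineMap.lineMap x y t) y := by
    refine ⟨t, ⟨div_nonneg (by linarith) h0.le, ?_⟩, rfl⟩
    rw [ht, div_le_one h0]
    linarith
  refine hw.wOppSide₁₃ ((C.mem_affineSpan_iff _).2 ?_)
  have : C.L.pe (AffineMap.lineMap x y t) = t * (C.L.pe y - C.L.pe x) + C.L.pe x := by
    rw [AffineMap.lineMap_apply]
    simp only [LatticeFrame.pe, vsub_eq_sub, vadd_eq_add, Pi.add_apply, Pi.smul_apply,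
        Pi.sub_apply, smul_eq_mul]
    ring
  rw [this, ht']; ring

theorem mul_neg_of_sOppSide {x y : Fin 2 → ℝ} (h : (affineSpan ℝ e).SOppSide x y) :
    (C.L.pe x - C.L.pe C.v1) * (C.L.pe y - C.L.pe C.v1) < 0 := by
  obtain ⟨⟨p, hp, q, hq, hr⟩, hx, hy⟩ := h
  rw [C.mem_affineSpan_iff] at hp hq hx hy
  have hsub : ∀ a b, C.L.pe (a - b) = C.L.pe a - C.L.pe b := by
    intro a b
    simp only [LatticeFrame.pe, Pi.sub_apply]; ring
  have hsmul : ∀ (r : ℝ) a, C.L.pe (r • a) = r * C.L.pe a := by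
    intro r a
    simp only [LatticeFrame.pe, Pi.smul_apply, smul_eq_mul]; ring
  rcases hr with h1 | h1 | ⟨r, s, hr, hs, h1⟩
  · rw [vsub_eq_sub, sub_eq_zero] at h1
    exact absurd (h1 ▸ hp) hx
  · rw [vsub_eq_sub, sub_eq_zero] at h1
    exact absurd (h1 ▸ hq) hy
  · have h2 := congrArg C.L.pe h1
    rw [hsmul, hsmul, vsub_eq_sub, vsub_eq_sub, hsub, hsub, hp, hq] at h2
    have hx' := sub_ne_zero.2 hx
    have h3 : s * ((C.L.pe x - C.L.pe C.v1) * (C.L.pe y - C.L.pe C.v1)) =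
        -(r * (C.L.pe x - C.L.pe C.v1) ^ 2) := by
      linear_combination (C.L.pe x - C.L.pe C.v1) * h2
    have h4 : 0 < r * (C.L.pe x - C.L.pe C.v1) ^ 2 := by positivity
    by_contra hcon
    have := mul_nonneg hs.le (not_lt.1 hcon)
    linarith

/-- A third monomial γ maximal at a point of `e` forms a unimodular triangle with α₀ and α₁, so its
second coordinate is ±1. Comparing it with α₂ or α₃ along `e` shows that it is maximal at the
corresponding end as well. -/
theorem eq_of_mem_maxAt (hQ : Q.Nonsingular) {w : Fin 2 → ℝ} (hw : w ∈ e) {γ : Fin 2 →₀ ℕ}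
    (hγ : γ ∈ Q.maxAt w) (h0 : γ ≠ C.α0) (h1 : γ ≠ C.α1) :
    (γ = C.α2 ∨ γ = C.α3) ∧ Q.maxAt w = {C.α0, C.α1, γ} := by
  obtain ⟨hw0, hw1⟩ := (C.mem_iff w).1 hw
  have hcross : cross C.α0 C.α1 γ ≠ 0 := by
    have h2 : 2 ≤ (Q.maxAt w).card := Finset.one_lt_card.2 ⟨_, hw0, _, hw1, C.ne01⟩
    rcases hQ.maxAt_cases h2 with ⟨a, b, hab, hM, -⟩ | ⟨a, b, c, hM, hcr⟩
    · exfalso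
      rw [hM, Finset.mem_insert, Finset.mem_singleton] at hw0 hw1 hγ
      have := C.ne01
      rcases hw0 with h3 | h3 <;> rcases hw1 with h4 | h4 <;> rcases hγ with h5 | h5 <;>
        simp_all
    · rw [hM] at hw0 hw1 hγ
      simp only [Finset.mem_insert, Finset.mem_singleton] at hw0 hw1 hγ
      exact abs_cross_eq_one_of_mem_of_ne hcr hw0 hw1 hγ C.ne01 h0.symm h1.symm
  obtain ⟨hM, habs⟩ := hQ.maxAt_eq_triangle hw0 hw1 hγ hcross
  refine ⟨?_, hM⟩
  rw [C.L.cross_eq C.α0, C.i1, C.j1, C.L.i_self, C.L.j_self] at habs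
  have hj : |C.L.j C.α0 γ| = 1 := by
    have hD : |C.L.D| = 1 := by
      have := C.L.sq_eq
      rw [← abs_mul_abs_self] at this
      nlinarith [abs_nonneg C.L.D]
    have h3 : C.L.D * ((1 - 0) * (C.L.j C.α0 γ - 0) - (0 - 0) * (C.L.i C.α0 γ - 0)) =
        C.L.D * C.L.j C.α0 γ := by ring
    rwa [h3, abs_mul, hD, one_mul] at habs
  have hγs := (TropPoly.mem_maxAt.1 hγ).1
  have hTw : Q.term γ w - Q.term C.α0 w = 0 := sub_eq_zero.2 (TropPoly.term_eq_of_mem hw0 hγ)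
  have hpe := C.pe_eq hw
  have hpe2 := C.pe_eq C.v2_mem
  rcases (abs_eq (zero_le_one)).1 hj with hj | hj
  · left
    have hT1 := (TropPoly.mem_maxAt.1 C.mem01).2 γ hγs
    have hT2 := (TropPoly.mem_maxAt.1 hw0).2 C.α2 C.mem_supp2
    have h3 := sub_eq_zero.2 (TropPoly.term_eq_of_mem C.mem01 C.mem21)
    have k1 := C.L.term_sub_eq Q C.α0 γ C.v1
    have k2 := C.L.term_sub_eq Q C.α0 C.α2 w
    rw [C.L.term_sub_eq] at hTw h3
    rw [hj] at hTw k1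
    rw [C.i2, C.j2] at h3 k2
    rw [hpe] at hTw k2
    push_cast at *
    have : γ ∈ Q.maxAt C.v1 := (TropPoly.mem_maxAt_iff_of_mem C.mem01 hγs).2 (by linarith)
    rw [C.max1] at this
    simp only [Finset.mem_insert, Finset.mem_singleton] at this
    exact (this.resolve_left h0).resolve_left h1
  · right
    have hT1 := (TropPoly.mem_maxAt.1 C.mem02).2 γ hγs
    have hT2 := (TropPoly.mem_maxAt.1 hw0).2 C.α3 C.mem_supp3
    have h3 := sub_eq_zero.2 (TropPoly.term_eq_of_mem C.mem02 C.mem32)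
    have k1 := C.L.term_sub_eq Q C.α0 γ C.v2
    have k2 := C.L.term_sub_eq Q C.α0 C.α3 w
    rw [C.L.term_sub_eq] at hTw h3
    rw [hj] at hTw k1
    rw [C.i3, C.j3] at h3 k2
    rw [hpe] at hTw k2
    rw [hpe2] at h3 k1
    push_cast at *
    have : γ ∈ Q.maxAt C.v2 := (TropPoly.mem_maxAt_iff_of_mem C.mem02 hγs).2 (by linarith)
    rw [C.max2] at this
    simp only [Finset.mem_insert, Finset.mem_singleton] at this
    exact (this.resolve_left h0).resolve_left h1

theorem eq_setOf : e = {w | C.α0 ∈ Q.maxAt w ∧ C.α1 ∈ Q.maxAt w} := Set.ext C.mem_iff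

/-- The edges adjacent to `e`. -/
theorem adjacent (hQ : Q.Nonsingular) {f : Set (Fin 2 → ℝ)} (hf : Q.IsEdge f) (hne : f ≠ e)
    (hfe : (f ∩ e).Nonempty) : ∃ a b v, (a = C.α0 ∨ a = C.α1) ∧ (b = C.α2 ∨ b = C.α3) ∧
      Q.maxAt v = {a, b} ∧ Q.dual f = {a, b} ∧ f = {w | a ∈ Q.maxAt w ∧ b ∈ Q.maxAt w} := by
  obtain ⟨v, a, b, hab, hM, -, hd, hfs⟩ := hQ.isEdge_iff.1 hf
  obtain ⟨w, hwf, hwe⟩ := hfe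
  have hwf' := hwf
  rw [hfs] at hwf'
  obtain ⟨hwa, hwb⟩ := hwf'
  have key : ∀ a b, a ≠ b → a ∈ Q.maxAt w → b ∈ Q.maxAt w → b ≠ C.α0 → b ≠ C.α1 →
      (a = C.α0 ∨ a = C.α1) ∧ (b = C.α2 ∨ b = C.α3) := by
    intro a b hab ha hb h0 h1
    obtain ⟨h2, h3⟩ := C.eq_of_mem_maxAt hQ hwe hb h0 h1
    refine ⟨?_, h2⟩
    rw [h3] at ha
    simp only [Finset.mem_insert, Finset.mem_singleton] at ha
    rcases ha with h | h | h
    · exact Or.inl h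
    · exact Or.inr h
    · exact absurd h hab
  by_cases hb : b = C.α0 ∨ b = C.α1
  · by_cases ha : a = C.α0 ∨ a = C.α1
    · exfalso
      refine hne ?_
      rw [hfs, C.eq_setOf]
      rcases ha with rfl | rfl <;> rcases hb with rfl | rfl
      · exact absurd rfl hab
      · rfl
      · ext w; exact and_comm
      · exact absurd rfl hab
    · push Not at ha
      obtain ⟨h1, h2⟩ := key b a hab.symm hwb hwa ha.1 ha.2
      exact ⟨b, a, v, h1, h2, by rw [hM, Finset.pair_comm], by rw [hd, Finset.pair_comm], by
        rw [hfs]; ext w; exact and_comm⟩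
  · push Not at hb
    obtain ⟨h1, h2⟩ := key a b hab hwa hwb hb.1 hb.2
    exact ⟨a, b, v, h1, h2, hM, hd, hfs⟩

/-- An adjacent edge is dual to {a, b} with a in {α₀, α₁} and b in {α₂, α₃}, and a alone decides on
which side it leaves. For ε in the phase of `e` the signs of α₀ and α₁ differ, so for each b exactly
one choice of a gives an edge carrying ε. The choices for α₂ and α₃ differ exactly if the signs of
α₂ and α₃ do. -/
theorem isTwisted_iff (hQ : Q.Nonsingular) (δ : (Fin 2 →₀ ℕ) → ℤˣ)
    {E : Set (Fin 2 → ℝ) → Set (Fin 2 → ZMod 2)} (he : Q.IsEdge e)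
    (hE : ∀ f, Q.IsEdge f → E f = Q.phase δ f) : Q.IsTwisted E e ↔ C.edgeSign δ = -1 := by
  have hunits : ∀ {s t u : ℤˣ}, s ≠ t → t ≠ u → s = u := by decide
  constructor
  · intro h
    by_contra hsign
    -- One element of the phase suffices: it will violate the twisting condition.
    obtain ⟨ε, hε⟩ := C.L.exists_chiE_eq (-(δ C.α0 * δ C.α1))
    have hε' := (TropPoly.mem_phase_iff (δ := δ) C.L C.dual_eq C.i1 C.j1 ε).2 hε
    have h23 := not_not.1 (mt (C.symSign_ne_iff hε').1 hsign)
    have h01 := (TropPoly.mem_phase_of_dual_eq C.dual_eq ε).1 hε'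
    -- The endpoint a has the sign opposite to the common sign of α₂ and α₃. The edges dual to {a,
    -- α₂} and {a, α₃} both carry ε and both lie where the term of a is at least that of a'.
    obtain ⟨a, a', ha, hsa, hpe⟩ : ∃ a a', ((a = C.α0 ∧ a' = C.α1) ∨ (a = C.α1 ∧ a' = C.α0)) ∧
        TropPoly.symSign δ ε a ≠ TropPoly.symSign δ ε C.α2 ∧
        ∃ s : ℝ, ∀ v, Q.term a v - Q.term a' v = s * (C.L.pe v - C.L.pe C.v1) := by
      by_cases h02 : TropPoly.symSign δ ε C.α0 = TropPoly.symSign δ ε C.α2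
      · refine ⟨C.α1, C.α0, Or.inr ⟨rfl, rfl⟩, fun h' => h01 (h02.trans h'.symm), 1, fun v => ?_⟩
        rw [C.term1_sub, one_mul]
      · refine ⟨C.α0, C.α1, Or.inl ⟨rfl, rfl⟩, h02, -1, fun v => ?_⟩
        rw [← C.term1_sub]; ring
    obtain ⟨s, hpe⟩ := hpe
    have c1 : ∀ γ, γ ∈ Q.maxAt C.v1 ↔ γ = a ∨ γ = C.α2 ∨ γ = a' := by
      intro γ
      rw [C.max1]
      simp only [Finset.mem_insert, Finset.mem_singleton]
      rcases ha with ⟨rfl, rfl⟩ | ⟨rfl, rfl⟩ <;> tauto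
    have c2 : ∀ γ, γ ∈ Q.maxAt C.v2 ↔ γ = a ∨ γ = C.α3 ∨ γ = a' := by
      intro γ
      rw [C.max2]
      simp only [Finset.mem_insert, Finset.mem_singleton]
      rcases ha with ⟨rfl, rfl⟩ | ⟨rfl, rfl⟩ <;> tauto
    have hD : C.L.D ≠ 0 := fun h => by have := C.L.sq_eq; rw [h] at this; simp at this
    have d1 : cross a C.α2 a' ≠ 0 := by
      rw [C.L.cross_eq C.α0]
      rcases ha with ⟨rfl, rfl⟩ | ⟨rfl, rfl⟩ <;>
        simp [C.i1, C.i2, C.j1, C.j2, C.L.i_self, C.L.j_self, hD]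
    have d2 : cross a C.α3 a' ≠ 0 := by
      rw [C.L.cross_eq C.α0]
      rcases ha with ⟨rfl, rfl⟩ | ⟨rfl, rfl⟩ <;>
        simp [C.i1, C.i3, C.j1, C.j3, C.L.i_self, C.L.j_self, hD]
    obtain ⟨w1, hw1⟩ := TropPoly.exists_maxAt_eq_pair c1 d1
    obtain ⟨w2, hw2⟩ := TropPoly.exists_maxAt_eq_pair c2 d2
    have ha2 : a ≠ C.α2 := by
      rintro rfl; exact hsa rfl
    have ha3 : a ≠ C.α3 := by
      rintro rfl; exact hsa h23.symm
    obtain ⟨f1, g1⟩ := TropPoly.isEdge_of_maxAt_eq_pair ha2 hw1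
    obtain ⟨f2, g2⟩ := TropPoly.isEdge_of_maxAt_eq_pair ha3 hw2
    have hdne : ∀ b, b ≠ C.α0 → b ≠ C.α1 → ({a, b} : Finset (Fin 2 →₀ ℕ)) ≠ {C.α0, C.α1} := by
      intro b h0 h1 h2
      have : b ∈ ({C.α0, C.α1} : Finset (Fin 2 →₀ ℕ)) := by rw [← h2]; simp
      simp [h0, h1] at this
    have hav1 : a ∈ Q.maxAt C.v1 := (c1 a).2 (Or.inl rfl)
    have hav2 : a ∈ Q.maxAt C.v2 := (c2 a).2 (Or.inl rfl)
    have haS := (TropPoly.mem_maxAt.1 hav1).1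
    have ha'S := (TropPoly.mem_maxAt.1 ((c1 a').2 (Or.inr (Or.inr rfl)))).1
    obtain ⟨x, hx, y, hy, hxy⟩ := h ε (by rw [hE e he]; exact hε') _ _ f1 f2
      (fun h' => hdne _ C.ne02.symm C.ne12.symm (by rw [← g1, h', C.dual_eq]))
      (fun h' => hdne _ C.ne03.symm C.ne13.symm (by rw [← g2, h', C.dual_eq]))
      (fun h' => by
        have : C.α2 ∈ ({a, C.α3} : Finset (Fin 2 →₀ ℕ)) := by rw [← g2, ← h', g1]; simp
        rw [Finset.mem_insert, Finset.mem_singleton] at this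
        rcases this with h2 | h2
        · exact ha2 h2.symm
        · exact C.ne23 h2)
      ⟨C.v1, ⟨hav1, C.mem21⟩, C.v1_mem⟩ ⟨C.v2, ⟨hav2, C.mem32⟩, C.v2_mem⟩
      (by rw [hE _ f1, TropPoly.mem_phase_of_dual_eq g1]; exact hsa)
      (by rw [hE _ f2, TropPoly.mem_phase_of_dual_eq g2, ← h23]; exact hsa)
    have hneg := C.mul_neg_of_sOppSide hxy
    have hx' : 0 ≤ s * (C.L.pe x - C.L.pe C.v1) := by
      rw [← hpe]; exact sub_nonneg.2 ((TropPoly.mem_maxAt.1 hx.1).2 _ ha'S)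
    have hy' : 0 ≤ s * (C.L.pe y - C.L.pe C.v1) := by
      rw [← hpe]; exact sub_nonneg.2 ((TropPoly.mem_maxAt.1 hy.1).2 _ ha'S)
    have h3 := mul_nonneg hx' hy'
    have hs : s ≠ 0 := by
      rintro rfl
      have h4 := hpe w1
      rw [zero_mul, sub_eq_zero] at h4
      have h5 : a ∈ Q.maxAt w1 := by rw [hw1]; simp
      have h6 : a' ∈ Q.maxAt w1 := (TropPoly.mem_maxAt_iff_of_mem h5 ha'S).2 h4.symm
      rw [hw1, Finset.mem_insert, Finset.mem_singleton] at h6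
      have n1 := C.ne01
      have n2 := C.ne02
      have n3 := C.ne12
      rcases ha with ⟨rfl, rfl⟩ | ⟨rfl, rfl⟩ <;> rcases h6 with h6 | h6 <;> simp_all
    have h4 : 0 < s ^ 2 := by positivity
    have h5 : s ^ 2 * ((C.L.pe x - C.L.pe C.v1) * (C.L.pe y - C.L.pe C.v1)) < 0 :=
      mul_neg_of_pos_of_neg h4 hneg
    linarith
  · intro hsign ε hε e1 e2 h1 h2 hne1 hne2 h12 hm1 hm2 hε1 hε2
    rw [hE e he] at hε
    rw [hE e1 h1] at hε1
    rw [hE e2 h2] at hε2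
    have h23 := (C.symSign_ne_iff hε).2 hsign
    have h01 := (TropPoly.mem_phase_of_dual_eq C.dual_eq ε).1 hε
    obtain ⟨a, b, x, ha, hb, hM, hd, hs⟩ := C.adjacent hQ h1 hne1 hm1
    obtain ⟨a', b', y, ha', hb', hM', hd', hs'⟩ := C.adjacent hQ h2 hne2 hm2
    rw [TropPoly.mem_phase_of_dual_eq hd] at hε1
    rw [TropPoly.mem_phase_of_dual_eq hd'] at hε2
    have hx1 : x ∈ e1 := by rw [hs]; constructor <;> rw [hM] <;> simp
    have hy2 : y ∈ e2 := by rw [hs']; constructor <;> rw [hM'] <;> simp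
    refine ⟨x, hx1, y, hy2, ?_⟩
    -- With the same a the vertices b and b' would have equal signs, which is excluded for α₂ and
    -- α₃.
    have haa' : a ≠ a' := by
      rintro rfl
      by_cases hbb : b = b'
      · exact h12 (by rw [hs, hs', hbb])
      · have h3 := hunits hε1.symm hε2
        rcases hb with rfl | rfl <;> rcases hb' with rfl | rfl
        · exact hbb rfl
        · exact h23 h3
        · exact h23 h3.symm
        · exact hbb rfl
    have side : ∀ {a a' b : Fin 2 →₀ ℕ} {x : Fin 2 → ℝ}, Q.maxAt x = {a, b} → a ≠ a' →
        (a' = C.α0 ∨ a' = C.α1) → (b = C.α2 ∨ b = C.α3) → Q.term a' x < Q.term a x := by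
      intro a a' b x hM hne ha' hb
      refine TropPoly.term_lt_of_notMem (by rw [hM]; simp) ?_ ?_
      · rcases ha' with rfl | rfl
        · exact C.mem_supp0
        · exact C.mem_supp1
      · rw [hM, Finset.mem_insert, Finset.mem_singleton, not_or]
        refine ⟨hne.symm, ?_⟩
        rcases ha' with rfl | rfl <;> rcases hb with rfl | rfl
        · exact C.ne02
        · exact C.ne03
        · exact C.ne12
        · exact C.ne13
    have s1 := side hM haa' ha' hb
    have s2 := side hM' haa'.symm ha hb'
    have t1 := C.term1_sub x
    have t2 := C.term1_sub y
    rcases ha with rfl | rfl <;> rcases ha' with rfl | rfl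
    · exact absurd rfl haa'
    · exact C.sOppSide_of_lt (by linarith) (by linarith)
    · exact (C.sOppSide_of_lt (by linarith) (by linarith)).symm
    · exact absurd rfl haa'

end EdgeChart
end

noncomputable section
open MvPolynomial Puiseux

/-! ### Torus charts -/

theorem inv_mul_mul_comm_cancel {M : Type*} [CommGroup M] (a b c d f : M) :
    a⁻¹ * d * (b⁻¹ * f * d⁻¹) = c * a⁻¹ * b⁻¹ * (c⁻¹ * f) := by
  calc a⁻¹ * d * (b⁻¹ * f * d⁻¹) = a⁻¹ * b⁻¹ * f * (d * d⁻¹) := by ac_rfl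
    _ = a⁻¹ * b⁻¹ * f * (c * c⁻¹) := by rw [mul_inv_cancel, mul_inv_cancel]
    _ = _ := by ac_rfl

theorem zpow_mul_zpow_comb {M : Type*} [CommGroup M] {a b : M} {m n m' n' r s : ℤ} :
    (a ^ m * b ^ n) ^ r * (a ^ m' * b ^ n') ^ s = a ^ (m * r + m' * s) * b ^ (n * r + n' * s) := by
  rw [mul_zpow, mul_zpow, ← zpow_mul, ← zpow_mul, ← zpow_mul, ← zpow_mul, zpow_add, zpow_add]
  exact mul_mul_mul_comm _ _ _ _

/-- Monomial coordinates on the torus: `χ₁ = X₀ x`, `χ₂ = U₀ u`, `χ₁ᵏ χ₂⁻¹ = W₀ w`. -/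
structure TorusChart where
  L : LatticeFrame
  k : ℤ
  X0 : Puiseuxˣ
  U0 : Puiseuxˣ
  W0 : Puiseuxˣ

namespace TorusChart

variable (T : TorusChart) {R S : Type} [CommRing R] [Algebra Puiseux R] [CommRing S]
  [Algebra Puiseux S]

/-- A nonzero constant in an algebra. -/
def cst (R : Type) [CommRing R] [Algebra Puiseux R] : Puiseuxˣ →* Rˣ :=
  Units.map (algebraMap Puiseux R : Puiseux →* R)

@[simp] theorem val_cst (c : Puiseuxˣ) : ((cst R c : Rˣ) : R) = algebraMap Puiseux R c := rfl

/-- The first coordinate. -/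
def x (z : Fin 2 → Rˣ) : Rˣ := (cst R T.X0)⁻¹ * (z 0 ^ T.L.e0 * z 1 ^ T.L.e1)

/-- The second coordinate. -/
def u (z : Fin 2 → Rˣ) : Rˣ := (cst R T.U0)⁻¹ * (z 0 ^ T.L.f0 * z 1 ^ T.L.f1)

/-- The third coordinate, a function of the others. -/
def w (z : Fin 2 → Rˣ) : Rˣ :=
  (cst R T.W0)⁻¹ * (z 0 ^ T.L.e0 * z 1 ^ T.L.e1) ^ T.k * (z 0 ^ T.L.f0 * z 1 ^ T.L.f1)⁻¹

/-- The constant in `u w = θ xᵏ`. -/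
def θ : Puiseuxˣ := T.X0 ^ T.k * T.U0⁻¹ * T.W0⁻¹

theorem u_mul_w (z : Fin 2 → Rˣ) : T.u z * T.w z = cst R T.θ * T.x z ^ T.k := by
  simp only [u, w, θ, x, map_mul, map_zpow, map_inv, mul_zpow, inv_zpow]
  exact inv_mul_mul_comm_cancel _ _ _ _ _

/-- The point with given coordinates. -/
def inv (x u : Rˣ) : Fin 2 → Rˣ :=
  ![(cst R T.X0 * x) ^ (T.L.D * T.L.f1) * (cst R T.U0 * u) ^ (-(T.L.D * T.L.e1)),
    (cst R T.X0 * x) ^ (-(T.L.D * T.L.f0)) * (cst R T.U0 * u) ^ (T.L.D * T.L.e0)]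

theorem x_inv (x u : Rˣ) : T.x (T.inv x u) = x := by
  have h1 : T.L.D * T.L.f1 * T.L.e0 + -(T.L.D * T.L.f0) * T.L.e1 = 1 := by
    linear_combination T.L.D * T.L.det_eq + T.L.sq_eq
  have h2 : -(T.L.D * T.L.e1) * T.L.e0 + (T.L.D * T.L.e0) * T.L.e1 = 0 := by ring
  simp only [TorusChart.x, inv, Matrix.cons_val_zero, Matrix.cons_val_one]
  rw [zpow_mul_zpow_comb, h1, h2, zpow_one, zpow_zero, mul_one, inv_mul_cancel_left]

theorem u_inv (x u : Rˣ) : T.u (T.inv x u) = u := by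
  have h1 : T.L.D * T.L.f1 * T.L.f0 + -(T.L.D * T.L.f0) * T.L.f1 = 0 := by ring
  have h2 : -(T.L.D * T.L.e1) * T.L.f0 + (T.L.D * T.L.e0) * T.L.f1 = 1 := by
    linear_combination T.L.D * T.L.det_eq + T.L.sq_eq
  simp only [TorusChart.u, inv, Matrix.cons_val_zero, Matrix.cons_val_one]
  rw [zpow_mul_zpow_comb, h1, h2, zpow_one, zpow_zero, one_mul, inv_mul_cancel_left]

theorem inv_x_u (z : Fin 2 → Rˣ) : T.inv (T.x z) (T.u z) = z := by
  have k1 : T.L.e0 * (T.L.D * T.L.f1) + T.L.f0 * -(T.L.D * T.L.e1) = 1 := by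
    linear_combination T.L.D * T.L.det_eq + T.L.sq_eq
  have k2 : T.L.e1 * (T.L.D * T.L.f1) + T.L.f1 * -(T.L.D * T.L.e1) = 0 := by ring
  have k3 : T.L.e0 * -(T.L.D * T.L.f0) + T.L.f0 * (T.L.D * T.L.e0) = 0 := by ring
  have k4 : T.L.e1 * -(T.L.D * T.L.f0) + T.L.f1 * (T.L.D * T.L.e0) = 1 := by
    linear_combination T.L.D * T.L.det_eq + T.L.sq_eq
  funext l
  fin_cases l
  · change (cst R T.X0 * T.x z) ^ _ * (cst R T.U0 * T.u z) ^ _ = z 0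
    rw [x, u, mul_inv_cancel_left, mul_inv_cancel_left, zpow_mul_zpow_comb, k1, k2, zpow_one, zpow_zero,
      mul_one]
  · change (cst R T.X0 * T.x z) ^ _ * (cst R T.U0 * T.u z) ^ _ = z 1
    rw [x, u, mul_inv_cancel_left, mul_inv_cancel_left, zpow_mul_zpow_comb, k3, k4, zpow_one, zpow_zero,
      one_mul]

theorem ext_of {z z' : Fin 2 → Rˣ} (hx : T.x z = T.x z') (hu : T.u z = T.u z') : z = z' := by
  rw [← T.inv_x_u z, hx, hu, T.inv_x_u]

theorem map_cst (f : R →ₐ[Puiseux] S) (c : Puiseuxˣ) :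
    Units.map (f : R →* S) (cst R c) = cst S c :=
  Units.ext (f.commutes c)

theorem map_x (f : R →ₐ[Puiseux] S) (z : Fin 2 → Rˣ) :
    Units.map (f : R →* S) (T.x z) = T.x fun i => Units.map (f : R →* S) (z i) := by
  simp only [x, map_mul, map_inv, map_zpow, map_cst]

theorem map_u (f : R →ₐ[Puiseux] S) (z : Fin 2 → Rˣ) :
    Units.map (f : R →* S) (T.u z) = T.u fun i => Units.map (f : R →* S) (z i) := by
  simp only [u, map_mul, map_inv, map_zpow, map_cst]

theorem map_w (f : R →ₐ[Puiseux] S) (z : Fin 2 → Rˣ) :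
    Units.map (f : R →* S) (T.w z) = T.w fun i => Units.map (f : R →* S) (z i) := by
  simp only [w, map_mul, map_inv, map_zpow, map_cst]

/-- The constants of the chart are real. -/
def IsReal : Prop := IsRealSeries T.X0 ∧ IsRealSeries T.U0 ∧ IsRealSeries T.W0

theorem cst_self (c : Puiseuxˣ) : cst Puiseux c = c := Units.ext rfl

theorem conj_unit {c : Puiseuxˣ} (hc : IsRealSeries c) : Units.map (conj : Puiseux →* Puiseux) c = c :=
  Units.ext (isRealSeries_iff.1 hc)

theorem conj_x (hT : T.IsReal) (z : Fin 2 → Puiseuxˣ) :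
    Units.map (conj : Puiseux →* Puiseux) (T.x z) =
      T.x fun i => Units.map (conj : Puiseux →* Puiseux) (z i) := by
  simp only [x, map_mul, map_inv, map_zpow, cst_self, conj_unit hT.1]

theorem conj_u (hT : T.IsReal) (z : Fin 2 → Puiseuxˣ) :
    Units.map (conj : Puiseux →* Puiseux) (T.u z) =
      T.u fun i => Units.map (conj : Puiseux →* Puiseux) (z i) := by
  simp only [u, map_mul, map_inv, map_zpow, cst_self, conj_unit hT.2.1]

end TorusChart

/-- Real constants of non-negative order in an algebra. -/
def realCst (R : Type) [CommRing R] [Algebra Puiseux R] : realRing →+* R :=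
  (algebraMap Puiseux R).comp realRing.subtype

theorem map_realCst {R S : Type} [CommRing R] [Algebra Puiseux R] [CommRing S]
    [Algebra Puiseux S] (f : R →ₐ[Puiseux] S) (b : realRing) : f (realCst R b) = realCst S b :=
  f.commutes _

/-- The first expression of the system. -/
def QuadSystem.exprA (D : QuadSystem realRing) (a : realRing) (R : Type) [CommRing R]
    [Algebra Puiseux R] (x y u w : R) : R :=
  realCst R a + u + w + eval₂ (realCst R) ![x, y, u, w] D.ψA

/-- The second expression of the system. -/
def QuadSystem.exprB (D : QuadSystem realRing) (a : realRing) (R : Type) [CommRing R]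
    [Algebra Puiseux R] (x y u w : R) : R :=
  x - realCst R (D.x₀ + D.ε * a) + eval₂ (realCst R) ![x, y, u, w] D.ψB

/-- In the coordinates of `T`, the intersection of the curves of `F` and `G` over `e` is described
by the system `D` at the parameter `a`. -/
structure IsQuadChart (F G : MvPolynomial (Fin 2) Puiseux) (e : Set (Fin 2 → ℝ)) (T : TorusChart)
    (D : QuadSystem realRing) (a : realRing) : Prop where
  real : T.IsReal
  small : D.Small realIdeal
  isUnit : IsUnit (D.x₀ + D.ε * a)
  θ_eq : ∀ (R : Type) [CommRing R] [Algebra Puiseux R] (x : Rˣ),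
    realCst R D.θ * eval₂ (realCst R) ![(x : R), ((x⁻¹ : Rˣ) : R)] D.h =
      ((TorusChart.cst R T.θ * x ^ T.k : Rˣ) : R)
  eq_F : ∀ (R : Type) [CommRing R] [Algebra Puiseux R] (z : Fin 2 → Rˣ), ∃ (c : Rˣ) (b : R),
    aeval (fun i => (z i : R)) F = c * (D.exprA a R (T.x z) ((T.x z)⁻¹ : Rˣ) (T.u z) (T.w z) +
      b * D.exprB a R (T.x z) ((T.x z)⁻¹ : Rˣ) (T.u z) (T.w z))
  eq_G : ∀ (R : Type) [CommRing R] [Algebra Puiseux R] (z : Fin 2 → Rˣ), ∃ c : Rˣ,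
    aeval (fun i => (z i : R)) G = c * D.exprB a R (T.x z) ((T.x z)⁻¹ : Rˣ) (T.u z) (T.w z)
  trop : ∀ z : Fin 2 → Puiseuxˣ, tropPoint (fun i => (z i : Puiseux)) ∈ e ↔
    ord (T.x z : Puiseux) = 0 ∧ 0 ≤ ord (T.u z : Puiseux) ∧ 0 ≤ ord (T.w z : Puiseux)

/-! ### Points over the edge and roots of the quadratic polynomial -/

theorem isUnit_valRing_iff {x : valRing} : IsUnit x ↔ ord (x : Puiseux) = 0 := by
  constructor
  · rintro ⟨⟨x, y, hxy, -⟩, rfl⟩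
    have h : (x : Puiseux) * y = 1 := congrArg Subtype.val hxy
    have h1 := congrArg ord h
    rw [ord_mul, ord_one] at h1
    exact le_antisymm (by
      calc ord (x : Puiseux) = ord (x : Puiseux) + 0 := (add_zero _).symm
        _ ≤ ord (x : Puiseux) + ord (y : Puiseux) := by gcongr; exact y.2
        _ = 0 := h1) x.2
  · intro h
    have hx := ne_zero_of_ord_eq_zero h
    exact IsUnit.of_mul_eq_one (⟨(x : Puiseux)⁻¹, (ord_inv_of_ord_eq_zero h).ge⟩ : valRing)
      (Subtype.ext (mul_inv_cancel₀ hx))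

theorem ord_add_one_eq_zero {x : Puiseux} (hx : 0 < ord x) : ord (x + 1) = 0 := by
  rw [add_comm, ord_add_eq_left (by rwa [ord_one]), ord_one]

theorem ord_pos_of_mem_mul {b c : Puiseux} (hb : 0 < ord b) (hc : 0 ≤ ord c) : 0 < ord (b * c) := by
  rw [ord_mul]
  exact lt_of_lt_of_le hb (by
    calc ord b = ord b + 0 := (add_zero _).symm
      _ ≤ ord b + ord c := by gcongr)

/-- The inclusion of the real series of non-negative order. -/
def realToVal : realRing →+* valRing := Subring.inclusion inf_le_left

/-- The hypothesis of `QuadSystem.IsSol.mem_ideal` for the valuation ring of the complex series,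
where x, y, u, w of a point over `e` live. -/
theorem realToVal_mem_jacobson (b : realRing) (hb : b ∈ realIdeal) :
    realToVal b ∈ Ideal.jacobson (⊥ : Ideal valRing) := by
  rw [Ideal.mem_jacobson_bot]
  intro c
  rw [isUnit_valRing_iff]
  exact ord_add_one_eq_zero (ord_pos_of_mem_mul hb c.2)

/-- The valuation ring is integrally closed: a root of negative order would make 1 an element of
positive order. -/
theorem ord_nonneg_of_root {p q r : Puiseux} (hp : 0 ≤ ord p) (hq : 0 ≤ ord q)
    (hr : r ^ 2 + p * r + q = 0) : 0 ≤ ord r := by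
  by_contra hneg
  have hr0 : r ≠ 0 := by rintro rfl; simp at hneg
  have hinv : 0 < ord r⁻¹ := by
    rw [ord_pos_iff (inv_ne_zero hr0), val_inv hr0]
    rw [ord_nonneg_iff hr0] at hneg
    linarith
  have h1 : (1 : Puiseux) = -(r⁻¹ * (p + q * r⁻¹)) := by
    field_simp
    linear_combination hr
  have h2 : 0 < ord (1 : Puiseux) := by
    rw [h1, ord_neg]
    refine ord_pos_of_mem_mul hinv (le_trans (le_min hp ?_) (ord_add _ _))
    rw [ord_mul]
    exact add_nonneg hq hinv.le
  simp at h2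

namespace IsQuadChart

variable {F G : MvPolynomial (Fin 2) Puiseux} {e : Set (Fin 2 → ℝ)} {T : TorusChart}
  {D : QuadSystem realRing} {a p κ : realRing} {X Y U : QuadraticAlgebra realRing (-(D.θ * κ)) (-p)}

/-- Evaluation of an element of the quadratic algebra. -/
def lin {b c : realRing} (R : Type) [CommRing R] [Algebra Puiseux R] (s : QuadraticAlgebra realRing b c)
    (r : R) : R := realCst R s.re + realCst R s.im * r

/-- `r` is a root of the quadratic polynomial. -/
def IsRoot (D : QuadSystem realRing) (p κ : realRing) (r : Puiseux) : Prop :=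
  r ^ 2 + p * r + (D.θ * κ : realRing) = 0

/-- The point `z` corresponds to the root `r`. -/
structure IsPt (T : TorusChart) (X U : QuadraticAlgebra realRing (-(D.θ * κ)) (-p))
    (z : Fin 2 → Puiseuxˣ) (r : Puiseux) : Prop where
  w : (T.w z : Puiseux) = r
  x : (T.x z : Puiseux) = lin Puiseux X r
  u : (T.u z : Puiseux) = lin Puiseux U r

theorem IsPt.unique {z z' : Fin 2 → Puiseuxˣ} {r : Puiseux} (h : IsPt T X U z r)
    (h' : IsPt T X U z' r) : z = z' :=
  T.ext_of (Units.ext (h.x.trans h'.x.symm)) (Units.ext (h.u.trans h'.u.symm))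

theorem conj_lin {b c : realRing} (s : QuadraticAlgebra realRing b c) (r : Puiseux) :
    conj (lin Puiseux s r) = lin Puiseux s (conj r) := by
  have h : ∀ b : realRing, conj (realCst Puiseux b) = realCst Puiseux b :=
    fun b => isRealSeries_iff.1 (mem_realRing.1 b.2).2
  rw [lin, map_add, map_mul, h, h, lin]

theorem IsPt.conj_eq (hT : T.IsReal) {z z' : Fin 2 → Puiseuxˣ} {r r' : Puiseux}
    (h : IsPt T X U z r) (h' : IsPt T X U z' r') (hr : r' = conj r) (i : Fin 2) :
    (z' i : Puiseux) = conj (z i) := by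
  have h1 : z' = fun i => Units.map (conj : Puiseux →* Puiseux) (z i) := by
    refine T.ext_of (Units.ext ?_) (Units.ext ?_)
    · rw [← T.conj_x hT, h'.x, hr, ← conj_lin, ← h.x]; rfl
    · rw [← T.conj_u hT, h'.u, hr, ← conj_lin, ← h.u]; rfl
  rw [h1]; rfl

variable (hC : IsQuadChart F G e T D a)

include hC

/-- Up to units, F is the first expression of the system plus a multiple of the second, and G is the
second; an ideal containing F and G contains both expressions. -/
theorem span_le {R : Type} [CommRing R] [Algebra Puiseux R] (z : Fin 2 → Rˣ) {I : Ideal R}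
    (hF : aeval (fun i => (z i : R)) F ∈ I) (hG : aeval (fun i => (z i : R)) G ∈ I) :
    D.exprA a R (T.x z) ((T.x z)⁻¹ : Rˣ) (T.u z) (T.w z) ∈ I ∧
      D.exprB a R (T.x z) ((T.x z)⁻¹ : Rˣ) (T.u z) (T.w z) ∈ I := by
  obtain ⟨c, b, h1⟩ := hC.eq_F R z
  obtain ⟨c', h2⟩ := hC.eq_G R z
  rw [h1, Ideal.unit_mul_mem_iff_mem _ c.isUnit] at hF
  rw [h2, Ideal.unit_mul_mem_iff_mem _ c'.isUnit] at hG
  refine ⟨?_, hG⟩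
  have := I.sub_mem hF (I.mul_mem_left b hG)
  rwa [add_sub_cancel_right] at this

theorem aeval_eq_zero {R : Type} [CommRing R] [Algebra Puiseux R] (z : Fin 2 → Rˣ)
    (hA : D.exprA a R (T.x z) ((T.x z)⁻¹ : Rˣ) (T.u z) (T.w z) = 0)
    (hB : D.exprB a R (T.x z) ((T.x z)⁻¹ : Rˣ) (T.u z) (T.w z) = 0) :
    aeval (fun i => (z i : R)) F = 0 ∧ aeval (fun i => (z i : R)) G = 0 := by
  obtain ⟨c, b, h1⟩ := hC.eq_F R z
  obtain ⟨c', h2⟩ := hC.eq_G R z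
  rw [h1, h2, hA, hB]
  simp

/-- A root in an algebra gives a point over this algebra. -/
theorem exists_point_of_root (hS : D.IsSol a p κ X Y U) {R : Type} [CommRing R]
    [Algebra Puiseux R] (r : R) (hr : r ^ 2 + realCst R p * r + realCst R (D.θ * κ) = 0) :
    ∃ z : Fin 2 → Rˣ, (T.x z : R) = lin R X r ∧ (T.u z : R) = lin R U r ∧ (T.w z : R) = r ∧
      (((T.x z)⁻¹ : Rˣ) : R) = lin R Y r ∧
      aeval (fun i => (z i : R)) F = 0 ∧ aeval (fun i => (z i : R)) G = 0 := by
  obtain ⟨hB, hxy, hA, huw⟩ := hS.map (realCst R) r hr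
  change lin R X r * lin R Y r = 1 at hxy
  change lin R U r * r = realCst R D.θ * eval₂ (realCst R) ![lin R X r, lin R Y r] D.h at huw
  let x : Rˣ := ⟨lin R X r, lin R Y r, hxy, by rw [mul_comm, hxy]⟩
  have hθ := hC.θ_eq R x
  have huw' : lin R U r * r = ((TorusChart.cst R T.θ * x ^ T.k : Rˣ) : R) := by
    rw [← hθ, huw]; rfl
  -- In u r = θ xᵏ the right side is a unit because θ is a non-zero constant, so u is invertible and
  -- x, u determine a point of the torus.
  have hu : IsUnit (lin R U r) := isUnit_of_mul_isUnit_left (huw' ▸ Units.isUnit _)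
  obtain ⟨u, hu⟩ := hu
  -- Both w and r are the quotient of θ xᵏ by u.
  have hw : ((T.w (T.inv x u) : Rˣ) : R) = r := by
    have h1 := T.u_mul_w (T.inv x u)
    rw [T.u_inv, T.x_inv] at h1
    have h2 := congrArg Units.val h1
    rw [Units.val_mul, ← huw', ← hu] at h2
    exact (Units.mul_right_inj u).1 h2
  have hxv : ((T.x (T.inv x u) : Rˣ) : R) = lin R X r := by rw [T.x_inv]
  have huv : ((T.u (T.inv x u) : Rˣ) : R) = lin R U r := by rw [T.u_inv, hu]
  have hyv : (((T.x (T.inv x u))⁻¹ : Rˣ) : R) = lin R Y r := by rw [T.x_inv]; rfl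
  refine ⟨T.inv x u, hxv, huv, hw, hyv, hC.aeval_eq_zero _ ?_ ?_⟩
  · rw [QuadSystem.exprA, hxv, huv, hyv, hw]; exact hA
  · rw [QuadSystem.exprB, hxv, huv, hyv, hw]; exact hB

/-- The root has non-negative order, hence so do X(r), Y(r) and U(r). The first two are mutually
inverse, so x has order zero and the point lies over `e`. -/
theorem exists_mem_interPoints (hS : D.IsSol a p κ X Y U) {r : Puiseux} (hr : IsRoot D p κ r) :
    ∃ z : Fin 2 → Puiseuxˣ, IsPt T X U z r ∧ (fun i => (z i : Puiseux)) ∈ interPoints F G e := by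
  obtain ⟨z, h1, h2, h3, h4, h5, h6⟩ := hC.exists_point_of_root hS r hr
  refine ⟨z, ⟨h3, h1, h2⟩, ⟨fun i => (z i).ne_zero, h5⟩, ⟨fun i => (z i).ne_zero, h6⟩, ?_⟩
  have hr0 : 0 ≤ ord r := ord_nonneg_of_root p.2.1 (D.θ * κ).2.1 hr
  have hlin : ∀ s : QuadraticAlgebra realRing (-(D.θ * κ)) (-p), lin Puiseux s r ∈ valRing :=
    fun s => valRing.add_mem s.re.2.1 (valRing.mul_mem s.im.2.1 hr0)
  rw [hC.trop]
  refine ⟨?_, by rw [h2]; exact hlin U, by rw [h3]; exact hr0⟩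
  have h7 : IsUnit (⟨lin Puiseux X r, hlin X⟩ : valRing) := by
    refine IsUnit.of_mul_eq_one (⟨lin Puiseux Y r, hlin Y⟩ : valRing) (Subtype.ext ?_)
    change lin Puiseux X r * lin Puiseux Y r = 1
    rw [← h1, ← h4, Units.mul_inv]
  rw [h1]
  exact isUnit_valRing_iff.1 h7

/-- A point over `e` has x, y, u, w in the valuation ring, so Nakayama's argument applies there with
the zero ideal and shows that w is a root and determines x and u. -/
theorem exists_root_of_mem (hS : D.IsSol a p κ X Y U) {q : Fin 2 → Puiseux}
    (hq : q ∈ interPoints F G e) : ∃ (z : Fin 2 → Puiseuxˣ) (r : Puiseux),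
      q = (fun i => (z i : Puiseux)) ∧ IsRoot D p κ r ∧ IsPt T X U z r := by
  obtain ⟨⟨hq0, hF⟩, ⟨-, hG⟩, ht⟩ := hq
  let z : Fin 2 → Puiseuxˣ := fun i => Units.mk0 (q i) (hq0 i)
  refine ⟨z, T.w z, rfl, ?_⟩
  obtain ⟨hx, hu, hw⟩ := (hC.trop z).1 ht
  obtain ⟨hA, hB⟩ := hC.span_le (I := ⊥) z (Ideal.mem_bot.2 hF) (Ideal.mem_bot.2 hG)
  rw [Ideal.mem_bot] at hA hB
  have hy : 0 ≤ ord (((T.x z)⁻¹ : Puiseuxˣ) : Puiseux) := by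
    rw [Units.val_inv_eq_inv_val, ord_inv_of_ord_eq_zero hx]
  let x' : valRing := ⟨T.x z, hx.ge⟩
  let y' : valRing := ⟨((T.x z)⁻¹ : Puiseuxˣ), hy⟩
  let u' : valRing := ⟨T.u z, hu⟩
  let w' : valRing := ⟨T.w z, hw⟩
  have hcomp : valRing.subtype.comp realToVal = realCst Puiseux := rfl
  have h4 : ∀ P : MvPolynomial (Fin 4) realRing, ((eval₂ realToVal ![x', y', u', w'] P : valRing) :
      Puiseux) = eval₂ (realCst Puiseux) ![(T.x z : Puiseux), ((T.x z)⁻¹ : Puiseuxˣ), T.u z, T.w z] P := by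
    intro P
    have := QuadSystem.hom_eval₂_four valRing.subtype realToVal x' y' u' w' P
    rwa [hcomp] at this
  have h2 : ((eval₂ realToVal ![x', y'] D.h : valRing) : Puiseux) =
      eval₂ (realCst Puiseux) ![(T.x z : Puiseux), ((T.x z)⁻¹ : Puiseuxˣ)] D.h := by
    have := QuadSystem.hom_eval₂_two valRing.subtype realToVal x' y' D.h
    rwa [hcomp] at this
  obtain ⟨k1, k2, k3⟩ := hS.mem_ideal hC.small realToVal realToVal_mem_jacobson (x := x') (y := y')
    (u := u') (w := w') (I := ⊥) (Subtype.ext (Units.mul_inv _))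
    (Subtype.ext (by
      change ((T.u z : Puiseuxˣ) : Puiseux) * (T.w z : Puiseuxˣ) = (D.θ : Puiseux) * _
      rw [h2]
      have := hC.θ_eq Puiseux (T.x z)
      rw [← T.u_mul_w z] at this
      exact this.symm))
    (by rw [Ideal.mem_bot]; apply Subtype.ext; exact (congrArg (fun t => (T.x z : Puiseux) - realCst Puiseux (D.x₀ + D.ε * a) + t) (h4 D.ψB)).trans hB)
    (by rw [Ideal.mem_bot]; apply Subtype.ext; exact (congrArg (fun t => realCst Puiseux a + (T.u z : Puiseux) + T.w z + t) (h4 D.ψA)).trans hA)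
  rw [Ideal.mem_bot] at k1 k2 k3
  exact ⟨congrArg Subtype.val k3, ⟨rfl, sub_eq_zero.1 (congrArg Subtype.val k1),
    sub_eq_zero.1 (congrArg Subtype.val k2)⟩⟩

end IsQuadChart
end

noncomputable section
open MvPolynomial Puiseux

/-! ### Intersection multiplicities -/

namespace LocalRingAt

variable (z : Fin 2 → Puiseuxˣ)

/-- The point with coordinates `z`. -/
abbrev pt : Fin 2 → Puiseux := fun i => (z i : Puiseux)

theorem isUnit_algebraMap_iff (f : MvPolynomial (Fin 2) Puiseux) :
    IsUnit (algebraMap _ (LocalRingAt (pt z)) f) ↔ eval (pt z) f ≠ 0 := by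
  rw [IsLocalization.AtPrime.isUnit_to_map_iff (LocalRingAt (pt z)) (pointIdeal (pt z)) f]
  exact Iff.rfl

/-- The coordinate functions, as units of the local ring. -/
def coord : Fin 2 → (LocalRingAt (pt z))ˣ := fun i =>
  ((isUnit_algebraMap_iff z (X i)).2 (by rw [eval_X]; exact (z i).ne_zero)).unit

theorem algebraMap_eq_aeval (f : MvPolynomial (Fin 2) Puiseux) :
    algebraMap _ (LocalRingAt (pt z)) f = aeval (fun i => (coord z i : LocalRingAt (pt z))) f := by
  have h : IsScalarTower.toAlgHom Puiseux (MvPolynomial (Fin 2) Puiseux) (LocalRingAt (pt z)) =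
      aeval fun i => (coord z i : LocalRingAt (pt z)) := by
    refine MvPolynomial.algHom_ext fun i => ?_
    rw [aeval_X]
    rfl
  exact congrArg (fun g => g f) h

/-- The homomorphism from the local ring given by a point over an algebra. -/
def lift {S : Type} [CommRing S] [Algebra Puiseux S] (zS : Fin 2 → Sˣ)
    (h : ∀ f : MvPolynomial (Fin 2) Puiseux, eval (pt z) f ≠ 0 →
      IsUnit (aeval (fun i => (zS i : S)) f)) : LocalRingAt (pt z) →ₐ[Puiseux] S :=
  IsLocalization.liftAlgHom (M := (pointIdeal (pt z)).primeCompl)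
    (f := aeval fun i => (zS i : S)) fun y => h y y.2

theorem lift_algebraMap {S : Type} [CommRing S] [Algebra Puiseux S] (zS : Fin 2 → Sˣ)
    (h : ∀ f : MvPolynomial (Fin 2) Puiseux, eval (pt z) f ≠ 0 →
      IsUnit (aeval (fun i => (zS i : S)) f)) (f : MvPolynomial (Fin 2) Puiseux) :
    lift z zS h (algebraMap _ _ f) = aeval (fun i => (zS i : S)) f :=
  IsLocalization.lift_eq _ _

theorem map_lift_coord {S : Type} [CommRing S] [Algebra Puiseux S] (zS : Fin 2 → Sˣ)
    (h : ∀ f : MvPolynomial (Fin 2) Puiseux, eval (pt z) f ≠ 0 →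
      IsUnit (aeval (fun i => (zS i : S)) f)) :
    (fun i => Units.map (lift z zS h : LocalRingAt (pt z) →* S) (coord z i)) = zS := by
  funext i
  apply Units.ext
  change lift z zS h (algebraMap _ _ (X i)) = _
  rw [lift_algebraMap, aeval_X]

/-- Evaluation at the point. -/
def ev : LocalRingAt (pt z) →ₐ[Puiseux] Puiseux :=
  lift z z fun _ hf => isUnit_iff_ne_zero.2 hf

theorem map_ev_coord :
    (fun i => Units.map (ev z : LocalRingAt (pt z) →* Puiseux) (coord z i)) = z :=
  map_lift_coord z z _

theorem isUnit_of_ev_ne_zero {x : LocalRingAt (pt z)} (hx : ev z x ≠ 0) : IsUnit x := by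
  obtain ⟨⟨f, s⟩, h⟩ := IsLocalization.surj (pointIdeal (pt z)).primeCompl x
  have h1 := congrArg (ev z) h
  rw [map_mul, ev, lift_algebraMap, lift_algebraMap] at h1
  have hs : eval (pt z) (s : MvPolynomial (Fin 2) Puiseux) ≠ 0 := s.2
  have hf : eval (pt z) f ≠ 0 := by
    intro h0
    have h2 : ev z x * eval (pt z) (s : MvPolynomial (Fin 2) Puiseux) = 0 := h1.trans h0
    exact (mul_ne_zero hx hs) h2
  exact isUnit_of_mul_isUnit_left (h ▸ (isUnit_algebraMap_iff z f).2 hf)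

/-- The elements of the local ring whose value at the point has non-negative order. -/
def valSubring : Subring (LocalRingAt (pt z)) := valRing.comap (ev z : LocalRingAt (pt z) →+* Puiseux)

/-- The inclusion of the constants. -/
def realToSub : realRing →+* valSubring z :=
  (realCst (LocalRingAt (pt z))).codRestrict (valSubring z) fun b => by
    change (ev z) (algebraMap Puiseux _ (b : Puiseux)) ∈ valRing
    rw [AlgHom.commutes]
    exact b.2.1

/-- Constants of positive order are zero or units in the local ring, so Nakayama's lemma has to be
used in a smaller ring. In `valSubring` the element 1 + b c has a value of order zero; its inverse
exists in the local ring and again has a value of order zero. -/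
theorem realToSub_mem_jacobson (b : realRing) (hb : b ∈ realIdeal) :
    realToSub z b ∈ Ideal.jacobson (⊥ : Ideal (valSubring z)) := by
  rw [Ideal.mem_jacobson_bot]
  intro c
  have h1 : ev z ((realToSub z b * c + 1 : valSubring z) : LocalRingAt (pt z)) =
      (b : Puiseux) * ev z c + 1 := by
    change ev z (realCst (LocalRingAt (pt z)) b * (c : LocalRingAt (pt z)) + 1) = _
    rw [map_add, map_mul, map_realCst, map_one]; rfl
  have h2 : ord ((b : Puiseux) * ev z c + 1) = 0 := ord_add_one_eq_zero (ord_pos_of_mem_mul hb c.2)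
  obtain ⟨v, hv⟩ := isUnit_of_ev_ne_zero z
    (x := ((realToSub z b * c + 1 : valSubring z) : LocalRingAt (pt z)))
    (by rw [h1]; exact ne_zero_of_ord_eq_zero h2)
  have h3 : ev z (v⁻¹ : (LocalRingAt (pt z))ˣ) ∈ valRing := by
    have h4 : ev z (v⁻¹ : (LocalRingAt (pt z))ˣ) = ((b : Puiseux) * ev z c + 1)⁻¹ := by
      refine eq_inv_of_mul_eq_one_left ?_
      rw [← h1, ← hv, ← map_mul, Units.inv_mul, map_one]
    rw [h4]
    exact (ord_inv_of_ord_eq_zero h2).ge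
  refine IsUnit.of_mul_eq_one (⟨(v⁻¹ : (LocalRingAt (pt z))ˣ), h3⟩ : valSubring z) (Subtype.ext ?_)
  change ((realToSub z b * c + 1 : valSubring z) : LocalRingAt (pt z)) * (v⁻¹ : (LocalRingAt (pt z))ˣ) = 1
  rw [← hv, Units.mul_inv]

end LocalRingAt

/-! ### The local algebra of the intersection -/

namespace IsQuadChart

open LocalRingAt

variable {F G : MvPolynomial (Fin 2) Puiseux} {e : Set (Fin 2 → ℝ)} {T : TorusChart}
  {D : QuadSystem realRing} {a p κ : realRing} {X Y U : QuadraticAlgebra realRing (-(D.θ * κ)) (-p)}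
  {z : Fin 2 → Puiseuxˣ} {r : Puiseux}

/-- The ideal of the intersection in the local ring. -/
abbrev interIdeal (F G : MvPolynomial (Fin 2) Puiseux) (z : Fin 2 → Puiseuxˣ) :
    Ideal (LocalRingAt (pt z)) :=
  Ideal.span {algebraMap _ (LocalRingAt (pt z)) F, algebraMap _ (LocalRingAt (pt z)) G}

theorem map_lin {R S : Type} [CommRing R] [Algebra Puiseux R] [CommRing S] [Algebra Puiseux S]
    (f : R →ₐ[Puiseux] S) {b c : realRing} (s : QuadraticAlgebra realRing b c) (r : R) :
    f (lin R s r) = lin S s (f r) := by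
  rw [lin, map_add, map_mul, map_realCst, map_realCst, lin]

theorem interIdeal_le_ker (hz : pt z ∈ interPoints F G e) :
    interIdeal F G z ≤ RingHom.ker (ev z) := by
  rw [Ideal.span_le]
  have h : ∀ f : MvPolynomial (Fin 2) Puiseux, ev z (algebraMap _ _ f) = eval (pt z) f :=
    fun f => lift_algebraMap z z _ f
  rintro _ (rfl | rfl)
  · rw [SetLike.mem_coe, RingHom.mem_ker, h]; exact hz.1.2
  · rw [SetLike.mem_coe, RingHom.mem_ker, h]; exact hz.2.1.2

variable (hC : IsQuadChart F G e T D a)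

include hC

/-- The argument of `exists_root_of_mem` for the generic functions near the point: it is carried out
in `valSubring` with the contraction of the intersection ideal. -/
theorem relations_mem (hS : D.IsSol a p κ X Y U) (hz : pt z ∈ interPoints F G e) :
    (T.x (coord z) : LocalRingAt (pt z)) - lin _ X (T.w (coord z) : LocalRingAt (pt z)) ∈
        interIdeal F G z ∧
      (T.u (coord z) : LocalRingAt (pt z)) - lin _ U (T.w (coord z) : LocalRingAt (pt z)) ∈
        interIdeal F G z ∧
      (T.w (coord z) : LocalRingAt (pt z)) ^ 2 + realCst _ p * T.w (coord z) +
        realCst _ (D.θ * κ) ∈ interIdeal F G z := by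
  set A := LocalRingAt (pt z)
  set ζ := coord z
  obtain ⟨hx, hu, hw⟩ := (hC.trop z).1 hz.2.2
  have hF : aeval (fun i => (ζ i : A)) F ∈ interIdeal F G z := by
    rw [← algebraMap_eq_aeval]; exact Ideal.subset_span (by simp)
  have hG : aeval (fun i => (ζ i : A)) G ∈ interIdeal F G z := by
    rw [← algebraMap_eq_aeval]; exact Ideal.subset_span (by simp)
  obtain ⟨hA, hB⟩ := hC.span_le ζ hF hG
  have hy : 0 ≤ ord (((T.x z)⁻¹ : Puiseuxˣ) : Puiseux) := by
    rw [Units.val_inv_eq_inv_val, ord_inv_of_ord_eq_zero hx]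
  have ex : Units.map (ev z : A →* Puiseux) (T.x ζ) = T.x z := by
    rw [T.map_x, map_ev_coord]
  have eu : Units.map (ev z : A →* Puiseux) (T.u ζ) = T.u z := by
    rw [T.map_u, map_ev_coord]
  have ew : Units.map (ev z : A →* Puiseux) (T.w ζ) = T.w z := by
    rw [T.map_w, map_ev_coord]
  have ey : Units.map (ev z : A →* Puiseux) (T.x ζ)⁻¹ = (T.x z)⁻¹ := by
    rw [map_inv, ex]
  let x' : valSubring z := ⟨T.x ζ, by
    change 0 ≤ ord ((Units.map (ev z : A →* Puiseux) (T.x ζ) : Puiseuxˣ) : Puiseux)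
    rw [ex]; exact hx.ge⟩
  let y' : valSubring z := ⟨((T.x ζ)⁻¹ : Aˣ), by
    change 0 ≤ ord ((Units.map (ev z : A →* Puiseux) (T.x ζ)⁻¹ : Puiseuxˣ) : Puiseux)
    rw [ey]; exact hy⟩
  let u' : valSubring z := ⟨T.u ζ, by
    change 0 ≤ ord ((Units.map (ev z : A →* Puiseux) (T.u ζ) : Puiseuxˣ) : Puiseux)
    rw [eu]; exact hu⟩
  let w' : valSubring z := ⟨T.w ζ, by
    change 0 ≤ ord ((Units.map (ev z : A →* Puiseux) (T.w ζ) : Puiseuxˣ) : Puiseux)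
    rw [ew]; exact hw⟩
  have hcomp : (valSubring z).subtype.comp (realToSub z) = realCst A := rfl
  have h4 : ∀ P : MvPolynomial (Fin 4) realRing, ((eval₂ (realToSub z) ![x', y', u', w'] P :
      valSubring z) : A) =
        eval₂ (realCst A) ![(T.x ζ : A), ((T.x ζ)⁻¹ : Aˣ), T.u ζ, T.w ζ] P := by
    intro P
    have := QuadSystem.hom_eval₂_four (valSubring z).subtype (realToSub z) x' y' u' w' P
    rwa [hcomp] at this
  have h2 : ((eval₂ (realToSub z) ![x', y'] D.h : valSubring z) : A) =
      eval₂ (realCst A) ![(T.x ζ : A), ((T.x ζ)⁻¹ : Aˣ)] D.h := by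
    have := QuadSystem.hom_eval₂_two (valSubring z).subtype (realToSub z) x' y' D.h
    rwa [hcomp] at this
  obtain ⟨k1, k2, k3⟩ := hS.mem_ideal hC.small (realToSub z) (realToSub_mem_jacobson z) (x := x')
    (y := y') (u := u') (w := w') (I := (interIdeal F G z).comap (valSubring z).subtype)
    (Subtype.ext (Units.mul_inv _))
    (Subtype.ext (by
      change ((T.u ζ : Aˣ) : A) * (T.w ζ : Aˣ) = realCst A D.θ * _
      rw [h2]
      have := hC.θ_eq A (T.x ζ)
      rw [← T.u_mul_w ζ] at this
      exact this.symm))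
    (by
      rw [Ideal.mem_comap]
      have h5 : (valSubring z).subtype (x' - realToSub z (D.x₀ + D.ε * a) +
          eval₂ (realToSub z) ![x', y', u', w'] D.ψB) = D.exprB a A (T.x ζ) ((T.x ζ)⁻¹ : Aˣ)
            (T.u ζ) (T.w ζ) := by
        rw [QuadSystem.exprB, ← h4]; rfl
      rw [h5]; exact hB)
    (by
      rw [Ideal.mem_comap]
      have h5 : (valSubring z).subtype (realToSub z a + u' + w' +
          eval₂ (realToSub z) ![x', y', u', w'] D.ψA) = D.exprA a A (T.x ζ) ((T.x ζ)⁻¹ : Aˣ)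
            (T.u ζ) (T.w ζ) := by
        rw [QuadSystem.exprA, ← h4]; rfl
      rw [h5]; exact hA)
  exact ⟨k1, k2, k3⟩

omit hC in
/-- A homomorphism that satisfies the equations of the point is evaluation at the point. -/
theorem eq_algebraMap_ev (hr : IsPt T X U z r) {B : Type} [CommRing B] [Algebra Puiseux B]
    (π : LocalRingAt (pt z) →ₐ[Puiseux] B)
    (h1 : π ((T.x (coord z)).val - lin _ X (T.w (coord z)).val) = 0)
    (h2 : π ((T.u (coord z)).val - lin _ U (T.w (coord z)).val) = 0)
    (hw : π (T.w (coord z)).val = algebraMap Puiseux B r) (f : LocalRingAt (pt z)) :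
    π f = algebraMap Puiseux B (ev z f) := by
  let ι : Puiseux →ₐ[Puiseux] B := Algebra.ofId Puiseux B
  have hι : ∀ b, ι b = algebraMap Puiseux B b := fun b => rfl
  have hcoord : (fun i => Units.map (π : LocalRingAt (pt z) →* B) (coord z i)) =
      fun i => Units.map (ι : Puiseux →* B) (z i) := by
    refine T.ext_of (R := B) ?_ ?_
    · rw [← T.map_x π, ← T.map_x ι]
      apply Units.ext
      change π (T.x (coord z)).val = ι (T.x z).val
      rw [map_sub, sub_eq_zero, map_lin π, hw] at h1
      rw [h1, hr.x, map_lin ι]; rfl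
    · rw [← T.map_u π, ← T.map_u ι]
      apply Units.ext
      change π (T.u (coord z)).val = ι (T.u z).val
      rw [map_sub, sub_eq_zero, map_lin π, hw] at h2
      rw [h2, hr.u, map_lin ι]; rfl
  have hhom : (π : LocalRingAt (pt z) →+* B) = (ι : Puiseux →+* B).comp
      (ev z : LocalRingAt (pt z) →+* Puiseux) := by
    refine IsLocalization.ringHom_ext (pointIdeal (pt z)).primeCompl ?_
    refine MvPolynomial.ringHom_ext (fun c => ?_) fun i => ?_
    · change π (algebraMap _ _ (C c)) = ι (ev z (algebraMap _ _ (C c)))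
      rw [algebraMap_eq_aeval, aeval_C, AlgHom.commutes, AlgHom.commutes, hι]
      rfl
    · have h3 := congrArg Units.val (congrFun hcoord i)
      have h4 : ev z (algebraMap _ _ (MvPolynomial.X i)) = z i :=
        congrArg Units.val (congrFun (map_ev_coord z) i)
      change π (algebraMap _ _ (MvPolynomial.X i)) = ι (ev z (algebraMap _ _ (MvPolynomial.X i)))
      rw [h4]
      exact h3
  exact congrArg (fun g => g f) hhom

/-- Modulo an ideal that contains the equations and `w - r`, every function is constant. -/
theorem sub_ev_mem (hS : D.IsSol a p κ X Y U) (hz : pt z ∈ interPoints F G e)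
    (hr : IsPt T X U z r) {J : Ideal (LocalRingAt (pt z))} (hI : interIdeal F G z ≤ J)
    (hJ : (T.w (coord z)).val - algebraMap Puiseux _ r ∈ J)
    (f : LocalRingAt (pt z)) : f - algebraMap Puiseux _ (ev z f) ∈ J := by
  obtain ⟨h1, h2, -⟩ := hC.relations_mem hS hz
  have hπ : ∀ f ∈ J, Ideal.Quotient.mkₐ Puiseux J f = 0 :=
    fun f hf => Ideal.Quotient.eq_zero_iff_mem.2 hf
  have hw := hπ _ hJ
  rw [map_sub, AlgHom.commutes, sub_eq_zero] at hw
  have h5 := eq_algebraMap_ev (B := LocalRingAt (pt z) ⧸ J) hr (Ideal.Quotient.mkₐ Puiseux J)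
    (hπ _ (hI h1)) (hπ _ (hI h2)) hw f
  rw [← Ideal.Quotient.eq_zero_iff_mem]
  change Ideal.Quotient.mkₐ Puiseux J (f - algebraMap Puiseux _ (ev z f)) = 0
  rw [map_sub, h5, AlgHom.commutes, sub_self]

/-- A simple root gives multiplicity one. -/
theorem interMult_eq_one (hS : D.IsSol a p κ X Y U) (hz : pt z ∈ interPoints F G e)
    (hr : IsPt T X U z r) (hroot : IsRoot D p κ r) (hsimple : 2 * r + p ≠ 0) :
    interMult F G (pt z) = 1 := by
  obtain ⟨-, -, h3⟩ := hC.relations_mem hS hz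
  set w : LocalRingAt (pt z) := (T.w (coord z)).val with hw
  have hev : ev z w = r := by
    rw [← hr.w]
    have : Units.map (ev z : LocalRingAt (pt z) →* Puiseux) (T.w (coord z)) = T.w z := by
      rw [T.map_w, map_ev_coord]
    exact congrArg Units.val this
  have hJ : w - algebraMap Puiseux _ r ∈ interIdeal F G z := by
    -- The cofactor of w - r has the value 2 r + p at the point, which is non-zero for a simple
    -- root, so it is a unit of the local ring.
    have h4 : w ^ 2 + realCst _ p * w + realCst _ (D.θ * κ) =
        (w + algebraMap Puiseux _ (r + p)) * (w - algebraMap Puiseux _ r) := by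
      have h5 := congrArg (algebraMap Puiseux (LocalRingAt (pt z))) hroot
      rw [map_zero, map_add, map_add, map_mul, map_pow] at h5
      rw [map_add, realCst, RingHom.comp_apply, RingHom.comp_apply]
      change w ^ 2 + algebraMap Puiseux _ (p : Puiseux) * w +
        algebraMap Puiseux _ ((D.θ * κ : realRing) : Puiseux) = _
      linear_combination h5
    rw [h4] at h3
    refine (Ideal.unit_mul_mem_iff_mem _ (isUnit_of_ev_ne_zero z ?_)).1 h3
    rw [map_add, hev, AlgHom.commutes]
    change r + (r + p) ≠ 0
    rwa [← add_assoc, ← two_mul]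
  have hne : interIdeal F G z ≠ ⊤ := by
    intro h
    have h1 : (1 : LocalRingAt (pt z)) ∈ interIdeal F G z := by rw [h]; trivial
    have := interIdeal_le_ker hz h1
    rw [RingHom.mem_ker, map_one] at this
    exact one_ne_zero this
  have : Nontrivial (LocalRingAt (pt z) ⧸ interIdeal F G z) := Ideal.Quotient.nontrivial_iff.2 hne
  refine (finrank_eq_one_iff_of_nonzero' (1 : LocalRingAt (pt z) ⧸ interIdeal F G z)
    one_ne_zero).2 fun q => ?_
  obtain ⟨f, rfl⟩ := Ideal.Quotient.mk_surjective q
  refine ⟨ev z f, ?_⟩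
  have h6 := hC.sub_ev_mem hS hz hr le_rfl hJ f
  rw [← Algebra.algebraMap_eq_smul_one]
  exact (Ideal.Quotient.eq.2 h6).symm

/-- A double root gives multiplicity two. -/
theorem interMult_eq_two (hS : D.IsSol a p κ X Y U) (hz : pt z ∈ interPoints F G e)
    (hr : IsPt T X U z r) (hroot : IsRoot D p κ r) (hdouble : 2 * r + p = 0) :
    interMult F G (pt z) = 2 := by
  obtain ⟨-, -, h3⟩ := hC.relations_mem hS hz
  set w : LocalRingAt (pt z) := (T.w (coord z)).val with hw
  have hev : ev z w = r := by
    rw [← hr.w]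
    have : Units.map (ev z : LocalRingAt (pt z) →* Puiseux) (T.w (coord z)) = T.w z := by
      rw [T.map_w, map_ev_coord]
    exact congrArg Units.val this
  set n : LocalRingAt (pt z) := w - algebraMap Puiseux _ r with hn
  have hroot' : ∀ (R : Type) [CommRing R] [Algebra Puiseux R] (s : R),
      s ^ 2 + realCst R p * s + realCst R (D.θ * κ) = (s - algebraMap Puiseux R r) ^ 2 := by
    intro R _ _ s
    have h5 := congrArg (algebraMap Puiseux R) hroot
    have h6 := congrArg (algebraMap Puiseux R) hdouble
    rw [map_zero, map_add, map_add, map_mul, map_pow] at h5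
    rw [map_zero, map_add, map_mul, map_ofNat] at h6
    rw [realCst, RingHom.comp_apply, RingHom.comp_apply]
    change s ^ 2 + algebraMap Puiseux _ (p : Puiseux) * s +
      algebraMap Puiseux _ ((D.θ * κ : realRing) : Puiseux) = _
    linear_combination h5 + (s - algebraMap Puiseux R r) * h6
  have hsq : n ^ 2 ∈ interIdeal F G z := by rw [hn, ← hroot']; exact h3
  -- the lower bound, by a point over the dual numbers
  obtain ⟨zD, d1, d2, d3, -, d5, d6⟩ := hC.exists_point_of_root hS
    (R := DualNumber Puiseux) (algebraMap Puiseux _ r + DualNumber.eps) (by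
      rw [hroot', add_sub_cancel_left, pow_two, DualNumber.eps_mul_eps])
  let fst : DualNumber Puiseux →ₐ[Puiseux] Puiseux := TrivSqZeroExt.fstHom Puiseux Puiseux Puiseux
  have hfst : fst (algebraMap Puiseux _ r + DualNumber.eps) = r := by
    rw [map_add, AlgHom.commutes]
    change r + 0 = r
    rw [add_zero]
  have hzD : (fun i => Units.map (fst : DualNumber Puiseux →* Puiseux) (zD i)) = z := by
    refine T.ext_of (Units.ext ?_) (Units.ext ?_)
    · rw [← T.map_x fst, hr.x]
      change fst (T.x zD : DualNumber Puiseux) = _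
      rw [d1, map_lin, hfst]
    · rw [← T.map_u fst, hr.u]
      change fst (T.u zD : DualNumber Puiseux) = _
      rw [d2, map_lin, hfst]
  have hlift : ∀ f : MvPolynomial (Fin 2) Puiseux, eval (pt z) f ≠ 0 →
      IsUnit (aeval (fun i => (zD i : DualNumber Puiseux)) f) := by
    intro f hf
    rw [TrivSqZeroExt.isUnit_iff_isUnit_fst]
    change IsUnit (fst (aeval (fun i => (zD i : DualNumber Puiseux)) f))
    have : fst.comp (aeval fun i => (zD i : DualNumber Puiseux)) = aeval (pt z) := by
      refine MvPolynomial.algHom_ext fun i => ?_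
      rw [AlgHom.comp_apply, aeval_X, aeval_X]
      exact congrArg Units.val (congrFun hzD i)
    rw [← AlgHom.comp_apply, this]
    exact isUnit_iff_ne_zero.2 hf
  let Λ := lift z zD hlift
  have hker : interIdeal F G z ≤ RingHom.ker Λ := by
    rw [Ideal.span_le]
    rintro _ (rfl | rfl)
    · rw [SetLike.mem_coe, RingHom.mem_ker, lift_algebraMap]; exact d5
    · rw [SetLike.mem_coe, RingHom.mem_ker, lift_algebraMap]; exact d6
  have hΛn : Λ n = DualNumber.eps := by
    have : Units.map (Λ : LocalRingAt (pt z) →* DualNumber Puiseux) (T.w (coord z)) = T.w zD := by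
      rw [T.map_w, map_lift_coord]
    have h5 : Λ w = _ := (congrArg Units.val this).trans d3
    rw [hn, map_sub, h5, AlgHom.commutes, add_sub_cancel_left]
  let mk := Ideal.Quotient.mkₐ Puiseux (interIdeal F G z)
  let φ : Puiseux × Puiseux →ₗ[Puiseux] LocalRingAt (pt z) ⧸ interIdeal F G z :=
    (LinearMap.toSpanSingleton Puiseux _ (mk 1)).coprod (LinearMap.toSpanSingleton Puiseux _ (mk n))
  have hφ : ∀ c d : Puiseux, φ (c, d) =
      mk (algebraMap Puiseux _ c + algebraMap Puiseux _ d * n) := by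
    intro c d
    rw [map_add, map_mul, AlgHom.commutes, AlgHom.commutes, ← Algebra.smul_def,
      Algebra.algebraMap_eq_smul_one]
    rfl
  have hinj : Function.Injective φ := by
    rw [injective_iff_map_eq_zero]
    rintro ⟨c, d⟩ h0
    rw [hφ] at h0
    have h5 := hker (Ideal.Quotient.eq_zero_iff_mem.1 h0)
    rw [RingHom.mem_ker, map_add, map_mul, hΛn, AlgHom.commutes, AlgHom.commutes] at h5
    have h6 := congrArg TrivSqZeroExt.fst h5
    have h7 := congrArg TrivSqZeroExt.snd h5
    simp [TrivSqZeroExt.algebraMap_eq_inl] at h6 h7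
    rw [h6, h7]; rfl
  have hsurj : Function.Surjective φ := by
    intro q
    obtain ⟨f, rfl⟩ := Ideal.Quotient.mk_surjective q
    -- Modulo the intersection ideal every f is its value plus a multiple g n. Replacing g in the
    -- same way leaves a multiple of n², which vanishes, so 1 and n span the quotient.
    set J := interIdeal F G z ⊔ Ideal.span {n} with hJ
    have hJmem : ∀ f, ∃ g, f - algebraMap Puiseux _ (ev z f) - g * n ∈ interIdeal F G z := by
      intro f
      have h6 := hC.sub_ev_mem hS hz hr (J := J) le_sup_left
        (Ideal.mem_sup_right (Ideal.mem_span_singleton_self n)) f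
      obtain ⟨i, hi, j, hj, hij⟩ := Submodule.mem_sup.1 h6
      obtain ⟨g, rfl⟩ := Ideal.mem_span_singleton'.1 hj
      exact ⟨g, by rw [← hij, add_sub_cancel_right]; exact hi⟩
    obtain ⟨g, hg⟩ := hJmem f
    obtain ⟨g', hg'⟩ := hJmem g
    refine ⟨(ev z f, ev z g), ?_⟩
    rw [hφ]
    refine (Ideal.Quotient.eq.2 ?_).symm
    have : f - (algebraMap Puiseux _ (ev z f) + algebraMap Puiseux _ (ev z g) * n) =
        (f - algebraMap Puiseux _ (ev z f) - g * n) +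
          (n * (g - algebraMap Puiseux _ (ev z g) - g' * n) + g' * n ^ 2) := by ring
    rw [this]
    exact Ideal.add_mem _ hg (Ideal.add_mem _ (Ideal.mul_mem_left _ _ hg')
      (Ideal.mul_mem_left _ _ hsq))
  rw [interMult, ← (LinearEquiv.ofBijective φ ⟨hinj, hsurj⟩).finrank_eq, Module.finrank_prod,
    Module.finrank_self]

end IsQuadChart
end

noncomputable section
open MvPolynomial Puiseux

/-! ### The type of an intersection and its discriminant -/

namespace Puiseux

theorem puiseux_two_ne_zero : (2 : Puiseux) ≠ 0 := by
  intro h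
  have h1 : (2 : Puiseux) * (half : realRing) = 1 := congrArg Subtype.val two_mul_half
  rw [h, zero_mul] at h1
  exact zero_ne_one h1

/-- The imaginary unit. -/
def im : Puiseux := mono 0 Complex.I

theorem im_sq : im ^ 2 = -1 := by
  rw [im, pow_two, mono_mul, Complex.I_mul_I, add_zero]
  apply series_injective
  rw [series_mono, series_neg, series_one, HahnSeries.single_neg, HahnSeries.single_zero_one]

theorem conj_im : conj im = -im := by
  apply series_injective
  ext r
  rw [coeff_conj, im, series_neg, series_mono, HahnSeries.coeff_neg]
  by_cases h : r = 0
  · rw [h, HahnSeries.coeff_single_same, Complex.conj_I]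
  · rw [HahnSeries.coeff_single_of_ne h, map_zero, neg_zero]

end Puiseux

namespace IsQuadChart

open LocalRingAt

variable {F G : MvPolynomial (Fin 2) Puiseux} {e : Set (Fin 2 → ℝ)} {T : TorusChart}
  {D : QuadSystem realRing} {a p κ : realRing} {X Y U : QuadraticAlgebra realRing (-(D.θ * κ)) (-p)}

/-- The discriminant. -/
def disc (D : QuadSystem realRing) (p κ : realRing) : Puiseux :=
  (p : Puiseux) ^ 2 - 4 * ((D.θ * κ : realRing) : Puiseux)

theorem isRoot_iff {r : Puiseux} : IsRoot D p κ r ↔ (2 * r + p) ^ 2 = disc D p κ := by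
  rw [IsRoot, disc]
  constructor
  · intro h; linear_combination 4 * h
  · intro h
    have h2 : (2 : Puiseux) ^ 2 ≠ 0 := pow_ne_zero _ puiseux_two_ne_zero
    refine (mul_eq_zero.1 ?_).resolve_left h2
    linear_combination h

theorem isReal_disc : IsRealSeries (disc D p κ) := by
  have h4 : IsRealSeries (4 : Puiseux) := mem_realSubfield.1 (by
    have : (4 : Puiseux) = ((4 : realSubfield) : Puiseux) := rfl
    rw [this]; exact Subtype.mem _)
  exact (p.2.2 |> mem_realSubfield.1).pow 2 |>.sub
    (h4.mul (mem_realSubfield.1 (D.θ * κ).2.2))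

variable (hC : IsQuadChart F G e T D a) (hS : D.IsSol a p κ X Y U)

include hC hS

/-- The two roots are (±s - p) / 2. They differ because s is not zero, and the coordinate w
separates the two points. -/
theorem exists_pair {s : Puiseux} (hs : s ^ 2 = disc D p κ) (hs0 : s ≠ 0) :
    ∃ z z' : Fin 2 → Puiseuxˣ, IsPt T X U z ((s - p) / 2) ∧ IsPt T X U z' ((-s - p) / 2) ∧
      pt z ≠ pt z' ∧ interPoints F G e = {pt z, pt z'} ∧ interMult F G (pt z) = 1 ∧
      interMult F G (pt z') = 1 := by
  have h2 := puiseux_two_ne_zero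
  have e1 : 2 * ((s - p) / 2) + (p : Puiseux) = s := by field_simp; ring
  have e2 : 2 * ((-s - p) / 2) + (p : Puiseux) = -s := by field_simp; ring
  have r1 : IsRoot D p κ ((s - p) / 2) := isRoot_iff.2 (by rw [e1, hs])
  have r2 : IsRoot D p κ ((-s - p) / 2) := isRoot_iff.2 (by rw [e2, neg_sq, hs])
  obtain ⟨z, hz, hzi⟩ := hC.exists_mem_interPoints hS r1
  obtain ⟨z', hz', hzi'⟩ := hC.exists_mem_interPoints hS r2
  refine ⟨z, z', hz, hz', ?_, ?_, hC.interMult_eq_one hS hzi hz r1 (by rwa [e1]),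
    hC.interMult_eq_one hS hzi' hz' r2 (by rw [e2]; exact neg_ne_zero.2 hs0)⟩
  · intro h
    have h3 : z = z' := funext fun i => Units.ext (congrFun h i)
    have h4 := hz.w
    rw [h3, hz'.w] at h4
    have h5 : s = -s := by linear_combination (-1 : Puiseux) * e1 + e2 - 2 * h4
    have h6 : 2 * s = 0 := by linear_combination h5
    exact (mul_ne_zero h2 hs0) h6
  · ext q
    constructor
    · intro hq
      obtain ⟨y, r, rfl, hr, hy⟩ := hC.exists_root_of_mem hS hq
      have h3 : (2 * r + p) ^ 2 = s ^ 2 := by rw [isRoot_iff.1 hr, hs]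
      rcases sq_eq_sq_iff_eq_or_eq_neg.1 h3 with h4 | h4
      · have : r = (s - p) / 2 := by rw [← h4]; field_simp; ring
        rw [this] at hy
        rw [hy.unique hz]; exact Or.inl rfl
      · have : r = (-s - p) / 2 := by rw [← h4]; field_simp; ring
        rw [this] at hy
        rw [hy.unique hz']; exact Or.inr rfl
    · rintro (rfl | rfl) <;> assumption

theorem twoReal_of_isPos (h : IsPos (disc D p κ)) : TwoReal F G e := by
  obtain ⟨s, hs, hs2⟩ := h.exists_sqrt
  obtain ⟨z, z', hz, hz', hne, hI, m1, m2⟩ := hC.exists_pair hS hs2 hs.ne_zero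
  have hp : IsRealSeries (p : Puiseux) := (mem_realRing.1 p.2).2
  have h2 : IsRealSeries (2 : Puiseux) := by
    have := IsRealSeries.one.add IsRealSeries.one
    rwa [one_add_one_eq_two] at this
  refine ⟨pt z, pt z', hne, fun i => ?_, fun i => ?_, hI, m1, m2⟩
  · exact isRealSeries_iff.2 (hz.conj_eq hC.real hz
      (isRealSeries_iff.1 ((hs.isReal.sub hp).div h2)).symm i).symm
  · exact isRealSeries_iff.2 (hz'.conj_eq hC.real hz'
      (isRealSeries_iff.1 ((hs.isReal.neg.sub hp).div h2)).symm i).symm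

/-- The discriminant is the square of i s with s real. Conjugation changes the sign of i s, hence
exchanges the two roots and the two points. -/
theorem twoConj_of_isPos_neg (h : IsPos (-disc D p κ)) : TwoConj F G e := by
  obtain ⟨s, hs, hs2⟩ := h.exists_sqrt
  have hs0 : im * s ≠ 0 := by
    refine mul_ne_zero (fun h0 => ?_) hs.ne_zero
    have := im_sq
    rw [h0] at this
    norm_num at this
  obtain ⟨z, z', hz, hz', hne, hI, m1, m2⟩ := hC.exists_pair hS (s := im * s)
    (by rw [mul_pow, im_sq, hs2]; ring) hs0
  have hp : conj (p : Puiseux) = p := isRealSeries_iff.1 (mem_realRing.1 p.2).2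
  refine ⟨pt z, pt z', hne, fun i r => ?_, hI, m1, m2⟩
  rw [← coeff_conj]
  have := hz.conj_eq hC.real hz' (by
    rw [map_div₀, map_sub, map_mul, conj_im, hp, isRealSeries_iff.1 hs.isReal, map_ofNat]
    ring) i
  exact congrArg (fun y : Puiseux => y.series.coeff r) this

theorem doubleReal_of_eq_zero (h : disc D p κ = 0) : DoubleReal F G e := by
  have h2 := puiseux_two_ne_zero
  have e1 : 2 * (-(p : Puiseux) / 2) + (p : Puiseux) = 0 := by field_simp; ring
  have r1 : IsRoot D p κ (-(p : Puiseux) / 2) := isRoot_iff.2 (by rw [e1, h]; ring)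
  obtain ⟨z, hz, hzi⟩ := hC.exists_mem_interPoints hS r1
  have hp : conj (p : Puiseux) = p := isRealSeries_iff.1 (mem_realRing.1 p.2).2
  refine ⟨pt z, fun i => ?_, ?_, hC.interMult_eq_two hS hzi hz r1 e1⟩
  · exact isRealSeries_iff.2 (hz.conj_eq hC.real hz
      (by rw [map_div₀, map_neg, hp, map_ofNat]) i).symm
  · ext q
    constructor
    · intro hq
      obtain ⟨y, r, rfl, hr, hy⟩ := hC.exists_root_of_mem hS hq
      have h3 : (2 * r + p) ^ 2 = 0 := by rw [isRoot_iff.1 hr, h]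
      have h4 : 2 * r + p = 0 := pow_eq_zero_iff (by norm_num : 2 ≠ 0) |>.1 h3
      have : r = -(p : Puiseux) / 2 := by field_simp; linear_combination h4
      rw [this] at hy
      rw [hy.unique hz]; rfl
    · rintro rfl; exact hzi

/-- A non-zero discriminant is positive or negative and would give two different points. -/
theorem disc_eq_zero_of_doubleReal (h : DoubleReal F G e) : disc D p κ = 0 := by
  by_contra h0
  obtain ⟨q, -, hq, -⟩ := h
  have key : ∀ p p' : Fin 2 → Puiseux, p ≠ p' → interPoints F G e = {p, p'} → False := by
    intro p p' hne h1
    rw [hq] at h1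
    have h2 : p ∈ ({q} : Set (Fin 2 → Puiseux)) := by rw [h1]; simp
    have h3 : p' ∈ ({q} : Set (Fin 2 → Puiseux)) := by rw [h1]; simp
    exact hne (h2.trans h3.symm)
  rcases IsPos.or_neg isReal_disc h0 with h1 | h1
  · obtain ⟨p, p', hne, -, -, h2, -⟩ := hC.twoReal_of_isPos hS h1
    exact key p p' hne h2
  · obtain ⟨p, p', hne, -, h2, -⟩ := hC.twoConj_of_isPos_neg hS h1
    exact key p p' hne h2

theorem trichotomy : TwoReal F G e ∨ TwoConj F G e ∨ DoubleReal F G e := by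
  by_cases h0 : disc D p κ = 0
  · exact Or.inr (Or.inr (hC.doubleReal_of_eq_zero hS h0))
  · rcases IsPos.or_neg isReal_disc h0 with h1 | h1
    · exact Or.inl (hC.twoReal_of_isPos hS h1)
    · exact Or.inr (Or.inl (hC.twoConj_of_isPos_neg hS h1))

end IsQuadChart
end

noncomputable section
open MvPolynomial Puiseux

/-! ### The normal form of two curves near a common edge -/

/-- The real series of non-negative order given by a series, if it is one. -/
def toReal (x : Puiseux) : realRing :=
  open Classical in if h : x ∈ realRing then ⟨x, h⟩ else 0

theorem coe_toReal {x : Puiseux} (h : x ∈ realRing) : (toReal x : Puiseux) = x := by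
  rw [toReal, dif_pos h]

/-- The monomial `tʳ` as a unit. -/
def monoUnit (r : ℝ) : Puiseuxˣ := Units.mk0 (mono r 1) (mono_ne_zero one_ne_zero)

theorem val_monoUnit (r : ℝ) : val (monoUnit r) = r := val_mono one_ne_zero

theorem isPos_monoUnit (r : ℝ) : IsPos (monoUnit r : Puiseux) := by
  have := IsPos.monomial (r := r) (c := 1) one_pos
  rwa [Complex.ofReal_one] at this

/-- A nonzero series as a unit. -/
def toUnit (x : Puiseux) : Puiseuxˣ :=
  open Classical in if h : x = 0 then 1 else Units.mk0 x h

theorem coe_toUnit {x : Puiseux} (h : x ≠ 0) : (toUnit x : Puiseux) = x := by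
  rw [toUnit, dif_neg h]; rfl

theorem val_units_mul (x y : Puiseuxˣ) : val ((x * y : Puiseuxˣ) : Puiseux) = val x + val y :=
  val_mul x.ne_zero y.ne_zero

theorem val_units_inv (x : Puiseuxˣ) : val ((x⁻¹ : Puiseuxˣ) : Puiseux) = -val x := by
  rw [Units.val_inv_eq_inv_val, val_inv x.ne_zero]

theorem val_units_zpow (x : Puiseuxˣ) (n : ℤ) : val ((x ^ n : Puiseuxˣ) : Puiseux) = n * val x := by
  rw [Units.val_zpow_eq_zpow_val, val_zpow x.ne_zero]

theorem isRealSeries_units_mul {x y : Puiseuxˣ} (hx : IsRealSeries x) (hy : IsRealSeries y) :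
    IsRealSeries ((x * y : Puiseuxˣ) : Puiseux) := hx.mul hy

theorem isRealSeries_units_inv {x : Puiseuxˣ} (hx : IsRealSeries x) :
    IsRealSeries ((x⁻¹ : Puiseuxˣ) : Puiseux) := by
  rw [Units.val_inv_eq_inv_val]; exact hx.inv

theorem isRealSeries_units_zpow {x : Puiseuxˣ} (hx : IsRealSeries x) (n : ℤ) :
    IsRealSeries ((x ^ n : Puiseuxˣ) : Puiseux) := by
  rw [Units.val_zpow_eq_zpow_val]; exact hx.zpow n

theorem mem_realRing_of_val {x : Puiseux} (hx : x ≠ 0) (hr : IsRealSeries x) (hv : 0 ≤ val x) :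
    x ∈ realRing := mem_realRing.2 ⟨(ord_nonneg_iff hx).2 hv, hr⟩

theorem mul_mul_inv_mul_inv_mul {M : Type*} [CommGroup M] (a b c d : M) :
    a * b * (a⁻¹ * c * (b⁻¹ * d)) = c * d := by
  calc a * b * (a⁻¹ * c * (b⁻¹ * d)) = (a * a⁻¹) * (b * b⁻¹) * (c * d) := by ac_rfl
    _ = c * d := by rw [mul_inv_cancel, mul_inv_cancel, one_mul, one_mul]

namespace TorusChart

variable (T : TorusChart) {R : Type} [CommRing R] [Algebra Puiseux R]

/-- The constant factor of a monomial in the chart. -/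
def scale (i j : ℤ) : Puiseuxˣ :=
  if 0 ≤ j then T.X0 ^ i * T.U0 ^ j else T.X0 ^ (i + T.k * j) * T.W0 ^ (-j)

/-- The monomial `χ₁ⁱ χ₂ʲ` in the chart, up to a constant. -/
def mon (z : Fin 2 → Rˣ) (i j : ℤ) : Rˣ :=
  if 0 ≤ j then T.x z ^ i * T.u z ^ j else T.x z ^ (i + T.k * j) * T.w z ^ (-j)

/-- The monomial with a given exponent. -/
def zmon (z : Fin 2 → Rˣ) (γ : Fin 2 →₀ ℕ) : Rˣ := z 0 ^ (γ 0 : ℤ) * z 1 ^ (γ 1 : ℤ)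

/-- A monomial with j ≥ 0 is written with u, one with j < 0 with w. In this way only non-negative
powers of u and w occur, and powers of x of either sign are covered by x and y = 1 / x. -/
theorem zmon_eq (z : Fin 2 → Rˣ) (o γ : Fin 2 →₀ ℕ) : zmon z γ =
    zmon z o * (cst R (T.scale (T.L.i o γ) (T.L.j o γ)) * T.mon z (T.L.i o γ) (T.L.j o γ)) := by
  have h0 := T.L.zero_eq o γ
  have h1 := T.L.one_eq o γ
  have hγ : zmon z γ = zmon z o * ((z 0 ^ T.L.e0 * z 1 ^ T.L.e1) ^ T.L.i o γ *
      (z 0 ^ T.L.f0 * z 1 ^ T.L.f1) ^ T.L.j o γ) := by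
    rw [zpow_mul_zpow_comb, zmon, zmon,
      show (γ 0 : ℤ) = o 0 + (T.L.e0 * T.L.i o γ + T.L.f0 * T.L.j o γ) by linarith,
      show (γ 1 : ℤ) = o 1 + (T.L.e1 * T.L.i o γ + T.L.f1 * T.L.j o γ) by linarith, zpow_add,
      zpow_add (z 1)]
    exact mul_mul_mul_comm (z 0 ^ (o 0 : ℤ)) _ _ _
  rw [hγ, scale, mon, x, u, w]
  generalize z 0 ^ T.L.e0 * z 1 ^ T.L.e1 = χ₁
  generalize z 0 ^ T.L.f0 * z 1 ^ T.L.f1 = χ₂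
  generalize T.L.i o γ = i
  generalize T.L.j o γ = j
  congr 1
  split_ifs with h
  · rw [map_mul, map_zpow, map_zpow, mul_zpow _ χ₁, mul_zpow _ χ₂, inv_zpow, inv_zpow,
      mul_mul_inv_mul_inv_mul]
  · rw [map_mul, map_zpow, map_zpow, mul_zpow _ χ₁, mul_assoc _ (χ₁ ^ T.k), mul_zpow _ (χ₁ ^ T.k * _),
      inv_zpow, inv_zpow, mul_mul_inv_mul_inv_mul, mul_zpow, ← zpow_mul, inv_zpow, zpow_neg χ₂,
      inv_inv, ← mul_assoc, ← zpow_add]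
    congr 2
    ring

/-- The polynomial form of `xⁿ`. -/
def xpow (n : ℤ) : MvPolynomial (Fin 4) realRing :=
  if 0 ≤ n then X 0 ^ n.toNat else X 1 ^ (-n).toNat

/-- The polynomial form of `xⁿ` in two variables. -/
def hpow (n : ℤ) : MvPolynomial (Fin 2) realRing :=
  if 0 ≤ n then X 0 ^ n.toNat else X 1 ^ (-n).toNat

/-- The polynomial form of a monomial in the chart. -/
def monPoly (k i j : ℤ) : MvPolynomial (Fin 4) realRing :=
  if 0 ≤ j then xpow i * X 2 ^ j.toNat else xpow (i + k * j) * X 3 ^ (-j).toNat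

theorem val_zpow_of_nonneg {M : Type*} [CommRing M] (x : Mˣ) {n : ℤ} (h : 0 ≤ n) :
    ((x ^ n : Mˣ) : M) = (x : M) ^ n.toNat := by
  obtain ⟨m, rfl⟩ := Int.eq_ofNat_of_zero_le h
  simp

theorem val_zpow_of_neg {M : Type*} [CommRing M] (x : Mˣ) {n : ℤ} (h : ¬ 0 ≤ n) :
    ((x ^ n : Mˣ) : M) = ((x⁻¹ : Mˣ) : M) ^ (-n).toNat := by
  rw [← val_zpow_of_nonneg _ (by omega), inv_zpow, zpow_neg, inv_inv]

theorem eval₂_hpow (x : Rˣ) (n : ℤ) :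
    eval₂ (realCst R) ![(x : R), ((x⁻¹ : Rˣ) : R)] (hpow n) = ((x ^ n : Rˣ) : R) := by
  rw [hpow]
  split_ifs with h
  · rw [val_zpow_of_nonneg x h, eval₂_pow, eval₂_X]; rfl
  · rw [val_zpow_of_neg x h, eval₂_pow, eval₂_X]; rfl

theorem eval₂_monPoly (z : Fin 2 → Rˣ) (i j : ℤ) :
    eval₂ (realCst R) ![(T.x z : R), ((T.x z)⁻¹ : Rˣ), T.u z, T.w z] (monPoly T.k i j) =
      (T.mon z i j : R) := by
  have hx : ∀ n : ℤ, eval₂ (realCst R) ![(T.x z : R), ((T.x z)⁻¹ : Rˣ), T.u z, T.w z] (xpow n) =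
      ((T.x z ^ n : Rˣ) : R) := by
    intro n
    rw [xpow]
    split_ifs with h
    · rw [val_zpow_of_nonneg _ h, eval₂_pow, eval₂_X]; rfl
    · rw [val_zpow_of_neg _ h, eval₂_pow, eval₂_X]; rfl
  rw [monPoly, mon]
  split_ifs with h
  · rw [Units.val_mul, val_zpow_of_nonneg _ h, eval₂_mul, hx, eval₂_pow, eval₂_X]; rfl
  · rw [Units.val_mul, val_zpow_of_nonneg _ (by omega : 0 ≤ -j), eval₂_mul, hx, eval₂_pow,
      eval₂_X]; rfl

/-- The coefficients of a polynomial in the chart. -/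
def normCoeff (H : MvPolynomial (Fin 2) Puiseux) (o : Fin 2 →₀ ℕ) (n : Puiseuxˣ)
    (γ : Fin 2 →₀ ℕ) : Puiseux :=
  H.coeff γ * ((n⁻¹ * T.scale (T.L.i o γ) (T.L.j o γ) : Puiseuxˣ) : Puiseux)

theorem aeval_eq_sum (H : MvPolynomial (Fin 2) Puiseux) (o : Fin 2 →₀ ℕ) (n : Puiseuxˣ)
    (z : Fin 2 → Rˣ) : aeval (fun i => (z i : R)) H = ((zmon z o * cst R n : Rˣ) : R) *
      ∑ γ ∈ H.support, algebraMap Puiseux R (T.normCoeff H o n γ) *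
        (T.mon z (T.L.i o γ) (T.L.j o γ) : R) := by
  rw [aeval_def, eval₂_eq', Finset.mul_sum]
  refine Finset.sum_congr rfl fun γ _ => ?_
  have h1 : ∏ i, (z i : R) ^ γ i = (zmon z γ : R) := by
    rw [Fin.prod_univ_two, zmon, zpow_natCast, zpow_natCast]; rfl
  rw [h1, T.zmon_eq z o γ, normCoeff, map_mul, ← val_cst, map_mul, map_inv]
  push_cast
  have h2 : (cst R n : R) * ((cst R n)⁻¹ : Rˣ) = 1 := Units.mul_inv _
  linear_combination (-(algebraMap Puiseux R (H.coeff γ)) * (zmon z o : R) *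
    (cst R (T.scale (T.L.i o γ) (T.L.j o γ)) : R) * (T.mon z (T.L.i o γ) (T.L.j o γ) : R)) * h2

/-- The part of a polynomial with exponents in `S`, in the chart. -/
def part (H : MvPolynomial (Fin 2) Puiseux) (o : Fin 2 →₀ ℕ) (n : Puiseuxˣ)
    (S : Finset (Fin 2 →₀ ℕ)) : MvPolynomial (Fin 4) realRing :=
  ∑ γ ∈ S, C (toReal (T.normCoeff H o n γ)) * monPoly T.k (T.L.i o γ) (T.L.j o γ)

theorem eval₂_part {H : MvPolynomial (Fin 2) Puiseux} {o : Fin 2 →₀ ℕ} {n : Puiseuxˣ}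
    {S : Finset (Fin 2 →₀ ℕ)} (h : ∀ γ ∈ S, T.normCoeff H o n γ ∈ realRing) (z : Fin 2 → Rˣ) :
    eval₂ (realCst R) ![(T.x z : R), ((T.x z)⁻¹ : Rˣ), T.u z, T.w z] (T.part H o n S) =
      ∑ γ ∈ S, algebraMap Puiseux R (T.normCoeff H o n γ) *
        (T.mon z (T.L.i o γ) (T.L.j o γ) : R) := by
  rw [part, eval₂_sum]
  refine Finset.sum_congr rfl fun γ hγ => ?_
  rw [eval₂_mul, eval₂_C, eval₂_monPoly, realCst, RingHom.comp_apply]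
  congr 2
  exact coe_toReal (h γ hγ)

theorem part_mem {H : MvPolynomial (Fin 2) Puiseux} {o : Fin 2 →₀ ℕ} {n : Puiseuxˣ}
    {S : Finset (Fin 2 →₀ ℕ)} (h : ∀ γ ∈ S, T.normCoeff H o n γ ∈ realRing)
    (h' : ∀ γ ∈ S, 0 < ord (T.normCoeff H o n γ)) :
    T.part H o n S ∈ realIdeal.map (C : realRing →+* MvPolynomial (Fin 4) realRing) := by
  refine Ideal.sum_mem _ fun γ hγ => Ideal.mul_mem_right _ _ (Ideal.mem_map_of_mem _ ?_)
  rw [mem_realIdeal, coe_toReal (h γ hγ)]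
  exact h' γ hγ

theorem isReal_scale (hT : T.IsReal) (i j : ℤ) : IsRealSeries (T.scale i j : Puiseux) := by
  rw [scale]
  split_ifs
  · exact isRealSeries_units_mul (isRealSeries_units_zpow hT.1 _) (isRealSeries_units_zpow hT.2.1 _)
  · exact isRealSeries_units_mul (isRealSeries_units_zpow hT.1 _) (isRealSeries_units_zpow hT.2.2 _)

end TorusChart

/-! ### The torus chart of a bounded edge -/

namespace EdgeChart

variable {Q Q' : TropPoly} {e e' : Set (Fin 2 → ℝ)} (Γ : EdgeChart Q e)
  (F G : MvPolynomial (Fin 2) Puiseux)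

/-- The normalising constant of `F`. -/
def nF : Puiseuxˣ := monoUnit (-Q.coeff Γ.α0)

/-- The torus chart of an edge. -/
def torus : TorusChart where
  L := Γ.L
  k := Γ.k
  X0 := monoUnit (Q.coeff Γ.α1 - Q.coeff Γ.α0)
  U0 := Γ.nF * (toUnit (F.coeff Γ.α2))⁻¹
  W0 := Γ.nF * (toUnit (F.coeff Γ.α3))⁻¹

variable {F G}

theorem coeff_ne_zero (hF : tropPoly F = Q) {γ : Fin 2 →₀ ℕ} (h : γ ∈ Q.supp) : F.coeff γ ≠ 0 := by
  rw [← hF] at h; exact mem_support_iff.1 h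

theorem val_coeff (hF : tropPoly F = Q) (γ : Fin 2 →₀ ℕ) : val (F.coeff γ) = -Q.coeff γ := by
  rw [← hF]; exact (neg_neg _).symm

theorem pe_v2 : Γ.L.pe Γ.v2 = Γ.L.pe Γ.v1 := Γ.pe_eq Γ.v2_mem

theorem coeff1_eq : Q.coeff Γ.α1 - Q.coeff Γ.α0 = -Γ.L.pe Γ.v1 := by
  have h := Γ.term1_sub Γ.v1
  rw [Γ.L.term_sub_eq, Γ.i1, Γ.j1] at h
  push_cast at h
  linarith

theorem coeff2_eq : Q.coeff Γ.α2 - Q.coeff Γ.α0 = -Γ.L.pf Γ.v1 := by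
  have h := sub_eq_zero.2 (TropPoly.term_eq_of_mem Γ.mem01 Γ.mem21)
  rw [Γ.L.term_sub_eq, Γ.i2, Γ.j2] at h
  push_cast at h
  linarith

theorem coeff3_eq : Q.coeff Γ.α3 - Q.coeff Γ.α0 = -(Γ.k * Γ.L.pe Γ.v1 - Γ.L.pf Γ.v2) := by
  have h := sub_eq_zero.2 (TropPoly.term_eq_of_mem Γ.mem02 Γ.mem32)
  rw [Γ.L.term_sub_eq, Γ.i3, Γ.j3, Γ.pe_v2] at h
  push_cast at h
  linarith

theorem pf_lt : Γ.L.pf Γ.v2 < Γ.L.pf Γ.v1 := by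
  have h := sub_neg.2 Γ.term2_v2_lt
  rw [Γ.L.term_sub_eq, Γ.i2, Γ.j2, Γ.coeff2_eq] at h
  push_cast at h
  linarith

theorem val_X0 : val (Γ.torus F).X0 = -Γ.L.pe Γ.v1 := by
  rw [torus, val_monoUnit, coeff1_eq]

theorem val_U0 (hF : tropPoly F = Q) : val (Γ.torus F).U0 = -Γ.L.pf Γ.v1 := by
  rw [torus, val_units_mul, val_units_inv, coe_toUnit (coeff_ne_zero hF Γ.mem_supp2), nF,
    val_monoUnit, val_coeff hF, ← coeff2_eq]; ring

theorem val_W0 (hF : tropPoly F = Q) :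
    val (Γ.torus F).W0 = -(Γ.k * Γ.L.pe Γ.v1 - Γ.L.pf Γ.v2) := by
  rw [torus, val_units_mul, val_units_inv, coe_toUnit (coeff_ne_zero hF Γ.mem_supp3), nF,
    val_monoUnit, val_coeff hF, ← coeff3_eq]; ring

theorem isReal_torus (hF : tropPoly F = Q) (hr : ∀ γ, IsRealSeries (F.coeff γ)) :
    (Γ.torus F).IsReal := by
  refine ⟨(isPos_monoUnit _).isReal, isRealSeries_units_mul (isPos_monoUnit _).isReal
    (isRealSeries_units_inv ?_), isRealSeries_units_mul (isPos_monoUnit _).isReal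
    (isRealSeries_units_inv ?_)⟩
  · rw [coe_toUnit (coeff_ne_zero hF Γ.mem_supp2)]; exact hr _
  · rw [coe_toUnit (coeff_ne_zero hF Γ.mem_supp3)]; exact hr _

/-- The vertex at which a monomial has to be compared. -/
def vertex (j : ℤ) : Fin 2 → ℝ := if 0 ≤ j then Γ.v1 else Γ.v2

theorem val_scale (hF : tropPoly F = Q) (i j : ℤ) : val ((Γ.torus F).scale i j) =
    -(i * Γ.L.pe (Γ.vertex j) + j * Γ.L.pf (Γ.vertex j)) := by
  rw [TorusChart.scale, vertex]
  split_ifs with h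
  · rw [val_units_mul, val_units_zpow, val_units_zpow, Γ.val_X0, Γ.val_U0 hF]; ring
  · rw [val_units_mul, val_units_zpow, val_units_zpow, Γ.val_X0, Γ.val_W0 hF, Γ.pe_v2]
    change ((i + Γ.k * j : ℤ) : ℝ) * _ + _ = _
    push_cast
    ring

theorem normCoeff_ne_zero {H : MvPolynomial (Fin 2) Puiseux} {P : TropPoly} (hH : tropPoly H = P)
    {o γ : Fin 2 →₀ ℕ} (hγ : γ ∈ P.supp) (n : Puiseuxˣ) : (Γ.torus F).normCoeff H o n γ ≠ 0 :=
  mul_ne_zero (coeff_ne_zero hH hγ) (Units.ne_zero _)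

/-- The valuation is the amount by which γ stays below o at v₁ (for j ≥ 0) or v₂ (for j < 0). If o
is maximal along `e`, it is non-negative, and it vanishes only for monomials maximal at that vertex.
-/
theorem val_normCoeff (hF : tropPoly F = Q) {H : MvPolynomial (Fin 2) Puiseux} {P : TropPoly}
    (hH : tropPoly H = P) {o γ : Fin 2 →₀ ℕ} (hγ : γ ∈ P.supp) :
    val ((Γ.torus F).normCoeff H o (monoUnit (-P.coeff o)) γ) =
      P.term o (Γ.vertex (Γ.L.j o γ)) - P.term γ (Γ.vertex (Γ.L.j o γ)) := by
  rw [TorusChart.normCoeff, val_mul (coeff_ne_zero hH hγ) (Units.ne_zero _), val_units_mul,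
    val_units_inv, val_monoUnit, val_coeff hH, Γ.val_scale hF]
  have := Γ.L.term_sub_eq P o γ (Γ.vertex (Γ.L.j o γ))
  change -P.coeff γ + (- -P.coeff o + -(Γ.L.i o γ * Γ.L.pe (Γ.vertex (Γ.L.j o γ)) +
    Γ.L.j o γ * Γ.L.pf (Γ.vertex (Γ.L.j o γ)))) = _
  linarith

theorem isReal_normCoeff (hF : tropPoly F = Q) (hr : ∀ γ, IsRealSeries (F.coeff γ))
    {H : MvPolynomial (Fin 2) Puiseux} (hHr : ∀ γ, IsRealSeries (H.coeff γ)) (o γ : Fin 2 →₀ ℕ)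
    (r : ℝ) : IsRealSeries ((Γ.torus F).normCoeff H o (monoUnit r) γ) :=
  (hHr γ).mul (isRealSeries_units_mul (isRealSeries_units_inv (isPos_monoUnit r).isReal)
    (TorusChart.isReal_scale _ (Γ.isReal_torus hF hr) _ _))

/-- The valuation of x measures the distance from the line of `e`; on this line those of u and w
measure the positions relative to the two ends. -/
theorem tropPoint_mem_iff (hF : tropPoly F = Q) (z : Fin 2 → Puiseuxˣ) :
    tropPoint (fun i => (z i : Puiseux)) ∈ e ↔ ord ((Γ.torus F).x z : Puiseux) = 0 ∧
      0 ≤ ord ((Γ.torus F).u z : Puiseux) ∧ 0 ≤ ord ((Γ.torus F).w z : Puiseux) := by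
  rw [ord_eq_zero_iff (Units.ne_zero _), ord_nonneg_iff (Units.ne_zero _),
    ord_nonneg_iff (Units.ne_zero _)]
  set t := tropPoint (fun i => (z i : Puiseux)) with ht
  have ht0 : t 0 = -val (z 0) := rfl
  have ht1 : t 1 = -val (z 1) := rfl
  have hx : val ((Γ.torus F).x z) = Γ.L.pe Γ.v1 - Γ.L.pe t := by
    rw [TorusChart.x, val_units_mul, val_units_inv, TorusChart.cst_self, Γ.val_X0, val_units_mul,
      val_units_zpow, val_units_zpow, LatticeFrame.pe.eq_1 Γ.L t, ht0, ht1]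
    change _ + ((Γ.L.e0 : ℝ) * _ + (Γ.L.e1 : ℝ) * _) = _
    ring
  have hu : val ((Γ.torus F).u z) = Γ.L.pf Γ.v1 - Γ.L.pf t := by
    rw [TorusChart.u, val_units_mul, val_units_inv, TorusChart.cst_self, Γ.val_U0 hF,
      val_units_mul, val_units_zpow, val_units_zpow, LatticeFrame.pf.eq_1 Γ.L t, ht0, ht1]
    change _ + ((Γ.L.f0 : ℝ) * _ + (Γ.L.f1 : ℝ) * _) = _
    ring
  have hw : val ((Γ.torus F).w z) =
      Γ.k * (Γ.L.pe Γ.v1 - Γ.L.pe t) - (Γ.L.pf Γ.v2 - Γ.L.pf t) := by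
    rw [TorusChart.w, val_units_mul, val_units_mul, val_units_inv, TorusChart.cst_self,
      Γ.val_W0 hF, val_units_inv, val_units_mul, val_units_zpow, val_units_zpow, val_units_zpow,
      val_units_mul, val_units_zpow, val_units_zpow]
    change - -((Γ.k : ℝ) * Γ.L.pe Γ.v1 - Γ.L.pf Γ.v2) + (Γ.k : ℝ) * ((Γ.L.e0 : ℝ) * _ +
      (Γ.L.e1 : ℝ) * _) + -((Γ.L.f0 : ℝ) * _ + (Γ.L.f1 : ℝ) * _) = _
    have h1 : Γ.L.pe t = -(Γ.L.e0 * val (z 0) + Γ.L.e1 * val (z 1)) := by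
      rw [LatticeFrame.pe, ht0, ht1]; ring
    have h2 : Γ.L.pf t = -(Γ.L.f0 * val (z 0) + Γ.L.f1 * val (z 1)) := by
      rw [LatticeFrame.pf, ht0, ht1]; ring
    rw [h1, h2]; ring
  rw [hx, hu, hw, Γ.mem_iff]
  constructor
  · rintro ⟨h0, h1⟩
    have h2 := Γ.pe_eq ((Γ.mem_iff t).2 ⟨h0, h1⟩)
    have h3 := (TropPoly.mem_maxAt.1 h0).2 _ Γ.mem_supp2
    have h4 := (TropPoly.mem_maxAt.1 h0).2 _ Γ.mem_supp3
    have h5 := Γ.L.term_sub_eq Q Γ.α0 Γ.α2 t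
    have h6 := Γ.L.term_sub_eq Q Γ.α0 Γ.α3 t
    rw [Γ.i2, Γ.j2, Γ.coeff2_eq] at h5
    rw [Γ.i3, Γ.j3, Γ.coeff3_eq, h2] at h6
    push_cast at h5 h6
    rw [h2]
    refine ⟨sub_self _, by linarith, ?_⟩
    rw [sub_self, mul_zero]
    linarith
  · rintro ⟨h1, h2, h3⟩
    rw [h1, mul_zero] at h3
    -- Between the ends a monomial with j ≥ 0 does no better against α₀ than at v₁, and one with j <
    -- 0 no better than at v₂.
    have hle : ∀ γ ∈ Q.supp, Q.term γ t ≤ Q.term Γ.α0 t := by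
      intro γ hγ
      have k0 := Γ.L.term_sub_eq Q Γ.α0 γ t
      have hpe : Γ.L.pe t = Γ.L.pe Γ.v1 := by linarith
      by_cases hj : 0 ≤ Γ.L.j Γ.α0 γ
      · have k1 := Γ.L.term_sub_eq Q Γ.α0 γ Γ.v1
        have k2 := (TropPoly.mem_maxAt.1 Γ.mem01).2 γ hγ
        have k3 : 0 ≤ (Γ.L.j Γ.α0 γ : ℝ) := by exact_mod_cast hj
        have k4 := mul_nonneg k3 h2
        rw [hpe] at k0
        linarith
      · have k1 := Γ.L.term_sub_eq Q Γ.α0 γ Γ.v2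
        have k2 := (TropPoly.mem_maxAt.1 Γ.mem02).2 γ hγ
        have k3 : (Γ.L.j Γ.α0 γ : ℝ) ≤ 0 := by exact_mod_cast (not_le.1 hj).le
        have k4 := mul_nonneg_of_nonpos_of_nonpos k3 (by linarith : Γ.L.pf Γ.v2 - Γ.L.pf t ≤ 0)
        rw [hpe, ← Γ.pe_v2] at k0
        linarith
    have h0 : Γ.α0 ∈ Q.maxAt t := TropPoly.mem_maxAt.2 ⟨Γ.mem_supp0, hle⟩
    refine ⟨h0, (TropPoly.mem_maxAt_iff_of_mem h0 Γ.mem_supp1).2 ?_⟩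
    have := Γ.term1_sub t
    linarith

end EdgeChart
end

noncomputable section
open MvPolynomial Puiseux

/-! ### The quadratic system of two curves near a common edge -/

theorem isPos_mul_right_iff {x y : Puiseux} (hx : IsRealSeries x) (hy : IsPos y) :
    IsPos (x * y) ↔ IsPos x := by
  by_cases hx0 : x = 0
  · simp [hx0]
  · rw [IsPos.mul_iff hx hx0 hy.isReal hy.ne_zero]; simp [hy]

/-- The sign of a nonzero real series. -/
def signReal (x : Puiseux) : realRing := open Classical in if IsPos x then 1 else -1

theorem signReal_mul_self (x : Puiseux) : signReal x * signReal x = 1 := by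
  rw [signReal]; split_ifs <;> ring

theorem isPos_signReal_mul {x : Puiseux} (hx : IsRealSeries x) (h0 : x ≠ 0) :
    IsPos (signReal x * x) := by
  rw [signReal]
  split_ifs with h
  · simpa using h
  · simpa using (IsPos.not_iff hx h0).1 h

theorem ord_signReal_mul (x y : Puiseux) : ord (signReal x * y) = ord y := by
  rw [signReal]
  split_ifs
  · simp
  · simp [ord_neg]

namespace TorusChart

variable (T : TorusChart)

theorem scale_zero_zero : T.scale 0 0 = 1 := by simp [scale]

theorem scale_one_zero : T.scale 1 0 = T.X0 := by simp [scale]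

theorem scale_zero_one : T.scale 0 1 = T.U0 := by simp [scale]

theorem scale_neg_one : T.scale T.k (-1) = T.W0 := by simp [scale]

variable {R : Type} [CommRing R] [Algebra Puiseux R] (z : Fin 2 → Rˣ)

theorem mon_zero_zero : T.mon z 0 0 = 1 := by simp [mon]

theorem mon_one_zero : T.mon z 1 0 = T.x z := by simp [mon]

theorem mon_zero_one : T.mon z 0 1 = T.u z := by simp [mon]

theorem mon_neg_one : T.mon z T.k (-1) = T.w z := by simp [mon]

end TorusChart

namespace EdgeChart

variable {Q Q' : TropPoly} {e e' : Set (Fin 2 → ℝ)} (Γ : EdgeChart Q e)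
  (F G : MvPolynomial (Fin 2) Puiseux) (β0 β1 : Fin 2 →₀ ℕ)

/-- The normalised coefficients of `F` at a vertex of the dual edge. -/
def fc (γ : Fin 2 →₀ ℕ) : realRing := toReal ((Γ.torus F).normCoeff F Γ.α0 Γ.nF γ)

/-- The normalised coefficients of `G`. -/
def gc (γ : Fin 2 →₀ ℕ) : realRing :=
  toReal ((Γ.torus F).normCoeff G β0 (monoUnit (val (G.coeff β0))) γ)

/-- The inverse of the second coefficient of `F`. -/
def fi : realRing := toReal ((Γ.fc F Γ.α1 : Puiseux)⁻¹)

/-- The inverse of the second coefficient of `G`. -/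
def gi : realRing := toReal ((Γ.gc F G β0 β1 : Puiseux)⁻¹)

/-- The terms of positive order of `F`. -/
def tailF : MvPolynomial (Fin 4) realRing :=
  (Γ.torus F).part F Γ.α0 Γ.nF (F.support \ {Γ.α0, Γ.α1, Γ.α2, Γ.α3})

/-- The terms of positive order of `G`. -/
def tailG : MvPolynomial (Fin 4) realRing :=
  (Γ.torus F).part G β0 (monoUnit (val (G.coeff β0))) (G.support \ {β0, β1})

/-- The system describing the intersection. -/
def sys (x₀ ε : realRing) : QuadSystem realRing where
  ψA := Γ.tailF F - C (Γ.fc F Γ.α1 * Γ.gi F G β0 β1) * Γ.tailG F G β0 β1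
  ψB := C (Γ.gi F G β0 β1) * Γ.tailG F G β0 β1
  θ := toReal (signReal (Γ.torus F).θ * (Γ.torus F).θ)
  x₀ := x₀
  ε := ε
  h := C (signReal (Γ.torus F).θ) * TorusChart.hpow Γ.k

/-- The parameter of the system. -/
def param : realRing := Γ.fc F Γ.α0 - Γ.fc F Γ.α1 * (Γ.gc F G β0 β0 * Γ.gi F G β0 β1)

/-- `F` and `G` are real with the tropical polynomials of the chart. -/
structure Adapted (Q' : TropPoly) (e' : Set (Fin 2 → ℝ)) : Prop where
  tropF : tropPoly F = Q
  tropG : tropPoly G = Q'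
  realF : ∀ γ, IsRealSeries (F.coeff γ)
  realG : ∀ γ, IsRealSeries (G.coeff γ)
  aligned : Γ.Aligned Q' e' β0 β1

theorem vertex_mem (j : ℤ) : Γ.vertex j ∈ e := by
  rw [vertex]; split_ifs
  · exact Γ.v1_mem
  · exact Γ.v2_mem

/-! ### The normal forms of the two curves -/

namespace Adapted

variable {Γ F G β0 β1} (h : Γ.Adapted F G β0 β1 Q' e')

include h

theorem ne : β0 ≠ β1 := by
  rintro rfl
  have := h.aligned.i1
  rw [Γ.L.i_self] at this
  exact zero_ne_one this

theorem mem0 {v : Fin 2 → ℝ} (hv : v ∈ e) : β0 ∈ Q'.maxAt v := by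
  rw [h.aligned.maxAt_eq v hv]; simp

theorem mem1 {v : Fin 2 → ℝ} (hv : v ∈ e) : β1 ∈ Q'.maxAt v := by
  rw [h.aligned.maxAt_eq v hv]; simp

theorem mem_supp0 : β0 ∈ Q'.supp := (TropPoly.mem_maxAt.1 (h.mem0 Γ.v1_mem)).1

theorem mem_supp1 : β1 ∈ Q'.supp := (TropPoly.mem_maxAt.1 (h.mem1 Γ.v1_mem)).1

theorem monoUnit_eq : monoUnit (val (G.coeff β0)) = monoUnit (-Q'.coeff β0) := by
  rw [val_coeff h.tropG]

theorem normCoeffF_pos {γ : Fin 2 →₀ ℕ} (hγ : γ ∈ F.support \ {Γ.α0, Γ.α1, Γ.α2, Γ.α3}) :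
    0 < val ((Γ.torus F).normCoeff F Γ.α0 Γ.nF γ) := by
  obtain ⟨h1, h2⟩ := Finset.mem_sdiff.1 hγ
  have h3 : γ ∈ Q.supp := h.tropF ▸ h1
  rw [nF, Γ.val_normCoeff h.tropF h.tropF h3, sub_pos]
  simp only [Finset.mem_insert, Finset.mem_singleton, not_or] at h2
  rw [vertex]
  split_ifs
  · exact TropPoly.term_lt_of_notMem Γ.mem01 h3 (by rw [Γ.max1]; simp [h2])
  · exact TropPoly.term_lt_of_notMem Γ.mem02 h3 (by rw [Γ.max2]; simp [h2])

theorem normCoeffG_pos {γ : Fin 2 →₀ ℕ} (hγ : γ ∈ G.support \ {β0, β1}) :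
    0 < val ((Γ.torus F).normCoeff G β0 (monoUnit (val (G.coeff β0))) γ) := by
  obtain ⟨h1, h2⟩ := Finset.mem_sdiff.1 hγ
  have h3 : γ ∈ Q'.supp := h.tropG ▸ h1
  rw [h.monoUnit_eq, Γ.val_normCoeff h.tropF h.tropG h3, sub_pos]
  exact TropPoly.term_lt_of_notMem (h.mem0 (Γ.vertex_mem _)) h3
    (by rwa [h.aligned.maxAt_eq _ (Γ.vertex_mem _)])

theorem normCoeffF_mem {γ : Fin 2 →₀ ℕ} (h3 : γ ∈ Q.supp)
    (h0 : 0 ≤ val ((Γ.torus F).normCoeff F Γ.α0 Γ.nF γ)) :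
    (Γ.torus F).normCoeff F Γ.α0 Γ.nF γ ∈ realRing :=
  mem_realRing_of_val (Γ.normCoeff_ne_zero h.tropF h3 _)
    (Γ.isReal_normCoeff h.tropF h.realF h.realF _ _ _) h0

theorem normCoeffG_mem {γ : Fin 2 →₀ ℕ} (h3 : γ ∈ Q'.supp)
    (h0 : 0 ≤ val ((Γ.torus F).normCoeff G β0 (monoUnit (val (G.coeff β0))) γ)) :
    (Γ.torus F).normCoeff G β0 (monoUnit (val (G.coeff β0))) γ ∈ realRing :=
  mem_realRing_of_val (Γ.normCoeff_ne_zero h.tropG h3 _)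
    (Γ.isReal_normCoeff h.tropF h.realF h.realG _ _ _) h0

theorem tailF_mem (γ : Fin 2 →₀ ℕ) (hγ : γ ∈ F.support \ {Γ.α0, Γ.α1, Γ.α2, Γ.α3}) :
    (Γ.torus F).normCoeff F Γ.α0 Γ.nF γ ∈ realRing :=
  h.normCoeffF_mem (h.tropF ▸ (Finset.mem_sdiff.1 hγ).1) (h.normCoeffF_pos hγ).le

theorem tailG_mem (γ : Fin 2 →₀ ℕ) (hγ : γ ∈ G.support \ {β0, β1}) :
    (Γ.torus F).normCoeff G β0 (monoUnit (val (G.coeff β0))) γ ∈ realRing :=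
  h.normCoeffG_mem (h.tropG ▸ (Finset.mem_sdiff.1 hγ).1) (h.normCoeffG_pos hγ).le

theorem fc_spec {γ : Fin 2 →₀ ℕ} (hγ : γ = Γ.α0 ∨ γ = Γ.α1) :
    (Γ.fc F γ : Puiseux) = (Γ.torus F).normCoeff F Γ.α0 Γ.nF γ ∧ ord (Γ.fc F γ : Puiseux) = 0 := by
  have hv : ∀ v ∈ e, γ ∈ Q.maxAt v := fun v hv => by
    rw [Γ.mem_iff] at hv
    rcases hγ with rfl | rfl
    · exact hv.1
    · exact hv.2
  have h3 : γ ∈ Q.supp := (TropPoly.mem_maxAt.1 (hv _ Γ.v1_mem)).1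
  have h0 : val ((Γ.torus F).normCoeff F Γ.α0 Γ.nF γ) = 0 := by
    rw [nF, Γ.val_normCoeff h.tropF h.tropF h3, sub_eq_zero]
    have hm := Γ.vertex_mem (Γ.L.j Γ.α0 γ)
    exact TropPoly.term_eq_of_mem (hv _ hm) ((Γ.mem_iff _).1 hm).1
  have h1 := coe_toReal (h.normCoeffF_mem h3 h0.ge)
  exact ⟨h1, by rw [fc, h1, ord_eq_zero_iff (Γ.normCoeff_ne_zero h.tropF h3 _), h0]⟩

theorem gc_spec {γ : Fin 2 →₀ ℕ} (hγ : γ = β0 ∨ γ = β1) :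
    (Γ.gc F G β0 γ : Puiseux) = (Γ.torus F).normCoeff G β0 (monoUnit (val (G.coeff β0))) γ ∧
      ord (Γ.gc F G β0 γ : Puiseux) = 0 := by
  have hv : ∀ v ∈ e, γ ∈ Q'.maxAt v := fun v hv => by
    rcases hγ with rfl | rfl
    · exact h.mem0 hv
    · exact h.mem1 hv
  have h3 : γ ∈ Q'.supp := (TropPoly.mem_maxAt.1 (hv _ Γ.v1_mem)).1
  have h0 : val ((Γ.torus F).normCoeff G β0 (monoUnit (val (G.coeff β0))) γ) = 0 := by
    rw [h.monoUnit_eq, Γ.val_normCoeff h.tropF h.tropG h3, sub_eq_zero]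
    have hm := Γ.vertex_mem (Γ.L.j β0 γ)
    exact TropPoly.term_eq_of_mem (hv _ hm) (h.mem0 hm)
  have h1 := coe_toReal (h.normCoeffG_mem h3 h0.ge)
  exact ⟨h1, by rw [gc, h1, ord_eq_zero_iff (Γ.normCoeff_ne_zero h.tropG h3 _), h0]⟩

theorem fc_mul_fi : Γ.fc F Γ.α1 * Γ.fi F = 1 := by
  obtain ⟨h1, h2⟩ := h.fc_spec (Or.inr rfl)
  refine Subtype.ext ?_
  have := coe_toReal (mem_realRing.2 ⟨(ord_inv_of_ord_eq_zero h2).ge, (Γ.fc F Γ.α1).2.2 |>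
    mem_realSubfield.1 |>.inv⟩)
  change (Γ.fc F Γ.α1 : Puiseux) * (Γ.fi F : Puiseux) = 1
  rw [fi, this, mul_inv_cancel₀ (ne_zero_of_ord_eq_zero h2)]

theorem gc_mul_gi : Γ.gc F G β0 β1 * Γ.gi F G β0 β1 = 1 := by
  obtain ⟨h1, h2⟩ := h.gc_spec (Or.inr rfl)
  refine Subtype.ext ?_
  have := coe_toReal (mem_realRing.2 ⟨(ord_inv_of_ord_eq_zero h2).ge, (Γ.gc F G β0 β1).2.2 |>
    mem_realSubfield.1 |>.inv⟩)
  change (Γ.gc F G β0 β1 : Puiseux) * (Γ.gi F G β0 β1 : Puiseux) = 1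
  rw [gi, this, mul_inv_cancel₀ (ne_zero_of_ord_eq_zero h2)]

theorem isReal_θ : IsRealSeries ((Γ.torus F).θ : Puiseux) := by
  have hT := Γ.isReal_torus h.tropF h.realF
  exact isRealSeries_units_mul (isRealSeries_units_mul (isRealSeries_units_zpow hT.1 _)
    (isRealSeries_units_inv hT.2.1)) (isRealSeries_units_inv hT.2.2)

/-- The valuation is `pf v1 - pf v2`, the lattice length of `e`. -/
theorem ord_θ : 0 < ord ((Γ.torus F).θ : Puiseux) := by
  rw [ord_pos_iff (Units.ne_zero _), TorusChart.θ, val_units_mul, val_units_mul, val_units_zpow,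
    val_units_inv, val_units_inv, Γ.val_X0, Γ.val_U0 h.tropF, Γ.val_W0 h.tropF]
  change 0 < (Γ.k : ℝ) * _ + _ + _
  linarith [Γ.pf_lt]

/-- The system uses |θ|; the sign of θ goes into `h`, so that κ carries all sign information. -/
theorem coe_sys_θ (x₀ ε : realRing) : ((Γ.sys F G β0 β1 x₀ ε).θ : Puiseux) =
    signReal (Γ.torus F).θ * (Γ.torus F).θ :=
  coe_toReal (mem_realRing.2 ⟨by rw [ord_signReal_mul]; exact h.ord_θ.le,
    (mem_realSubfield.1 (signReal _).2.2).mul h.isReal_θ⟩)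

theorem isPos_sys_θ (x₀ ε : realRing) : IsPos ((Γ.sys F G β0 β1 x₀ ε).θ : Puiseux) := by
  rw [h.coe_sys_θ]
  exact isPos_signReal_mul h.isReal_θ (Units.ne_zero _)

theorem small (x₀ ε : realRing) : (Γ.sys F G β0 β1 x₀ ε).Small realIdeal := by
  have hF : Γ.tailF F ∈ realIdeal.map (C : realRing →+* MvPolynomial (Fin 4) realRing) := by
    refine TorusChart.part_mem _ h.tailF_mem fun γ hγ => ?_
    rw [ord_pos_iff (Γ.normCoeff_ne_zero h.tropF (h.tropF ▸ (Finset.mem_sdiff.1 hγ).1) _)]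
    exact h.normCoeffF_pos hγ
  have hG : Γ.tailG F G β0 β1 ∈ realIdeal.map (C : realRing →+* MvPolynomial (Fin 4) realRing) := by
    refine TorusChart.part_mem _ h.tailG_mem fun γ hγ => ?_
    rw [ord_pos_iff (Γ.normCoeff_ne_zero h.tropG (h.tropG ▸ (Finset.mem_sdiff.1 hγ).1) _)]
    exact h.normCoeffG_pos hγ
  refine ⟨Ideal.sub_mem _ hF (Ideal.mul_mem_left _ _ hG), Ideal.mul_mem_left _ _ hG, ?_⟩
  rw [mem_realIdeal, h.coe_sys_θ, ord_signReal_mul]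
  exact h.ord_θ

/-- The constants of the chart absorb the coefficients of F at α₂ and α₃, so u and w appear with
coefficient 1. -/
theorem aeval_F {R : Type} [CommRing R] [Algebra Puiseux R] (z : Fin 2 → Rˣ) :
    aeval (fun i => (z i : R)) F =
      ((TorusChart.zmon z Γ.α0 * TorusChart.cst R Γ.nF : Rˣ) : R) * (realCst R (Γ.fc F Γ.α0) +
        realCst R (Γ.fc F Γ.α1) * (Γ.torus F).x z + (Γ.torus F).u z + (Γ.torus F).w z +
        eval₂ (realCst R) ![((Γ.torus F).x z : R), (((Γ.torus F).x z)⁻¹ : Rˣ), (Γ.torus F).u z,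
          (Γ.torus F).w z] (Γ.tailF F)) := by
  have hsub : ({Γ.α0, Γ.α1, Γ.α2, Γ.α3} : Finset (Fin 2 →₀ ℕ)) ⊆ F.support := by
    change _ ⊆ (tropPoly F).supp
    rw [h.tropF]
    intro γ hγ
    simp only [Finset.mem_insert, Finset.mem_singleton] at hγ
    rcases hγ with rfl | rfl | rfl | rfl
    exacts [Γ.mem_supp0, Γ.mem_supp1, Γ.mem_supp2, Γ.mem_supp3]
  have h2 : (Γ.torus F).normCoeff F Γ.α0 Γ.nF Γ.α2 = 1 := by
    change F.coeff Γ.α2 * ((Γ.nF⁻¹ * (Γ.torus F).scale (Γ.L.i Γ.α0 Γ.α2) (Γ.L.j Γ.α0 Γ.α2) :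
      Puiseuxˣ) : Puiseux) = 1
    rw [Γ.i2, Γ.j2, TorusChart.scale_zero_one]
    change _ * ((Γ.nF⁻¹ * (Γ.nF * (toUnit (F.coeff Γ.α2))⁻¹) : Puiseuxˣ) : Puiseux) = 1
    rw [inv_mul_cancel_left, Units.val_inv_eq_inv_val, coe_toUnit (coeff_ne_zero h.tropF Γ.mem_supp2),
      mul_inv_cancel₀ (coeff_ne_zero h.tropF Γ.mem_supp2)]
  have h3 : (Γ.torus F).normCoeff F Γ.α0 Γ.nF Γ.α3 = 1 := by
    change F.coeff Γ.α3 * ((Γ.nF⁻¹ * (Γ.torus F).scale (Γ.L.i Γ.α0 Γ.α3) (Γ.L.j Γ.α0 Γ.α3) :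
      Puiseuxˣ) : Puiseux) = 1
    rw [Γ.i3, Γ.j3, show Γ.k = (Γ.torus F).k from rfl, TorusChart.scale_neg_one]
    change _ * ((Γ.nF⁻¹ * (Γ.nF * (toUnit (F.coeff Γ.α3))⁻¹) : Puiseuxˣ) : Puiseux) = 1
    rw [inv_mul_cancel_left, Units.val_inv_eq_inv_val, coe_toUnit (coeff_ne_zero h.tropF Γ.mem_supp3),
      mul_inv_cancel₀ (coeff_ne_zero h.tropF Γ.mem_supp3)]
  rw [(Γ.torus F).aeval_eq_sum F Γ.α0 Γ.nF z, tailF, (Γ.torus F).eval₂_part h.tailF_mem,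
    ← Finset.sum_sdiff hsub, Finset.sum_insert (by simp [Γ.ne01, Γ.ne02, Γ.ne03]),
    Finset.sum_insert (by simp [Γ.ne12, Γ.ne13]), Finset.sum_insert (by simp [Γ.ne23]),
    Finset.sum_singleton, h2, h3, ← (h.fc_spec (Or.inl rfl)).1, ← (h.fc_spec (Or.inr rfl)).1]
  change _ * (_ + (_ * (((Γ.torus F).mon z (Γ.L.i Γ.α0 Γ.α0) (Γ.L.j Γ.α0 Γ.α0) : Rˣ) : R) +
    (_ * (((Γ.torus F).mon z (Γ.L.i Γ.α0 Γ.α1) (Γ.L.j Γ.α0 Γ.α1) : Rˣ) : R) +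
    (_ * (((Γ.torus F).mon z (Γ.L.i Γ.α0 Γ.α2) (Γ.L.j Γ.α0 Γ.α2) : Rˣ) : R) +
    _ * (((Γ.torus F).mon z (Γ.L.i Γ.α0 Γ.α3) (Γ.L.j Γ.α0 Γ.α3) : Rˣ) : R))))) = _
  rw [Γ.L.i_self, Γ.L.j_self, Γ.i1, Γ.j1, Γ.i2, Γ.j2, Γ.i3, Γ.j3, TorusChart.mon_zero_zero,
    TorusChart.mon_one_zero, TorusChart.mon_zero_one, show Γ.k = (Γ.torus F).k from rfl,
    TorusChart.mon_neg_one, map_one, Units.val_one, realCst, RingHom.comp_apply,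
    RingHom.comp_apply]
  change _ * (_ + (algebraMap Puiseux R (Γ.fc F Γ.α0 : Puiseux) * 1 + _)) =
    _ * (algebraMap Puiseux R (Γ.fc F Γ.α0 : Puiseux) +
      algebraMap Puiseux R (Γ.fc F Γ.α1 : Puiseux) * _ + _ + _ + _)
  ring

theorem aeval_G {R : Type} [CommRing R] [Algebra Puiseux R] (z : Fin 2 → Rˣ) :
    aeval (fun i => (z i : R)) G =
      ((TorusChart.zmon z β0 * TorusChart.cst R (monoUnit (val (G.coeff β0))) : Rˣ) : R) *
        (realCst R (Γ.gc F G β0 β0) + realCst R (Γ.gc F G β0 β1) * (Γ.torus F).x z +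
        eval₂ (realCst R) ![((Γ.torus F).x z : R), (((Γ.torus F).x z)⁻¹ : Rˣ), (Γ.torus F).u z,
          (Γ.torus F).w z] (Γ.tailG F G β0 β1)) := by
  have hsub : ({β0, β1} : Finset (Fin 2 →₀ ℕ)) ⊆ G.support := by
    change _ ⊆ (tropPoly G).supp
    rw [h.tropG]
    intro γ hγ
    simp only [Finset.mem_insert, Finset.mem_singleton] at hγ
    rcases hγ with rfl | rfl
    exacts [h.mem_supp0, h.mem_supp1]
  rw [(Γ.torus F).aeval_eq_sum G β0 (monoUnit (val (G.coeff β0))) z, tailG,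
    (Γ.torus F).eval₂_part h.tailG_mem,
    ← Finset.sum_sdiff hsub, Finset.sum_insert (by simp [h.ne]),
    Finset.sum_singleton, ← (h.gc_spec (Or.inl rfl)).1, ← (h.gc_spec (Or.inr rfl)).1]
  change _ * (_ + (_ * (((Γ.torus F).mon z (Γ.L.i β0 β0) (Γ.L.j β0 β0) : Rˣ) : R) +
    (_ * (((Γ.torus F).mon z (Γ.L.i β0 β1) (Γ.L.j β0 β1) : Rˣ) : R)))) = _
  rw [Γ.L.i_self, Γ.L.j_self, h.aligned.i1, h.aligned.j1, TorusChart.mon_zero_zero,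
    TorusChart.mon_one_zero, Units.val_one, realCst, RingHom.comp_apply, RingHom.comp_apply]
  change _ * (_ + (algebraMap Puiseux R (Γ.gc F G β0 β0 : Puiseux) * 1 + _)) =
    _ * (algebraMap Puiseux R (Γ.gc F G β0 β0 : Puiseux) +
      algebraMap Puiseux R (Γ.gc F G β0 β1 : Puiseux) * _ + _)
  ring

/-- The value -g₀ / g₁ may be split as x₀ + ε a in any way. The choice ε = 0 keeps the system fixed
when a coefficient of F varies, and ε = 1 / f₁ does so when a coefficient of G varies. -/
theorem isQuadChart {x₀ ε : realRing}
    (hx : x₀ + ε * Γ.param F G β0 β1 = -(Γ.gc F G β0 β0 * Γ.gi F G β0 β1)) :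
    IsQuadChart F G e (Γ.torus F) (Γ.sys F G β0 β1 x₀ ε) (Γ.param F G β0 β1) where
  real := Γ.isReal_torus h.tropF h.realF
  small := h.small x₀ ε
  isUnit := by
    change IsUnit (x₀ + ε * Γ.param F G β0 β1)
    rw [hx, IsUnit.neg_iff]
    exact (isUnit_realRing_iff.2 (h.gc_spec (Or.inl rfl)).2).mul
      (IsUnit.of_mul_eq_one_right _ h.gc_mul_gi)
  θ_eq R _ _ x := by
    change realCst R (Γ.sys F G β0 β1 x₀ ε).θ * eval₂ (realCst R) ![(x : R), ((x⁻¹ : Rˣ) : R)]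
      (C (signReal (Γ.torus F).θ) * TorusChart.hpow Γ.k) = _
    rw [eval₂_mul, eval₂_C, TorusChart.eval₂_hpow, Units.val_mul, TorusChart.val_cst]
    have h1 : realCst R (Γ.sys F G β0 β1 x₀ ε).θ = realCst R (signReal (Γ.torus F).θ) *
        algebraMap Puiseux R (Γ.torus F).θ := by
      change algebraMap Puiseux R ((Γ.sys F G β0 β1 x₀ ε).θ : Puiseux) = _
      rw [h.coe_sys_θ, map_mul]; rfl
    have h2 : realCst R (signReal (Γ.torus F).θ) * realCst R (signReal (Γ.torus F).θ) = 1 := by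
      rw [← map_mul, signReal_mul_self, map_one]
    rw [h1]
    change _ = _ * ((x ^ Γ.k : Rˣ) : R)
    linear_combination (algebraMap Puiseux R (Γ.torus F).θ * ((x ^ Γ.k : Rˣ) : R)) * h2
  eq_F R _ _ z := by
    -- Subtracting f₁ times the equation of G removes x from the linear part of F and produces a =
    -- f₀ - f₁ g₀ / g₁.
    refine ⟨TorusChart.zmon z Γ.α0 * TorusChart.cst R Γ.nF, realCst R (Γ.fc F Γ.α1),
      (h.aeval_F z).trans ?_⟩
    congr 1
    have h1 : realCst R (Γ.gc F G β0 β1) * realCst R (Γ.gi F G β0 β1) = 1 := by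
      rw [← map_mul, h.gc_mul_gi, map_one]
    rw [QuadSystem.exprA, QuadSystem.exprB]
    change _ = realCst R (Γ.param F G β0 β1) + _ + _ + eval₂ _ _ (Γ.tailF F -
      C (Γ.fc F Γ.α1 * Γ.gi F G β0 β1) * Γ.tailG F G β0 β1) + _ * (_ -
      realCst R (x₀ + ε * Γ.param F G β0 β1) +
      eval₂ _ _ (C (Γ.gi F G β0 β1) * Γ.tailG F G β0 β1))
    rw [hx, param, eval₂_sub, eval₂_mul, eval₂_mul, eval₂_C, eval₂_C]
    simp only [map_sub, map_mul, map_neg]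
    ring
  eq_G R _ _ z := by
    have h1 : realCst R (Γ.gi F G β0 β1) * realCst R (Γ.gc F G β0 β1) = 1 := by
      rw [← map_mul, mul_comm, h.gc_mul_gi, map_one]
    let g : Rˣ := ⟨realCst R (Γ.gc F G β0 β1), realCst R (Γ.gi F G β0 β1), by rw [mul_comm, h1], h1⟩
    refine ⟨TorusChart.zmon z β0 * TorusChart.cst R (monoUnit (val (G.coeff β0))) * g,
      (h.aeval_G z).trans ?_⟩
    generalize TorusChart.zmon z β0 * TorusChart.cst R (monoUnit (val (G.coeff β0))) = c
    rw [Units.val_mul, mul_assoc]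
    congr 1
    rw [QuadSystem.exprB]
    change _ = realCst R (Γ.gc F G β0 β1) * (_ - realCst R (x₀ + ε * Γ.param F G β0 β1) +
      eval₂ _ _ (C (Γ.gi F G β0 β1) * Γ.tailG F G β0 β1))
    rw [hx, eval₂_mul, eval₂_C]
    simp only [map_mul, map_neg]
    linear_combination (-realCst R (Γ.gc F G β0 β0) - eval₂ (realCst R) ![((Γ.torus F).x z : R),
      (((Γ.torus F).x z)⁻¹ : Rˣ), (Γ.torus F).u z, (Γ.torus F).w z] (Γ.tailG F G β0 β1)) * h1
  trop z := Γ.tropPoint_mem_iff h.tropF z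

end Adapted

end EdgeChart
end

noncomputable section
open MvPolynomial Puiseux

/-! ### Families of intersections depending on a parameter -/

theorem isPos_iff_of_sub_mem {x y : realRing} (hx : IsUnit x) (h : y - x ∈ realIdeal) :
    IsPos (x : Puiseux) ↔ IsPos (y : Puiseux) := by
  refine isPos_congr (mem_realSubfield.1 x.2.2) (mem_realSubfield.1 y.2.2) ?_
  rw [isUnit_realRing_iff.1 hx]
  exact mem_realIdeal.1 h

theorem isPos_four : IsPos (4 : Puiseux) := by
  have h := IsPos.one.add IsPos.one
  have := h.add h
  norm_num at this
  exact this

theorem mem_realIdeal_of_sq_mem {x : realRing} (h : x ^ 2 ∈ realIdeal) : x ∈ realIdeal := by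
  by_contra hx
  exact isUnit_realRing_iff_notMem.1 ((isUnit_realRing_iff_notMem.2 hx).pow 2) h

theorem isUnit_two_realRing : IsUnit (2 : realRing) := IsUnit.of_mul_eq_one _ two_mul_half

/-- The multiples of a monomial. -/
def multiple (r : ℝ) (n : ℕ) : Puiseux := mono r ((n + 1 : ℝ) : ℂ)

theorem multiple_coeff_ne_zero (n : ℕ) : (((n : ℝ) + 1 : ℝ) : ℂ) ≠ 0 := by
  exact_mod_cast n.succ_ne_zero

theorem val_multiple (r : ℝ) (n : ℕ) : val (multiple r n) = r := val_mono (multiple_coeff_ne_zero n)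

theorem multiple_ne_zero (r : ℝ) (n : ℕ) : multiple r n ≠ 0 := mono_ne_zero (multiple_coeff_ne_zero n)

theorem multiple_mem {r : ℝ} (hr : 0 < r) (n : ℕ) : multiple r n ∈ realRing :=
  mem_realRing_of_val (multiple_ne_zero r n) (IsRealSeries.mono r _) (by rw [val_multiple]; exact hr.le)

theorem multiple_injective (r : ℝ) : Function.Injective (multiple r) := by
  intro m n h
  have := congrArg (fun x : Puiseux => x.series.coeff r) h
  simp only [multiple, series_mono, HahnSeries.coeff_single_same] at this
  have h : m + 1 = n + 1 := by exact_mod_cast this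
  omega

theorem ord_four_mul (x : Puiseux) : ord (4 * x) = ord x := by
  have h2 : ord ((2 : realRing) : Puiseux) = 0 := isUnit_realRing_iff.1 isUnit_two_realRing
  have h4 : (4 : Puiseux) = ((2 : realRing) : Puiseux) * ((2 : realRing) : Puiseux) := by
    change (4 : Puiseux) = 2 * 2; norm_num
  rw [ord_mul, h4, ord_mul, h2, add_zero, zero_add]

theorem exists_realRing_sqrt {x : realRing} (hx : IsPos (x : Puiseux)) :
    ∃ s : realRing, s ^ 2 = x := by
  obtain ⟨s, hs, hsx⟩ := hx.exists_sqrt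
  refine ⟨⟨s, mem_realRing_of_val hs.ne_zero hs.isReal ?_⟩, Subtype.ext hsx⟩
  have h1 := (ord_nonneg_iff hx.ne_zero).1 x.2.1
  rw [← hsx, val_pow hs.ne_zero] at h1
  push_cast at h1
  linarith

theorem exists_inv_add {σ s : realRing} (hs : IsUnit s) (h : σ - s ∈ realIdeal) :
    ∃ τ, τ * (σ + s) = 1 := by
  have h1 : σ + s - 2 * s ∈ realIdeal := by rwa [show σ + s - 2 * s = σ - s by ring]
  exact (isUnit_of_sub_mem (isUnit_two_realRing.mul hs) h1).exists_left_inv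

namespace IsQuadChart

variable {F G : MvPolynomial (Fin 2) Puiseux} {e : Set (Fin 2 → ℝ)} {T : TorusChart}
  {D : QuadSystem realRing} {a p κ : realRing} {X Y U : QuadraticAlgebra realRing (-(D.θ * κ)) (-p)}

theorem disc_eq : disc D p κ = (p : Puiseux) ^ 2 + 4 * -((D.θ * κ : realRing) : Puiseux) := by
  rw [disc]; ring

/-- The square p² has order zero and dominates 4 θ κ, which has positive order. -/
theorem isPos_disc_of_isUnit (hθ : D.θ ∈ realIdeal) (hp : IsUnit p) : IsPos (disc D p κ) := by
  have h0 := isUnit_realRing_iff.1 (hp.pow 2)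
  have h1 : IsPos ((p : Puiseux) ^ 2) :=
    IsPos.sq (mem_realSubfield.1 p.2.2) (ne_zero_of_ord_eq_zero (isUnit_realRing_iff.1 hp))
  have h2 := mem_realIdeal.1 (realIdeal.mul_mem_left 4 (realIdeal.neg_mem
    (realIdeal.mul_mem_right κ hθ)))
  rw [disc_eq]
  refine h1.add_of_ord_lt (isPos_four.isReal.mul (mem_realSubfield.1 (D.θ * κ).2.2).neg) ?_
  rw [show ord ((p : Puiseux) ^ 2) = 0 from h0]
  exact h2

/-- The discriminant is a square plus a positive series, whatever the size of p. -/
theorem isPos_disc_of_neg (hθ : IsPos (D.θ : Puiseux)) (hκ : IsPos (-κ : Puiseux)) :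
    IsPos (disc D p κ) := by
  have h : IsPos (4 * -((D.θ * κ : realRing) : Puiseux)) := by
    refine isPos_four.mul ?_
    rw [show -((D.θ * κ : realRing) : Puiseux) = (D.θ : Puiseux) * -(κ : Puiseux) by
      rw [mul_neg]; rfl]
    exact hθ.mul hκ
  rw [disc_eq]
  by_cases hp : (p : Puiseux) = 0
  · rw [hp, zero_pow two_ne_zero, zero_add]; exact h
  · exact (IsPos.sq (mem_realSubfield.1 p.2.2) hp).add h

theorem exists_isSol (hC : IsQuadChart F G e T D a) {y : realRing} (hy : (D.x₀ + D.ε * a) * y = 1) :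
    ∃ p κ X Y U, D.IsSol a p κ X Y U ∧ p - a ∈ realIdeal ∧
      κ - eval ![D.x₀ + D.ε * a, y] D.h ∈ realIdeal :=
  QuadSystem.exists_isSol_of_left realRing_fixedPointProperty hC.small hy

theorem twoReal_of_notMem (hC : IsQuadChart F G e T D a) (ha : a ∉ realIdeal) :
    TwoReal F G e := by
  obtain ⟨y, hy⟩ := hC.isUnit.exists_right_inv
  obtain ⟨p, κ, X, Y, U, hS, hp, -⟩ := hC.exists_isSol hy
  exact hC.twoReal_of_isPos hS (isPos_disc_of_isUnit hC.small.θ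
    (isUnit_of_sub_mem (isUnit_realRing_iff_notMem.2 ha) hp))

theorem twoReal_of_isPos_neg (hC : IsQuadChart F G e T D a) (hθ : IsPos (D.θ : Puiseux))
    {y : realRing} (hy : (D.x₀ + D.ε * a) * y = 1)
    (hu : IsUnit (eval ![D.x₀ + D.ε * a, y] D.h))
    (hh : IsPos (-(eval ![D.x₀ + D.ε * a, y] D.h : realRing) : Puiseux)) : TwoReal F G e := by
  obtain ⟨p, κ, X, Y, U, hS, -, hκ⟩ := hC.exists_isSol hy
  refine hC.twoReal_of_isPos hS (isPos_disc_of_neg hθ ?_)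
  have h1 : -κ - -(eval ![D.x₀ + D.ε * a, y] D.h) ∈ realIdeal := by
    rw [← neg_sub', ]
    exact realIdeal.neg_mem hκ
  exact (isPos_iff_of_sub_mem hu.neg h1).1 hh

theorem twoReal_or (hC : IsQuadChart F G e T D a) :
    TwoReal F G e ∨ TwoConj F G e ∨ DoubleReal F G e := by
  obtain ⟨y, hy⟩ := hC.isUnit.exists_right_inv
  obtain ⟨p, κ, X, Y, U, hS, -, -⟩ := hC.exists_isSol hy
  exact hC.trichotomy hS

/-- A family of pairs of curves whose intersections over `e` are described by the same system. -/
structure Family (D : QuadSystem realRing) (T : TorusChart) (e : Set (Fin 2 → ℝ))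
    (A : Set realRing) (F G : realRing → MvPolynomial (Fin 2) Puiseux) (y k : realRing) :
    Prop where
  chart : ∀ a ∈ A, IsQuadChart (F a) (G a) e T D a
  mem : ∀ a ∈ realIdeal, a ∈ A
  θ_pos : IsPos (D.θ : Puiseux)
  hy : D.x₀ * y = 1
  hk : eval ![D.x₀, y] D.h = k
  isUnit_k : IsUnit k
  k_pos : IsPos (k : Puiseux)

/-! ### Counting the parameters of each type -/

namespace Family

variable {A : Set realRing} {F G : realRing → MvPolynomial (Fin 2) Puiseux} {y k : realRing}
  (H : Family D T e A F G y k)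

include H

theorem small : D.Small realIdeal := (H.chart 0 (H.mem 0 realIdeal.zero_mem)).small

theorem θ_ne_zero : D.θ ≠ 0 := fun h => H.θ_pos.ne_zero (congrArg Subtype.val h)

/-- For small b the element x₀ + ε b remains a unit, and `h` evaluated there has the residue of k.
The sign of κ is therefore constant on the small parameters. -/
theorem exists_inv {b : realRing} (hb : b ∈ realIdeal) : ∃ y', (D.x₀ + D.ε * b) * y' = 1 ∧
    ∀ κ, κ - eval ![D.x₀ + D.ε * b, y'] D.h ∈ realIdeal → κ - k ∈ realIdeal := by
  have hm : D.x₀ + D.ε * b - D.x₀ ∈ realIdeal := by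
    rw [add_sub_cancel_left]; exact realIdeal.mul_mem_left _ hb
  obtain ⟨y', hy'⟩ := (isUnit_of_sub_mem (IsUnit.of_mul_eq_one _ H.hy) hm).exists_right_inv
  refine ⟨y', hy', fun κ hκ => ?_⟩
  have h1 : y' - y ∈ realIdeal := by
    have h2 : y' - y = -(y' * y) * (D.x₀ + D.ε * b - D.x₀) := by
      linear_combination y * hy' - y' * H.hy
    rw [h2]; exact realIdeal.mul_mem_left _ hm
  have h3 := MvPolynomial.eval₂_sub_eval₂_mem (RingHom.id realRing) realIdeal
    (v := ![D.x₀ + D.ε * b, y']) (v' := ![D.x₀, y]) (by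
      intro i; fin_cases i
      · exact hm
      · exact h1) D.h
  rw [← H.hk]
  have := realIdeal.add_mem hκ h3
  rwa [show κ - eval ![D.x₀ + D.ε * b, y'] D.h + (eval₂ (RingHom.id realRing)
    ![D.x₀ + D.ε * b, y'] D.h - eval₂ (RingHom.id realRing) ![D.x₀, y] D.h) =
    κ - eval ![D.x₀, y] D.h by simp only [eval, coe_eval₂Hom]; ring] at this

theorem eq_of_isSol {a p κ p' κ' : realRing} (ha : a ∈ realIdeal)
    {X Y U : QuadraticAlgebra realRing (-(D.θ * κ)) (-p)} (h : D.IsSol a p κ X Y U)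
    {X' Y' U' : QuadraticAlgebra realRing (-(D.θ * κ')) (-p')} (h' : D.IsSol a p' κ' X' Y' U') :
    p = p' ∧ κ = κ' := by
  obtain ⟨y', hy', -⟩ := H.exists_inv ha
  exact QuadSystem.IsSol.unique_of_left realRing_fixedPointProperty H.small H.θ_ne_zero hy' h h'

theorem exists_of_right {p : realRing} (hp : p ∈ realIdeal) : ∃ a ∈ realIdeal, ∃ κ X Y U,
    D.IsSol a p κ X Y U ∧ κ - k ∈ realIdeal := by
  obtain ⟨y', hy', hk'⟩ := H.exists_inv hp
  obtain ⟨a, κ, X, Y, U, hS, ha, hκ⟩ :=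
    QuadSystem.exists_isSol_of_right realRing_fixedPointProperty H.small hy'
  refine ⟨a, ?_, κ, X, Y, U, hS, hk' κ hκ⟩
  have := realIdeal.add_mem ha hp
  rwa [sub_add_cancel] at this

/-- The values of the parameter obtained from a sequence of values of `p`. -/
theorem infinite_of_forall (p : ℕ → realRing) (hp : ∀ n, p n ∈ realIdeal)
    (hinj : Function.Injective p) {Z : MvPolynomial (Fin 2) Puiseux → MvPolynomial (Fin 2) Puiseux →
      Prop} (hZ : ∀ n a κ X Y U, a ∈ A → D.IsSol a (p n) κ X Y U → κ - k ∈ realIdeal →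
      Z (F a) (G a)) : {a | a ∈ A ∧ Z (F a) (G a)}.Infinite := by
  choose a ha κ X Y U hS hκ using fun n => H.exists_of_right (hp n)
  -- Each p n is realised by some small a, and different p need different a because a determines p.
  refine Set.infinite_of_injective_forall_mem (f := a) (fun m n hmn => hinj ?_) fun n =>
    ⟨H.mem _ (ha n), hZ n _ _ _ _ _ (H.mem _ (ha n)) (hS n) (hκ n)⟩
  have h1 : ∀ b, b = a n → ∀ κ X Y U, D.IsSol b (p m) κ X Y U → p m = p n := by
    rintro b rfl κ X Y U h
    exact (H.eq_of_isSol (ha n) h (hS n)).1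
  exact h1 _ hmn _ _ _ _ (hS m)

theorem infinite_of_pos {r : ℝ} (hr : 0 < r) {Z : MvPolynomial (Fin 2) Puiseux →
      MvPolynomial (Fin 2) Puiseux → Prop} (hZ : ∀ (p : realRing), (p : Puiseux) ≠ 0 →
        val (p : Puiseux) = r → ∀ a κ X Y U, a ∈ A →
      D.IsSol a p κ X Y U → κ - k ∈ realIdeal → Z (F a) (G a)) :
    {a | a ∈ A ∧ Z (F a) (G a)}.Infinite := by
  refine H.infinite_of_forall (fun n => ⟨multiple r n, multiple_mem hr n⟩) (fun n => ?_)
    (fun m n h => multiple_injective r (congrArg Subtype.val h)) fun n =>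
      hZ ⟨multiple r n, multiple_mem hr n⟩ (multiple_ne_zero r n) (val_multiple r n)
  rw [mem_realIdeal]
  exact (ord_pos_iff (multiple_ne_zero r n)).2 (by rwa [val_multiple])

theorem val_θ_pos : 0 < val (D.θ : Puiseux) :=
  (ord_pos_iff H.θ_pos.ne_zero).1 (mem_realIdeal.1 H.small.θ)

theorem κ_spec {κ : realRing} (hκ : κ - k ∈ realIdeal) : IsUnit κ ∧ IsPos (κ : Puiseux) :=
  ⟨isUnit_of_sub_mem H.isUnit_k hκ, (isPos_iff_of_sub_mem H.isUnit_k hκ).1 H.k_pos⟩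

theorem ord_θκ {κ : realRing} (hκ : κ - k ∈ realIdeal) :
    ord (4 * ((D.θ * κ : realRing) : Puiseux)) = (val (D.θ : Puiseux) : ℝ) := by
  rw [ord_four_mul]
  change ord ((D.θ : Puiseux) * (κ : Puiseux)) = _
  rw [ord_mul, isUnit_realRing_iff.1 (H.κ_spec hκ).1, add_zero, ord_eq_val H.θ_pos.ne_zero]

/-- If p has order val θ / 3, then p² has smaller order than θ κ and gives the discriminant its
sign. -/
theorem infinite_twoReal : {a | a ∈ A ∧ TwoReal (F a) (G a) e}.Infinite := by
  have hv := H.val_θ_pos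
  refine H.infinite_of_pos (r := val (D.θ : Puiseux) / 3) (by linarith) (Z := fun F G => TwoReal F G e)
    fun p hp0 hp a κ X Y U ha hS hκ => ?_
  refine (H.chart a ha).twoReal_of_isPos hS ?_
  have h4 : IsRealSeries (4 * ((D.θ * κ : realRing) : Puiseux)) :=
    isPos_four.isReal.mul (mem_realSubfield.1 (D.θ * κ).2.2)
  rw [disc, sub_eq_add_neg]
  refine (IsPos.sq (mem_realSubfield.1 p.2.2) hp0).add_of_ord_lt h4.neg ?_
  rw [ord_neg, H.ord_θκ hκ, ord_eq_val (pow_ne_zero 2 hp0), val_pow hp0, hp, WithTop.coe_lt_coe]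
  push_cast
  linarith

/-- If p has order val θ, then p² has twice this order and -4 θ κ gives the discriminant its sign.
-/
theorem infinite_twoConj : {a | a ∈ A ∧ TwoConj (F a) (G a) e}.Infinite := by
  have hv := H.val_θ_pos
  refine H.infinite_of_pos hv (Z := fun F G => TwoConj F G e)
    fun p hp0 hp a κ X Y U ha hS hκ => ?_
  refine (H.chart a ha).twoConj_of_isPos_neg hS ?_
  rw [disc, neg_sub, sub_eq_add_neg]
  refine (isPos_four.mul (H.θ_pos.mul (H.κ_spec hκ).2)).add_of_ord_lt
    ((mem_realSubfield.1 p.2.2).pow 2).neg ?_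
  change ord (4 * ((D.θ * κ : realRing) : Puiseux)) < _
  rw [ord_neg, H.ord_θκ hκ, ord_eq_val (pow_ne_zero 2 hp0), val_pow hp0, hp, WithTop.coe_lt_coe]
  push_cast
  linarith

/-- A double point means p² = 4 θ κ. This makes p and a small, so κ is close to k = s² and has a
unique square root σ near s; hence p = 2 r σ with r one of the two roots of θ. Each r belongs to
exactly one a by `exists_isSol_double` and `unique_double`. -/
theorem encard_doubleReal : {a | a ∈ A ∧ DoubleReal (F a) (G a) e}.encard = 2 := by
  have hm := realRing_fixedPointProperty
  obtain ⟨s, hs⟩ := exists_realRing_sqrt H.k_pos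
  obtain ⟨r, hr⟩ := exists_realRing_sqrt H.θ_pos
  have hsu : IsUnit s := isUnit_pow_iff two_ne_zero |>.1 (hs ▸ H.isUnit_k)
  have hr0 : r ≠ 0 := by rintro rfl; exact H.θ_ne_zero (by rw [← hr]; ring)
  have hrm : r ∈ realIdeal := mem_realIdeal_of_sq_mem (hr ▸ H.small.θ)
  obtain ⟨t, ht⟩ := (isUnit_two_realRing.mul hsu).exists_right_inv
  have hs' : s ^ 2 = eval ![D.x₀, y] D.h := hs.trans H.hk.symm
  obtain ⟨a, σ, X, Y, U, hS, hσ, ha⟩ :=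
    QuadSystem.exists_isSol_double hm H.small H.hy hrm hs' ht
  obtain ⟨a', σ', X', Y', U', hS', hσ', ha'⟩ :=
    QuadSystem.exists_isSol_double hm H.small H.hy (realIdeal.neg_mem hrm) hs' ht
  -- The values of p are 2 r σ and -2 r σ'. They differ because σ + σ' is congruent to the unit 2 s.
  have hne : a ≠ a' := by
    have key : ∀ b, b = a' → D.IsSol b (2 * r * σ) (σ ^ 2) X Y U → False := by
      rintro b rfl h
      have h1 := (H.eq_of_isSol ha' h hS').1
      have h2 : IsUnit (σ + σ') := isUnit_of_sub_mem (isUnit_two_realRing.mul hsu) (by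
        rw [show σ + σ' - 2 * s = (σ - s) + (σ' - s) by ring]; exact realIdeal.add_mem hσ hσ')
      have h3 : 2 * r * (σ + σ') = 0 := by linear_combination h1
      exact mul_ne_zero (mul_ne_zero isUnit_two_realRing.ne_zero hr0) h2.ne_zero h3
    exact fun h => key a h hS
  have hD : ∀ (r σ : realRing), r ^ 2 = D.θ → disc D (2 * r * σ) (σ ^ 2) = 0 := by
    intro r σ h
    have : ((2 * r * σ) ^ 2 - 4 * (D.θ * σ ^ 2) : realRing) = 0 := by rw [← h]; ring
    exact congrArg Subtype.val this
  rw [Set.encard_eq_two]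
  refine ⟨a, a', hne, ?_⟩
  ext b
  rw [Set.mem_ofPred_eq, Set.mem_insert_iff, Set.mem_singleton_iff]
  constructor
  · rintro ⟨hbA, hb⟩
    have hC := H.chart b hbA
    obtain ⟨y', hy'⟩ := hC.isUnit.exists_right_inv
    obtain ⟨p, κ, X₁, Y₁, U₁, hS₁, hp, -⟩ := hC.exists_isSol hy'
    have hd := hC.disc_eq_zero_of_doubleReal hS₁ hb
    have hd' : p ^ 2 = 4 * (D.θ * κ) := Subtype.ext (sub_eq_zero.1 hd)
    have hpm : p ∈ realIdeal := mem_realIdeal_of_sq_mem (by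
      rw [hd']; exact realIdeal.mul_mem_left _ (realIdeal.mul_mem_right _ H.small.θ))
    have hbm : b ∈ realIdeal := by
      have := realIdeal.sub_mem hpm hp
      rwa [sub_sub_cancel] at this
    obtain ⟨y₂, hy₂, hk₂⟩ := H.exists_inv hbm
    obtain ⟨p₂, κ₂, X₂, Y₂, U₂, hS₂, -, hκ₂⟩ := hC.exists_isSol hy₂
    have hκ : κ - k ∈ realIdeal := by
      rw [(H.eq_of_isSol hbm hS₁ hS₂).2]; exact hk₂ _ hκ₂
    obtain ⟨s', hss⟩ := hsu.exists_right_inv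
    -- The root of κ near s is s ν with ν² = κ / s².
    obtain ⟨ν, hν, hν1⟩ := exists_sq_eq_one_add (μ := s' ^ 2 * (κ - k)) (realIdeal.mul_mem_left _ hκ)
    have hσκ : κ = (s * ν) ^ 2 := by
      rw [mul_pow, hν, hs]
      have : k * s' ^ 2 = 1 := by rw [← hs, ← mul_pow, hss, one_pow]
      linear_combination -(κ - k) * this
    have hσs : s * ν - s ∈ realIdeal := by
      rw [show s * ν - s = s * (ν - 1) by ring]; exact realIdeal.mul_mem_left _ hν1
    obtain ⟨τ, hτ⟩ := exists_inv_add hsu hσs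
    have hpp : (p - 2 * r * (s * ν)) * (p - 2 * -r * (s * ν)) = 0 := by
      rw [hσκ, ← hr] at hd'
      linear_combination hd'
    rcases mul_eq_zero.1 hpp with h1 | h1
    · left
      obtain ⟨τ', hτ'⟩ := exists_inv_add hsu hσ
      exact QuadSystem.IsSol.unique_double hm H.small H.θ_ne_zero H.hy hrm hs' ht hτ hτ'
        (sub_eq_zero.1 h1) hσκ rfl rfl hS₁ hS
    · right
      obtain ⟨τ', hτ'⟩ := exists_inv_add hsu hσ'
      exact QuadSystem.IsSol.unique_double hm H.small H.θ_ne_zero H.hy (realIdeal.neg_mem hrm) hs' ht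
        hτ hτ' (sub_eq_zero.1 h1) hσκ rfl rfl hS₁ hS'
  · rintro (rfl | rfl)
    · exact ⟨H.mem _ ha, (H.chart _ (H.mem _ ha)).doubleReal_of_eq_zero hS (hD r σ hr)⟩
    · exact ⟨H.mem _ ha', (H.chart _ (H.mem _ ha')).doubleReal_of_eq_zero hS'
        (hD (-r) σ' (by rw [neg_sq, hr]))⟩

end Family

end IsQuadChart
end

noncomputable section
open MvPolynomial Puiseux

/-! ### The tropicalisation of a curve with non-singular tropical polynomial -/

theorem TropPoly.maxAt_nonempty {P : TropPoly} (h : P.supp.Nonempty) (v : Fin 2 → ℝ) :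
    (P.maxAt v).Nonempty := by
  obtain ⟨α, hα, hmax⟩ := Finset.exists_max_image P.supp (fun α => P.term α v) h
  exact ⟨α, TropPoly.mem_maxAt.2 ⟨hα, hmax⟩⟩

section Term

variable {F : MvPolynomial (Fin 2) Puiseux} {p : Fin 2 → Puiseux}

theorem monomial_ne_zero (hp : ∀ i, p i ≠ 0) {γ : Fin 2 →₀ ℕ} (hγ : γ ∈ F.support) :
    F.coeff γ * ∏ i, p i ^ γ i ≠ 0 :=
  mul_ne_zero (mem_support_iff.1 hγ) (Finset.prod_ne_zero_iff.2 fun i _ => pow_ne_zero _ (hp i))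

theorem ord_monomial (hp : ∀ i, p i ≠ 0) {γ : Fin 2 →₀ ℕ} (hγ : γ ∈ F.support) :
    ord (F.coeff γ * ∏ i, p i ^ γ i) = ((-(tropPoly F).term γ (tropPoint p) : ℝ) : WithTop ℝ) := by
  rw [ord_eq_val (monomial_ne_zero hp hγ), val_mul (mem_support_iff.1 hγ)
    (Finset.prod_ne_zero_iff.2 fun i _ => pow_ne_zero _ (hp i)), Fin.prod_univ_two,
    val_mul (pow_ne_zero _ (hp 0)) (pow_ne_zero _ (hp 1)), val_pow (hp 0), val_pow (hp 1),
    TropPoly.term, Fin.sum_univ_two]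
  change _ = ((-(-val (F.coeff γ) + ((γ 0 : ℝ) * -val (p 0) + (γ 1 : ℝ) * -val (p 1))) : ℝ) :
    WithTop ℝ)
  congr 1
  ring

/-- If the maximum were attained only once, a single term of F would have least order and could not
be cancelled. -/
theorem tropPoint_mem_curve (hF : F ≠ 0) (hp : p ∈ torusCurve F) :
    tropPoint p ∈ (tropPoly F).curve := by
  classical
  rw [TropPoly.mem_curve]
  by_contra hlt
  have hne := TropPoly.maxAt_nonempty (P := tropPoly F) (by
    change F.support.Nonempty
    rwa [Finset.nonempty_iff_ne_empty, Ne, support_eq_empty]) (tropPoint p)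
  obtain ⟨γ, hγ⟩ := Finset.card_eq_one.1 (le_antisymm (Nat.lt_succ_iff.1 (not_le.1 hlt))
    (Finset.card_pos.2 hne))
  have hγm : γ ∈ (tropPoly F).maxAt (tropPoint p) := by rw [hγ]; simp
  have hγs : γ ∈ F.support := (TropPoly.mem_maxAt.1 hγm).1
  have h0 := hp.2
  rw [eval_eq', ← Finset.add_sum_erase _ _ hγs] at h0
  have h1 : ord (F.coeff γ * ∏ i, p i ^ γ i) <
      ord (∑ β ∈ F.support.erase γ, F.coeff β * ∏ i, p i ^ β i) := by
    rw [ord_monomial hp.1 hγs]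
    refine ord_sum_lt _ _ _ (WithTop.coe_lt_top _) fun β hβ => ?_
    obtain ⟨hβ1, hβ2⟩ := Finset.mem_erase.1 hβ
    rw [ord_monomial hp.1 hβ2, WithTop.coe_lt_coe, neg_lt_neg_iff]
    exact TropPoly.term_lt_of_notMem hγm hβ2 (by rw [hγ]; simpa using hβ1)
  have h2 := ord_add_eq_left h1
  rw [h0, ord_zero, eq_comm, ord_eq_top] at h2
  exact monomial_ne_zero hp.1 hγs h2

end Term

/-- The torus chart centred at a point of the plane. -/
def LatticeFrame.chartAt (L : LatticeFrame) (v : Fin 2 → ℝ) : TorusChart where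
  L := L
  k := 0
  X0 := monoUnit (-L.pe v)
  U0 := monoUnit (-L.pf v)
  W0 := (monoUnit (-L.pf v))⁻¹

/-! ### Lifting points of the tropical curve -/

namespace LatticeFrame

variable (L : LatticeFrame) (v : Fin 2 → ℝ)

theorem val_scale_chartAt (i j : ℤ) :
    val ((L.chartAt v).scale i j) = -(i * L.pe v + j * L.pf v) := by
  rw [TorusChart.scale]
  split_ifs
  · rw [val_units_mul, val_units_zpow, val_units_zpow, chartAt, val_monoUnit, val_monoUnit]; ring
  · rw [val_units_mul, val_units_zpow, val_units_zpow, chartAt, val_monoUnit, val_units_inv,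
      val_monoUnit]
    push_cast
    ring

theorem isReal_chartAt : (L.chartAt v).IsReal :=
  ⟨(isPos_monoUnit _).isReal, (isPos_monoUnit _).isReal,
    isRealSeries_units_inv (isPos_monoUnit _).isReal⟩

variable {F : MvPolynomial (Fin 2) Puiseux}

theorem val_normCoeff_chartAt {o γ : Fin 2 →₀ ℕ} (hγ : γ ∈ F.support) :
    val ((L.chartAt v).normCoeff F o (monoUnit (val (F.coeff o))) γ) =
      (tropPoly F).term o v - (tropPoly F).term γ v := by
  rw [TorusChart.normCoeff, val_mul (mem_support_iff.1 hγ) (Units.ne_zero _), val_units_mul,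
    val_units_inv, val_monoUnit, L.val_scale_chartAt]
  have := L.term_sub_eq (tropPoly F) o γ v
  have h1 : (tropPoly F).coeff γ = -val (F.coeff γ) := rfl
  have h2 : (tropPoly F).coeff o = -val (F.coeff o) := rfl
  rw [h1, h2] at this
  change _ + (_ + -(L.i o γ * L.pe v + L.j o γ * L.pf v)) = _
  linarith

theorem ord_normCoeff_chartAt {o γ : Fin 2 →₀ ℕ} (hγ : γ ∈ F.support) :
    ord ((L.chartAt v).normCoeff F o (monoUnit (val (F.coeff o))) γ) =
      (((tropPoly F).term o v - (tropPoly F).term γ v : ℝ) : WithTop ℝ) := by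
  have h : (L.chartAt v).normCoeff F o (monoUnit (val (F.coeff o))) γ ≠ 0 :=
    mul_ne_zero (mem_support_iff.1 hγ) (Units.ne_zero _)
  rw [ord_eq_val h, L.val_normCoeff_chartAt v hγ]

theorem normCoeff_chartAt_mem (hr : ∀ γ, IsRealSeries (F.coeff γ)) {o γ : Fin 2 →₀ ℕ}
    (ho : o ∈ (tropPoly F).maxAt v) (hγ : γ ∈ F.support) :
    (L.chartAt v).normCoeff F o (monoUnit (val (F.coeff o))) γ ∈ realRing := by
  rw [mem_realRing, L.ord_normCoeff_chartAt v hγ]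
  refine ⟨?_, (hr γ).mul (isRealSeries_units_mul (isRealSeries_units_inv (isPos_monoUnit _).isReal)
    (TorusChart.isReal_scale _ (L.isReal_chartAt v) _ _))⟩
  exact_mod_cast sub_nonneg.2 ((TropPoly.mem_maxAt.1 ho).2 γ hγ)

theorem val_inv_chartAt {x u : Puiseuxˣ} (hx : val x = 0) (hu : val u = 0) :
    tropPoint (fun i => ((L.chartAt v).inv x u i : Puiseux)) = v := by
  have hd := L.det_real
  have hs := L.sq_real
  funext l
  rw [tropPoint]
  fin_cases l
  · change -val (((TorusChart.cst Puiseux _ * x) ^ (L.D * L.f1) *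
      (TorusChart.cst Puiseux _ * u) ^ (-(L.D * L.e1)) : Puiseuxˣ) : Puiseux) = v 0
    rw [TorusChart.cst_self, TorusChart.cst_self, val_units_mul, val_units_zpow, val_units_zpow,
      val_units_mul, val_units_mul, hx, hu, chartAt, val_monoUnit, val_monoUnit, pe, pf]
    push_cast
    linear_combination (L.D * v 0 : ℝ) * hd + v 0 * hs
  · change -val (((TorusChart.cst Puiseux _ * x) ^ (-(L.D * L.f0)) *
      (TorusChart.cst Puiseux _ * u) ^ (L.D * L.e0) : Puiseuxˣ) : Puiseux) = v 1
    rw [TorusChart.cst_self, TorusChart.cst_self, val_units_mul, val_units_zpow, val_units_zpow,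
      val_units_mul, val_units_mul, hx, hu, chartAt, val_monoUnit, val_monoUnit, pe, pf]
    push_cast
    linear_combination (L.D * v 1 : ℝ) * hd + v 1 * hs

end LatticeFrame

theorem mem_map_C_of_mem_map_C {n m : ℕ} {v : Fin n → MvPolynomial (Fin m) realRing}
    {p : MvPolynomial (Fin n) realRing}
    (hp : p ∈ realIdeal.map (C : realRing →+* MvPolynomial (Fin n) realRing)) :
    eval₂ C v p ∈ realIdeal.map (C : realRing →+* MvPolynomial (Fin m) realRing) :=
  MvPolynomial.eval₂_mem_of_mem_map _ (fun _ h => Ideal.mem_map_of_mem _ h) v hp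

/-- A perturbed linear equation has a unit solution. -/
theorem exists_unit_solution {g f c : realRing} (hg : IsUnit g) (hf : IsUnit f) (hc : IsUnit c)
    {Ψ : MvPolynomial (Fin 4) realRing}
    (hΨ : Ψ ∈ realIdeal.map (C : realRing →+* MvPolynomial (Fin 4) realRing)) :
    ∃ x y d : realRing, x * y = 1 ∧ c * d = 1 ∧ g + f * x + eval ![x, y, c, d] Ψ = 0 := by
  obtain ⟨g', hg'⟩ := hg.exists_right_inv
  obtain ⟨f', hf'⟩ := hf.exists_right_inv
  obtain ⟨d, hd⟩ := hc.exists_right_inv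
  let Θ : MvPolynomial (Fin 2) realRing := eval₂ C ![X 0, X 1, C c, C d] Ψ
  have hΘ : Θ ∈ realIdeal.map (C : realRing →+* MvPolynomial (Fin 2) realRing) :=
    mem_map_C_of_mem_map_C hΨ
  -- The unknowns are x and its inverse y, started at -g / f and -f / g. The equation for y is y (g
  -- + E) = -f, where E is the value of the perturbation.
  obtain ⟨z, hz, -⟩ := realRing_fixedPointProperty 2 ![-(g * f'), -(g' * f)]
    ![-(C f' * Θ), X 1 * (-(C (g' * f) * (C f' * Θ)))] (by
      intro i
      fin_cases i
      · exact neg_mem (Ideal.mul_mem_left _ _ hΘ)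
      · exact Ideal.mul_mem_left _ _ (neg_mem (Ideal.mul_mem_left _ _
          (Ideal.mul_mem_left _ _ hΘ))))
  have hev : eval z Θ = eval ![z 0, z 1, c, d] Ψ := by
    have := QuadSystem.hom_eval₂_four (eval z) (C : realRing →+* MvPolynomial (Fin 2) realRing)
      (X 0) (X 1) (C c) (C d) Ψ
    rw [eval_X, eval_X, eval_C, eval_C] at this
    rw [this, show (eval z).comp (C : realRing →+* MvPolynomial (Fin 2) realRing) = RingHom.id _ from
      RingHom.ext fun b => eval_C b]
    rfl
  have h0 : z 0 = -(g * f') + eval z (-(C f' * Θ)) := hz 0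
  have h1 : z 1 = -(g' * f) + eval z (X 1 * (-(C (g' * f) * (C f' * Θ)))) := hz 1
  simp only [map_neg, map_mul, eval_C, eval_X] at h0 h1
  rw [hev] at h0 h1
  refine ⟨z 0, z 1, d, ?_, hd, ?_⟩
  · generalize eval ![z 0, z 1, c, d] Ψ = E at h0 h1
    have h2 : z 1 * (g + E) + f = 0 := by
      linear_combination g * h1 - (f + z 1 * E) * hg' - z 1 * E * g * g' * hf'
    linear_combination z 1 * h0 - f' * h2 + hf'
  · linear_combination f * h0 - (g + eval ![z 0, z 1, c, d] Ψ) * hf'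

theorem isUnit_realRing_coe {x : realRing} (hx : IsUnit x) :
    ∃ y : Puiseuxˣ, (y : Puiseux) = x ∧ val (y : Puiseux) = 0 := by
  have h := isUnit_realRing_iff.1 hx
  have h0 := ne_zero_of_ord_eq_zero h
  exact ⟨Units.mk0 x h0, rfl, (ord_eq_zero_iff h0).1 h⟩

open Classical in
/-- A point of the curve over `v`, provided a partial sum of the initial form is a unit. -/
theorem exists_mem_torusCurve {F : MvPolynomial (Fin 2) Puiseux}
    (hr : ∀ γ, IsRealSeries (F.coeff γ)) {v : Fin 2 → ℝ} (L : LatticeFrame) {α β : Fin 2 →₀ ℕ}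
    (hα : α ∈ (tropPoly F).maxAt v) (hβ : β ∈ (tropPoly F).maxAt v) (hi : L.i α β = 1)
    (hj : L.j α β = 0)
    (h0 : ∀ γ ∈ (tropPoly F).maxAt v, γ ≠ β → L.i α γ = 0 ∧ 0 ≤ L.j α γ)
    {c g : realRing} (hc : IsUnit c) (hg : IsUnit g)
    (hgc : (g : Puiseux) = ∑ γ ∈ ((tropPoly F).maxAt v).erase β,
      (L.chartAt v).normCoeff F α (monoUnit (val (F.coeff α))) γ * (c : Puiseux) ^ (L.j α γ).toNat) :
    ∃ p ∈ torusCurve F, tropPoint p = v := by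
  set T := L.chartAt v with hT
  set nc := T.normCoeff F α (monoUnit (val (F.coeff α))) with hnc
  have hmem : ∀ γ ∈ F.support, nc γ ∈ realRing := fun γ hγ => L.normCoeff_chartAt_mem v hr hα hγ
  have hβs : β ∈ F.support := (TropPoly.mem_maxAt.1 hβ).1
  have hfu : IsUnit (⟨nc β, hmem β hβs⟩ : realRing) := by
    rw [isUnit_realRing_iff]
    change ord (nc β) = 0
    rw [hnc, hT, L.ord_normCoeff_chartAt v hβs, TropPoly.term_eq_of_mem hβ hα, sub_self]
    rfl
  set S := F.support \ (tropPoly F).maxAt v with hS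
  have hSm : ∀ γ ∈ S, nc γ ∈ realRing := fun γ hγ => hmem γ (Finset.mem_sdiff.1 hγ).1
  have hΨ := T.part_mem (o := α) (n := monoUnit (val (F.coeff α))) hSm (by
    intro γ hγ
    obtain ⟨h1, h2⟩ := Finset.mem_sdiff.1 hγ
    rw [hT, L.ord_normCoeff_chartAt v h1]
    exact_mod_cast sub_pos.2 (TropPoly.term_lt_of_notMem hα h1 h2))
  obtain ⟨x, y, d, hxy, hcd, heq⟩ := exists_unit_solution hg hfu hc hΨ
  obtain ⟨x', hx', hx0⟩ := isUnit_realRing_coe (IsUnit.of_mul_eq_one _ hxy)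
  obtain ⟨c', hc', hc0⟩ := isUnit_realRing_coe hc
  set z := T.inv x' c' with hz
  have hzx : T.x z = x' := T.x_inv _ _
  have hzu : T.u z = c' := T.u_inv _ _
  have hyv : (((T.x z)⁻¹ : Puiseuxˣ) : Puiseux) = y := by
    rw [hzx]
    refine (Units.mul_right_inj x').1 ?_
    rw [Units.mul_inv, hx']
    exact (congrArg Subtype.val hxy).symm
  have hw : (T.w z : Puiseux) = d := by
    have h1 := T.u_mul_w z
    -- In this chart k = 0 and W₀ = U₀⁻¹, so θ = 1 and w = 1 / u.
    have h2 : TorusChart.cst Puiseux T.θ * T.x z ^ T.k = 1 := by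
      rw [TorusChart.cst_self, TorusChart.θ, hT]
      change (L.chartAt v).X0 ^ (0 : ℤ) * (L.chartAt v).U0⁻¹ * (L.chartAt v).U0⁻¹⁻¹ *
        (T.x z) ^ (0 : ℤ) = 1
      rw [zpow_zero, zpow_zero, one_mul, mul_inv_cancel, mul_one]
    rw [h2, hzu] at h1
    refine (Units.mul_right_inj c').1 ?_
    rw [← Units.val_mul, h1, hc']
    exact (congrArg Subtype.val hcd).symm
  refine ⟨fun i => (z i : Puiseux), ⟨fun i => (z i).ne_zero, ?_⟩, L.val_inv_chartAt v hx0 hc0⟩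
  have hsub : (tropPoly F).maxAt v ⊆ F.support := fun γ hγ => (TropPoly.mem_maxAt.1 hγ).1
  have h1 := T.aeval_eq_sum F α (monoUnit (val (F.coeff α))) z
  rw [← Finset.sum_sdiff hsub, ← Finset.add_sum_erase _ _ hβ, ← T.eval₂_part hSm, hzx, hzu] at h1
  rw [hzx] at hyv
  rw [hyv, hw, hx', hc'] at h1
  change eval (fun i => (z i : Puiseux)) F = _ at h1
  rw [h1]
  refine mul_eq_zero_of_right _ ?_
  have h2 : (T.mon z (T.L.i α β) (T.L.j α β) : Puiseux) = x := by
    change (T.mon z (L.i α β) (L.j α β) : Puiseux) = x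
    rw [hi, hj, TorusChart.mon_one_zero, hzx, hx']
  have h3 : ∑ γ ∈ ((tropPoly F).maxAt v).erase β, algebraMap Puiseux Puiseux (nc γ) *
      (T.mon z (T.L.i α γ) (T.L.j α γ) : Puiseux) = g := by
    rw [hgc]
    refine Finset.sum_congr rfl fun γ hγ => ?_
    obtain ⟨h4, h5⟩ := Finset.mem_erase.1 hγ
    obtain ⟨h6, h7⟩ := h0 γ h5 h4
    change nc γ * (T.mon z (L.i α γ) (L.j α γ) : Puiseux) = _
    rw [h6, TorusChart.mon, if_pos h7, zpow_zero, one_mul, TorusChart.val_zpow_of_nonneg _ h7, hzu,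
      hc']
  have h8 := QuadSystem.hom_eval₂_four realRing.subtype (RingHom.id realRing) x y c d
    (T.part F α (monoUnit (val (F.coeff α))) S)
  have h9 := congrArg Subtype.val heq
  change (g : Puiseux) + nc β * x + realRing.subtype (eval₂ (RingHom.id realRing) ![x, y, c, d]
    (T.part F α (monoUnit (val (F.coeff α))) S)) = 0 at h9
  rw [h8] at h9
  rw [h3, h2]
  change eval₂ _ ![(x : Puiseux), (y : Puiseux), (c : Puiseux), (d : Puiseux)] _ + (nc β * x + g) = 0
  rw [← h9, RingHom.comp_id]
  change eval₂ realRing.subtype _ _ + _ = _ + eval₂ realRing.subtype ![(x : Puiseux), (y : Puiseux), (c : Puiseux), (d : Puiseux)] _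
  ring

/-- One coordinate of the point is prescribed and the other is solved for: the initial form at v has
two or three terms and is linear in x, with unit coefficients. -/
theorem curve_subset_image {F : MvPolynomial (Fin 2) Puiseux}
    (hr : ∀ γ, IsRealSeries (F.coeff γ)) (hQ : (tropPoly F).Nonsingular) :
    (tropPoly F).curve ⊆ tropPoint '' torusCurve F := by
  classical
  intro v hv
  have hmem : ∀ {α} (L : LatticeFrame), α ∈ (tropPoly F).maxAt v → ∀ γ ∈ (tropPoly F).maxAt v,
      ∃ f : realRing, IsUnit f ∧
        (f : Puiseux) = (L.chartAt v).normCoeff F α (monoUnit (val (F.coeff α))) γ := by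
    intro α L hα γ hγ
    have hγs : γ ∈ F.support := (TropPoly.mem_maxAt.1 hγ).1
    refine ⟨⟨_, L.normCoeff_chartAt_mem v hr hα hγs⟩, ?_, rfl⟩
    rw [isUnit_realRing_iff]
    change ord ((L.chartAt v).normCoeff F α (monoUnit (val (F.coeff α))) γ) = 0
    rw [L.ord_normCoeff_chartAt v hγs, TropPoly.term_eq_of_mem hγ hα, sub_self]
    rfl
  rcases hQ.maxAt_cases (TropPoly.mem_curve.1 hv) with ⟨α, β, hne, hM, hl⟩ | ⟨α, β, γ, hM, hc⟩
  · obtain ⟨L, h0, h1⟩ := LatticeFrame.exists_ofPair (α := α) (β := β) (by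
      rw [← hl, latLen, latLen, ← neg_sub (β 0 : ℤ), ← neg_sub (β 1 : ℤ), Int.gcd_neg, Int.neg_gcd])
    have hα : α ∈ (tropPoly F).maxAt v := by rw [hM]; simp
    have he : ((tropPoly F).maxAt v).erase β = {α} := by
      rw [hM, Finset.pair_comm, Finset.erase_insert (by simpa using hne.symm)]
    obtain ⟨f, hf, hf'⟩ := hmem L hα α hα
    refine exists_mem_torusCurve hr L hα (show β ∈ _ by rw [hM]; simp)
      (L.i_eq_of (a := 1) (b := 0) (by rw [h0]; ring) (by rw [h1]; ring))
      (L.j_eq_of (a := 1) (b := 0) (by rw [h0]; ring) (by rw [h1]; ring)) ?_ isUnit_one hf ?_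
    · intro γ hγ hγβ
      rw [hM, Finset.mem_insert, Finset.mem_singleton] at hγ
      rw [hγ.resolve_right hγβ, L.i_self, L.j_self]
      exact ⟨rfl, le_rfl⟩
    · rw [he, Finset.sum_singleton, ← hf', L.j_self, Int.toNat_zero, pow_zero, mul_one]
  · set L := LatticeFrame.ofTriangle α β γ hc with hL
    have hα : α ∈ (tropPoly F).maxAt v := by rw [hM]; simp
    have hγ : γ ∈ (tropPoly F).maxAt v := by rw [hM]; simp
    have hi1 : L.i α β = 1 := L.i_eq_of (b := 0) (by rw [hL, LatticeFrame.ofTriangle]; ring)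
      (by rw [hL, LatticeFrame.ofTriangle]; ring)
    have hj1 : L.j α β = 0 := L.j_eq_of (a := 1) (by rw [hL, LatticeFrame.ofTriangle]; ring)
      (by rw [hL, LatticeFrame.ofTriangle]; ring)
    have hi2 : L.i α γ = 0 := L.i_eq_of (b := 1) (by rw [hL, LatticeFrame.ofTriangle]; ring)
      (by rw [hL, LatticeFrame.ofTriangle]; ring)
    have hj2 : L.j α γ = 1 := L.j_eq_of (a := 0) (by rw [hL, LatticeFrame.ofTriangle]; ring)
      (by rw [hL, LatticeFrame.ofTriangle]; ring)
    have hne1 : α ≠ β := by rintro rfl; rw [L.i_self] at hi1; omega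
    have hne2 : α ≠ γ := by rintro rfl; rw [L.j_self] at hj2; omega
    have hne3 : β ≠ γ := by rintro rfl; omega
    have he : ((tropPoly F).maxAt v).erase β = {α, γ} := by
      rw [hM, Finset.insert_comm, Finset.erase_insert (by simp [hne1.symm, hne3])]
    obtain ⟨f, hf, hf'⟩ := hmem L hα α hα
    obtain ⟨f₂, hf₂, hf₂'⟩ := hmem L hα γ hγ
    -- The values at c = 1 and c = 2 differ by the unit f₂, so they cannot both be non-units.
    obtain ⟨c, hc, hg⟩ : ∃ c : realRing, IsUnit c ∧ IsUnit (f + f₂ * c) := by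
      by_cases h : IsUnit (f + f₂ * 1)
      · exact ⟨1, isUnit_one, h⟩
      · refine ⟨2, isUnit_two_realRing, ?_⟩
        rw [isUnit_realRing_iff_notMem, not_not] at h
        exact isUnit_of_sub_mem hf₂ (by rwa [show f + f₂ * 2 - f₂ = f + f₂ * 1 by ring])
    refine exists_mem_torusCurve hr L hα (show β ∈ _ by rw [hM]; simp) hi1 hj1 ?_ hc hg ?_
    · intro δ hδ hδβ
      rw [hM, Finset.mem_insert, Finset.mem_insert, Finset.mem_singleton] at hδ
      rcases hδ with rfl | rfl | rfl
      · rw [L.i_self, L.j_self]; exact ⟨rfl, le_rfl⟩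
      · exact absurd rfl hδβ
      · rw [hi2, hj2]; exact ⟨rfl, zero_le_one⟩
    · rw [he, Finset.sum_pair hne2, ← hf', ← hf₂', L.j_self, hj2, Int.toNat_zero, pow_zero, mul_one,
        Int.toNat_one, pow_one]
      rfl

theorem image_torusCurve_eq {F : MvPolynomial (Fin 2) Puiseux} (hF : F ≠ 0)
    (hr : ∀ γ, IsRealSeries (F.coeff γ)) (hQ : (tropPoly F).Nonsingular) :
    tropPoint '' torusCurve F = (tropPoly F).curve := by
  refine subset_antisymm ?_ (curve_subset_image hr hQ)
  rintro _ ⟨p, hp, rfl⟩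
  exact tropPoint_mem_curve hF hp
end

noncomputable section
open MvPolynomial Puiseux

/-! ### Signs of real series -/

/-- The sign of a real series. -/
def sgn (x : Puiseux) : ℤˣ := open Classical in if IsPos x then 1 else -1

theorem sgn_eq_one_iff {x : Puiseux} : sgn x = 1 ↔ IsPos x := by
  rw [sgn]; split_ifs with h <;> simp [h]

theorem sgn_of_isPos {x : Puiseux} (h : IsPos x) : sgn x = 1 := sgn_eq_one_iff.2 h

theorem sgn_eq_sgn_iff {x y : Puiseux} : sgn x = sgn y ↔ (IsPos x ↔ IsPos y) := by
  rw [sgn, sgn]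
  split_ifs with h h' h' <;> simp [h, h']

theorem signDist_eq_sgn {F : MvPolynomial (Fin 2) Puiseux} {γ : Fin 2 →₀ ℕ}
    (h : IsRealSeries (F.coeff γ)) : signDist F γ = sgn (F.coeff γ) := by
  rw [signDist, sgn]
  congr 1
  exact propext ⟨fun h1 => ⟨h, h1⟩, fun h1 => h1.2⟩

theorem sgn_mul {x y : Puiseux} (hx : IsRealSeries x) (hx0 : x ≠ 0) (hy : IsRealSeries y)
    (hy0 : y ≠ 0) : sgn (x * y) = sgn x * sgn y := by
  have h := IsPos.mul_iff hx hx0 hy hy0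
  rw [sgn, sgn, sgn]
  by_cases h1 : IsPos x <;> by_cases h2 : IsPos y <;> simp [h, h1, h2]

theorem isPos_units_inv {x : Puiseuxˣ} (hx : IsPos (x : Puiseux)) :
    IsPos ((x⁻¹ : Puiseuxˣ) : Puiseux) := by
  rw [Units.val_inv_eq_inv_val]; exact hx.inv

theorem isPos_units_mul {x y : Puiseuxˣ} (hx : IsPos (x : Puiseux)) (hy : IsPos (y : Puiseux)) :
    IsPos ((x * y : Puiseuxˣ) : Puiseux) := hx.mul hy

theorem sgn_mul_of_isPos {x y : Puiseux} (hx : IsRealSeries x) (hy : IsPos y) :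
    sgn (x * y) = sgn x := sgn_eq_sgn_iff.2 (isPos_mul_right_iff hx hy)

theorem sgn_neg {x : Puiseux} (hx : IsRealSeries x) (hx0 : x ≠ 0) : sgn (-x) = -sgn x := by
  rw [sgn, sgn]
  by_cases h : IsPos x
  · rw [if_pos h, if_neg h.not_neg]
  · rw [if_neg h, if_pos ((IsPos.not_iff hx hx0).1 h), neg_neg]

theorem isPos_neg_iff {x : Puiseux} (hx : IsRealSeries x) (hx0 : x ≠ 0) :
    IsPos (-x) ↔ sgn x = -1 := by
  rw [← sgn_eq_one_iff, sgn_neg hx hx0, neg_eq_iff_eq_neg]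

theorem sgn_inv {x : Puiseux} (hx : IsRealSeries x) (hx0 : x ≠ 0) : sgn x⁻¹ = sgn x := by
  have h := sgn_mul hx.inv (inv_ne_zero hx0) hx hx0
  rw [inv_mul_cancel₀ hx0, sgn_of_isPos IsPos.one] at h
  exact (Int.units_eq_one_or (sgn x)).elim (fun h1 => by rw [h1] at h ⊢; simpa using h.symm)
    fun h1 => by rw [h1] at h ⊢; rw [mul_neg, mul_one] at h; exact neg_eq_iff_eq_neg.1 h.symm

theorem sgn_units_mul {x y : Puiseuxˣ} (hx : IsRealSeries x) (hy : IsRealSeries y) :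
    sgn ((x * y : Puiseuxˣ) : Puiseux) = sgn x * sgn y := sgn_mul hx x.ne_zero hy y.ne_zero

theorem sgn_units_inv {x : Puiseuxˣ} (hx : IsRealSeries x) :
    sgn ((x⁻¹ : Puiseuxˣ) : Puiseux) = sgn x := by
  rw [Units.val_inv_eq_inv_val, sgn_inv hx x.ne_zero]

theorem sgn_units_zpow {x : Puiseuxˣ} (hx : IsRealSeries x) (n : ℤ) :
    sgn ((x ^ n : Puiseuxˣ) : Puiseux) = sgn x ^ n := by
  have hnat : ∀ m : ℕ, sgn ((x ^ m : Puiseuxˣ) : Puiseux) = sgn x ^ m := by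
    intro m
    induction m with
    | zero => rw [pow_zero, pow_zero]; exact sgn_of_isPos IsPos.one
    | succ m ih =>
      rw [pow_succ, pow_succ, sgn_units_mul _ hx, ih]
      have := isRealSeries_units_zpow hx m
      rwa [zpow_natCast] at this
  obtain ⟨m, rfl | rfl⟩ := n.eq_nat_or_neg
  · rw [zpow_natCast, zpow_natCast, hnat]
  · rw [zpow_neg, zpow_neg, zpow_natCast, zpow_natCast, sgn_units_inv, hnat]
    · exact (Int.units_inv_eq_self _).symm
    · have := isRealSeries_units_zpow hx m
      rwa [zpow_natCast] at this

theorem sgn_monoUnit (r : ℝ) : sgn (monoUnit r : Puiseux) = 1 := sgn_of_isPos (isPos_monoUnit r)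

theorem sgn_signReal (x : Puiseux) : sgn (signReal x : Puiseux) = sgn x := by
  rw [signReal, sgn_eq_sgn_iff]
  split_ifs with h
  · exact iff_of_true IsPos.one h
  · exact iff_of_false IsPos.one.not_neg h

theorem isReal_coe (x : realRing) : IsRealSeries (x : Puiseux) := mem_realSubfield.1 x.2.2

theorem IsUnit.coe_ne_zero {x : realRing} (hx : IsUnit x) : (x : Puiseux) ≠ 0 :=
  ne_zero_of_ord_eq_zero (isUnit_realRing_iff.1 hx)

theorem sgn_coe_mul {x y : realRing} (hx : IsUnit x) (hy : IsUnit y) :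
    sgn ((x * y : realRing) : Puiseux) = sgn x * sgn y :=
  sgn_mul (isReal_coe x) hx.coe_ne_zero (isReal_coe y) hy.coe_ne_zero

theorem sgn_coe_neg {x : realRing} (hx : IsUnit x) : sgn ((-x : realRing) : Puiseux) = -sgn x :=
  sgn_neg (isReal_coe x) hx.coe_ne_zero

theorem sgn_eq_of_sub_mem {x y : realRing} (hx : IsUnit x) (h : y - x ∈ realIdeal) :
    sgn (y : Puiseux) = sgn (x : Puiseux) :=
  sgn_eq_sgn_iff.2 (isPos_iff_of_sub_mem hx h).symm

theorem sgn_inv_coe {x y : realRing} (h : x * y = 1) : sgn (y : Puiseux) = sgn (x : Puiseux) := by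
  have hx : IsUnit x := IsUnit.of_mul_eq_one _ h
  have h1 : (y : Puiseux) = (x : Puiseux)⁻¹ :=
    eq_inv_of_mul_eq_one_right (congrArg Subtype.val h)
  rw [h1, sgn_inv (isReal_coe x) hx.coe_ne_zero]

/-! ### Signs of the normal form -/

namespace EdgeChart

variable {Q : TropPoly} {e : Set (Fin 2 → ℝ)} (Γ : EdgeChart Q e) (F : MvPolynomial (Fin 2) Puiseux)

theorem isPos_nF : IsPos (Γ.nF : Puiseux) := isPos_monoUnit _

theorem isPos_X0 : IsPos ((Γ.torus F).X0 : Puiseux) := isPos_monoUnit _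

end EdgeChart

namespace EdgeChart.Adapted

variable {Q Q' : TropPoly} {e e' : Set (Fin 2 → ℝ)} {Γ : EdgeChart Q e}
  {F G : MvPolynomial (Fin 2) Puiseux} {β0 β1 : Fin 2 →₀ ℕ} (h : Γ.Adapted F G β0 β1 Q' e')

include h

theorem fc_zero : (Γ.fc F Γ.α0 : Puiseux) = F.coeff Γ.α0 * ((Γ.nF⁻¹ : Puiseuxˣ) : Puiseux) := by
  rw [(h.fc_spec (Or.inl rfl)).1]
  change F.coeff Γ.α0 * ((Γ.nF⁻¹ * (Γ.torus F).scale (Γ.L.i Γ.α0 Γ.α0) (Γ.L.j Γ.α0 Γ.α0) :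
    Puiseuxˣ) : Puiseux) = _
  rw [Γ.L.i_self, Γ.L.j_self, TorusChart.scale_zero_zero, mul_one]

theorem gc_zero : (Γ.gc F G β0 β0 : Puiseux) =
    G.coeff β0 * (((monoUnit (val (G.coeff β0)))⁻¹ : Puiseuxˣ) : Puiseux) := by
  rw [(h.gc_spec (Or.inl rfl)).1]
  change G.coeff β0 * (((monoUnit (val (G.coeff β0)))⁻¹ * (Γ.torus F).scale (Γ.L.i β0 β0)
    (Γ.L.j β0 β0) : Puiseuxˣ) : Puiseux) = _
  rw [Γ.L.i_self, Γ.L.j_self, TorusChart.scale_zero_zero, mul_one]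

theorem isUnit_fc {γ : Fin 2 →₀ ℕ} (hγ : γ = Γ.α0 ∨ γ = Γ.α1) : IsUnit (Γ.fc F γ) :=
  isUnit_realRing_iff.2 (h.fc_spec hγ).2

theorem isUnit_gc {γ : Fin 2 →₀ ℕ} (hγ : γ = β0 ∨ γ = β1) : IsUnit (Γ.gc F G β0 γ) :=
  isUnit_realRing_iff.2 (h.gc_spec hγ).2

theorem isUnit_fi : IsUnit (Γ.fi F) := IsUnit.of_mul_eq_one_right _ h.fc_mul_fi

theorem isUnit_gi : IsUnit (Γ.gi F G β0 β1) := IsUnit.of_mul_eq_one_right _ h.gc_mul_gi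

theorem sgn_fc_zero : sgn (Γ.fc F Γ.α0 : Puiseux) = signDist F Γ.α0 := by
  rw [h.fc_zero, sgn_mul_of_isPos (h.realF _) (isPos_units_inv Γ.isPos_nF),
    signDist_eq_sgn (h.realF _)]

theorem sgn_fc_one : sgn (Γ.fc F Γ.α1 : Puiseux) = signDist F Γ.α1 := by
  rw [(h.fc_spec (Or.inr rfl)).1]
  change sgn (F.coeff Γ.α1 * ((Γ.nF⁻¹ * (Γ.torus F).scale (Γ.L.i Γ.α0 Γ.α1) (Γ.L.j Γ.α0 Γ.α1) :
    Puiseuxˣ) : Puiseux)) = _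
  rw [Γ.i1, Γ.j1, TorusChart.scale_one_zero, sgn_mul_of_isPos (h.realF _)
    (isPos_units_mul (isPos_units_inv Γ.isPos_nF) (Γ.isPos_X0 F)), signDist_eq_sgn (h.realF _)]

theorem sgn_gc_zero : sgn (Γ.gc F G β0 β0 : Puiseux) = signDist G β0 := by
  rw [h.gc_zero, sgn_mul_of_isPos (h.realG _) (isPos_units_inv (isPos_monoUnit _)),
    signDist_eq_sgn (h.realG _)]

theorem sgn_gc_one : sgn (Γ.gc F G β0 β1 : Puiseux) = signDist G β1 := by
  rw [(h.gc_spec (Or.inr rfl)).1]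
  change sgn (G.coeff β1 * (((monoUnit (val (G.coeff β0)))⁻¹ * (Γ.torus F).scale (Γ.L.i β0 β1)
    (Γ.L.j β0 β1) : Puiseuxˣ) : Puiseux)) = _
  rw [h.aligned.i1, h.aligned.j1, TorusChart.scale_one_zero, sgn_mul_of_isPos (h.realG _)
    (isPos_units_mul (isPos_units_inv (isPos_monoUnit _)) (Γ.isPos_X0 F)),
    signDist_eq_sgn (h.realG _)]

theorem sgn_fi : sgn (Γ.fi F : Puiseux) = signDist F Γ.α1 := by
  rw [sgn_inv_coe h.fc_mul_fi, h.sgn_fc_one]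

theorem sgn_gi : sgn (Γ.gi F G β0 β1 : Puiseux) = signDist G β1 := by
  rw [sgn_inv_coe h.gc_mul_gi, h.sgn_gc_one]

/-- The constant for x is a pure monomial and positive; those for u and w carry the signs of the
coefficients at α₂ and α₃. -/
theorem sgn_θ : sgn ((Γ.torus F).θ : Puiseux) = signDist F Γ.α2 * signDist F Γ.α3 := by
  have hT := Γ.isReal_torus h.tropF h.realF
  have key : ∀ γ, F.coeff γ ≠ 0 → sgn ((Γ.nF * (toUnit (F.coeff γ))⁻¹ : Puiseuxˣ) : Puiseux) =
      signDist F γ := by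
    intro γ hγ
    have hr : IsRealSeries (toUnit (F.coeff γ) : Puiseux) := by rw [coe_toUnit hγ]; exact h.realF _
    rw [sgn_units_mul Γ.isPos_nF.isReal (isRealSeries_units_inv hr), sgn_units_inv hr,
      coe_toUnit hγ, sgn_of_isPos Γ.isPos_nF, one_mul, signDist_eq_sgn (h.realF _)]
  rw [TorusChart.θ, sgn_units_mul (isRealSeries_units_mul (isRealSeries_units_zpow hT.1 _)
    (isRealSeries_units_inv hT.2.1)) (isRealSeries_units_inv hT.2.2),
    sgn_units_mul (isRealSeries_units_zpow hT.1 _) (isRealSeries_units_inv hT.2.1),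
    sgn_units_zpow hT.1, sgn_units_inv hT.2.1, sgn_units_inv hT.2.2,
    ← key _ (coeff_ne_zero h.tropF Γ.mem_supp2), ← key _ (coeff_ne_zero h.tropF Γ.mem_supp3),
    show sgn ((Γ.torus F).X0 : Puiseux) = 1 from sgn_monoUnit _, one_zpow, one_mul]
  rfl

/-- The sign of the constant of the system. -/
theorem eval_sys_h {x₀ ε x y : realRing} (hxy : x * y = 1) :
    IsUnit (eval ![x, y] (Γ.sys F G β0 β1 x₀ ε).h) ∧
      sgn ((eval ![x, y] (Γ.sys F G β0 β1 x₀ ε).h : realRing) : Puiseux) =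
        signDist F Γ.α2 * signDist F Γ.α3 * sgn (x : Puiseux) ^ Γ.k := by
  obtain ⟨x', hx', hx0⟩ := isUnit_realRing_coe (IsUnit.of_mul_eq_one _ hxy)
  have hy' : ((x'⁻¹ : Puiseuxˣ) : Puiseux) = y := by
    refine (Units.mul_right_inj x').1 ?_
    rw [Units.mul_inv, hx']
    exact (congrArg Subtype.val hxy).symm
  have hr : IsRealSeries (x' : Puiseux) := by rw [hx']; exact isReal_coe x
  have h1 : ((eval ![x, y] (Γ.sys F G β0 β1 x₀ ε).h : realRing) : Puiseux) =
      signReal (Γ.torus F).θ * ((x' ^ Γ.k : Puiseuxˣ) : Puiseux) := by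
    have h2 := QuadSystem.hom_eval₂_two realRing.subtype (RingHom.id realRing) x y
      (C (signReal (Γ.torus F).θ) * TorusChart.hpow Γ.k)
    change realRing.subtype (eval₂ (RingHom.id realRing) ![x, y]
      (C (signReal (Γ.torus F).θ) * TorusChart.hpow Γ.k)) = _
    rw [h2, eval₂_mul, eval₂_C, ← TorusChart.eval₂_hpow, hy', hx']
    rfl
  have hs : IsUnit (signReal (Γ.torus F).θ) := IsUnit.of_mul_eq_one _ (signReal_mul_self _)
  refine ⟨?_, ?_⟩
  · rw [isUnit_realRing_iff, h1, ord_signReal_mul, ord_eq_zero_iff (Units.ne_zero _),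
      val_units_zpow, hx0, mul_zero]
  · rw [h1, sgn_mul (isReal_coe _) hs.coe_ne_zero (isRealSeries_units_zpow hr _) (Units.ne_zero _),
      sgn_signReal, h.sgn_θ, sgn_units_zpow hr, hx']

end EdgeChart.Adapted

/-! ### Realisations -/

namespace TropPoly

variable {P Q : TropPoly}

theorem maxAt_congr (hs : Q.supp = P.supp) (hc : ∀ γ ∈ P.supp, Q.coeff γ = P.coeff γ)
    (v : Fin 2 → ℝ) : Q.maxAt v = P.maxAt v := by
  have ht : ∀ γ ∈ P.supp, Q.term γ v = P.term γ v := fun γ hγ => by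
    rw [term, term, hc γ hγ]
  ext γ
  rw [mem_maxAt, mem_maxAt, hs]
  refine and_congr_right fun hγ => forall₂_congr fun β hβ => ?_
  rw [ht γ hγ, ht β hβ]

theorem isEdge_congr (h : ∀ v, Q.maxAt v = P.maxAt v) (e : Set (Fin 2 → ℝ)) :
    Q.IsEdge e ↔ P.IsEdge e := by simp only [IsEdge, h]

theorem dual_congr (hs : Q.supp = P.supp) (h : ∀ v, Q.maxAt v = P.maxAt v) (e : Set (Fin 2 → ℝ)) :
    Q.dual e = P.dual e := by
  ext γ
  simp only [dual, Finset.mem_filter, hs, h]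

theorem mem_supp_of_mem_dual {e : Set (Fin 2 → ℝ)} {α : Fin 2 →₀ ℕ} (h : α ∈ P.dual e) :
    α ∈ P.supp := by
  simp only [dual, Finset.mem_filter] at h
  exact h.1

theorem phase_congr {δ δ' : (Fin 2 →₀ ℕ) → ℤˣ} {e : Set (Fin 2 → ℝ)} (hd : Q.dual e = P.dual e)
    (h : ∀ γ ∈ P.supp, δ γ = δ' γ) : Q.phase δ e = P.phase δ' e := by
  have hs : ∀ ε, ∀ γ ∈ P.dual e, symSign δ ε γ = symSign δ' ε γ := fun ε γ hγ => by
    rw [symSign, symSign, h γ (mem_supp_of_mem_dual hγ)]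
  ext ε
  rw [phase, phase, Set.mem_ofPred_eq, Set.mem_ofPred_eq, hd]
  constructor
  · rintro ⟨α, hα, β, hβ, hne⟩
    exact ⟨α, hα, β, hβ, by rwa [← hs ε α hα, ← hs ε β hβ]⟩
  · rintro ⟨α, hα, β, hβ, hne⟩
    exact ⟨α, hα, β, hβ, by rwa [hs ε α hα, hs ε β hβ]⟩

theorem IsEdge.supp_nonempty {e : Set (Fin 2 → ℝ)} (he : P.IsEdge e) : P.supp.Nonempty := by
  obtain ⟨v, h2, -⟩ := he
  obtain ⟨α, hα⟩ := Finset.card_pos.1 (lt_of_lt_of_le two_pos h2)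
  exact ⟨α, (mem_maxAt.1 hα).1⟩

end TropPoly

section Realisation

variable {P : TropPoly} {E : Set (Fin 2 → ℝ) → Set (Fin 2 → ZMod 2)}
  {F H : MvPolynomial (Fin 2) Puiseux} {e : Set (Fin 2 → ℝ)}

/-- The tropical polynomial of a realisation need not be P; it shares only edges and weights with
it. All later arguments work with the tropical polynomial of F itself. -/
theorem IsRealisation.nonsingular (hP : P.Nonsingular) (h : IsRealisation P E F) :
    (tropPoly F).Nonsingular :=
  hP.transfer (fun e => (h.2.1.2 e).1) fun e => (h.2.1.2 e).2

theorem IsRealisation.isEdge (h : IsRealisation P E F) (he : P.IsEdge e) : (tropPoly F).IsEdge e :=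
  (h.2.1.2 e).1.2 he

theorem ne_zero_of_isEdge (he : (tropPoly F).IsEdge e) : F ≠ 0 := by
  rintro rfl
  obtain ⟨γ, hγ⟩ := he.supp_nonempty
  exact mem_support_iff.1 hγ (coeff_zero γ)

theorem IsRealisation.of_tropPoly_eq (hP : P.Nonsingular) (he : P.IsEdge e)
    (h : IsRealisation P E F) (hH : ∀ γ, IsRealSeries (H.coeff γ)) (ht : tropPoly H = tropPoly F)
    (hs : ∀ γ, signDist H γ = signDist F γ) : IsRealisation P E H := by
  refine ⟨hH, ⟨?_, ?_⟩, ?_⟩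
  · rw [image_torusCurve_eq (ne_zero_of_isEdge (e := e) (ht ▸ h.isEdge he)) hH
      (ht ▸ h.nonsingular hP), ht]
    exact TropPoly.curve_eq_of_isEdge_iff fun e => (h.2.1.2 e).1
  · rw [ht]; exact h.2.1.2
  · rw [ht, show signDist H = signDist F from funext hs]; exact h.2.2

/-- The patchworking polynomial with coefficients δ(γ) t^(-a_γ). Its tropical polynomial has the
support and coefficients of P, and by `image_torusCurve_eq` its curve fills the tropical curve. -/
theorem exists_isRealisation (hP : P.Nonsingular) (hE : P.IsRealPhase E) (he : P.IsEdge e) :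
    ∃ F, IsRealisation P E F := by
  obtain ⟨δ, hδ⟩ := hE
  let F : MvPolynomial (Fin 2) Puiseux :=
    ∑ γ ∈ P.supp, monomial γ (mono (-P.coeff γ) ((δ γ : ℤ) : ℂ))
  have hδ0 : ∀ γ, ((δ γ : ℤ) : ℂ) ≠ 0 := fun γ => by exact_mod_cast (δ γ).ne_zero
  have hcF : ∀ γ, F.coeff γ = if γ ∈ P.supp then mono (-P.coeff γ) ((δ γ : ℤ) : ℂ) else 0 := by
    intro γ
    rw [coeff_sum]
    simp only [coeff_monomial]
    rw [Finset.sum_ite_eq']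
  have hsupp : (tropPoly F).supp = P.supp := by
    ext γ
    change γ ∈ F.support ↔ _
    rw [mem_support_iff, hcF]
    split_ifs with h
    · exact iff_of_true (mono_ne_zero (hδ0 γ)) h
    · exact iff_of_false (fun h => h rfl) h
  have hcoeff : ∀ γ ∈ P.supp, (tropPoly F).coeff γ = P.coeff γ := by
    intro γ hγ
    change -val (F.coeff γ) = _
    rw [hcF, if_pos hγ, val_mono (hδ0 γ), neg_neg]
  have hm := TropPoly.maxAt_congr hsupp hcoeff
  have hd := TropPoly.dual_congr hsupp hm
  have hedge := TropPoly.isEdge_congr hm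
  have hr : ∀ γ, IsRealSeries (F.coeff γ) := by
    intro γ
    rw [hcF]
    split_ifs
    · have := IsRealSeries.mono (-P.coeff γ) ((δ γ : ℤ) : ℝ)
      rwa [show (((δ γ : ℤ) : ℝ) : ℂ) = ((δ γ : ℤ) : ℂ) by push_cast; rfl] at this
    · exact IsRealSeries.zero
  have hs : ∀ γ ∈ P.supp, signDist F γ = δ γ := by
    intro γ hγ
    rw [signDist, hcF, if_pos hγ, series_mono, HahnSeries.leadingCoeff_of_single]
    rcases Int.units_eq_one_or (δ γ) with h | h <;> rw [h] <;> norm_num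
  have hw : ∀ e, (tropPoly F).weight e = P.weight e := fun e => by
    rw [TropPoly.weight, TropPoly.weight, hd]
  have hQ : (tropPoly F).Nonsingular := hP.transfer hedge fun e _ => hw e
  refine ⟨F, hr, ⟨?_, fun e => ⟨hedge e, fun _ => hw e⟩⟩, fun e he => ?_⟩
  · rw [image_torusCurve_eq (ne_zero_of_isEdge ((hedge e).2 he)) hr hQ]
    exact TropPoly.curve_eq_of_isEdge_iff hedge
  · rw [hδ e he]
    exact TropPoly.phase_congr (hd e) hs

theorem coeff_setCoeff (α γ : Fin 2 →₀ ℕ) (c : Puiseux) :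
    (setCoeff F α c).coeff γ = if γ = α then c else F.coeff γ := by
  rw [setCoeff, coeff_add, coeff_monomial]
  by_cases h : γ = α
  · rw [if_pos h, if_pos h.symm, h, add_sub_cancel]
  · rw [if_neg h, if_neg (Ne.symm h), add_zero]

theorem coeff_setCoeff_self (α : Fin 2 →₀ ℕ) (c : Puiseux) : (setCoeff F α c).coeff α = c := by
  rw [coeff_setCoeff, if_pos rfl]

theorem coeff_setCoeff_of_ne {α γ : Fin 2 →₀ ℕ} (h : γ ≠ α) (c : Puiseux) :
    (setCoeff F α c).coeff γ = F.coeff γ := by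
  rw [coeff_setCoeff, if_neg h]

theorem eval_setCoeff (α : Fin 2 →₀ ℕ) (c : Puiseux) (p : Fin 2 → Puiseux) :
    eval p (setCoeff F α c) = eval p F + (c - F.coeff α) * ∏ i, p i ^ α i := by
  rw [setCoeff, map_add, eval_monomial, Finsupp.prod_fintype _ _ fun i => pow_zero _]

/-- Monomials do not vanish on the torus, so a point determines the varying coefficient. Different
values of c with non-empty curves thus give different curves. -/
theorem eq_of_mem_torusCurve {α : Fin 2 →₀ ℕ} {c c' : Puiseux} {p : Fin 2 → Puiseux}
    (h : p ∈ torusCurve (setCoeff F α c)) (h' : p ∈ torusCurve (setCoeff F α c')) : c = c' := by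
  have h1 := h.2
  have h2 := h'.2
  rw [eval_setCoeff] at h1 h2
  have h3 : (c - c') * ∏ i, p i ^ α i = 0 := by linear_combination h1 - h2
  exact sub_eq_zero.1 ((mul_eq_zero.1 h3).resolve_right
    (Finset.prod_ne_zero_iff.2 fun i _ => pow_ne_zero _ (h.1 i)))

theorem tropPoly_setCoeff_eq {α : Fin 2 →₀ ℕ} (hα : F.coeff α ≠ 0) {c : Puiseux} (hc : c ≠ 0)
    (hv : val c = val (F.coeff α)) : tropPoly (setCoeff F α c) = tropPoly F := by
  have h1 : (tropPoly (setCoeff F α c)).supp = (tropPoly F).supp := by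
    ext γ
    change γ ∈ (setCoeff F α c).support ↔ γ ∈ F.support
    rw [mem_support_iff, mem_support_iff, coeff_setCoeff]
    split_ifs with h
    · rw [h]; exact iff_of_true hc hα
    · rfl
  have h2 : (tropPoly (setCoeff F α c)).coeff = (tropPoly F).coeff := by
    funext γ
    change -val ((setCoeff F α c).coeff γ) = -val (F.coeff γ)
    rw [coeff_setCoeff]
    split_ifs with h
    · rw [hv, h]
    · rfl
  calc tropPoly (setCoeff F α c) = ⟨(tropPoly (setCoeff F α c)).supp,
        (tropPoly (setCoeff F α c)).coeff⟩ := rfl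
    _ = _ := by rw [h1, h2]

/-- At v only α and β are maximal. After the change of the coefficient at α the point is still on
the curve, and this is possible only if α again ties with β. -/
theorem val_eq_of_mem_curve {α β : Fin 2 →₀ ℕ} (hne : α ≠ β) {v : Fin 2 → ℝ}
    (hM : (tropPoly F).maxAt v = {α, β}) {c : Puiseux}
    (hv : v ∈ (tropPoly (setCoeff F α c)).curve) : c ≠ 0 ∧ val c = val (F.coeff α) := by
  have hβm : β ∈ (tropPoly F).maxAt v := by rw [hM]; simp
  have hαm : α ∈ (tropPoly F).maxAt v := by rw [hM]; simp
  set Qc := tropPoly (setCoeff F α c) with hQc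
  have hsupp : ∀ γ, γ ≠ α → (γ ∈ Qc.supp ↔ γ ∈ (tropPoly F).supp) := by
    intro γ hγ
    change γ ∈ (setCoeff F α c).support ↔ γ ∈ F.support
    rw [mem_support_iff, mem_support_iff, coeff_setCoeff_of_ne hγ]
  have hterm : ∀ γ, γ ≠ α → Qc.term γ v = (tropPoly F).term γ v := by
    intro γ hγ
    rw [TropPoly.term, TropPoly.term]
    change -val ((setCoeff F α c).coeff γ) + _ = -val (F.coeff γ) + _
    rw [coeff_setCoeff_of_ne hγ]
  have hβs : β ∈ Qc.supp := (hsupp β hne.symm).2 (TropPoly.mem_maxAt.1 hβm).1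
  have hsub : Qc.maxAt v ⊆ {α, β} := by
    intro γ hγ
    by_cases hγα : γ = α
    · simp [hγα]
    obtain ⟨h1, h2⟩ := TropPoly.mem_maxAt.1 hγ
    rw [← hM]
    refine (TropPoly.mem_maxAt_iff_of_mem hβm ((hsupp γ hγα).1 h1)).2 (le_antisymm
      ((TropPoly.mem_maxAt.1 hβm).2 γ ((hsupp γ hγα).1 h1)) ?_)
    rw [← hterm γ hγα, ← hterm β hne.symm]
    exact h2 β hβs
  have hEq : Qc.maxAt v = {α, β} := Finset.eq_of_subset_of_card_le hsub (by
    rw [Finset.card_pair hne]; exact TropPoly.mem_curve.1 hv)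
  have hαm' : α ∈ Qc.maxAt v := by rw [hEq]; simp
  have hβm' : β ∈ Qc.maxAt v := by rw [hEq]; simp
  have hc : c ≠ 0 := by
    have := mem_support_iff.1 (TropPoly.mem_maxAt.1 hαm').1
    rwa [coeff_setCoeff_self] at this
  refine ⟨hc, ?_⟩
  have h1 := TropPoly.term_eq_of_mem hβm' hαm'
  rw [hterm β hne.symm, ← TropPoly.term_eq_of_mem hβm hαm, TropPoly.term, TropPoly.term] at h1
  change -val ((setCoeff F α c).coeff α) + _ = -val (F.coeff α) + _ at h1
  rw [coeff_setCoeff_self] at h1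
  linarith

/-- Which coefficients at an endpoint of a dual edge give a realisation: necessary conditions. -/
theorem IsRealisation.setCoeff_spec (hP : P.Nonsingular) (he : P.IsEdge e)
    (h : IsRealisation P E F) {α : Fin 2 →₀ ℕ} (hα : α ∈ (tropPoly F).dual e) {c : Puiseux}
    (hc : IsRealisation P E (setCoeff F α c)) :
    IsRealSeries c ∧ c ≠ 0 ∧ val c = val (F.coeff α) := by
  obtain ⟨v, β, γ, hne, hM, -, hd, -⟩ := (h.nonsingular hP).isEdge_iff.1 (h.isEdge he)
  refine ⟨by have := hc.1 α; rwa [coeff_setCoeff_self] at this, ?_⟩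
  have hv : v ∈ (tropPoly (setCoeff F α c)).curve := by
    rw [TropPoly.curve_eq_of_isEdge_iff (P := P) fun e => (hc.2.1.2 e).1,
      ← TropPoly.curve_eq_of_isEdge_iff (Q := tropPoly F) fun e => (h.2.1.2 e).1,
      TropPoly.mem_curve, hM, Finset.card_pair hne]
  rw [hd, Finset.mem_insert, Finset.mem_singleton] at hα
  rcases hα with rfl | rfl
  · exact val_eq_of_mem_curve hne hM hv
  · exact val_eq_of_mem_curve hne.symm (hM.trans (Finset.pair_comm _ _)) hv

/-- Sufficient conditions. -/
theorem IsRealisation.setCoeff (hP : P.Nonsingular) (he : P.IsEdge e)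
    (h : IsRealisation P E F) {α : Fin 2 →₀ ℕ} (hα : α ∈ (tropPoly F).dual e) {c : Puiseux}
    (hr : IsRealSeries c) (h0 : c ≠ 0) (hv : val c = val (F.coeff α))
    (hs : sgn c = sgn (F.coeff α)) : IsRealisation P E (setCoeff F α c) := by
  have hα0 : F.coeff α ≠ 0 := mem_support_iff.1 (TropPoly.mem_supp_of_mem_dual hα)
  have hreal : ∀ γ, IsRealSeries ((_root_.setCoeff F α c).coeff γ) := by
    intro γ
    rw [coeff_setCoeff]
    split_ifs
    · exact hr
    · exact h.1 γ
  refine h.of_tropPoly_eq hP he hreal (tropPoly_setCoeff_eq hα0 h0 hv) fun γ => ?_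
  rw [signDist_eq_sgn (hreal γ), signDist_eq_sgn (h.1 γ), coeff_setCoeff]
  split_ifs with hγ
  · rw [hs, hγ]
  · rfl

end Realisation
end

noncomputable section
open MvPolynomial Puiseux

/-! ### Varying one coefficient -/

namespace TorusChart

variable (T : TorusChart) (H : MvPolynomial (Fin 2) Puiseux) (o : Fin 2 →₀ ℕ) (n : Puiseuxˣ)

theorem normCoeff_setCoeff {α γ : Fin 2 →₀ ℕ} (h : γ ≠ α) (c : Puiseux) :
    T.normCoeff (setCoeff H α c) o n γ = T.normCoeff H o n γ := by
  rw [normCoeff, coeff_setCoeff_of_ne h, normCoeff]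

theorem part_setCoeff {α : Fin 2 →₀ ℕ} {S : Finset (Fin 2 →₀ ℕ)} (h : α ∉ S) (c : Puiseux) :
    T.part (setCoeff H α c) o n S = T.part H o n S := by
  rw [part, part]
  refine Finset.sum_congr rfl fun γ hγ => ?_
  rw [normCoeff_setCoeff _ _ _ _ (by rintro rfl; exact h hγ)]

end TorusChart

namespace EdgeChart

variable {Q : TropPoly} {e : Set (Fin 2 → ℝ)} (Γ : EdgeChart Q e)
  (F G : MvPolynomial (Fin 2) Puiseux) (β0 β1 : Fin 2 →₀ ℕ) (c : Puiseux)

theorem torus_setCoeff : Γ.torus (setCoeff F Γ.α0 c) = Γ.torus F := by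
  rw [torus, torus, coeff_setCoeff_of_ne Γ.ne02.symm, coeff_setCoeff_of_ne Γ.ne03.symm]

theorem fc_setCoeff : Γ.fc (setCoeff F Γ.α0 c) Γ.α1 = Γ.fc F Γ.α1 := by
  rw [fc, fc, torus_setCoeff, TorusChart.normCoeff_setCoeff _ _ _ _ Γ.ne01.symm]

theorem gc_setCoeff_left (γ : Fin 2 →₀ ℕ) :
    Γ.gc (setCoeff F Γ.α0 c) G β0 γ = Γ.gc F G β0 γ := by
  rw [gc, gc, torus_setCoeff]

theorem gi_setCoeff_left : Γ.gi (setCoeff F Γ.α0 c) G β0 β1 = Γ.gi F G β0 β1 := by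
  rw [gi, gi, gc_setCoeff_left]

theorem sys_setCoeff_left (hs : (setCoeff F Γ.α0 c).support = F.support) (x₀ ε : realRing) :
    Γ.sys (setCoeff F Γ.α0 c) G β0 β1 x₀ ε = Γ.sys F G β0 β1 x₀ ε := by
  have hF : Γ.tailF (setCoeff F Γ.α0 c) = Γ.tailF F := by
    rw [tailF, tailF, torus_setCoeff, hs, TorusChart.part_setCoeff _ _ _ _ (by simp)]
  have hG : Γ.tailG (setCoeff F Γ.α0 c) G β0 β1 = Γ.tailG F G β0 β1 := by
    rw [tailG, tailG, torus_setCoeff]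
  rw [sys, sys, hF, hG, fc_setCoeff, gi_setCoeff_left, torus_setCoeff]

variable {β0 β1}

theorem gc_setCoeff_right (hne : β0 ≠ β1) (hv : val c = val (G.coeff β0)) :
    Γ.gc F (setCoeff G β0 c) β0 β1 = Γ.gc F G β0 β1 := by
  rw [gc, gc, coeff_setCoeff_self, hv, TorusChart.normCoeff_setCoeff _ _ _ _ hne.symm]

theorem gi_setCoeff_right (hne : β0 ≠ β1) (hv : val c = val (G.coeff β0)) :
    Γ.gi F (setCoeff G β0 c) β0 β1 = Γ.gi F G β0 β1 := by
  rw [gi, gi, Γ.gc_setCoeff_right F G c hne hv]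

theorem sys_setCoeff_right (hne : β0 ≠ β1) (hv : val c = val (G.coeff β0))
    (hs : (setCoeff G β0 c).support = G.support) (x₀ ε : realRing) :
    Γ.sys F (setCoeff G β0 c) β0 β1 x₀ ε = Γ.sys F G β0 β1 x₀ ε := by
  have hG : Γ.tailG F (setCoeff G β0 c) β0 β1 = Γ.tailG F G β0 β1 := by
    rw [tailG, tailG, coeff_setCoeff_self, hv, hs, TorusChart.part_setCoeff _ _ _ _ (by simp)]
  rw [sys, sys, hG, Γ.gi_setCoeff_right F G c hne hv]

end EdgeChart

theorem isReal_coeff_setCoeff {F : MvPolynomial (Fin 2) Puiseux}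
    (hF : ∀ γ, IsRealSeries (F.coeff γ)) {α : Fin 2 →₀ ℕ} {c : Puiseux} (hc : IsRealSeries c)
    (γ : Fin 2 →₀ ℕ) : IsRealSeries ((setCoeff F α c).coeff γ) := by
  rw [coeff_setCoeff]
  split_ifs
  · exact hc
  · exact hF γ

theorem val_coe_of_isUnit {x : realRing} (hx : IsUnit x) : val (x : Puiseux) = 0 :=
  (ord_eq_zero_iff hx.coe_ne_zero).1 (isUnit_realRing_iff.1 hx)

theorem exists_coe_eq_mul_inv {N : Puiseuxˣ} (hN : IsRealSeries (N : Puiseux)) {c : Puiseux}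
    (hc : IsRealSeries c) (hc0 : c ≠ 0) (hv : val c = val (N : Puiseux)) :
    ∃ x : realRing, (N : Puiseux) * x = c := by
  refine ⟨⟨c * ((N⁻¹ : Puiseuxˣ) : Puiseux), mem_realRing_of_val (mul_ne_zero hc0 (Units.ne_zero _))
    (hc.mul (isRealSeries_units_inv hN)) ?_⟩, ?_⟩
  · rw [val_mul hc0 (Units.ne_zero _), val_units_inv, hv, add_neg_cancel]
  · change (N : Puiseux) * (c * ((N⁻¹ : Puiseuxˣ) : Puiseux)) = c
    rw [mul_left_comm, Units.mul_inv, mul_one]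

/-! ### The families obtained from a coefficient of F and from a coefficient of G -/

namespace EdgeChart.Adapted

variable {Q Q' : TropPoly} {e e' : Set (Fin 2 → ℝ)} {Γ : EdgeChart Q e}
  {F G : MvPolynomial (Fin 2) Puiseux} {β0 β1 : Fin 2 →₀ ℕ} (h : Γ.Adapted F G β0 β1 Q' e')

include h

theorem setCoeff_left {c : Puiseux} (hc : IsRealSeries c) (hc0 : c ≠ 0)
    (hv : val c = val (F.coeff Γ.α0)) : Γ.Adapted (setCoeff F Γ.α0 c) G β0 β1 Q' e' where
  tropF := (tropPoly_setCoeff_eq (coeff_ne_zero h.tropF Γ.mem_supp0) hc0 hv).trans h.tropF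
  tropG := h.tropG
  realF := isReal_coeff_setCoeff h.realF hc
  realG := h.realG
  aligned := h.aligned

theorem setCoeff_right {c : Puiseux} (hc : IsRealSeries c) (hc0 : c ≠ 0)
    (hv : val c = val (G.coeff β0)) : Γ.Adapted F (setCoeff G β0 c) β0 β1 Q' e' where
  tropF := h.tropF
  tropG := (tropPoly_setCoeff_eq (coeff_ne_zero h.tropG h.mem_supp0) hc0 hv).trans h.tropG
  realF := h.realF
  realG := isReal_coeff_setCoeff h.realG hc
  aligned := h.aligned

/-- The coefficient is parametrised as c = n (a + f₁ g₀ / g₁), so that the parameter of the system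
is a. Nothing else in the system involves f₀. -/
theorem isQuadChart_setCoeff_left {c : Puiseux} (hc : IsRealSeries c) (hc0 : c ≠ 0)
    (hv : val c = val (F.coeff Γ.α0)) {a : realRing}
    (ha : (Γ.nF : Puiseux) * ((a + Γ.fc F Γ.α1 * (Γ.gc F G β0 β0 * Γ.gi F G β0 β1) : realRing) :
      Puiseux) = c) :
    IsQuadChart (setCoeff F Γ.α0 c) G e (Γ.torus F)
      (Γ.sys F G β0 β1 (-(Γ.gc F G β0 β0 * Γ.gi F G β0 β1)) 0) a := by
  have h' := h.setCoeff_left hc hc0 hv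
  have h1 : Γ.fc (setCoeff F Γ.α0 c) Γ.α0 =
      a + Γ.fc F Γ.α1 * (Γ.gc F G β0 β0 * Γ.gi F G β0 β1) := by
    refine Subtype.ext ?_
    rw [h'.fc_zero, coeff_setCoeff_self, ← ha, mul_assoc, mul_left_comm, Units.mul_inv, mul_one]
  have h2 : Γ.param (setCoeff F Γ.α0 c) G β0 β1 = a := by
    rw [param, h1, fc_setCoeff, gc_setCoeff_left, gi_setCoeff_left, add_sub_cancel_right]
  have h3 := h'.isQuadChart (x₀ := -(Γ.gc F G β0 β0 * Γ.gi F G β0 β1)) (ε := 0) (by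
    rw [gc_setCoeff_left, gi_setCoeff_left, zero_mul, add_zero])
  rwa [torus_setCoeff, sys_setCoeff_left _ _ _ _ _ _ (congrArg TropPoly.supp
    (tropPoly_setCoeff_eq (coeff_ne_zero h.tropF Γ.mem_supp0) hc0 hv)), h2] at h3

/-- Solving a = f₀ - f₁ g₀ / g₁ for g₀ gives c = n (f₀ - a) g₁ / f₁. The start value -g₀ / g₁ then
is -f₀ / f₁ + a / f₁, affine in a with fixed coefficients. -/
theorem isQuadChart_setCoeff_right {c : Puiseux} (hc : IsRealSeries c) (hc0 : c ≠ 0)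
    (hv : val c = val (G.coeff β0)) {a : realRing}
    (ha : (monoUnit (val (G.coeff β0)) : Puiseux) *
      (((Γ.fc F Γ.α0 - a) * (Γ.fi F * Γ.gc F G β0 β1) : realRing) : Puiseux) = c) :
    IsQuadChart F (setCoeff G β0 c) e (Γ.torus F)
      (Γ.sys F G β0 β1 (-(Γ.fc F Γ.α0 * Γ.fi F)) (Γ.fi F)) a := by
  have h' := h.setCoeff_right hc hc0 hv
  have h1 : Γ.gc F (setCoeff G β0 c) β0 β0 = (Γ.fc F Γ.α0 - a) * (Γ.fi F * Γ.gc F G β0 β1) := by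
    refine Subtype.ext ?_
    rw [h'.gc_zero, coeff_setCoeff_self, hv, ← ha, mul_assoc, mul_left_comm, Units.mul_inv, mul_one]
  have hf := h.fc_mul_fi
  have hg := h.gc_mul_gi
  have h2 : Γ.param F (setCoeff G β0 c) β0 β1 = a := by
    rw [param, h1, Γ.gi_setCoeff_right F G c h.ne hv]
    linear_combination -(Γ.fc F Γ.α0 - a) * Γ.gc F G β0 β1 * Γ.gi F G β0 β1 * hf -
      (Γ.fc F Γ.α0 - a) * hg
  have h3 := h'.isQuadChart (x₀ := -(Γ.fc F Γ.α0 * Γ.fi F)) (ε := Γ.fi F) (by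
    rw [h2, h1, Γ.gi_setCoeff_right F G c h.ne hv]
    linear_combination (Γ.fc F Γ.α0 - a) * Γ.fi F * hg)
  rwa [Γ.sys_setCoeff_right F G c h.ne hv (congrArg TropPoly.supp
    (tropPoly_setCoeff_eq (coeff_ne_zero h.tropG h.mem_supp0) hc0 hv)), h2] at h3

/-- The link between algebra and combinatorics: at an x₀ of the sign forced by equal phases, κ has
the sign that decides whether the edge is twisted. -/
theorem sgn_eval_sys {x₀ ε y : realRing} (hy : x₀ * y = 1)
    (hx : sgn (x₀ : Puiseux) = -(signDist F Γ.α0 * signDist F Γ.α1)) :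
    sgn ((eval ![x₀, y] (Γ.sys F G β0 β1 x₀ ε).h : realRing) : Puiseux) =
      Γ.edgeSign (signDist F) := by
  rw [(h.eval_sys_h hy).2, hx, edgeSign]

variable (hE : signDist F Γ.α0 * signDist F Γ.α1 = signDist G β0 * signDist G β1)
  (hT : Γ.edgeSign (signDist F) = 1)

include hE hT

/-- For small a the coefficient has the leading term of f₁ g₀ / g₁, which has the required valuation
and, the phases being equal, the sign of f₀. All small a are therefore admissible, and every
admissible c arises from exactly one a. -/
theorem family_left {R : Puiseux → Prop}
    (h1 : ∀ c, R c → IsRealSeries c ∧ c ≠ 0 ∧ val c = val (F.coeff Γ.α0))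
    (h2 : ∀ c, IsRealSeries c → c ≠ 0 → val c = val (F.coeff Γ.α0) →
      sgn c = sgn (F.coeff Γ.α0) → R c) :
    ∃ (D : QuadSystem realRing) (T : TorusChart) (cf : realRing → Puiseux) (y k : realRing),
      IsQuadChart.Family D T e {a | R (cf a)} (fun a => setCoeff F Γ.α0 (cf a)) (fun _ => G) y k ∧
      Function.Injective cf ∧ ∀ c, R c → ∃ a, cf a = c := by
  set b := Γ.fc F Γ.α1 * (Γ.gc F G β0 β0 * Γ.gi F G β0 β1) with hb
  have hf1 := h.isUnit_fc (Or.inr rfl)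
  have hg0 := h.isUnit_gc (Or.inl rfl)
  have hbu : IsUnit b := hf1.mul (hg0.mul h.isUnit_gi)
  have hvN : val (Γ.nF : Puiseux) = val (F.coeff Γ.α0) := by
    rw [val_coeff h.tropF]; exact val_monoUnit _
  have hx₀ : IsUnit (-(Γ.gc F G β0 β0 * Γ.gi F G β0 β1)) := (hg0.mul h.isUnit_gi).neg
  obtain ⟨y, hy⟩ := hx₀.exists_right_inv
  have hs : sgn ((Γ.gc F G β0 β0 * Γ.gi F G β0 β1 : realRing) : Puiseux) =
      signDist F Γ.α0 * signDist F Γ.α1 := by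
    rw [sgn_coe_mul hg0 h.isUnit_gi, h.sgn_gc_zero, h.sgn_gi, hE]
  have hk := h.sgn_eval_sys (ε := 0) hy (by rw [sgn_coe_neg (hg0.mul h.isUnit_gi), hs])
  refine ⟨Γ.sys F G β0 β1 (-(Γ.gc F G β0 β0 * Γ.gi F G β0 β1)) 0, Γ.torus F,
    fun a => (Γ.nF : Puiseux) * ((a + b : realRing) : Puiseux), y, _, ⟨?_, ?_, h.isPos_sys_θ _ _, hy,
      rfl, (h.eval_sys_h hy).1, sgn_eq_one_iff.1 (hk.trans hT)⟩, ?_, ?_⟩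
  · intro a ha
    obtain ⟨k1, k2, k3⟩ := h1 _ ha
    exact h.isQuadChart_setCoeff_left k1 k2 k3 rfl
  · intro a ha
    have hm : a + b - b ∈ realIdeal := by rwa [add_sub_cancel_right]
    have hu := isUnit_of_sub_mem hbu hm
    refine h2 _ (Γ.isPos_nF.isReal.mul (isReal_coe _)) (mul_ne_zero (Units.ne_zero _) hu.coe_ne_zero)
      ?_ ?_
    · rw [val_mul (Units.ne_zero _) hu.coe_ne_zero, val_coe_of_isUnit hu, add_zero, hvN]
    · beta_reduce
      rw [mul_comm, sgn_mul_of_isPos (isReal_coe _) Γ.isPos_nF, sgn_eq_of_sub_mem hbu hm, hb,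
        sgn_coe_mul hf1 (hg0.mul h.isUnit_gi), hs, h.sgn_fc_one, ← signDist_eq_sgn (h.realF _),
        mul_left_comm, ← sq, Int.units_sq, mul_one]
  · intro a a' haa
    exact add_right_cancel (Subtype.ext ((Units.mul_right_inj Γ.nF).1 haa))
  · intro c hc
    obtain ⟨k1, k2, k3⟩ := h1 c hc
    obtain ⟨x, hx⟩ := exists_coe_eq_mul_inv Γ.isPos_nF.isReal k1 k2 (k3.trans hvN.symm)
    exact ⟨x - b, by beta_reduce; rw [sub_add_cancel, hx]⟩

/-- As for F, except that small a keeps f₀ - a close to f₀, and equality of the phases turns the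
sign of f₀ g₁ / f₁ into that of g₀. -/
theorem family_right {R : Puiseux → Prop}
    (h1 : ∀ c, R c → IsRealSeries c ∧ c ≠ 0 ∧ val c = val (G.coeff β0))
    (h2 : ∀ c, IsRealSeries c → c ≠ 0 → val c = val (G.coeff β0) →
      sgn c = sgn (G.coeff β0) → R c) :
    ∃ (D : QuadSystem realRing) (T : TorusChart) (cf : realRing → Puiseux) (y k : realRing),
      IsQuadChart.Family D T e {a | R (cf a)} (fun _ => F) (fun a => setCoeff G β0 (cf a)) y k ∧
      Function.Injective cf ∧ ∀ c, R c → ∃ a, cf a = c := by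
  set b := Γ.fi F * Γ.gc F G β0 β1 with hb
  have hf0 := h.isUnit_fc (Or.inl rfl)
  have hg1 := h.isUnit_gc (Or.inr rfl)
  have hbu : IsUnit b := h.isUnit_fi.mul hg1
  set N := monoUnit (val (G.coeff β0)) with hN
  have hvN : val (N : Puiseux) = val (G.coeff β0) := val_monoUnit _
  have hNp : IsPos (N : Puiseux) := isPos_monoUnit _
  have hx₀ : IsUnit (-(Γ.fc F Γ.α0 * Γ.fi F)) := (hf0.mul h.isUnit_fi).neg
  obtain ⟨y, hy⟩ := hx₀.exists_right_inv
  have hk := h.sgn_eval_sys (ε := Γ.fi F) hy (by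
    rw [sgn_coe_neg (hf0.mul h.isUnit_fi), sgn_coe_mul hf0 h.isUnit_fi, h.sgn_fc_zero, h.sgn_fi])
  refine ⟨Γ.sys F G β0 β1 (-(Γ.fc F Γ.α0 * Γ.fi F)) (Γ.fi F), Γ.torus F,
    fun a => (N : Puiseux) * (((Γ.fc F Γ.α0 - a) * b : realRing) : Puiseux), y, _,
    ⟨?_, ?_, h.isPos_sys_θ _ _, hy, rfl, (h.eval_sys_h hy).1, sgn_eq_one_iff.1 (hk.trans hT)⟩, ?_, ?_⟩
  · intro a ha
    obtain ⟨k1, k2, k3⟩ := h1 _ ha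
    exact h.isQuadChart_setCoeff_right k1 k2 k3 rfl
  · intro a ha
    have hm : Γ.fc F Γ.α0 - a - Γ.fc F Γ.α0 ∈ realIdeal := by
      rw [sub_sub_cancel_left]; exact realIdeal.neg_mem ha
    have hu := isUnit_of_sub_mem hf0 hm
    refine h2 _ (hNp.isReal.mul (isReal_coe _)) (mul_ne_zero (Units.ne_zero _)
      (hu.mul hbu).coe_ne_zero) ?_ ?_
    · rw [val_mul (Units.ne_zero _) (hu.mul hbu).coe_ne_zero, val_coe_of_isUnit (hu.mul hbu), add_zero,
        hvN]
    · beta_reduce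
      rw [mul_comm, sgn_mul_of_isPos (isReal_coe _) hNp, sgn_coe_mul hu hbu,
        sgn_eq_of_sub_mem hf0 hm, hb, sgn_coe_mul h.isUnit_fi hg1, h.sgn_fi, h.sgn_fc_zero,
        h.sgn_gc_one, ← signDist_eq_sgn (h.realG _), ← mul_assoc, hE, mul_assoc, ← sq, Int.units_sq,
        mul_one]
  · intro a a' haa
    exact sub_right_injective (hbu.mul_left_injective (Subtype.ext ((Units.mul_right_inj N).1 haa)))
  · intro c hc
    obtain ⟨k1, k2, k3⟩ := h1 c hc
    obtain ⟨x, hx⟩ := exists_coe_eq_mul_inv hNp.isReal k1 k2 (k3.trans hvN.symm)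
    obtain ⟨b', hb'⟩ := hbu.exists_left_inv
    refine ⟨Γ.fc F Γ.α0 - x * b', ?_⟩
    beta_reduce
    rw [sub_sub_cancel, mul_assoc, hb', mul_one, hx]

end EdgeChart.Adapted

/-- The number of coefficients of each type. -/
theorem IsQuadChart.Family.count {D : QuadSystem realRing} {T : TorusChart} {e : Set (Fin 2 → ℝ)}
    {R : Puiseux → Prop} {cf : realRing → Puiseux} {F G : Puiseux → MvPolynomial (Fin 2) Puiseux}
    {y k : realRing} (H : IsQuadChart.Family D T e {a | R (cf a)} (fun a => F (cf a))
      (fun a => G (cf a)) y k) (hinj : Function.Injective cf) (hsurj : ∀ c, R c → ∃ a, cf a = c) :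
    {c | R c ∧ TwoReal (F c) (G c) e}.Infinite ∧ {c | R c ∧ TwoConj (F c) (G c) e}.Infinite ∧
      {c | R c ∧ DoubleReal (F c) (G c) e}.encard = 2 := by
  have key : ∀ Z : Puiseux → Prop, {c | R c ∧ Z c} = cf '' {a | a ∈ {a | R (cf a)} ∧ Z (cf a)} := by
    intro Z
    ext c
    constructor
    · rintro ⟨hc, hZ⟩
      obtain ⟨a, rfl⟩ := hsurj c hc
      exact ⟨a, ⟨hc, hZ⟩, rfl⟩
    · rintro ⟨a, ⟨hc, hZ⟩, rfl⟩
      exact ⟨hc, hZ⟩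
  refine ⟨?_, ?_, ?_⟩
  · rw [key fun c => TwoReal (F c) (G c) e]
    exact H.infinite_twoReal.image hinj.injOn
  · rw [key fun c => TwoConj (F c) (G c) e]
    exact H.infinite_twoConj.image hinj.injOn
  · rw [key fun c => DoubleReal (F c) (G c) e, hinj.injOn.encard_image]
    exact H.encard_doubleReal

/-! ### Labelled charts -/

theorem LatticeFrame.i_eq_of_parallel (L L' : LatticeFrame) {α α' β β' : Fin 2 →₀ ℕ}
    (hi : L.i α α' = L.i β β') (hj : L.j α α' = L.j β β') : L'.i β β' = L'.i α α' := by
  have h0 := L.zero_eq α α'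
  have h1 := L.one_eq α α'
  have h2 := L.zero_eq β β'
  have h3 := L.one_eq β β'
  rw [hi, hj] at h0 h1
  exact L'.i_eq_of (b := L'.j α α') (by rw [h2, ← h0, L'.zero_eq]) (by rw [h3, ← h1, L'.one_eq])

/-- Every endpoint of the dual edge of `e'` is the first endpoint in some chart. -/
theorem exists_edgeChart_right {Q Q' : TropPoly} (hQ : Q.Nonsingular) (hQ' : Q'.Nonsingular)
    {e e' : Set (Fin 2 → ℝ)} (he : Q.IsEdge e) (he' : Q'.IsEdge e') (hb : Bornology.IsBounded e)
    (hee' : e ⊆ intrinsicInterior ℝ e') {β : Fin 2 →₀ ℕ} (hβ : β ∈ Q'.dual e') :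
    ∃ (Γ : EdgeChart Q e) (β1 : Fin 2 →₀ ℕ), Γ.Aligned Q' e' β β1 := by
  obtain ⟨v, α, α', -, -, -, hd, -⟩ := hQ.isEdge_iff.1 he
  obtain ⟨Γ, -⟩ := exists_edgeChart hQ he hb (α := α) (by rw [hd]; simp)
  obtain ⟨β0, β1, hA⟩ := Γ.aligned_or hQ' he' hee'
  have hβ' := hβ
  rw [hA.dual_eq, Finset.mem_insert, Finset.mem_singleton] at hβ'
  rcases hβ' with rfl | rfl
  · exact ⟨Γ, β1, hA⟩
  -- If β is the second endpoint in this chart, the chart with α₀ and α₁ exchanged is used;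
  -- reversing the dual edge of `e` also reverses the labelling of that of `e'`.
  obtain ⟨Γ', hΓ'⟩ := exists_edgeChart hQ he hb (α := Γ.α1) (by rw [Γ.dual_eq]; simp)
  have hα1 : Γ'.α1 = Γ.α0 := by
    have h1 : Γ'.α1 ∈ Q.dual e := by rw [Γ'.dual_eq]; simp
    rw [Γ.dual_eq, Finset.mem_insert, Finset.mem_singleton] at h1
    exact h1.resolve_right fun h => Γ'.ne01 (hΓ'.trans h.symm)
  obtain ⟨γ0, γ1, hA'⟩ := Γ'.aligned_or hQ' he' hee'
  have hi := Γ.L.i_eq_of_parallel Γ'.L (Γ.i1.trans hA.i1.symm) (Γ.j1.trans hA.j1.symm)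
  rw [← hα1, ← hΓ', Γ'.L.i_swap Γ'.α0 Γ'.α1, Γ'.i1] at hi
  have hγ : γ0 = β := by
    have h0 : γ0 ∈ Q'.dual e' := by rw [hA'.dual_eq]; simp
    have h1 : γ1 ∈ Q'.dual e' := by rw [hA'.dual_eq]; simp
    rw [hA.dual_eq, Finset.mem_insert, Finset.mem_singleton] at h0 h1
    refine h0.resolve_left ?_
    rintro rfl
    have h2 := hA'.i1
    rcases h1 with rfl | rfl
    · rw [LatticeFrame.i_self] at h2; omega
    · omega
  exact ⟨Γ', γ1, hγ ▸ hA'⟩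
end

noncomputable section
open MvPolynomial Puiseux

/-! ### The main theorem -/

section

variable {P P' : TropPoly} {E E' : Set (Fin 2 → ℝ) → Set (Fin 2 → ZMod 2)} {e e' : Set (Fin 2 → ℝ)}
  {F G : MvPolynomial (Fin 2) Puiseux} {β0 β1 : Fin 2 →₀ ℕ} {Γ : EdgeChart (tropPoly F) e}

theorem EdgeChart.Aligned.adapted (hF : IsRealisation P E F) (hG : IsRealisation P' E' G)
    (hA : Γ.Aligned (tropPoly G) e' β0 β1) : Γ.Adapted F G β0 β1 (tropPoly G) e' :=
  ⟨rfl, rfl, hF.1, hG.1, hA⟩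

theorem EdgeChart.Aligned.phase_eq_iff (hF : IsRealisation P E F) (hG : IsRealisation P' E' G)
    (he : P.IsEdge e) (he' : P'.IsEdge e') (hA : Γ.Aligned (tropPoly G) e' β0 β1) : E e = E' e' ↔
      signDist F Γ.α0 * signDist F Γ.α1 = signDist G β0 * signDist G β1 := by
  rw [← hF.2.2 e he, ← hG.2.2 e' he']
  exact TropPoly.phase_eq_iff Γ.L Γ.dual_eq Γ.i1 Γ.j1 hA.dual_eq hA.i1 hA.j1

theorem EdgeChart.isTwisted_iff_of_isRealisation (Γ : EdgeChart (tropPoly F) e)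
    (hP : P.Nonsingular) (hF : IsRealisation P E F) (he : P.IsEdge e) :
    P.IsTwisted E e ↔ Γ.edgeSign (signDist F) = -1 := by
  rw [← TropPoly.isTwisted_congr (Q := tropPoly F) fun f => (hF.2.1.2 f).1]
  exact Γ.isTwisted_iff (hF.nonsingular hP) (signDist F) (hF.isEdge he) fun f hf =>
    (hF.2.2 f ((hF.2.1.2 f).1.1 hf)).symm

theorem IsRealisation.exists_mem_dual (hP : P.Nonsingular) (hF : IsRealisation P E F)
    (he : P.IsEdge e) : ∃ α, α ∈ (tropPoly F).dual e := by
  obtain ⟨v, α, α', -, -, -, hd, -⟩ := (hF.nonsingular hP).isEdge_iff.1 (hF.isEdge he)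
  exact ⟨α, by rw [hd]; simp⟩

/-- If a = f₀ - f₁ g₀ / g₁ were small, f₀ and f₁ g₀ / g₁ would have the same sign, and the relative
signs would agree. -/
theorem EdgeChart.Adapted.twoReal_of_ne {Q' : TropPoly} (h : Γ.Adapted F G β0 β1 Q' e')
    (hne : signDist F Γ.α0 * signDist F Γ.α1 ≠ signDist G β0 * signDist G β1) : TwoReal F G e := by
  have hC := h.isQuadChart (x₀ := -(Γ.gc F G β0 β0 * Γ.gi F G β0 β1)) (ε := 0) (by
    rw [zero_mul, add_zero])
  refine hC.twoReal_of_notMem fun hm => hne ?_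
  have hf1 := h.isUnit_fc (Or.inr rfl)
  have hg0 := h.isUnit_gc (Or.inl rfl)
  have h1 := sgn_eq_of_sub_mem (hf1.mul (hg0.mul h.isUnit_gi)) hm
  rw [h.sgn_fc_zero, sgn_coe_mul hf1 (hg0.mul h.isUnit_gi), sgn_coe_mul hg0 h.isUnit_gi,
    h.sgn_fc_one, h.sgn_gc_zero, h.sgn_gi] at h1
  rw [h1, mul_right_comm, ← sq, Int.units_sq, one_mul]

/-- The constant `h` at the start value is a unit of sign -1, and κ is congruent to it. -/
theorem EdgeChart.Adapted.twoReal_of_edgeSign {Q' : TropPoly} (h : Γ.Adapted F G β0 β1 Q' e')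
    (hE : signDist F Γ.α0 * signDist F Γ.α1 = signDist G β0 * signDist G β1)
    (hT : Γ.edgeSign (signDist F) = -1) : TwoReal F G e := by
  have hC := h.isQuadChart (x₀ := -(Γ.gc F G β0 β0 * Γ.gi F G β0 β1)) (ε := 0) (by
    rw [zero_mul, add_zero])
  have hg0 := h.isUnit_gc (Or.inl rfl)
  obtain ⟨y, hy⟩ := hC.isUnit.exists_right_inv
  have h1 := h.eval_sys_h (x₀ := -(Γ.gc F G β0 β0 * Γ.gi F G β0 β1)) (ε := 0) hy
  refine hC.twoReal_of_isPos_neg (h.isPos_sys_θ _ _) hy h1.1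
    ((isPos_neg_iff (isReal_coe _) h1.1.coe_ne_zero).2 (h1.2.trans ?_))
  have h2 : sgn ((-(Γ.gc F G β0 β0 * Γ.gi F G β0 β1) + 0 * Γ.param F G β0 β1 : realRing) : Puiseux) =
      -(signDist F Γ.α0 * signDist F Γ.α1) := by
    rw [zero_mul, add_zero, sgn_coe_neg (hg0.mul h.isUnit_gi), sgn_coe_mul hg0 h.isUnit_gi,
      h.sgn_gc_zero, h.sgn_gi, hE]
  rw [← hT, EdgeChart.edgeSign, ← h2]
  rfl

variable (hP : P.Nonsingular) (hP' : P'.Nonsingular) (he : P.IsEdge e) (he' : P'.IsEdge e')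
  (hb : Bornology.IsBounded e) (hee' : e ⊆ intrinsicInterior ℝ e')
  (hF : IsRealisation P E F) (hG : IsRealisation P' E' G)

include hP hP' he he' hb hee' hF hG

theorem exists_aligned {α : Fin 2 →₀ ℕ} (hα : α ∈ (tropPoly F).dual e) :
    ∃ (Γ : EdgeChart (tropPoly F) e) (β0 β1 : Fin 2 →₀ ℕ), Γ.α0 = α ∧
      Γ.Aligned (tropPoly G) e' β0 β1 := by
  obtain ⟨Γ, hΓ⟩ := exists_edgeChart (hF.nonsingular hP) (hF.isEdge he) hb hα
  obtain ⟨β0, β1, hA⟩ := Γ.aligned_or (hG.nonsingular hP') (hG.isEdge he') hee'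
  exact ⟨Γ, β0, β1, hΓ, hA⟩

theorem twoReal_of_ne_or_isTwisted
    (h : E e ≠ E' e' ∨ (E e = E' e' ∧ P.IsTwisted E e)) : TwoReal F G e := by
  obtain ⟨α, hα⟩ := hF.exists_mem_dual hP he
  obtain ⟨Γ, β0, β1, -, hA⟩ := exists_aligned hP hP' he he' hb hee' hF hG hα
  rw [Ne, hA.phase_eq_iff hF hG he he', Γ.isTwisted_iff_of_isRealisation hP hF he] at h
  rcases h with h | ⟨h1, h2⟩
  · exact (hA.adapted hF hG).twoReal_of_ne h
  · exact (hA.adapted hF hG).twoReal_of_edgeSign h1 h2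

theorem twoReal_or_twoConj_or_doubleReal :
    TwoReal F G e ∨ TwoConj F G e ∨ DoubleReal F G e := by
  obtain ⟨α, hα⟩ := hF.exists_mem_dual hP he
  obtain ⟨Γ, β0, β1, -, hA⟩ := exists_aligned hP hP' he he' hb hee' hF hG hα
  exact ((hA.adapted hF hG).isQuadChart (x₀ := -(Γ.gc F G β0 β0 * Γ.gi F G β0 β1)) (ε := 0) (by
    rw [zero_mul, add_zero])).twoReal_or

variable (hEE : E e = E' e') (hT : ¬ P.IsTwisted E e)

include hEE hT

theorem count_left {α : Fin 2 →₀ ℕ} (hα : α ∈ (tropPoly F).dual e) :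
    {c | IsRealisation P E (setCoeff F α c) ∧ TwoReal (setCoeff F α c) G e}.Infinite ∧
    {c | IsRealisation P E (setCoeff F α c) ∧ TwoConj (setCoeff F α c) G e}.Infinite ∧
    {c | IsRealisation P E (setCoeff F α c) ∧ DoubleReal (setCoeff F α c) G e}.encard = 2 := by
  obtain ⟨Γ, β0, β1, rfl, hA⟩ := exists_aligned hP hP' he he' hb hee' hF hG hα
  obtain ⟨D, T, cf, y, k, H, hinj, hsurj⟩ := (hA.adapted hF hG).family_left
    (R := fun c => IsRealisation P E (setCoeff F Γ.α0 c)) ((hA.phase_eq_iff hF hG he he').1 hEE)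
    ((Int.units_eq_one_or _).resolve_right fun h =>
      hT ((Γ.isTwisted_iff_of_isRealisation hP hF he).2 h))
    (fun c hc => hF.setCoeff_spec hP he hα hc) fun c h1 h2 h3 h4 => hF.setCoeff hP he hα h1 h2 h3 h4
  exact IsQuadChart.Family.count (R := fun c => IsRealisation P E (setCoeff F Γ.α0 c))
    (F := fun c => setCoeff F Γ.α0 c) (G := fun _ => G) H hinj hsurj

theorem count_right {α : Fin 2 →₀ ℕ} (hα : α ∈ (tropPoly G).dual e') :
    {c | IsRealisation P' E' (setCoeff G α c) ∧ TwoReal F (setCoeff G α c) e}.Infinite ∧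
    {c | IsRealisation P' E' (setCoeff G α c) ∧ TwoConj F (setCoeff G α c) e}.Infinite ∧
    {c | IsRealisation P' E' (setCoeff G α c) ∧ DoubleReal F (setCoeff G α c) e}.encard = 2 := by
  obtain ⟨Γ, β1, hA⟩ := exists_edgeChart_right (hF.nonsingular hP) (hG.nonsingular hP')
    (hF.isEdge he) (hG.isEdge he') hb hee' hα
  obtain ⟨D, T, cf, y, k, H, hinj, hsurj⟩ := (hA.adapted hF hG).family_right
    (R := fun c => IsRealisation P' E' (setCoeff G α c)) ((hA.phase_eq_iff hF hG he he').1 hEE)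
    ((Int.units_eq_one_or _).resolve_right fun h =>
      hT ((Γ.isTwisted_iff_of_isRealisation hP hF he).2 h))
    (fun c hc => hG.setCoeff_spec hP' he' hα hc)
    fun c h1 h2 h3 h4 => hG.setCoeff hP' he' hα h1 h2 h3 h4
  exact IsQuadChart.Family.count (R := fun c => IsRealisation P' E' (setCoeff G α c))
    (F := fun _ => F) (G := fun c => setCoeff G α c) H hinj hsurj

end

/-- Infinitely many coefficients give infinitely many pairs of curves. -/
theorem infinite_pairs {P P' : TropPoly} {E E' : Set (Fin 2 → ℝ) → Set (Fin 2 → ZMod 2)}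
    {F G : MvPolynomial (Fin 2) Puiseux} {α : Fin 2 →₀ ℕ} (hG : IsRealisation P' E' G)
    {Z : MvPolynomial (Fin 2) Puiseux → MvPolynomial (Fin 2) Puiseux → Prop}
    (hZ : ∀ F G, Z F G → (torusCurve F).Nonempty)
    (h : {c | IsRealisation P E (setCoeff F α c) ∧ Z (setCoeff F α c) G}.Infinite) :
    {C : Set (Fin 2 → Puiseux) × Set (Fin 2 → Puiseux) |
      ∃ F G, IsRealisation P E F ∧ IsRealisation P' E' G ∧ Z F G ∧
        C = (torusCurve F, torusCurve G)}.Infinite := by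
  have hinj : Set.InjOn (fun c => (torusCurve (setCoeff F α c), torusCurve G))
      {c | IsRealisation P E (setCoeff F α c) ∧ Z (setCoeff F α c) G} := by
    intro c hc c' _ hcc
    obtain ⟨p, hp⟩ := hZ _ _ hc.2
    have h1 : torusCurve (setCoeff F α c) = torusCurve (setCoeff F α c') := congrArg Prod.fst hcc
    exact eq_of_mem_torusCurve hp (h1 ▸ hp)
  refine (h.image hinj).mono ?_
  rintro _ ⟨c, ⟨h1, h2⟩, rfl⟩
  exact ⟨_, _, h1, hG, h2, rfl⟩

theorem nonempty_of_interPoints_eq {F G : MvPolynomial (Fin 2) Puiseux} {e : Set (Fin 2 → ℝ)}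
    {p q : Fin 2 → Puiseux} (h : interPoints F G e = {p, q}) : (torusCurve F).Nonempty := by
  have hp : p ∈ interPoints F G e := by rw [h]; exact Set.mem_insert _ _
  exact ⟨p, hp.1⟩

theorem mainTheorem3 (P P' : TropPoly) (hP : P.Nonsingular) (hP' : P'.Nonsingular)
    (E E' : Set (Fin 2 → ℝ) → Set (Fin 2 → ZMod 2))
    (hE : P.IsRealPhase E) (hE' : P'.IsRealPhase E')
    (e e' : Set (Fin 2 → ℝ)) (he : P.IsEdge e) (he' : P'.IsEdge e')
    (hb : Bornology.IsBounded e) (hee' : e ⊆ intrinsicInterior ℝ e') :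
    ((E e ≠ E' e' ∨ (E e = E' e' ∧ P.IsTwisted E e)) →
      ∀ F G, IsRealisation P E F → IsRealisation P' E' G → TwoReal F G e) ∧
    (E e = E' e' → ¬ P.IsTwisted E e →
      (∀ F G, IsRealisation P E F → IsRealisation P' E' G →
        TwoReal F G e ∨ TwoConj F G e ∨ DoubleReal F G e) ∧
      {Z : Set (Fin 2 → Puiseux) × Set (Fin 2 → Puiseux) |
        ∃ F G, IsRealisation P E F ∧ IsRealisation P' E' G ∧ TwoReal F G e ∧
          Z = (torusCurve F, torusCurve G)}.Infinite ∧
      {Z : Set (Fin 2 → Puiseux) × Set (Fin 2 → Puiseux) |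
        ∃ F G, IsRealisation P E F ∧ IsRealisation P' E' G ∧ TwoConj F G e ∧
          Z = (torusCurve F, torusCurve G)}.Infinite ∧
      (∀ F G, IsRealisation P E F → IsRealisation P' E' G →
        (∀ α ∈ (tropPoly F).dual e,
          {c | IsRealisation P E (setCoeff F α c) ∧ TwoReal (setCoeff F α c) G e}.Infinite ∧
          {c | IsRealisation P E (setCoeff F α c) ∧ TwoConj (setCoeff F α c) G e}.Infinite ∧
          {c | IsRealisation P E (setCoeff F α c) ∧ DoubleReal (setCoeff F α c) G e}.encard = 2) ∧
        (∀ α ∈ (tropPoly G).dual e',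
          {c | IsRealisation P' E' (setCoeff G α c) ∧ TwoReal F (setCoeff G α c) e}.Infinite ∧
          {c | IsRealisation P' E' (setCoeff G α c) ∧ TwoConj F (setCoeff G α c) e}.Infinite ∧
          {c | IsRealisation P' E' (setCoeff G α c) ∧
            DoubleReal F (setCoeff G α c) e}.encard = 2))) := by
  refine ⟨fun h F G hF hG => twoReal_of_ne_or_isTwisted hP hP' he he' hb hee' hF hG h,
    fun hEE hT => ⟨fun F G hF hG =>
      twoReal_or_twoConj_or_doubleReal hP hP' he he' hb hee' hF hG, ?_, ?_,
      fun F G hF hG => ⟨fun α hα => count_left hP hP' he he' hb hee' hF hG hEE hT hα,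
        fun α hα => count_right hP hP' he he' hb hee' hF hG hEE hT hα⟩⟩⟩
  -- Any one pair of realisations suffices as a starting point; a single varying coefficient of F
  -- already gives infinitely many pairs of either type.
  all_goals
    obtain ⟨F, hF⟩ := exists_isRealisation hP hE he
    obtain ⟨G, hG⟩ := exists_isRealisation hP' hE' he'
    obtain ⟨α, hα⟩ := hF.exists_mem_dual hP he
    obtain ⟨h1, h2, -⟩ := count_left hP hP' he he' hb hee' hF hG hEE hT hα
  · exact infinite_pairs hG (Z := fun F G => TwoReal F G e)
      (fun F G ⟨p, q, _, _, _, h, _⟩ => nonempty_of_interPoints_eq h) h1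
  · exact infinite_pairs hG (Z := fun F G => TwoConj F G e)
      (fun F G ⟨p, q, _, _, h, _⟩ => nonempty_of_interPoints_eq h) h2
end
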